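/- **Setting.** There are $K<\infty$ cluster types. A cluster has a type $L\in\{1,\dots,K\}$ with $p_k={\rm pr}(L=k)>0$. A cluster of type $k$ has $M_k\ge 2$ units, covariates $X=(X_1,\dots,X_{M_k})$ with $X_j\in\mathbb R^{d_k}$, a treatment vector $A\in\{0,1\}^{M_k}$, potential outcomes $Y(a)\in\mathbb R^{M_k}$ for $a\in\{0,1\}^{M_k}$, and observed outcome $Y=Y(A)$ (consistency). Write $O=(Y,A,X)$, $e^*(a\mid x,k)={\rm pr}(A=a\mid X=x,L=k)$, $g^*(a,x,k)=E(Y\mid A=a,X=x,L=k)$, $\Sigma^*(a,x,k)={\rm var}(Y\mid A=a,X=x,L=k)$. Assume for each $k$ and $a$: $Y(a)$ and $A$ are independent given $X$ and $L=k$; $c<e^*(a\mid X,k)<1-c$ almost surely for some $c>0$; $E\{\|Y(a)\|_2^2\mid L=k\}<\infty$ (equivalently, $E\{\|g^*(a,X,k)\|_2^2\mid L=k\}$ and $E\{\Sigma^*(a,X,k)\mid L=k\}$ are finite); and $\Sigma^*(a,X,k)$ is almost surely positive definite. The estimand is $\tau^*=\sum_k v_k(p_k)\theta_k^*$ with $\theta_k^*=\sum_a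 E\{w_k(a,X)^{\rm T}Y(a)\mid L=k\}$, where $w_k$ is a bounded measurable weight and $v_k$ is continuously differentiable on $(0,\infty)$. The observed data $(O_i,L_i)$, $i=1,2,\dots$, are independent and identically distributed. **Models and estimators.** The propensity model is, with $u_j(x)=[1,x_j^{\rm T},\sum_{\ell\ne j}x_\ell^{\rm T}]$ and $\nu_k=(\beta_{e,k},\lambda_k)$, $\lambda_k>0$: given $X=x$, $L=k$ and $b\sim N(0,\lambda_k^{-1})$, the $A_j$ are independent with ${\rm logit}\,{\rm pr}(A_j=1\mid x,k,b)=u_j(x)\beta_{e,k}+b$; $e(a\mid x,k;\nu_k)$ is the resulting probability of $A=a$ after integrating out $b$. The outcome model is $Y_j=g_j(A,X,k;\beta_{g,k})+\xi+\epsilon_j$ with $g_j(a,x,k;\beta)=[1,a_j,\sum_{\ell\ne j}a_\ell,x_j^{\rm T},\sum_{\ell\neq j}x_\ell^{\rm T}]\beta$ and independent $\xi\sim N(0,\rho_k)$, $\epsilon_j\sim N(0,\eta_k^{-1})$ given $(A,X,L=k)$. For each $k$, $\widehat\nu_k$ maximizes, with probability tending to one, the log-likelihood of the propensity model over a compact set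 $\Theta_k\subset\mathbb R^{1+2d_k}\times(0,\infty)$, and $(\widehat\beta_{g,k},\widehat\eta_k,\widehat\rho_k)$ maximizes, with probability tending to one, the log-likelihood of the outcome model over $\mathbb R^{3+2d_k}\times(0,\infty)\times[0,\infty)$, each computed from the type $k$ clusters among the first $N$. Let $\widehat p_k=N_k/N$ be the proportion of type $k$, let $$\phi_k(O,e,g)=\frac{w_k(A,X)^{\rm T}\{Y-g(A,X,k)\}}{e(A\mid X,k)}+\sum_a w_k(a,X)^{\rm T}g(a,X,k),$$ $\widehat\theta_k=N_k^{-1}\sum_{i\le N:L_i=k}\phi_k\big(O_i,e(\cdot;\widehat\nu_k),g(\cdot;\widehat\beta_{g,k})\big)$ and $\widehat\tau=\sum_k v_k(\widehat p_k)\widehat\theta_k$. "The propensity model is correct" means that $e^*(a\mid X,k)=e(a\mid X,k;\nu_k^\dagger)$ almost surely for all $a,k$, where $\nu_k^\dagger$ is a given interior point of $\Theta_k$. "The outcome model is correct" means that for each $k$ some $\beta_{g,k}$ satisfies $g^*(a,X,k)=g(a,X,k;\beta_{g,k})$ almost surely for all $a$. **Conditions.** For each $k$: (a) the propensity model is globally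 identifiable: if $\nu,\nu'\in\Theta_k$ and $e(a\mid X,k;\nu)=e(a\mid X,k;\nu')$ almost surely for all $a$, then $\nu=\nu'$; (b) $E\{\|X\|_2^3\mid L=k\}<\infty$; (c) the information matrix $-E\{\nabla_\nu^2\log e(A\mid X,k;\nu_k^\dagger)\mid L=k\}$ is positive definite (it is the Fisher information if the propensity model is correct), and, given $L=k$, no non-trivial linear combination of the entries of $X$ is almost surely constant. **Conclusions.** 1. If the propensity model is correct (the outcome model may be wrong), then $\widehat\tau$ is asymptotically linear and asymptotically normal: there is a mean-zero square-integrable $\psi$ with $\sqrt N(\widehat\tau-\tau^*)=N^{-1/2}\sum_{i\le N}\psi(O_i,L_i)+o_P(1)$, and $\sqrt N(\widehat\tau-\tau^*)$ converges in distribution to $N(0,E\psi^2)$. 2. The same conclusion holds if the outcome model is correct (the propensity model may be wrong), provided that for each $k$ the limiting propensity parameter is well defined, i.e. $\nu_k^\dagger$ is the unique maximizer over $\Theta_k$ of $\nu\mapsto E\{\log e(A\mid X,k;\nu)\mid L=k\}$; the limiting propensity score satisfies overlap, $e(a\mid X,k;\nu_k^\dagger)>c'$ almost surely for all $a$, for some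 $c'>0$; and $E\{\|X\|_2^2\,\|Y-g^*(A,X,k)\|_2^2\mid L=k\}<\infty$ (automatic if the whole mixed effects outcome model holds). 3. If both models are correct, then $\widehat\tau$ is locally efficient: conclusion 1 holds with $\psi=\varphi$, $$\varphi=\sum_k v_k(p_k)\frac{1(L=k)\{\phi_k(O,e^*,g^*)-\theta_k^*\}}{p_k}+\sum_k\{1(L=k)-p_k\}v_k'(p_k)\theta_k^*;$$ $\varphi$ is the efficient influence function, in the nonparametric model for the law of $(O,L)$, of the functional $\sum_k v_k(p_k)\sum_aE\{w_k(a,X)^{\rm T}g(a,X,k)\mid L=k\}$, whose value at the true law is $\tau^*$; and the asymptotic variance $E\varphi^2$ is the semiparametric efficiency bound, the supremum of the Cramér–Rao bounds over regular one-dimensional parametric submodels. Regular submodels are those differentiable in quadratic mean at the true law whose likelihood ratios to it are bounded away from $0$ and $\infty$; their scores are all the mean-zero square-integrable functions of $(O,L)$. -/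

import Mathlib

open MeasureTheory ProbabilityTheory Filter Topology
open scoped ENNReal

noncomputable section

namespace PartialInterference

/-! ### Data of one cluster -/

/-- Treatment vectors of a cluster with `m` units. -/
abbrev Treat (m : ℕ) := Fin m → Bool

/-- Covariates of a cluster: unit `j` carries the vector `x j ∈ ℝ^d`. -/
abbrev Covar (m d : ℕ) := Fin m → Fin d → ℝ

/-- Observed data `O = (Y, A, X)` of a cluster. -/
abbrev Obs (m d : ℕ) := (Fin m → ℝ) × Treat m × Covar m d

/-- Full data `((Y(a))_a, A, X)` of a cluster, `Y(a)` being the vector of potential outcomes. -/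
abbrev Full (m d : ℕ) := (Treat m → Fin m → ℝ) × Treat m × Covar m d

/-- Consistency: the observed outcome is the potential outcome at the received treatment. -/
def observe {m d : ℕ} (f : Full m d) : Obs m d := (f.1 f.2.1, f.2.1, f.2.2)

/-- Observed data `(O, L)` of a cluster together with its type `L = z.1`; clusters of type `k`
have `M k` units, each with `d k` covariates. -/
abbrev Data {K : ℕ} (M d : Fin K → ℕ) := Σ k, Obs (M k) (d k)

/-- Numerical value of a treatment indicator. -/
def trt (b : Bool) : ℝ := if b then 1 else 0

/-- Euclidean norm of the stacked covariate vector of a cluster. -/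
def covarNorm {m d : ℕ} (x : Covar m d) : ℝ := √(∑ j, ∑ r, x j r ^ 2)

/-- `1(L = k) f(O)`. -/
def onType {K : ℕ} {M d : Fin K → ℕ} (k : Fin K) (f : Obs (M k) (d k) → ℝ) (z : Data M d) : ℝ :=
  if h : z.1 = k then f (h ▸ z.2) else 0

/-! ### Laws -/

/-- Law of `(O, L)` when `pr(L = k) = p k` and the full data given `L = k` have law `Q k`. -/
def obsLaw {K : ℕ} {M d : Fin K → ℕ} (p : Fin K → ℝ) (Q : ∀ k, Measure (Full (M k) (d k))) :
    Measure (Data M d) :=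
  ∑ k, ENNReal.ofReal (p k) • ((Q k).map observe).map (Sigma.mk k)

/-- `pr(L = k)`. -/
def typeProb {K : ℕ} {M d : Fin K → ℕ} (P : Measure (Data M d)) (k : Fin K) : ℝ :=
  P.real (Sigma.fst ⁻¹' {k})

/-- Conditional law of `O` given `L = k`. -/
def condLaw {K : ℕ} {M d : Fin K → ℕ} (P : Measure (Data M d)) (k : Fin K) :
    Measure (Obs (M k) (d k)) :=
  (P (Sigma.fst ⁻¹' {k}))⁻¹ • P.comap (Sigma.mk k)

/-! ### Propensity score, outcome regression and conditional covariance within a type -/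

/-- The σ-algebra generated by the covariates. -/
@[reducible] def sigmaX (m d : ℕ) : MeasurableSpace (Obs m d) :=
  MeasurableSpace.comap (fun o : Obs m d => o.2.2) inferInstance

/-- The σ-algebra generated by the covariates on the full data. -/
@[reducible] def sigmaXFull (m d : ℕ) : MeasurableSpace (Full m d) :=
  MeasurableSpace.comap (fun f : Full m d => f.2.2) inferInstance

theorem sigmaXFull_le (m d : ℕ) :
    sigmaXFull m d ≤ (inferInstance : MeasurableSpace (Full m d)) :=
  (show Measurable (fun f : Full m d => f.2.2) from measurable_snd.snd).comap_le

variable {m d : ℕ}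

/-- Propensity score `e(a | X)`. -/
def propensity (P : Measure (Obs m d)) (a : Treat m) : Obs m d → ℝ :=
  condExp (sigmaX m d) P ({o : Obs m d | o.2.1 = a}.indicator fun _ => 1)

/-- Outcome regression `g_j(a, X) = E(Y_j | A = a, X)`. -/
def outcomeReg (P : Measure (Obs m d)) (a : Treat m) (j : Fin m) (o : Obs m d) : ℝ :=
  condExp (sigmaX m d) P ({o : Obs m d | o.2.1 = a}.indicator fun o => o.1 j) o
    / propensity P a o

/-- Conditional covariance matrix `Σ(a, X) = var(Y | A = a, X)`. -/
def condCov (P : Measure (Obs m d)) (a : Treat m) (o : Obs m d) : Matrix (Fin m) (Fin m) ℝ :=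
  Matrix.of fun j l =>
    condExp (sigmaX m d) P ({o : Obs m d | o.2.1 = a}.indicator fun o =>
      (o.1 j - outcomeReg P a j o) * (o.1 l - outcomeReg P a l o)) o / propensity P a o

/-! ### Estimands -/

/-- Causal estimand `θ_k = ∑_a E{w_k(a, X)ᵀ Y(a) | L = k}`. -/
def thetaCausal (w : Treat m → Covar m d → Fin m → ℝ) (Q : Measure (Full m d)) : ℝ :=
  ∑ a, ∫ f, ∑ j, w a f.2.2 j * f.1 a j ∂Q

/-- The functional `∑_a E{w_k(a, X)ᵀ g(a, X) | L = k}` of the observed law. -/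
def thetaObs (w : Treat m → Covar m d → Fin m → ℝ) (P : Measure (Obs m d)) : ℝ :=
  ∑ a, ∫ o, ∑ j, w a o.2.2 j * outcomeReg P a j o ∂P

/-- `τ = ∑_k v_k(p_k) θ_k` as a functional of the observed law. -/
def tauObs {K : ℕ} {M d : Fin K → ℕ} (v : Fin K → ℝ → ℝ)
    (w : ∀ k, Treat (M k) → Covar (M k) (d k) → Fin (M k) → ℝ) (P : Measure (Data M d)) : ℝ :=
  ∑ k, v k (typeProb P k) * thetaObs (w k) (condLaw P k)

/-- The augmented inverse probability weighted term
`w(A, X)ᵀ{Y - g(A, X)} / e(A | X) + ∑_a w(a, X)ᵀ g(a, X)`. -/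
def aipw (w : Treat m → Covar m d → Fin m → ℝ) (e : Treat m → Obs m d → ℝ)
    (g : Treat m → Fin m → Obs m d → ℝ) (o : Obs m d) : ℝ :=
  (∑ j, w o.2.1 o.2.2 j * (o.1 j - g o.2.1 j o)) / e o.2.1 o
    + ∑ a, ∑ j, w a o.2.2 j * g a j o

/-! ### Logistic mixed effects propensity model -/

/-- Coefficients of the regressors `[1, x_j, ∑_{l ≠ j} x_l]`, followed by the precision of the
random intercept. -/
abbrev PSParam (d : ℕ) := (Unit ⊕ Fin d ⊕ Fin d) ⊕ Unit → ℝ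

/-- The precision `λ` of the random intercept. -/
def PSParam.precision (ν : PSParam d) : ℝ := ν (Sum.inr ())

/-- The regressors `[1, x_j, ∑_{l ≠ j} x_l]`. -/
def psRegressor (x : Covar m d) (j : Fin m) : Unit ⊕ Fin d ⊕ Fin d → ℝ :=
  Sum.elim (fun _ => 1) (Sum.elim (x j) (fun r => ∑ l ∈ Finset.univ.erase j, x l r))

/-- `pr(A_j = a | X = x, b)` when `logit pr(A_j = 1 | X = x, b) = [1, x_j, ∑_{l ≠ j} x_l] β + b`. -/
def psUnit (ν : PSParam d) (x : Covar m d) (b : ℝ) (j : Fin m) (a : Bool) : ℝ :=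
  let u := Real.sigmoid ((∑ i, psRegressor x j i * ν (Sum.inl i)) + b)
  if a then u else 1 - u

/-- Model propensity score `e(a | x; ν)`: the random intercept `b ∼ N(0, λ⁻¹)`, shared by the
cluster, is integrated out. -/
def psModel (a : Treat m) (x : Covar m d) (ν : PSParam d) : ℝ :=
  ∫ b, ∏ j, psUnit ν x b j (a j) ∂(gaussianReal 0 (Real.toNNReal ν.precision⁻¹))

/-- Partial derivative. -/
def partialDeriv {ι : Type*} [Fintype ι] [DecidableEq ι] (i : ι) (f : (ι → ℝ) → ℝ)
    (ν : ι → ℝ) : ℝ := fderiv ℝ f ν (Pi.single i 1)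

/-- Fisher information of the propensity model: `-E{∇² log e(A | X; ν)}`, the expected negative
derivative of the score. -/
def psInformation (P : Measure (Obs m d)) (ν : PSParam d) :
    Matrix ((Unit ⊕ Fin d ⊕ Fin d) ⊕ Unit) ((Unit ⊕ Fin d ⊕ Fin d) ⊕ Unit) ℝ :=
  Matrix.of fun i i' =>
    -∫ o, partialDeriv i (partialDeriv i' fun ν' => Real.log (psModel o.2.1 o.2.2 ν')) ν ∂P

/-- Global identifiability on the parameter set `Θ`. -/
def PSIdentifiable (P : Measure (Obs m d)) (Θ : Set (PSParam d)) : Prop :=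
  ∀ ν ∈ Θ, ∀ ν' ∈ Θ, (∀ a, ∀ᵐ o ∂P, psModel a o.2.2 ν = psModel a o.2.2 ν') → ν = ν'

/-! ### Linear mixed effects outcome model -/

/-- Coefficients of the regressors `[1, a_j, ∑_{l ≠ j} a_l, x_j, ∑_{l ≠ j} x_l]`. -/
abbrev ORCoef (d : ℕ) := Fin 3 ⊕ Fin d ⊕ Fin d → ℝ

/-- Parameter `(β, η, ρ)`: coefficients, precision of the unit-level error, and variance of the
random intercept. -/
abbrev ORParam (d : ℕ) := ORCoef d × ℝ × ℝ

/-- The regressors `[1, a_j, ∑_{l ≠ j} a_l, x_j, ∑_{l ≠ j} x_l]`. -/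
def orRegressor (a : Treat m) (x : Covar m d) (j : Fin m) : Fin 3 ⊕ Fin d ⊕ Fin d → ℝ :=
  Sum.elim ![1, trt (a j), ∑ l ∈ Finset.univ.erase j, trt (a l)]
    (Sum.elim (x j) (fun r => ∑ l ∈ Finset.univ.erase j, x l r))

/-- Model outcome regression `g_j(a, x; β)`. -/
def orModel (a : Treat m) (x : Covar m d) (β : ORCoef d) (j : Fin m) : ℝ :=
  ∑ i, orRegressor a x j i * β i

/-- Covariance matrix `η⁻¹ I + ρ 11ᵀ` of `Y` given `(A, X)` under the mixed effects model. -/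
def orCov (m : ℕ) (η ρ : ℝ) : Matrix (Fin m) (Fin m) ℝ :=
  η⁻¹ • (1 : Matrix (Fin m) (Fin m) ℝ) + ρ • Matrix.of fun _ _ => 1

/-- Residual vector `y - g(a, x; β)`. -/
def orResid (o : Obs m d) (β : ORCoef d) (j : Fin m) : ℝ := o.1 j - orModel o.2.1 o.2.2 β j

/-- Logarithm of the normal density `N(g(a, x; β), η⁻¹ I + ρ 11ᵀ)` at `y`. -/
def orLogLik (o : Obs m d) (γ : ORParam d) : ℝ :=
  -(1 / 2) * Real.log (((2 * Real.pi) • orCov m γ.2.1 γ.2.2).det)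
    - 1 / 2 * dotProduct (orResid o γ.1) ((orCov m γ.2.1 γ.2.2)⁻¹.mulVec (orResid o γ.1))

/-! ### Estimators -/

section Estimators

variable {K : ℕ} {M d : Fin K → ℕ} {Ω : Type*}

/-- Log-likelihood of the propensity model over the type `k` clusters among the first `N`. -/
def psSampleLogLik (Z : ℕ → Ω → Data M d) (k : Fin K) (N : ℕ) (ω : Ω) (ν : PSParam (d k)) : ℝ :=
  ∑ i ∈ Finset.range N, onType k (fun o => Real.log (psModel o.2.1 o.2.2 ν)) (Z i ω)

/-- Log-likelihood of the outcome model over the type `k` clusters among the first `N`. -/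
def orSampleLogLik (Z : ℕ → Ω → Data M d) (k : Fin K) (N : ℕ) (ω : Ω) (γ : ORParam (d k)) : ℝ :=
  ∑ i ∈ Finset.range N, onType k (fun o => orLogLik o γ) (Z i ω)

/-- With probability tending to one, `est N` maximizes the random criterion `ℓ N` over `Θ`. -/
def IsMaximizerEventually [MeasurableSpace Ω] {Par : Type*} (μ : Measure Ω) (Θ : Set Par)
    (ℓ : ℕ → Ω → Par → ℝ) (est : ℕ → Ω → Par) : Prop :=
  Tendsto (fun N => μ {ω | ¬ (est N ω ∈ Θ ∧ ∀ θ ∈ Θ, ℓ N ω θ ≤ ℓ N ω (est N ω))}) atTop (𝓝 0)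

/-- Parameter space of the outcome model. -/
def orSpace (d : ℕ) : Set (ORParam d) := {γ | 0 < γ.2.1 ∧ 0 ≤ γ.2.2}

/-- Number of type `k` clusters among the first `N`. -/
def typeCount (Z : ℕ → Ω → Data M d) (k : Fin K) (N : ℕ) (ω : Ω) : ℝ :=
  ∑ i ∈ Finset.range N, onType k (fun _ => 1) (Z i ω)

/-- `θ̂_k`, the root of `0 = ∑_i 1(L_i = k){φ_k(O_i, e(·; ν̂), g(·; β̂)) - θ_k}`. -/
def thetaHat (w : ∀ k, Treat (M k) → Covar (M k) (d k) → Fin (M k) → ℝ)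
    (Z : ℕ → Ω → Data M d) (psEst : ∀ k, ℕ → Ω → PSParam (d k))
    (orEst : ∀ k, ℕ → Ω → ORParam (d k)) (k : Fin K) (N : ℕ) (ω : Ω) : ℝ :=
  (∑ i ∈ Finset.range N, onType k (aipw (w k) (fun a o => psModel a o.2.2 (psEst k N ω))
    (fun a j o => orModel a o.2.2 (orEst k N ω).1 j)) (Z i ω)) / typeCount Z k N ω

/-- `τ̂ = ∑_k v_k(N_k / N) θ̂_k`. -/
def tauHat (v : Fin K → ℝ → ℝ) (w : ∀ k, Treat (M k) → Covar (M k) (d k) → Fin (M k) → ℝ)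
    (Z : ℕ → Ω → Data M d) (psEst : ∀ k, ℕ → Ω → PSParam (d k))
    (orEst : ∀ k, ℕ → Ω → ORParam (d k)) (N : ℕ) (ω : Ω) : ℝ :=
  ∑ k, v k (typeCount Z k N ω / N) * thetaHat w Z psEst orEst k N ω

end Estimators

/-! ### Asymptotic normality and efficiency -/

section Efficiency

variable {𝒵 Ω : Type*} [MeasurableSpace 𝒵] [MeasurableSpace Ω]

/-- `T N` is asymptotically linear for `τ` with influence function `ψ`, and
`√N (T N - τ)` converges in distribution to `N(0, E ψ²)`. -/
def AsymptoticallyNormalWith (μ : Measure Ω) [IsProbabilityMeasure μ] (P : Measure 𝒵)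
    (Z : ℕ → Ω → 𝒵) (T : ℕ → Ω → ℝ) (τ : ℝ) (ψ : 𝒵 → ℝ) : Prop :=
  MemLp ψ 2 P ∧ ∫ z, ψ z ∂P = 0 ∧
  TendstoInMeasure μ
    (fun (N : ℕ) ω => √(N : ℝ) * (T N ω - τ) - (√(N : ℝ))⁻¹ * ∑ i ∈ Finset.range N, ψ (Z i ω))
    atTop (fun _ => 0) ∧
  TendstoInDistribution (fun (N : ℕ) ω => √(N : ℝ) * (T N ω - τ)) atTop (id : ℝ → ℝ)
    (fun _ => μ) (gaussianReal 0 (Real.toNNReal (∫ z, ψ z ^ 2 ∂P)))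

/-- `t ↦ r t · P` (for `t` near `0`) is a regular one-dimensional parametric submodel through `P`
with score `s`: it is differentiable in quadratic mean at `t = 0`. The likelihood ratios are bounded
away from `0` and `∞`, so that every member has the overlap and moment properties of `P`. This does
not shrink the tangent space: every mean zero `s ∈ L²(P)` is the score of such a submodel, for
instance of `r t` proportional to `1 + tanh (2 t s) / 2`. -/
structure IsRegularSubmodel (P : Measure 𝒵) (r : ℝ → 𝒵 → ℝ) (s : 𝒵 → ℝ) : Prop where
  measurable : ∀ t, Measurable (r t)
  at_zero : ∀ z, r 0 z = 1
  bounds : ∃ C > 0, ∀ᶠ t in 𝓝 (0 : ℝ), ∀ z, C⁻¹ ≤ r t z ∧ r t z ≤ C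
  prob : ∀ᶠ t in 𝓝 (0 : ℝ), ∫ z, r t z ∂P = 1
  score_memLp : MemLp s 2 P
  qmd : Tendsto (fun t => ∫ z, ((√(r t z) - 1) / t - s z / 2) ^ 2 ∂P) (𝓝[≠] 0) (𝓝 0)

/-- The member of the submodel at parameter `t`. -/
def submodelLaw (P : Measure 𝒵) (r : ℝ → 𝒵 → ℝ) (t : ℝ) : Measure 𝒵 :=
  P.withDensity fun z => ENNReal.ofReal (r t z)

/-- `φ` is the efficient influence function of the functional `τ` at `P` in the nonparametric
model: `τ` is differentiable along all regular submodels with derivative `E(φ s)`, and `φ` belongs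
to the tangent space, the `L²(P)`-closed linear span of the scores. -/
def IsEfficientInfluenceFunction (P : Measure 𝒵) (τ : Measure 𝒵 → ℝ) (φ : 𝒵 → ℝ) : Prop :=
  MemLp φ 2 P ∧
  (∀ r s, IsRegularSubmodel P r s →
    HasDerivAt (fun t => τ (submodelLaw P r t)) (∫ z, φ z * s z ∂P) 0) ∧
  ∀ ε > 0, ∃ s ∈ Submodule.span ℝ {s : 𝒵 → ℝ | ∃ r, IsRegularSubmodel P r s},
    ∫ z, (φ z - s z) ^ 2 ∂P < ε

/-- Cramér-Rao bounds `(dτ/dt)² / E s²` for `τ` of the regular submodels. -/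
def cramerRaoBounds (P : Measure 𝒵) (τ : Measure 𝒵 → ℝ) : Set ℝ :=
  {b | ∃ r s τ', IsRegularSubmodel P r s ∧ 0 < ∫ z, s z ^ 2 ∂P ∧
    HasDerivAt (fun t => τ (submodelLaw P r t)) τ' 0 ∧ b = τ' ^ 2 / ∫ z, s z ^ 2 ∂P}

/-- `T` is efficient for `τ` at `P`: it is asymptotically linear and asymptotically normal, its
influence function `φ` is the efficient one, and its asymptotic variance is the semiparametric
efficiency bound, the supremum of the Cramér-Rao bounds of the regular submodels. -/
def IsEfficientWith (μ : Measure Ω) [IsProbabilityMeasure μ] (P : Measure 𝒵)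
    (Z : ℕ → Ω → 𝒵) (T : ℕ → Ω → ℝ) (τ : Measure 𝒵 → ℝ) (φ : 𝒵 → ℝ) : Prop :=
  AsymptoticallyNormalWith μ P Z T (τ P) φ ∧ IsEfficientInfluenceFunction P τ φ ∧
  IsLUB (cramerRaoBounds P τ) (∫ z, φ z ^ 2 ∂P)

end Efficiency

/-- The function
`∑_k v_k(p_k) 1(L = k){φ_k(O, e, g) - θ_k} / p_k + ∑_k {1(L = k) - p_k} v_k'(p_k) θ_k`. -/
def influence {K : ℕ} {M d : Fin K → ℕ} (v : Fin K → ℝ → ℝ)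
    (w : ∀ k, Treat (M k) → Covar (M k) (d k) → Fin (M k) → ℝ) (P : Measure (Data M d))
    (z : Data M d) : ℝ :=
  (∑ k, v k (typeProb P k) * (onType k (fun o =>
      aipw (w k) (propensity (condLaw P k)) (outcomeReg (condLaw P k)) o
        - thetaObs (w k) (condLaw P k)) z / typeProb P k))
    + ∑ k, (onType k (fun _ => 1) z - typeProb P k)
        * (deriv (v k) (typeProb P k) * thetaObs (w k) (condLaw P k))

/-! ### Assumptions and correct specification -/

/-- Identifying assumptions on the law `Q` of the full data of a cluster of a given type
(consistency is part of `observe`): conditional ignorability, overlap, moments. -/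
structure Identifying (Q : Measure (Full m d)) [IsProbabilityMeasure Q] : Prop where
  ignorability : ∀ a, CondIndepFun (sigmaXFull m d) (sigmaXFull_le m d)
    (fun f : Full m d => f.1 a) (fun f => f.2.1) Q
  overlap : ∃ c > 0, ∀ a, ∀ᵐ o ∂(Q.map observe),
    c < propensity (Q.map observe) a o ∧ propensity (Q.map observe) a o < 1 - c
  moments : ∀ a j, MemLp (fun f : Full m d => f.1 a j) 2 Q
  cov_posDef : ∀ a, ∀ᵐ o ∂(Q.map observe), (condCov (Q.map observe) a o).PosDef

/-- The covariate vector is non-degenerate: no non-trivial linear combination of its entries is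
almost surely constant. -/
def NondegenerateCovar (P : Measure (Obs m d)) : Prop :=
  ∀ c : Covar m d, c ≠ 0 → ¬ ∃ q : ℝ, ∀ᵐ o ∂P, ∑ j, ∑ i, c j i * o.2.2 j i = q

/-- The propensity model is correctly specified with true parameter `ν`. -/
def PSCorrect (P : Measure (Obs m d)) (ν : PSParam d) : Prop :=
  ∀ a, ∀ᵐ o ∂P, propensity P a o = psModel a o.2.2 ν

/-- The outcome regression is correctly specified. -/
def ORCorrect (P : Measure (Obs m d)) : Prop :=
  ∃ β : ORCoef d, ∀ a j, ∀ᵐ o ∂P, outcomeReg P a j o = orModel a o.2.2 β j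

/-- `ν` is the unique maximizer over `Θ` of the population log-likelihood of the propensity
model. -/
def IsPopulationMaximizer (P : Measure (Obs m d)) (Θ : Set (PSParam d)) (ν : PSParam d) : Prop :=
  ν ∈ Θ ∧ ∀ ν' ∈ Θ, ν' ≠ ν →
    ∫ o, Real.log (psModel o.2.1 o.2.2 ν') ∂P < ∫ o, Real.log (psModel o.2.1 o.2.2 ν) ∂P

end PartialInterference

end

open PartialInterference

/-! Within one type let `φ(ν, β)` be the augmented weighted term under the working models. Where
type `k` has been observed, `θ̂_k - θ_k` is the sample average of `1(L = k) {φ(ν̂, β̂) - θ_k}`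
divided by the frequency of the type. So everything reduces to asymptotic linearity of that average.
The delta method for `(s, p) ↦ v(p) (s / p + θ)` (`tauHat_isAsympLinear`), the central limit theorem
and Slutsky's lemma then give normality.

The average is expanded by an exact identity, `modelAipw_sub`. The propensity score acts only
through the factor `e(ν₀) / e(ν̂) = exp (-u)`, with `u` the difference of the log-likelihoods, and
the outcome coefficients act linearly. Hence `φ(ν̂, β̂)` is `φ(ν₀, β₀)`, plus `exp (-u) - 1` times a
weighted residual, plus a slope applied to `β̂ - β₀`. The score of the propensity model grows
linearly in the covariates, so the quadratic remainder carries the square of an envelope `b` of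
order `1 + ‖X‖` times a residual that is only square integrable. This product need not have a mean.
Third moments make the sample maximum of `b` negligible against `√N`, and this pays for the extra
factor `b` (`IsSample.weighted_expansion`).

The two nuisance estimators are treated differently. For the mixed logistic model, the law of the
intercept given the treatment is a tilt of the normal law by a factor whose logarithm is Lipschitz;
this bounds gradient and Hessian of the log-likelihood by multiples of `1 + ‖X‖` and its square
(`psGrad_psHess_bounds`), and the general M-estimation theorem `IsSample.mEstimator` applies. For
the outcome model, every non-constant regressor comes with its companion `∑_{l ≠ j}`, and the
working covariance is exchangeable; so the likelihood equations for the coefficients reduce to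
ordinary least squares, whatever the estimated variance components are (`sum_orScore_eq_zero`). The
coefficients therefore solve a linear equation, and the variance components never have to be
studied.

Double robustness enters through two kinds of population moments. The mean of `φ(ν₀, β₀)` is `θ_k`
as soon as one model is right (`integral_modelAipw_eq` shows both cases). If the propensity model is
right, the slope in `β` has mean zero, so mere consistency of `β̂` suffices, and the limit of `β̂`
may be any least squares solution. If the outcome model is right, `β̂` is itself asymptotically
linear, which is where the additional residual moment is used. If both are right, the correction for
estimating `ν` vanishes as well, since the residual is centred given `(A, X)`, and the influence
function is that of the known-nuisance estimator.

For efficiency, the law is reweighted by a density `q`. The error of the linear approximation `∫ q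
φ` to `θ_k` is a sum of integrals of `q - 1` times residuals times the change of the inverse
propensity score (`thetaObs_reweight_sub`). The propensity score is continuous in `q`, so by
Cauchy–Schwarz and uniform integrability this is `o(‖q - 1‖₂)`. Along a regular submodel `‖q - 1‖₂ =
O(t)`, which yields the pathwise derivative `E(φ s)`. Bounded centred functions are scores of the
submodels `1 + t s` and are dense among centred square integrable functions; with Cauchy–Schwarz
this identifies `φ` as efficient and its variance as the supremum of the Cramér–Rao bounds
(`isEfficientInfluenceFunction_and_isLUB`). -/

set_option linter.unusedSectionVars false

noncomputable section

namespace PartialInterference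

/-! ### Stochastic order symbols -/

section

section StochasticOrder

variable {Ω : Type*} [MeasurableSpace Ω] {μ : Measure Ω}
variable {E F : Type*} [SeminormedAddCommGroup E] [SeminormedAddCommGroup F]

/-- `p N` holds with probability tending to one. -/
def HighProb (μ : Measure Ω) (p : ℕ → Ω → Prop) : Prop :=
  Tendsto (fun N => μ {ω | ¬ p N ω}) atTop (𝓝 0)

/-- `X N = o_P(1)`. -/
def SmallInProb (μ : Measure Ω) (X : ℕ → Ω → E) : Prop :=
  ∀ δ > 0, HighProb μ fun N ω => ‖X N ω‖ < δ

/-- `X N = O_P(1)`. -/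
def BddInProb (μ : Measure Ω) (X : ℕ → Ω → E) : Prop :=
  ∀ ε > (0 : ℝ≥0∞), ∃ C : ℝ, ∀ᶠ N in atTop, μ {ω | ¬ ‖X N ω‖ ≤ C} ≤ ε

/-- Only monotonicity and subadditivity of the outer measure enter here and below, so the events
need not be measurable. -/
theorem HighProb.mono {p q : ℕ → Ω → Prop} (hp : HighProb μ p)
    (h : ∀ᶠ N in atTop, ∀ ω, p N ω → q N ω) : HighProb μ q := by
  refine tendsto_of_tendsto_of_tendsto_of_le_of_le' tendsto_const_nhds hp
    (Eventually.of_forall fun _ => zero_le) ?_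
  filter_upwards [h] with N hN
  exact measure_mono fun ω hω hp => hω (hN ω hp)

theorem HighProb.imp {p q : ℕ → Ω → Prop} (hp : HighProb μ p)
    (h : ∀ N ω, p N ω → q N ω) : HighProb μ q :=
  hp.mono (Eventually.of_forall h)

theorem highProb_of_forall {p : ℕ → Ω → Prop} (h : ∀ᶠ N in atTop, ∀ ω, p N ω) :
    HighProb μ p := by
  refine HighProb.mono (p := fun _ _ => True) ?_ (h.mono fun N hN ω _ => hN ω)
  simp [HighProb]

theorem HighProb.and {p q : ℕ → Ω → Prop} (hp : HighProb μ p) (hq : HighProb μ q) :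
    HighProb μ fun N ω => p N ω ∧ q N ω := by
  have h := hp.add hq
  rw [add_zero] at h
  refine tendsto_of_tendsto_of_tendsto_of_le_of_le tendsto_const_nhds h (fun _ => zero_le)
    fun N => ?_
  refine (measure_mono ?_).trans (measure_union_le _ _)
  intro ω hω
  by_cases h1 : p N ω
  · exact Or.inr fun h2 => hω ⟨h1, h2⟩
  · exact Or.inl h1

theorem HighProb.forall_fintype {ι : Type*} [Finite ι] {p : ι → ℕ → Ω → Prop}
    (hp : ∀ i, HighProb μ (p i)) : HighProb μ fun N ω => ∀ i, p i N ω := by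
  have := Fintype.ofFinite ι
  have h : Tendsto (fun N => ∑ i, μ {ω | ¬ p i N ω}) atTop (𝓝 (∑ _i : ι, 0)) :=
    tendsto_finsetSum _ fun i _ => hp i
  rw [Finset.sum_const_zero] at h
  refine tendsto_of_tendsto_of_tendsto_of_le_of_le tendsto_const_nhds h (fun _ => zero_le)
    fun N => ?_
  refine (measure_mono ?_).trans (measure_iUnion_fintype_le μ fun i => {ω | ¬ p i N ω})
  intro ω hω
  simpa using hω

theorem HighProb.forall_mem_finite {ι : Type*} {s : Set ι} (hs : s.Finite)
    {p : ι → ℕ → Ω → Prop} (hp : ∀ i ∈ s, HighProb μ (p i)) :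
    HighProb μ fun N ω => ∀ i ∈ s, p i N ω := by
  have := hs.to_subtype
  exact (HighProb.forall_fintype (fun i : s => hp i i.2)).imp fun N ω h i hi => h ⟨i, hi⟩

/-- Allows an argument to treat a tight sequence as bounded by a constant: the exceptional event
costs at most `ε / 2`. -/
theorem BddInProb.highProb {X : ℕ → Ω → E} (hX : BddInProb μ X) {p : ℕ → Ω → Prop}
    (h : ∀ C : ℝ, HighProb μ fun N ω => ‖X N ω‖ ≤ C → p N ω) : HighProb μ p := by
  rw [HighProb, ENNReal.tendsto_nhds_zero]
  intro ε hε
  obtain ⟨C, hC⟩ := hX (ε / 2) (ENNReal.half_pos hε.ne')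
  filter_upwards [hC, (ENNReal.tendsto_nhds_zero.1 (h C)) (ε / 2) (ENNReal.half_pos hε.ne')]
    with N h1 h2
  calc μ {ω | ¬ p N ω}
      ≤ μ ({ω | ¬ ‖X N ω‖ ≤ C} ∪ {ω | ¬ (‖X N ω‖ ≤ C → p N ω)}) := by
        refine measure_mono fun ω hω => ?_
        by_cases hc : ‖X N ω‖ ≤ C
        · exact Or.inr fun hh => hω (hh hc)
        · exact Or.inl hc
    _ ≤ ε / 2 + ε / 2 := (measure_union_le _ _).trans (add_le_add h1 h2)
    _ = ε := ENNReal.add_halves ε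

theorem BddInProb.of_imp {X : ℕ → Ω → E} (hX : BddInProb μ X) {Y : ℕ → Ω → F}
    (h : ∀ C : ℝ, ∃ C' : ℝ, HighProb μ fun N ω => ‖X N ω‖ ≤ C → ‖Y N ω‖ ≤ C') :
    BddInProb μ Y := by
  intro ε hε
  obtain ⟨C, hC⟩ := hX (ε / 2) (ENNReal.half_pos hε.ne')
  obtain ⟨C', hC'⟩ := h C
  refine ⟨C', ?_⟩
  filter_upwards [hC, (ENNReal.tendsto_nhds_zero.1 hC') (ε / 2) (ENNReal.half_pos hε.ne')]
    with N h1 h2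
  calc μ {ω | ¬ ‖Y N ω‖ ≤ C'}
      ≤ μ ({ω | ¬ ‖X N ω‖ ≤ C} ∪ {ω | ¬ (‖X N ω‖ ≤ C → ‖Y N ω‖ ≤ C')}) := by
        refine measure_mono fun ω hω => ?_
        by_cases hc : ‖X N ω‖ ≤ C
        · exact Or.inr fun hh => hω (hh hc)
        · exact Or.inl hc
    _ ≤ ε / 2 + ε / 2 := (measure_union_le _ _).trans (add_le_add h1 h2)
    _ = ε := ENNReal.add_halves ε

theorem BddInProb.of_le {X : ℕ → Ω → E} (hX : BddInProb μ X) {Y : ℕ → Ω → F}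
    (h : HighProb μ fun N ω => ‖Y N ω‖ ≤ ‖X N ω‖) : BddInProb μ Y :=
  hX.of_imp fun C => ⟨C, h.imp fun _ _ h1 h2 => h1.trans h2⟩

theorem SmallInProb.of_le {X : ℕ → Ω → E} (hX : SmallInProb μ X) {Y : ℕ → Ω → F}
    (h : HighProb μ fun N ω => ‖Y N ω‖ ≤ ‖X N ω‖) : SmallInProb μ Y := fun δ hδ =>
  (h.and (hX δ hδ)).imp fun _ _ h1 => h1.1.trans_lt h1.2

theorem SmallInProb.congr {X Y : ℕ → Ω → E} (hX : SmallInProb μ X)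
    (h : HighProb μ fun N ω => Y N ω = X N ω) : SmallInProb μ Y :=
  hX.of_le (h.imp fun _ _ h => by rw [h])

theorem SmallInProb.norm {X : ℕ → Ω → E} (hX : SmallInProb μ X) :
    SmallInProb μ fun N ω => ‖X N ω‖ := by simpa [SmallInProb] using hX

theorem BddInProb.norm {X : ℕ → Ω → E} (hX : BddInProb μ X) :
    BddInProb μ fun N ω => ‖X N ω‖ := by simpa [BddInProb] using hX

theorem SmallInProb.bddInProb {X : ℕ → Ω → E} (hX : SmallInProb μ X) : BddInProb μ X := by
  intro ε hε
  refine ⟨1, ?_⟩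
  filter_upwards [(ENNReal.tendsto_nhds_zero.1 (hX 1 one_pos)) ε hε] with N h
  exact (measure_mono fun ω (hω : ¬ _) (hh : _ < _) => hω hh.le).trans h

theorem bddInProb_const (c : E) : BddInProb μ fun _ _ => c := fun ε _ =>
  ⟨‖c‖, by simp⟩

theorem BddInProb.add {X Y : ℕ → Ω → E} (hX : BddInProb μ X) (hY : BddInProb μ Y) :
    BddInProb μ fun N ω => X N ω + Y N ω := by
  intro ε hε
  obtain ⟨C, hC⟩ := hX (ε / 2) (ENNReal.half_pos hε.ne')
  obtain ⟨D, hD⟩ := hY (ε / 2) (ENNReal.half_pos hε.ne')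
  refine ⟨C + D, ?_⟩
  filter_upwards [hC, hD] with N h1 h2
  calc μ {ω | ¬ ‖X N ω + Y N ω‖ ≤ C + D}
      ≤ μ ({ω | ¬ ‖X N ω‖ ≤ C} ∪ {ω | ¬ ‖Y N ω‖ ≤ D}) := by
        refine measure_mono fun ω hω => ?_
        by_contra hc
        simp only [Set.mem_union, Set.mem_ofPred_eq, not_or, not_not] at hc
        exact hω ((norm_add_le _ _).trans (add_le_add hc.1 hc.2))
    _ ≤ ε / 2 + ε / 2 := (measure_union_le _ _).trans (add_le_add h1 h2)
    _ = ε := ENNReal.add_halves ε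

theorem SmallInProb.add {X Y : ℕ → Ω → E} (hX : SmallInProb μ X) (hY : SmallInProb μ Y) :
    SmallInProb μ fun N ω => X N ω + Y N ω := fun δ hδ =>
  ((hX (δ / 2) (half_pos hδ)).and (hY (δ / 2) (half_pos hδ))).imp fun N ω h =>
    (norm_add_le _ _).trans_lt (by linarith [h.1, h.2])

theorem SmallInProb.neg {X : ℕ → Ω → E} (hX : SmallInProb μ X) :
    SmallInProb μ fun N ω => -X N ω := by simpa [SmallInProb] using hX

theorem SmallInProb.sub {X Y : ℕ → Ω → E} (hX : SmallInProb μ X) (hY : SmallInProb μ Y) :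
    SmallInProb μ fun N ω => X N ω - Y N ω := by
  simpa only [sub_eq_add_neg] using hX.add hY.neg

theorem smallInProb_zero : SmallInProb μ fun _ _ => (0 : E) := fun δ hδ =>
  highProb_of_forall (Eventually.of_forall fun _ _ => by simpa using hδ)

theorem SmallInProb.sum {ι : Type*} (s : Finset ι) {X : ι → ℕ → Ω → E}
    (hX : ∀ i ∈ s, SmallInProb μ (X i)) : SmallInProb μ fun N ω => ∑ i ∈ s, X i N ω := by
  classical
  induction s using Finset.induction_on with
  | empty => simpa using smallInProb_zero
  | insert i s hi ih =>
    simp only [Finset.sum_insert hi]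
    exact (hX i (by simp)).add (ih fun j hj => hX j (by simp [hj]))

theorem BddInProb.sum {ι : Type*} (s : Finset ι) {X : ι → ℕ → Ω → E}
    (hX : ∀ i ∈ s, BddInProb μ (X i)) : BddInProb μ fun N ω => ∑ i ∈ s, X i N ω := by
  classical
  induction s using Finset.induction_on with
  | empty => simpa using bddInProb_const 0
  | insert i s hi ih =>
    simp only [Finset.sum_insert hi]
    exact (hX i (by simp)).add (ih fun j hj => hX j (by simp [hj]))

theorem SmallInProb.mul_bdd {X Y : ℕ → Ω → ℝ} (hX : SmallInProb μ X) (hY : BddInProb μ Y) :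
    SmallInProb μ fun N ω => X N ω * Y N ω := by
  intro δ hδ
  refine hY.highProb fun C => ?_
  have hC : 0 < |C| + 1 := by positivity
  refine (hX (δ / (|C| + 1)) (by positivity)).imp fun N ω h1 h2 => ?_
  rw [lt_div_iff₀ hC] at h1
  rw [norm_mul]
  refine lt_of_le_of_lt ?_ h1
  exact mul_le_mul_of_nonneg_left (h2.trans (by linarith [le_abs_self C])) (norm_nonneg _)

theorem BddInProb.mul {X Y : ℕ → Ω → ℝ} (hX : BddInProb μ X) (hY : BddInProb μ Y) :
    BddInProb μ fun N ω => X N ω * Y N ω := by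
  intro ε hε
  obtain ⟨C, hC⟩ := hX (ε / 2) (ENNReal.half_pos hε.ne')
  obtain ⟨D, hD⟩ := hY (ε / 2) (ENNReal.half_pos hε.ne')
  refine ⟨|C| * |D|, ?_⟩
  filter_upwards [hC, hD] with N h1 h2
  calc μ {ω | ¬ ‖X N ω * Y N ω‖ ≤ |C| * |D|}
      ≤ μ ({ω | ¬ ‖X N ω‖ ≤ C} ∪ {ω | ¬ ‖Y N ω‖ ≤ D}) := by
        refine measure_mono fun ω hω => ?_
        by_contra hc
        simp only [Set.mem_union, Set.mem_ofPred_eq, not_or, not_not] at hc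
        refine hω ?_
        rw [norm_mul]
        exact mul_le_mul (hc.1.trans (le_abs_self C)) (hc.2.trans (le_abs_self D))
          (norm_nonneg _) (abs_nonneg _)
    _ ≤ ε / 2 + ε / 2 := (measure_union_le _ _).trans (add_le_add h1 h2)
    _ = ε := ENNReal.add_halves ε

theorem SmallInProb.of_norm_le_mul {X : ℕ → Ω → E} {A B : ℕ → Ω → ℝ} (hA : SmallInProb μ A)
    (hB : BddInProb μ B) (h : HighProb μ fun N ω => ‖X N ω‖ ≤ A N ω * B N ω) :
    SmallInProb μ X :=
  (hA.mul_bdd hB).of_le (h.imp fun _ _ h => h.trans (le_abs_self _))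

theorem BddInProb.of_norm_le {X : ℕ → Ω → E} {A : ℕ → Ω → ℝ} (hA : BddInProb μ A)
    (h : HighProb μ fun N ω => ‖X N ω‖ ≤ A N ω) : BddInProb μ X :=
  hA.of_le (h.imp fun _ _ h => h.trans (le_abs_self _))

theorem SmallInProb.of_norm_le {X : ℕ → Ω → E} {A : ℕ → Ω → ℝ} (hA : SmallInProb μ A)
    (h : HighProb μ fun N ω => ‖X N ω‖ ≤ A N ω) : SmallInProb μ X :=
  hA.of_le (h.imp fun _ _ h => h.trans (le_abs_self _))

theorem smallInProb_iff_tendstoInMeasure {X : ℕ → Ω → E} :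
    SmallInProb μ X ↔ TendstoInMeasure μ X atTop fun _ => 0 := by
  simp [SmallInProb, HighProb, tendstoInMeasure_iff_norm]

theorem smallInProb_sub_iff {X : ℕ → Ω → E} {c : E} :
    (SmallInProb μ fun N ω => X N ω - c) ↔ TendstoInMeasure μ X atTop fun _ => c := by
  simp [SmallInProb, HighProb, tendstoInMeasure_iff_norm]

theorem bddInProb_of_sub_small {X : ℕ → Ω → E} {c : E}
    (hX : SmallInProb μ fun N ω => X N ω - c) : BddInProb μ X := by
  simpa using hX.bddInProb.add (bddInProb_const c)

theorem smallInProb_of_tendsto {a : ℕ → ℝ} (h : Tendsto a atTop (𝓝 0)) :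
    SmallInProb μ fun N _ => a N := fun δ hδ => by
  refine highProb_of_forall ?_
  have := (Metric.tendsto_nhds.1 h) δ hδ
  filter_upwards [this] with N hN ω
  simpa using hN

end StochasticOrder

end

/-! ### Averages over an independent and identically distributed sample -/

section

section Averages

variable {Ω 𝒵 : Type*} [MeasurableSpace Ω] [MeasurableSpace 𝒵] {μ : Measure Ω}
  {P : Measure 𝒵} {Z : ℕ → Ω → 𝒵}

/-- `Z 0, Z 1, …` are independent with law `P`. -/
structure IsSample (μ : Measure Ω) (P : Measure 𝒵) (Z : ℕ → Ω → 𝒵) : Prop where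
  meas : ∀ i, Measurable (Z i)
  indep : iIndepFun Z μ
  law : ∀ i, μ.map (Z i) = P

/-- The average of `g` over the first `N` observations. -/
def avg {E : Type*} [AddCommGroup E] [Module ℝ E] (Z : ℕ → Ω → 𝒵) (g : 𝒵 → E) (N : ℕ) (ω : Ω) :
    E :=
  (N : ℝ)⁻¹ • ∑ i ∈ Finset.range N, g (Z i ω)

section Algebra

variable {E F : Type*} [NormedAddCommGroup E] [NormedSpace ℝ E] [NormedAddCommGroup F]
  [NormedSpace ℝ F] {N : ℕ} {ω : Ω}

theorem avg_add (g h : 𝒵 → E) :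
    avg Z (fun z => g z + h z) N ω = avg Z g N ω + avg Z h N ω := by
  simp [avg, Finset.sum_add_distrib]

theorem avg_sub (g h : 𝒵 → E) :
    avg Z (fun z => g z - h z) N ω = avg Z g N ω - avg Z h N ω := by
  simp [avg, Finset.sum_sub_distrib, smul_sub]

theorem avg_clm (L : E →L[ℝ] F) (g : 𝒵 → E) :
    avg Z (fun z => L (g z)) N ω = L (avg Z g N ω) := by
  simp [avg]

theorem avg_sum {ι : Type*} (s : Finset ι) (g : ι → 𝒵 → E) :
    avg Z (fun z => ∑ i ∈ s, g i z) N ω = ∑ i ∈ s, avg Z (g i) N ω := by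
  simp only [avg, Finset.smul_sum]
  rw [Finset.sum_comm]

theorem avg_const_mul (c : ℝ) (g : 𝒵 → ℝ) :
    avg Z (fun z => c * g z) N ω = c * avg Z g N ω := by
  simp only [avg, ← Finset.mul_sum, smul_eq_mul]; ring

theorem avg_apply {ι : Type*} [Fintype ι] (g : 𝒵 → ι → ℝ) (i : ι) :
    avg Z g N ω i = avg Z (fun z => g z i) N ω := by
  simp [avg]

theorem avg_const (hN : N ≠ 0) (c : E) : avg Z (fun _ => c) N ω = c := by
  have : (N : ℝ) ≠ 0 := by exact_mod_cast hN
  simp [avg, ← Nat.cast_smul_eq_nsmul ℝ, smul_smul, this]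

theorem avg_mono_of {g h : 𝒵 → ℝ} (H : ∀ i < N, g (Z i ω) ≤ h (Z i ω)) :
    avg Z g N ω ≤ avg Z h N ω := by
  simp only [avg, smul_eq_mul]
  exact mul_le_mul_of_nonneg_left
    (Finset.sum_le_sum fun i hi => H i (Finset.mem_range.1 hi)) (by positivity)

theorem norm_avg_le_of {g : 𝒵 → E} {h : 𝒵 → ℝ} (H : ∀ i < N, ‖g (Z i ω)‖ ≤ h (Z i ω)) :
    ‖avg Z g N ω‖ ≤ avg Z h N ω := by
  simp only [avg, norm_smul, norm_inv, smul_eq_mul]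
  rw [Real.norm_of_nonneg (by positivity)]
  exact mul_le_mul_of_nonneg_left
    (norm_sum_le_of_le _ fun i hi => H i (Finset.mem_range.1 hi)) (by positivity)

theorem avg_nonneg {g : 𝒵 → ℝ} (h : ∀ z, 0 ≤ g z) : 0 ≤ avg Z g N ω := by
  simp only [avg, smul_eq_mul]
  exact mul_nonneg (by positivity) (Finset.sum_nonneg fun i _ => h _)

theorem sqrt_mul_avg (g : 𝒵 → ℝ) :
    √(N : ℝ) * avg Z g N ω = (√(N : ℝ))⁻¹ * ∑ i ∈ Finset.range N, g (Z i ω) := by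
  simp only [avg, smul_eq_mul, ← mul_assoc]
  congr 1
  -- At `N = 0` both sides are zero, because the inverse of zero is zero.
  rcases Nat.eq_zero_or_pos N with rfl | hN
  · simp
  have h : (0 : ℝ) < √N := Real.sqrt_pos.2 (by exact_mod_cast hN)
  have h2 : √(N : ℝ) ^ 2 = N := Real.sq_sqrt (by positivity)
  have h3 : (0 : ℝ) < N := by exact_mod_cast hN
  field_simp
  exact h2

end Algebra

variable [IsProbabilityMeasure μ]

theorem IsSample.isProbabilityMeasure (hs : IsSample μ P Z) : IsProbabilityMeasure P :=
  hs.law 0 ▸ Measure.isProbabilityMeasure_map (hs.meas 0).aemeasurable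

theorem IsSample.measurePreserving (hs : IsSample μ P Z) (i : ℕ) :
    MeasurePreserving (Z i) μ P := ⟨hs.meas i, hs.law i⟩

theorem IsSample.identDistrib (hs : IsSample μ P Z) {E : Type*} [MeasurableSpace E] {g : 𝒵 → E}
    (hg : Measurable g) (i : ℕ) :
    IdentDistrib (fun ω => g (Z i ω)) (fun ω => g (Z 0 ω)) μ μ :=
  (IdentDistrib.mk (hs.meas i).aemeasurable (hs.meas 0).aemeasurable
    ((hs.law i).trans (hs.law 0).symm)).comp hg

theorem IsSample.integral (hs : IsSample μ P Z) {E : Type*} [NormedAddCommGroup E]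
    [NormedSpace ℝ E] {g : 𝒵 → E} (hg : AEStronglyMeasurable g P) (i : ℕ) :
    ∫ ω, g (Z i ω) ∂μ = ∫ z, g z ∂P := by
  rw [← hs.law i, integral_map (hs.meas i).aemeasurable ((hs.law i).symm ▸ hg)]

/-- Weak law of large numbers. -/
theorem IsSample.lln (hs : IsSample μ P Z) {E : Type*} [NormedAddCommGroup E] [NormedSpace ℝ E]
    [CompleteSpace E] [MeasurableSpace E] [BorelSpace E] [SecondCountableTopology E]
    {g : 𝒵 → E} (hg : Measurable g) (hi : Integrable g P) :
    SmallInProb μ fun N ω => avg Z g N ω - ∫ z, g z ∂P := by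
  rw [smallInProb_sub_iff]
  have h0 : Integrable (fun ω => g (Z 0 ω)) μ :=
    ((hs.measurePreserving 0).integrable_comp hi.aestronglyMeasurable).2 hi
  have h := strong_law_ae (μ := μ) (fun i ω => g (Z i ω)) h0
    (fun i j hij => (hs.indep.indepFun hij).comp hg hg) (hs.identDistrib hg)
  rw [hs.integral hi.aestronglyMeasurable 0] at h
  refine tendstoInMeasure_of_tendsto_ae (fun N => ?_) h
  refine Measurable.aestronglyMeasurable ?_
  have := fun i => hg.comp (hs.meas i)
  unfold avg
  exact (Finset.measurable_fun_sum _ fun i _ => this i).const_smul _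

theorem IsSample.bddInProb_avg (hs : IsSample μ P Z) {E : Type*} [NormedAddCommGroup E]
    [NormedSpace ℝ E] [CompleteSpace E] [MeasurableSpace E] [BorelSpace E]
    [SecondCountableTopology E] {g : 𝒵 → E} (hg : Measurable g) (hi : Integrable g P) :
    BddInProb μ (avg Z g) := bddInProb_of_sub_small (hs.lln hg hi)

/-- Central limit theorem for centred square integrable functions. -/
theorem IsSample.clt (hs : IsSample μ P Z) {g : 𝒵 → ℝ} (hg : Measurable g) (h2 : MemLp g 2 P)
    (h0 : ∫ z, g z ∂P = 0) :
    TendstoInDistribution (fun (N : ℕ) ω => √(N : ℝ) * avg Z g N ω) atTop (id : ℝ → ℝ)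
      (fun _ => μ) (gaussianReal 0 (Real.toNNReal (∫ z, g z ^ 2 ∂P))) := by
  have hL : MemLp (fun ω => g (Z 0 ω)) 2 μ := h2.comp_measurePreserving (hs.measurePreserving 0)
  have hE : ∫ ω, g (Z 0 ω) ∂μ = 0 := by rw [hs.integral h2.1 0, h0]
  have hV : Var[fun ω => g (Z 0 ω); μ] = ∫ z, g z ^ 2 ∂P := by
    rw [variance_of_integral_eq_zero hL.aemeasurable hE,
      hs.integral (g := fun z => g z ^ 2) (h2.1.pow 2) 0]
  have h := tendstoInDistribution_inv_sqrt_mul_sum_sub (P := μ) (X := fun i ω => g (Z i ω))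
    (Y := (id : ℝ → ℝ)) (P' := gaussianReal 0 (Var[fun ω => g (Z 0 ω); μ]).toNNReal)
    ⟨aemeasurable_id, by simp⟩ hL (hs.indep.comp (fun _ => g) fun _ => hg) (hs.identDistrib hg)
  rw [hV] at h
  simpa [hE, sqrt_mul_avg] using h

/-- Chebyshev's inequality: the variance of `√N * avg` is at most `∫ g²` for every `N`. -/
theorem IsSample.bddInProb_sqrt_avg (hs : IsSample μ P Z) {g : 𝒵 → ℝ} (hg : Measurable g)
    (h2 : MemLp g 2 P) (h0 : ∫ z, g z ∂P = 0) :
    BddInProb μ fun (N : ℕ) ω => √(N : ℝ) * avg Z g N ω := by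
  set V := ∫ z, g z ^ 2 ∂P with hV
  have hV0 : 0 ≤ V := integral_nonneg fun z => sq_nonneg _
  have hmem : ∀ i, MemLp (fun ω => g (Z i ω)) 2 μ := fun i =>
    h2.comp_measurePreserving (hs.measurePreserving i)
  have hmean : ∀ i, ∫ ω, g (Z i ω) ∂μ = 0 := fun i => by rw [hs.integral h2.1 i, h0]
  have key : ∀ (N : ℕ) (C : ℝ), 0 < C →
      μ {ω | C ≤ |√(N : ℝ) * avg Z g N ω|} ≤ ENNReal.ofReal (V / C ^ 2) := by
    intro N C hC
    have hsum : MemLp (∑ i ∈ Finset.range N, fun ω => g (Z i ω)) 2 μ :=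
      memLp_finsetSum' _ fun i _ => hmem i
    have hX : MemLp (fun ω => √(N : ℝ) * avg Z g N ω) 2 μ := by
      simp_rw [sqrt_mul_avg]
      convert hsum.const_mul (√(N : ℝ))⁻¹ using 2 with ω
      simp
    have hXE : ∫ ω, √(N : ℝ) * avg Z g N ω ∂μ = 0 := by
      simp_rw [sqrt_mul_avg]
      rw [integral_const_mul, integral_finsetSum _ fun i _ => (hmem i).integrable (by norm_num)]
      simp [hmean]
    have hXV : Var[fun ω => √(N : ℝ) * avg Z g N ω; μ] ≤ V := by
      have : (fun ω => √(N : ℝ) * avg Z g N ω) =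
          fun ω => (√(N : ℝ))⁻¹ * (∑ i ∈ Finset.range N, fun ω => g (Z i ω)) ω := by
        ext ω; simp [sqrt_mul_avg]
      rw [this, variance_const_mul, IndepFun.variance_sum (fun i _ => hmem i)
        (fun i _ j _ hij => (hs.indep.indepFun hij).comp hg hg)]
      have : ∀ i ∈ Finset.range N, Var[fun ω => g (Z i ω); μ] = V := fun i _ => by
        rw [variance_of_integral_eq_zero (hmem i).aemeasurable (hmean i),
          hs.integral (g := fun z => g z ^ 2) (h2.1.pow 2) i]
      rw [Finset.sum_congr rfl this]
      rcases Nat.eq_zero_or_pos N with rfl | hN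
      · simpa using hV0
      · have hN' : (0 : ℝ) < N := by exact_mod_cast hN
        simp only [Finset.sum_const, Finset.card_range, nsmul_eq_mul, inv_pow]
        rw [Real.sq_sqrt hN'.le, ← mul_assoc, inv_mul_cancel₀ hN'.ne', one_mul]
    have := meas_ge_le_variance_div_sq hX hC
    rw [hXE] at this
    simp only [sub_zero] at this
    exact this.trans (ENNReal.ofReal_le_ofReal (by gcongr))
  intro ε hε
  have hlim : Tendsto (fun C : ℝ => ENNReal.ofReal (V / C ^ 2)) atTop (𝓝 0) := by
    rw [← ENNReal.ofReal_zero]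
    exact ENNReal.tendsto_ofReal
      (tendsto_const_nhds.div_atTop (tendsto_pow_atTop (two_ne_zero)))
  obtain ⟨C, hC1, hC2⟩ := (((ENNReal.tendsto_nhds_zero.1 hlim) ε hε).and
    (eventually_gt_atTop 0)).exists
  refine ⟨C, Eventually.of_forall fun N => ((measure_mono fun ω hω => ?_).trans
    (key N C hC2)).trans hC1⟩
  exact (not_le.1 hω).le

theorem IsSample.bddInProb_sqrt_avg_pi (hs : IsSample μ P Z) {ι : Type*} [Fintype ι]
    {g : 𝒵 → ι → ℝ} (hg : Measurable g) (h2 : MemLp g 2 P) (h0 : ∫ z, g z ∂P = 0) :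
    BddInProb μ fun (N : ℕ) ω => √(N : ℝ) • avg Z g N ω := by
  have := hs.isProbabilityMeasure
  have h2' : ∀ i, MemLp (fun z => g z i) 2 P := fun i => MemLp.eval h2 i
  have h := BddInProb.sum Finset.univ (fun i _ =>
    (hs.bddInProb_sqrt_avg ((measurable_pi_apply i).comp hg) (h2' i) (by
      have := congrFun h0 i
      rw [eval_integral (fun j => (h2' j).integrable (by norm_num))] at this
      exact this)).norm)
  refine h.of_norm_le (highProb_of_forall (Eventually.of_forall fun N ω => ?_))
  refine (pi_norm_le_iff_of_nonneg (Finset.sum_nonneg fun _ _ => norm_nonneg _)).2 fun i => ?_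
  refine le_trans (le_of_eq ?_) (Finset.single_le_sum
    (f := fun i => ‖√(N : ℝ) * avg Z (fun z => g z i) N ω‖) (fun _ _ => norm_nonneg _)
    (Finset.mem_univ i))
  simp [avg_apply]

/-- Maxima of variables with finite third moment grow slower than `√N`. -/
theorem IsSample.max_small (hs : IsSample μ P Z) {ξ : 𝒵 → ℝ} (hξ : Measurable ξ)
    (h0 : ∀ z, 0 ≤ ξ z) (h3 : Integrable (fun z => ξ z ^ 3) P) {δ : ℝ} (hδ : 0 < δ) :
    HighProb μ fun N ω => ∀ i < N, ξ (Z i ω) ≤ δ * √(N : ℝ) := by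
  set T := ∫ z, ξ z ^ 3 ∂P
  have hT0 : 0 ≤ T := integral_nonneg fun z => pow_nonneg (h0 z) 3
  have key : ∀ N : ℕ, 0 < N → μ {ω | ¬ ∀ i < N, ξ (Z i ω) ≤ δ * √(N : ℝ)} ≤
      ENNReal.ofReal (T / δ ^ 3 * (√(N : ℝ))⁻¹) := by
    intro N hN
    have hN' : (0 : ℝ) < √N := Real.sqrt_pos.2 (by exact_mod_cast hN)
    -- Markov's inequality for `ξ ^ 3`. The union over `N` observations then leaves `N * N ^
    -- (-3/2)`.
    have hm : ∀ i, μ {ω | δ * √(N : ℝ) < ξ (Z i ω)} ≤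
        ENNReal.ofReal (T / (δ * √(N : ℝ)) ^ 3) := by
      intro i
      have e : {ω | δ * √(N : ℝ) < ξ (Z i ω)} = Z i ⁻¹' {z | δ * √(N : ℝ) < ξ z} := rfl
      rw [e, ← Measure.map_apply (hs.meas i) (measurableSet_lt measurable_const hξ), hs.law i]
      have := hs.isProbabilityMeasure
      rw [← ofReal_measureReal]
      refine ENNReal.ofReal_le_ofReal ?_
      rw [le_div_iff₀ (by positivity), mul_comm]
      refine le_trans ?_ (mul_meas_ge_le_integral_of_nonneg
        (Eventually.of_forall fun z => pow_nonneg (h0 z) 3) h3 ((δ * √(N : ℝ)) ^ 3))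
      refine mul_le_mul_of_nonneg_left (measureReal_mono fun z hz => ?_) (by positivity)
      exact pow_le_pow_left₀ (by positivity) (le_of_lt (show δ * √(N : ℝ) < ξ z from hz)) 3
    calc μ {ω | ¬ ∀ i < N, ξ (Z i ω) ≤ δ * √(N : ℝ)}
        ≤ μ (⋃ i ∈ Finset.range N, {ω | δ * √(N : ℝ) < ξ (Z i ω)}) := by
          refine measure_mono fun ω hω => ?_
          simp only [Set.mem_ofPred_eq, not_forall, not_le] at hω
          obtain ⟨i, hi, h⟩ := hω
          exact Set.mem_biUnion (Finset.mem_coe.2 (Finset.mem_range.2 hi)) h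
      _ ≤ ∑ i ∈ Finset.range N, μ {ω | δ * √(N : ℝ) < ξ (Z i ω)} :=
          measure_biUnion_finset_le _ _
      _ ≤ ∑ _i ∈ Finset.range N, ENNReal.ofReal (T / (δ * √(N : ℝ)) ^ 3) :=
          Finset.sum_le_sum fun i _ => hm i
      _ = ENNReal.ofReal (N * (T / (δ * √(N : ℝ)) ^ 3)) := by
          rw [ENNReal.ofReal_mul (by positivity)]; simp
      _ = _ := by
          congr 1
          have h2 : √(N : ℝ) ^ 2 = N := Real.sq_sqrt (by positivity)
          rw [mul_pow, pow_succ (√(N : ℝ)) 2, h2]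
          have : (0 : ℝ) < N := by exact_mod_cast hN
          field_simp
  refine tendsto_of_tendsto_of_tendsto_of_le_of_le' tendsto_const_nhds ?_
    (Eventually.of_forall fun _ => zero_le) ((eventually_gt_atTop 0).mono key)
  rw [← ENNReal.ofReal_zero]
  refine ENNReal.tendsto_ofReal ?_
  have : Tendsto (fun N : ℕ => (√(N : ℝ))⁻¹) atTop (𝓝 0) :=
    tendsto_inv_atTop_zero.comp (Real.tendsto_sqrt_atTop.comp tendsto_natCast_atTop_atTop)
  simpa using this.const_mul (T / δ ^ 3)

/-- Stochastic equicontinuity of averages of a dominated family which is continuous in the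
parameter. -/
theorem IsSample.equicontinuous (hs : IsSample μ P Z) {E G : Type*} [NormedAddCommGroup E]
    [SecondCountableTopology E] [NormedAddCommGroup G] [MeasurableSpace G] [BorelSpace G]
    [SecondCountableTopology G] {g : 𝒵 → E → G} {ν₀ : E} {r : ℝ} (hr : 0 < r)
    (hcont : ∀ z, ContinuousOn (g z) (Metric.ball ν₀ r))
    (hmeas : ∀ ν ∈ Metric.ball ν₀ r, Measurable fun z => g z ν)
    {B : 𝒵 → ℝ} (hB : Integrable B P) (hgB : ∀ z, ∀ ν ∈ Metric.ball ν₀ r, ‖g z ν‖ ≤ B z)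
    {ε : ℝ} (hε : 0 < ε) :
    ∃ δ > 0, δ ≤ r ∧ HighProb μ fun N ω => ∀ ν ∈ Metric.ball ν₀ δ,
      avg Z (fun z => ‖g z ν - g z ν₀‖) N ω ≤ ε := by
  have h00 : ν₀ ∈ Metric.ball ν₀ r := Metric.mem_ball_self hr
  obtain ⟨D, hDc, hDd⟩ := TopologicalSpace.exists_countable_dense E
  -- The modulus of continuity on a shrinking ball. The supremum runs over a countable dense set to
  -- be measurable; continuity extends the bound to the whole ball in `hle`.
  let W : ℕ → 𝒵 → ℝ≥0∞ := fun n z =>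
    ⨆ ν ∈ D ∩ Metric.ball ν₀ (r / (n + 1)), ENNReal.ofReal ‖g z ν - g z ν₀‖
  have hsub : ∀ n : ℕ, Metric.ball ν₀ (r / (n + 1)) ⊆ Metric.ball ν₀ r := fun n =>
    Metric.ball_subset_ball (div_le_self hr.le (by linarith [n.cast_nonneg (α := ℝ)]))
  have hWm : ∀ n, Measurable (W n) := fun n =>
    Measurable.biSup _ (hDc.mono Set.inter_subset_left) fun ν hν =>
      ((hmeas ν (hsub n hν.2)).sub (hmeas ν₀ h00)).norm.ennreal_ofReal
  have hWB : ∀ n z, W n z ≤ ENNReal.ofReal (2 * B z) := fun n z =>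
    iSup₂_le fun ν hν => ENNReal.ofReal_le_ofReal ((norm_sub_le _ _).trans
      (by linarith [hgB z ν (hsub n hν.2), hgB z ν₀ h00]))
  have hBfin : ∫⁻ z, ENNReal.ofReal (2 * B z) ∂P ≠ ∞ := (hB.const_mul 2).lintegral_lt_top.ne
  have hW0 : ∀ z, Tendsto (fun n => W n z) atTop (𝓝 0) := by
    intro z
    rw [ENNReal.tendsto_nhds_zero]
    intro η hη
    obtain ⟨η', hη', hlt⟩ := ENNReal.lt_iff_exists_real_btwn.1 hη
    have hη'0 : 0 < η' := by simpa using hlt.1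
    obtain ⟨δ, hδ, h⟩ := Metric.continuousAt_iff.1
      ((hcont z).continuousAt (Metric.isOpen_ball.mem_nhds h00)) η' hη'0
    have hlim : Tendsto (fun n : ℕ => r / ((n : ℝ) + 1)) atTop (𝓝 0) :=
      tendsto_const_nhds.div_atTop
        (tendsto_atTop_add_const_right _ _ tendsto_natCast_atTop_atTop)
    filter_upwards [hlim.eventually (gt_mem_nhds hδ)] with n hn
    refine iSup₂_le fun ν hν => le_trans ?_ hlt.2.le
    refine ENNReal.ofReal_le_ofReal ?_
    rw [← dist_eq_norm]
    exact (h ((Metric.mem_ball.1 hν.2).trans hn)).le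
  -- Dominated convergence makes the mean modulus small at one fixed radius; at that radius the law
  -- of large numbers controls its average.
  have hlim := tendsto_lintegral_of_dominated_convergence (μ := P) (F := W) (f := fun _ => 0)
    (fun z => ENNReal.ofReal (2 * B z)) hWm (fun n => Eventually.of_forall (hWB n)) hBfin
    (Eventually.of_forall hW0)
  rw [lintegral_zero] at hlim
  obtain ⟨n, hn⟩ := ((ENNReal.tendsto_nhds_zero.1 hlim) (ENNReal.ofReal (ε / 2))
    (by simpa using hε)).exists
  have hWtop : ∀ z, W n z ≠ ∞ := fun z => ((hWB n z).trans_lt ENNReal.ofReal_lt_top).ne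
  have hWi : Integrable (fun z => (W n z).toReal) P :=
    integrable_toReal_of_lintegral_ne_top (hWm n).aemeasurable
      (hn.trans_lt ENNReal.ofReal_lt_top).ne
  have hWint : ∫ z, (W n z).toReal ∂P ≤ ε / 2 := by
    rw [integral_toReal (hWm n).aemeasurable (Eventually.of_forall fun z => (hWtop z).lt_top)]
    exact ENNReal.toReal_le_of_le_ofReal (by positivity) hn
  have hpos : 0 < r / ((n : ℝ) + 1) := by positivity
  refine ⟨r / (n + 1), hpos, div_le_self hr.le (by linarith [n.cast_nonneg (α := ℝ)]), ?_⟩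
  have hle : ∀ z, ∀ ν ∈ Metric.ball ν₀ (r / ((n : ℝ) + 1)), ‖g z ν - g z ν₀‖ ≤ (W n z).toReal := by
    intro z ν hν
    have hc : ContinuousOn (fun ν => ‖g z ν - g z ν₀‖) (Metric.ball ν₀ (r / ((n : ℝ) + 1))) :=
      (((hcont z).mono (hsub n)).sub continuousOn_const).norm
    have hcl : ν ∈ closure (Metric.ball ν₀ (r / ((n : ℝ) + 1)) ∩ D) :=
      hDd.open_subset_closure_inter Metric.isOpen_ball hν
    have hw : ContinuousWithinAt (fun ν => ‖g z ν - g z ν₀‖)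
        (Metric.ball ν₀ (r / ((n : ℝ) + 1)) ∩ D) ν := (hc ν hν).mono Set.inter_subset_left
    have : (𝓝[Metric.ball ν₀ (r / ((n : ℝ) + 1)) ∩ D] ν).NeBot :=
      mem_closure_iff_nhdsWithin_neBot.1 hcl
    refine le_of_tendsto hw ?_
    filter_upwards [self_mem_nhdsWithin] with ν' hν'
    rw [← ENNReal.ofReal_le_iff_le_toReal (hWtop z)]
    exact le_iSup₂ (f := fun ν (_ : ν ∈ D ∩ Metric.ball ν₀ (r / ((n : ℝ) + 1))) =>
      ENNReal.ofReal ‖g z ν - g z ν₀‖) ν' ⟨hν'.2, hν'.1⟩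
  have hll := hs.lln (hWm n).ennreal_toReal hWi (ε / 2) (half_pos hε)
  refine hll.imp fun N ω h ν hν => ?_
  have h1 : avg Z (fun z => ‖g z ν - g z ν₀‖) N ω ≤ avg Z (fun z => (W n z).toReal) N ω :=
    avg_mono_of fun i _ => hle _ ν hν
  rw [Real.norm_eq_abs] at h
  linarith [(abs_lt.1 h).2]

end Averages

end

/-! ### Smoothness of the mixed logistic likelihood -/

section

/-- Probability of the treatment value `b` at logit `t`. -/
def unitProb (b : Bool) (t : ℝ) : ℝ := if b then Real.sigmoid t else 1 - Real.sigmoid t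

/-- Derivative of `log (unitProb b)`. -/
def unitScore (b : Bool) (t : ℝ) : ℝ := if b then 1 - Real.sigmoid t else -Real.sigmoid t

theorem unitProb_pos (b : Bool) (t : ℝ) : 0 < unitProb b t := by
  cases b <;> simp [unitProb, Real.sigmoid_pos, Real.sigmoid_lt_one]

theorem unitProb_le_one (b : Bool) (t : ℝ) : unitProb b t ≤ 1 := by
  cases b <;> simp [unitProb, Real.sigmoid_nonneg, Real.sigmoid_le_one]

theorem abs_unitScore_le (b : Bool) (t : ℝ) : |unitScore b t| ≤ 1 := by
  have h1 := Real.sigmoid_pos t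
  have h2 := Real.sigmoid_lt_one t
  cases b <;> simp only [unitScore, abs_le] <;> constructor <;> simp <;> linarith

theorem hasDerivAt_log_unitProb (b : Bool) (t : ℝ) :
    HasDerivAt (fun t => Real.log (unitProb b t)) (unitScore b t) t := by
  have h := Real.hasDerivAt_sigmoid t
  have h1 := (Real.sigmoid_pos t).ne'
  have h2 : 1 - Real.sigmoid t ≠ 0 := by linarith [Real.sigmoid_lt_one t]
  cases b
  · simp only [unitProb, unitScore]
    have h3 := (h.const_sub 1).log h2
    rw [neg_div, mul_div_cancel_right₀ _ h2] at h3
    simpa using h3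
  · simp only [unitProb, unitScore]
    have h3 := h.log h1
    rw [mul_div_cancel_left₀ _ h1] at h3
    simpa using h3

theorem hasDerivAt_unitScore (b : Bool) (t : ℝ) :
    HasDerivAt (unitScore b) (-(Real.sigmoid t * (1 - Real.sigmoid t))) t := by
  have h := Real.hasDerivAt_sigmoid t
  cases b
  · exact (h.neg).congr_of_eventuallyEq (Eventually.of_forall fun t => by simp [unitScore])
  · exact (h.const_sub 1).congr_of_eventuallyEq (Eventually.of_forall fun t => by simp [unitScore])

/-! #### Continuous linear maps -/

section Abstract

variable {V U : Type*} [NormedAddCommGroup V] [NormedSpace ℝ V] [NormedAddCommGroup U]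
  [NormedSpace ℝ U] {T : Type*} [TopologicalSpace T]

theorem continuous_smul_add_smulRight {c d : T → ℝ} {H : T → V →L[ℝ] U} {L : T → V →L[ℝ] ℝ}
    {L' : T → U} (hc : Continuous c) (hd : Continuous d) (hH : Continuous H)
    (hL : Continuous L) (hL' : Continuous L') :
    Continuous fun t => c t • H t + (d t • L t).smulRight (L' t) := by
  have h : Continuous fun t => (ContinuousLinearMap.smulRightL ℝ V U (d t • L t)) (L' t) := by
    fun_prop
  exact (hc.smul hH).add h

theorem norm_smul_add_smulRight_le (c d : ℝ) (H : V →L[ℝ] U) (L : V →L[ℝ] ℝ) (L' : U) :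
    ‖c • H + (d • L).smulRight L'‖ ≤ |c| * ‖H‖ + |d| * ‖L‖ * ‖L'‖ := by
  refine (norm_add_le _ _).trans (le_of_eq ?_)
  rw [ContinuousLinearMap.norm_smulRight_apply, norm_smul, norm_smul, Real.norm_eq_abs,
    Real.norm_eq_abs]

theorem norm_sum_smul_le {ι : Type*} [Fintype ι] (c : ι → ℝ) (x : ι → U)
    (hc : ∀ i, |c i| ≤ 1) (hx : ∀ i, ‖x i‖ ≤ 1) : ‖∑ i, c i • x i‖ ≤ Fintype.card ι := by
  refine (norm_sum_le _ _).trans ?_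
  calc _ ≤ ∑ _i : ι, (1 : ℝ) := Finset.sum_le_sum fun i _ => by
        rw [norm_smul]
        exact mul_le_one₀ (hc i) (norm_nonneg _) (hx i)
    _ = Fintype.card ι := by simp

theorem continuous_sum_smul {ι : Type*} [Fintype ι] {c : ι → T → ℝ} {x : ι → U}
    (hc : ∀ i, Continuous (c i)) : Continuous fun t => ∑ i, c i t • x i :=
  continuous_finsetSum _ fun i _ => (hc i).smul continuous_const

theorem hasFDerivAt_sum_smul {ι : Type*} [Fintype ι] {c : ι → V → ℝ} {c' : ι → V →L[ℝ] ℝ}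
    {x : ι → U} {v : V} (hc : ∀ i, HasFDerivAt (c i) (c' i) v) :
    HasFDerivAt (fun v => ∑ i, c i v • x i) (∑ i, (c' i).smulRight (x i)) v :=
  HasFDerivAt.fun_sum fun i _ => (hc i).smul_const (x i)

theorem norm_sum_smulRight_le {ι : Type*} [Fintype ι] (c : ι → ℝ) (x : ι → U →L[ℝ] ℝ)
    (hc : ∀ i, |c i| ≤ 1) (hx : ∀ i, ‖x i‖ ≤ 1) :
    ‖∑ i, (c i • x i).smulRight (x i)‖ ≤ Fintype.card ι := by
  refine (norm_sum_le Finset.univ fun i => (c i • x i).smulRight (x i)).trans ?_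
  calc _ ≤ ∑ _i : ι, (1 : ℝ) := Finset.sum_le_sum fun i _ => by
        rw [ContinuousLinearMap.norm_smulRight_apply, norm_smul]
        exact mul_le_one₀ (mul_le_one₀ (hc i) (norm_nonneg _) (hx i)) (norm_nonneg _) (hx i)
    _ = Fintype.card ι := by simp

theorem continuous_sum_smulRight {ι : Type*} [Fintype ι] {c : ι → T → ℝ} {x : ι → U →L[ℝ] ℝ}
    (hc : ∀ i, Continuous (c i)) : Continuous fun t => ∑ i, (c i t • x i).smulRight (x i) := by
  have h : ∀ t, ∑ i, (c i t • x i).smulRight (x i) = ∑ i, c i t • (x i).smulRight (x i) := by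
    intro t
    ext u v
    simp [mul_assoc]
  simp_rw [h]
  exact continuous_sum_smul (x := fun i => (x i).smulRight (x i)) hc

/-- The operator is `v ↦ w ↦ H (A v) (A w)`, in the shape in which the chain rule produces the
second derivative of a function composed with `A`. -/
theorem norm_flip_comp_comp_le (A : V →L[ℝ] U) (H : U →L[ℝ] U →L[ℝ] ℝ) :
    ‖(((ContinuousLinearMap.compL ℝ V U ℝ).flip A).comp H).comp A‖ ≤ ‖A‖ * ‖H‖ * ‖A‖ := by
  have h1 : ‖(ContinuousLinearMap.compL ℝ V U ℝ).flip A‖ ≤ ‖A‖ := by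
    refine (ContinuousLinearMap.le_opNorm _ _).trans ?_
    rw [ContinuousLinearMap.opNorm_flip]
    calc _ ≤ 1 * ‖A‖ :=
          mul_le_mul_of_nonneg_right (ContinuousLinearMap.norm_compL_le ..) (norm_nonneg _)
      _ = _ := one_mul _
  refine (ContinuousLinearMap.opNorm_comp_le _ _).trans ?_
  refine mul_le_mul_of_nonneg_right ((ContinuousLinearMap.opNorm_comp_le _ _).trans ?_)
    (norm_nonneg _)
  exact mul_le_mul_of_nonneg_right h1 (norm_nonneg _)

theorem continuous_flip_comp_comp {A : T → V →L[ℝ] U} {H : T → U →L[ℝ] U →L[ℝ] ℝ}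
    (hA : Continuous A) (hH : Continuous H) :
    Continuous fun t => (((ContinuousLinearMap.compL ℝ V U ℝ).flip (A t)).comp (H t)).comp
      (A t) := by
  have h2 : Continuous fun t => (ContinuousLinearMap.compL ℝ V U ℝ).flip (A t) := by fun_prop
  exact (h2.clm_comp hH).clm_comp hA

theorem hasFDerivAt_comp_clm {A : V →L[ℝ] U} {G : U → U →L[ℝ] ℝ} {H : U →L[ℝ] U →L[ℝ] ℝ} {y : V}
    (hG : HasFDerivAt G H (A y)) :
    HasFDerivAt (fun y => (G (A y)).comp A)
      ((((ContinuousLinearMap.compL ℝ V U ℝ).flip A).comp H).comp A) y :=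
  ((ContinuousLinearMap.compL ℝ V U ℝ).flip A).hasFDerivAt.comp y (hG.comp y A.hasFDerivAt)

variable {γ : Measure ℝ} {A : ℝ → V →L[ℝ] U} {bound : ℝ → ℝ}

/-- The parameter enters through a linear map depending on the integration variable. The domination
is global in `y`, so no neighbourhood has to be chosen. -/
theorem hasFDerivAt_integral_comp_clm {f : U → ℝ} {f' : U → U →L[ℝ] ℝ}
    (hA : Continuous A) (hf : ∀ u, HasFDerivAt f (f' u) u) (hf' : Continuous f')
    (hb : Integrable bound γ) (hbound : ∀ z y, ‖(f' (A z y)).comp (A z)‖ ≤ bound z)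
    (hi : ∀ y, Integrable (fun z => f (A z y)) γ) (y : V) :
    HasFDerivAt (fun y => ∫ z, f (A z y) ∂γ) (∫ z, (f' (A z y)).comp (A z) ∂γ) y :=
  hasFDerivAt_integral_of_dominated_of_fderiv_le (s := Set.univ) univ_mem
    (Eventually.of_forall fun y => (hi y).aestronglyMeasurable) (hi y)
    (show Continuous fun z => (f' (A z y)).comp (A z) by fun_prop).aestronglyMeasurable
    (Eventually.of_forall fun z y _ => hbound z y) hb
    (Eventually.of_forall fun z y _ => (hf _).comp y (A z).hasFDerivAt)

theorem hasFDerivAt_integral_comp_clm₂ {f' : U → U →L[ℝ] ℝ} {f'' : U → U →L[ℝ] U →L[ℝ] ℝ}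
    (hA : Continuous A) (hf : ∀ u, HasFDerivAt f' (f'' u) u) (hf'' : Continuous f'')
    (hb : Integrable bound γ) (hbound : ∀ z y, ‖(((ContinuousLinearMap.compL ℝ V U ℝ).flip
      (A z)).comp (f'' (A z y))).comp (A z)‖ ≤ bound z)
    (hi : ∀ y, Integrable (fun z => (f' (A z y)).comp (A z)) γ) (y : V) :
    HasFDerivAt (fun y => ∫ z, (f' (A z y)).comp (A z) ∂γ)
      (∫ z, (((ContinuousLinearMap.compL ℝ V U ℝ).flip (A z)).comp (f'' (A z y))).comp (A z) ∂γ)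
      y :=
  hasFDerivAt_integral_of_dominated_of_fderiv_le (s := Set.univ) univ_mem
    (Eventually.of_forall fun y => (hi y).aestronglyMeasurable) (hi y)
    (continuous_flip_comp_comp hA (hf''.comp (hA.clm_apply continuous_const))).aestronglyMeasurable
    (Eventually.of_forall fun z y _ => hbound z y) hb
    (Eventually.of_forall fun _ _ _ => hasFDerivAt_comp_clm (hf _))

theorem continuous_integral_comp_clm₂ {f'' : U → U →L[ℝ] U →L[ℝ] ℝ}
    (hA : Continuous A) (hf'' : Continuous f'')
    (hb : Integrable bound γ) (hbound : ∀ z y, ‖(((ContinuousLinearMap.compL ℝ V U ℝ).flip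
      (A z)).comp (f'' (A z y))).comp (A z)‖ ≤ bound z) :
    Continuous fun y => ∫ z, (((ContinuousLinearMap.compL ℝ V U ℝ).flip (A z)).comp
      (f'' (A z y))).comp (A z) ∂γ :=
  continuous_of_dominated (bound := bound)
    (fun _ => (continuous_flip_comp_comp hA
      (hf''.comp (hA.clm_apply continuous_const))).aestronglyMeasurable)
    (fun y => Eventually.of_forall fun z => hbound z y) hb
    (Eventually.of_forall fun z => continuous_flip_comp_comp continuous_const
      (hf''.comp (A z).continuous))

end Abstract

/-! ### Treatment probabilities of one cluster as functions of the linear predictors. -/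

section Cluster

variable {m : ℕ}

/-- Coordinate functional. -/
def coord (j : Fin m) : (Fin m → ℝ) →L[ℝ] ℝ := ContinuousLinearMap.proj j

/-- Probability of the treatment vector `a` at logits `u`. -/
def vecProb (a : Treat m) (u : Fin m → ℝ) : ℝ := ∏ j, unitProb (a j) (u j)

/-- Derivative of `log (vecProb a)`. -/
def vecScore (a : Treat m) (u : Fin m → ℝ) : (Fin m → ℝ) →L[ℝ] ℝ :=
  ∑ j, unitScore (a j) (u j) • coord j

/-- Second derivative of `log (vecProb a)`. -/
def vecHess (u : Fin m → ℝ) : (Fin m → ℝ) →L[ℝ] (Fin m → ℝ) →L[ℝ] ℝ :=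
  ∑ j, ((-(Real.sigmoid (u j) * (1 - Real.sigmoid (u j)))) • coord j).smulRight (coord j)

theorem vecProb_pos (a : Treat m) (u : Fin m → ℝ) : 0 < vecProb a u :=
  Finset.prod_pos fun j _ => unitProb_pos (a j) (u j)

theorem vecProb_le_one (a : Treat m) (u : Fin m → ℝ) : vecProb a u ≤ 1 :=
  Finset.prod_le_one (fun _ _ => (unitProb_pos _ _).le) fun _ _ => unitProb_le_one _ _

theorem sum_vecProb (u : Fin m → ℝ) : ∑ a, vecProb a u = 1 := by
  have h := Finset.prod_univ_sum (fun _ : Fin m => (Finset.univ : Finset Bool))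
    (fun j b => unitProb b (u j))
  simp only [Fintype.piFinset_univ] at h
  unfold vecProb
  rw [← h]
  simp [unitProb]

theorem norm_proj_le_one (j : Fin m) :
    ‖coord j‖ ≤ 1 :=
  ContinuousLinearMap.opNorm_le_bound _ zero_le_one fun x => by
    simpa [coord] using norm_le_pi_norm x j

theorem norm_vecScore_le (a : Treat m) (u : Fin m → ℝ) : ‖vecScore a u‖ ≤ m :=
  (norm_sum_smul_le _ _ (fun j => abs_unitScore_le (a j) (u j)) norm_proj_le_one).trans_eq
    (by simp)

theorem norm_vecHess_le (u : Fin m → ℝ) : ‖vecHess u‖ ≤ m := by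
  refine (norm_sum_smulRight_le _ _ (fun j => ?_) norm_proj_le_one).trans_eq (by simp)
  have h1 := Real.sigmoid_pos (u j)
  have h2 := Real.sigmoid_lt_one (u j)
  rw [abs_le]
  constructor <;> nlinarith

theorem hasFDerivAt_log_vecProb (a : Treat m) (u : Fin m → ℝ) :
    HasFDerivAt (fun u => Real.log (vecProb a u)) (vecScore a u) u := by
  have h : (fun u : Fin m → ℝ => Real.log (vecProb a u)) =
      fun u => ∑ j, Real.log (unitProb (a j) (u j)) := by
    ext u
    exact Real.log_prod fun j _ => (unitProb_pos _ _).ne'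
  rw [h]
  refine HasFDerivAt.fun_sum fun j _ => ?_
  exact (hasDerivAt_log_unitProb (a j) (u j)).comp_hasFDerivAt u (coord j).hasFDerivAt

/-- Differentiating through `exp ∘ log` gives the derivative as probability times score, which keeps
the factor `vecProb` needed in later bounds. -/
theorem hasFDerivAt_vecProb (a : Treat m) (u : Fin m → ℝ) :
    HasFDerivAt (vecProb a) (vecProb a u • vecScore a u) u := by
  have h := (hasFDerivAt_log_vecProb a u).exp
  simpa only [Real.exp_log (vecProb_pos a _)] using h

theorem hasFDerivAt_vecScore (a : Treat m) (u : Fin m → ℝ) :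
    HasFDerivAt (vecScore a) (vecHess u) u :=
  hasFDerivAt_sum_smul (c := fun j (u : Fin m → ℝ) => unitScore (a j) (u j)) fun j => by
    exact (hasDerivAt_unitScore (a j) (u j)).comp_hasFDerivAt u (coord j).hasFDerivAt

/-- Second derivative of `vecProb a`. -/
def vecProbHess (a : Treat m) (u : Fin m → ℝ) : (Fin m → ℝ) →L[ℝ] (Fin m → ℝ) →L[ℝ] ℝ :=
  vecProb a u • vecHess u + (vecProb a u • vecScore a u).smulRight (vecScore a u)

theorem hasFDerivAt_vecProb_smul_vecScore (a : Treat m) (u : Fin m → ℝ) :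
    HasFDerivAt (fun u => vecProb a u • vecScore a u) (vecProbHess a u) u :=
  (hasFDerivAt_vecProb a u).smul (hasFDerivAt_vecScore a u)

theorem continuous_vecProb (a : Treat m) : Continuous (vecProb a) :=
  continuous_iff_continuousAt.2 fun u => (hasFDerivAt_vecProb a u).continuousAt

theorem continuous_vecScore (a : Treat m) : Continuous (vecScore a) :=
  continuous_iff_continuousAt.2 fun u => (hasFDerivAt_vecScore a u).continuousAt

theorem continuous_vecHess : Continuous (vecHess (m := m)) := by
  have := continuous_sigmoid
  exact continuous_sum_smulRight (c := fun j (u : Fin m → ℝ) =>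
    -(Real.sigmoid (u j) * (1 - Real.sigmoid (u j)))) fun j => by fun_prop

theorem continuous_vecProbHess (a : Treat m) : Continuous (vecProbHess a) :=
  continuous_smul_add_smulRight (continuous_vecProb a) (continuous_vecProb a) continuous_vecHess
    (continuous_vecScore a) (continuous_vecScore a)

/-- The factor `vecProb a u` is kept instead of being bounded by one: its integral is comparable to
`mixProb`, which cancels in the derivatives of the logarithm. -/
theorem norm_vecProbHess_le (a : Treat m) (u : Fin m → ℝ) :
    ‖vecProbHess a u‖ ≤ (m + m ^ 2) * vecProb a u := by
  have hp := vecProb_pos a u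
  refine (norm_smul_add_smulRight_le _ _ _ _ _).trans ?_
  rw [abs_of_pos hp]
  have h1 := norm_vecScore_le a u
  have h2 := norm_vecHess_le u
  have h3 : ‖vecScore a u‖ * ‖vecScore a u‖ ≤ m * m :=
    mul_le_mul h1 h1 (norm_nonneg _) (Nat.cast_nonneg _)
  nlinarith

/-- The log-probability is `m`-Lipschitz in the logits. This Harnack-type inequality compares the
probabilities with and without the random intercept. -/
theorem vecProb_le_exp_mul (a : Treat m) (u u' : Fin m → ℝ) :
    vecProb a u ≤ Real.exp (m * ‖u - u'‖) * vecProb a u' := by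
  have h := Convex.norm_image_sub_le_of_norm_hasFDerivWithin_le (s := Set.univ)
    (fun u _ => (hasFDerivAt_log_vecProb a u).hasFDerivWithinAt)
    (fun u _ => norm_vecScore_le a u) convex_univ (Set.mem_univ u') (Set.mem_univ u)
  have h2 := (abs_le.1 (Real.norm_eq_abs _ ▸ h)).2
  rw [← Real.log_le_log_iff (vecProb_pos a u)
    (mul_pos (Real.exp_pos _) (vecProb_pos a u')), Real.log_mul (Real.exp_ne_zero _)
    (vecProb_pos a u').ne', Real.log_exp]
  linarith

/-- Linear predictors of the units of a cluster, and the standard deviation of the intercept. -/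
abbrev LinPred (m : ℕ) := (Fin m → ℝ) × ℝ

/-- The logits when the standardized random intercept is `z`. -/
def logits (m : ℕ) (z : ℝ) : LinPred m →L[ℝ] (Fin m → ℝ) :=
  ContinuousLinearMap.fst ℝ _ _ +
    z • (ContinuousLinearMap.pi fun _ => ContinuousLinearMap.snd ℝ (Fin m → ℝ) ℝ)

@[simp] theorem logits_apply (z : ℝ) (y : LinPred m) (j : Fin m) :
    logits m z y j = y.1 j + z * y.2 := by simp [logits]

/-- An exponential bound instead of `1 + |z|`: all envelopes become exponentials of `|z|`, whose
Gaussian moments are finite. -/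
theorem norm_logits_le (z : ℝ) : ‖logits m z‖ ≤ Real.exp |z| := by
  refine ContinuousLinearMap.opNorm_le_bound _ (Real.exp_pos _).le fun y => ?_
  refine (pi_norm_le_iff_of_nonneg (by positivity)).2 fun j => ?_
  rw [logits_apply]
  calc ‖y.1 j + z * y.2‖ ≤ ‖y.1 j‖ + ‖z * y.2‖ := norm_add_le _ _
    _ ≤ ‖y‖ + |z| * ‖y‖ := by
      rw [norm_mul]
      exact add_le_add ((norm_le_pi_norm _ j).trans (norm_fst_le y))
        (mul_le_mul_of_nonneg_left (norm_snd_le y) (norm_nonneg _))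
    _ = (|z| + 1) * ‖y‖ := by ring
    _ ≤ _ := mul_le_mul_of_nonneg_right (Real.add_one_le_exp _) (norm_nonneg _)

theorem continuous_logits : Continuous (logits m) := by unfold logits; fun_prop

theorem norm_logits_sub_le (z : ℝ) (y : LinPred m) :
    ‖logits m z y - y.1‖ ≤ |z| * |y.2| := by
  refine (pi_norm_le_iff_of_nonneg (by positivity)).2 fun j => ?_
  simp

/-- The standard normal distribution. -/
abbrev stdNormal : Measure ℝ := gaussianReal 0 1

theorem integrable_exp_abs (c : ℝ) : Integrable (fun z => Real.exp (c * |z|)) stdNormal := by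
  refine ((integrable_exp_mul_gaussianReal (μ := 0) (v := 1) c).add
    (integrable_exp_mul_gaussianReal (μ := 0) (v := 1) (-c))).mono'
    (by fun_prop) (Eventually.of_forall fun z => ?_)
  rw [Real.norm_of_nonneg (Real.exp_pos _).le]
  simp only [Pi.add_apply]
  rcases abs_choice z with h | h <;> rw [h]
  · linarith [Real.exp_pos (-c * z)]
  · rw [mul_neg, ← neg_mul]
    linarith [Real.exp_pos (c * z)]

/-- Probability of the treatment vector `a`, the random intercept being integrated out. -/
def mixProb (a : Treat m) (y : LinPred m) : ℝ := ∫ z, vecProb a (logits m z y) ∂stdNormal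

/-- Derivative of `mixProb a`. -/
def mixGrad (a : Treat m) (y : LinPred m) : LinPred m →L[ℝ] ℝ :=
  ∫ z, (vecProb a (logits m z y) • vecScore a (logits m z y)).comp (logits m z) ∂stdNormal

/-- Second derivative of the integrand of `mixProb a`. -/
def mixHessIntegrand (a : Treat m) (z : ℝ) (y : LinPred m) :
    LinPred m →L[ℝ] LinPred m →L[ℝ] ℝ :=
  (((ContinuousLinearMap.compL ℝ (LinPred m) (Fin m → ℝ) ℝ).flip (logits m z)).comp
    (vecProbHess a (logits m z y))).comp (logits m z)

/-- Second derivative of `mixProb a`. -/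
def mixHess (a : Treat m) (y : LinPred m) : LinPred m →L[ℝ] LinPred m →L[ℝ] ℝ :=
  ∫ z, mixHessIntegrand a z y ∂stdNormal

theorem norm_grad_integrand_le (a : Treat m) (z : ℝ) (y : LinPred m) :
    ‖(vecProb a (logits m z y) • vecScore a (logits m z y)).comp (logits m z)‖ ≤
      m * (vecProb a (logits m z y) * Real.exp (2 * |z|)) := by
  refine (ContinuousLinearMap.opNorm_comp_le _ _).trans ?_
  have hp := vecProb_pos a (logits m z y)
  rw [norm_smul, Real.norm_of_nonneg hp.le]
  calc _ ≤ vecProb a (logits m z y) * m * Real.exp (2 * |z|) := by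
        refine mul_le_mul (mul_le_mul_of_nonneg_left (norm_vecScore_le _ _) hp.le)
          ((norm_logits_le z).trans (Real.exp_le_exp.2 ?_)) (norm_nonneg _) (by positivity)
        linarith [abs_nonneg z]
    _ = _ := by ring

theorem norm_mixHessIntegrand_le (a : Treat m) (z : ℝ) (y : LinPred m) :
    ‖mixHessIntegrand a z y‖ ≤
      (m + m ^ 2) * (vecProb a (logits m z y) * Real.exp (2 * |z|)) := by
  have hp := vecProb_pos a (logits m z y)
  have hA := norm_logits_le (m := m) z
  calc _ ≤ ‖logits m z‖ * ‖vecProbHess a (logits m z y)‖ * ‖logits m z‖ :=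
        norm_flip_comp_comp_le _ _
    _ ≤ (Real.exp |z| * ((m + m ^ 2) * vecProb a (logits m z y))) * Real.exp |z| :=
        mul_le_mul (mul_le_mul hA (norm_vecProbHess_le a _) (ContinuousLinearMap.opNorm_nonneg _)
          (by positivity)) hA (ContinuousLinearMap.opNorm_nonneg _) (by positivity)
    _ = _ := by
      rw [two_mul, Real.exp_add]; ring

theorem norm_grad_integrand_le' (a : Treat m) (z : ℝ) (y : LinPred m) :
    ‖(vecProb a (logits m z y) • vecScore a (logits m z y)).comp (logits m z)‖ ≤
      m * Real.exp (2 * |z|) :=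
  (norm_grad_integrand_le a z y).trans (mul_le_mul_of_nonneg_left
    (mul_le_of_le_one_left (Real.exp_pos _).le (vecProb_le_one _ _)) (Nat.cast_nonneg _))

theorem norm_mixHessIntegrand_le' (a : Treat m) (z : ℝ) (y : LinPred m) :
    ‖mixHessIntegrand a z y‖ ≤ (m + m ^ 2) * Real.exp (2 * |z|) :=
  (norm_mixHessIntegrand_le a z y).trans (mul_le_mul_of_nonneg_left
    (mul_le_of_le_one_left (Real.exp_pos _).le (vecProb_le_one _ _)) (by positivity))

theorem continuous_vecProb_logits (a : Treat m) (y : LinPred m) :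
    Continuous fun z => vecProb a (logits m z y) :=
  (continuous_vecProb a).comp (continuous_logits.clm_apply continuous_const)

theorem integrable_vecProb_logits (a : Treat m) (y : LinPred m) (c : ℝ) :
    Integrable (fun z => vecProb a (logits m z y) * Real.exp (c * |z|)) stdNormal := by
  refine (integrable_exp_abs c).mono' ((continuous_vecProb_logits a y).mul
    (by fun_prop)).aestronglyMeasurable (Eventually.of_forall fun z => ?_)
  rw [norm_mul, Real.norm_of_nonneg (vecProb_pos _ _).le, Real.norm_of_nonneg (Real.exp_pos _).le]
  exact mul_le_of_le_one_left (Real.exp_pos _).le (vecProb_le_one _ _)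

theorem integrable_vecProb_logits' (a : Treat m) (y : LinPred m) :
    Integrable (fun z => vecProb a (logits m z y)) stdNormal := by
  simpa using integrable_vecProb_logits a y 0

theorem continuous_vecProb_smul_vecScore (a : Treat m) :
    Continuous fun u => vecProb a u • vecScore a u :=
  (continuous_vecProb a).smul (continuous_vecScore a)

theorem hasFDerivAt_mixProb (a : Treat m) (y : LinPred m) :
    HasFDerivAt (mixProb a) (mixGrad a y) y :=
  hasFDerivAt_integral_comp_clm continuous_logits (hasFDerivAt_vecProb a)
    (continuous_vecProb_smul_vecScore a) ((integrable_exp_abs 2).const_mul (m : ℝ))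
    (norm_grad_integrand_le' a) (integrable_vecProb_logits' a) y

theorem integrable_grad_integrand (a : Treat m) (y : LinPred m) :
    Integrable (fun z => (vecProb a (logits m z y) • vecScore a (logits m z y)).comp (logits m z))
      stdNormal := by
  refine Integrable.mono' ((integrable_exp_abs 2).const_mul (m : ℝ)) ?_
    (Eventually.of_forall fun z => norm_grad_integrand_le' a z y)
  exact (((continuous_vecProb_smul_vecScore a).comp
    (continuous_logits.clm_apply continuous_const)).clm_comp
      continuous_logits).aestronglyMeasurable

theorem hasFDerivAt_mixGrad (a : Treat m) (y : LinPred m) :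
    HasFDerivAt (mixGrad a) (mixHess a y) y :=
  hasFDerivAt_integral_comp_clm₂ continuous_logits (hasFDerivAt_vecProb_smul_vecScore a)
    (continuous_vecProbHess a) ((integrable_exp_abs 2).const_mul ((m : ℝ) + m ^ 2))
    (norm_mixHessIntegrand_le' a) (integrable_grad_integrand a) y

theorem continuous_mixHess (a : Treat m) : Continuous (mixHess a) :=
  continuous_integral_comp_clm₂ continuous_logits (continuous_vecProbHess a)
    ((integrable_exp_abs 2).const_mul ((m : ℝ) + m ^ 2)) (norm_mixHessIntegrand_le' a)

theorem continuous_mixProb (a : Treat m) : Continuous (mixProb a) :=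
  continuous_iff_continuousAt.2 fun u => (hasFDerivAt_mixProb a u).continuousAt

theorem continuous_mixGrad (a : Treat m) : Continuous (mixGrad a) :=
  continuous_iff_continuousAt.2 fun u => (hasFDerivAt_mixGrad a u).continuousAt

theorem sum_mixProb (y : LinPred m) : ∑ a, mixProb a y = 1 := by
  unfold mixProb
  rw [← integral_finsetSum _ fun a _ => integrable_vecProb_logits' a y]
  simp [sum_vecProb]

/-- An intercept of standardized size `z` moves each logit by at most `S * |z|`, which lowers the
probability by a factor of at most `exp (m * S * |z|)`; integrate over `z`. -/
theorem exp_mul_le_mixProb (a : Treat m) {S : ℝ} :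
    ∃ c > 0, ∀ y : LinPred m, |y.2| ≤ S → c * vecProb a y.1 ≤ mixProb a y := by
  refine ⟨∫ z, Real.exp (-(m * S) * |z|) ∂stdNormal,
    integral_exp_pos (integrable_exp_abs _), fun y hy => ?_⟩
  rw [← integral_mul_const]
  refine integral_mono ((integrable_exp_abs _).mul_const _) (integrable_vecProb_logits' a y)
    fun z => ?_
  have h := vecProb_le_exp_mul a y.1 (logits m z y)
  have h2 : ‖y.1 - logits m z y‖ ≤ |z| * S := by
    rw [norm_sub_rev]
    exact (norm_logits_sub_le z y).trans (mul_le_mul_of_nonneg_left hy (abs_nonneg _))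
  have h3 : vecProb a y.1 ≤ Real.exp (m * S * |z|) * vecProb a (logits m z y) := by
    refine h.trans (mul_le_mul_of_nonneg_right (Real.exp_le_exp.2 ?_) (vecProb_pos _ _).le)
    rw [mul_assoc, mul_comm S]
    exact mul_le_mul_of_nonneg_left h2 (Nat.cast_nonneg _)
  calc _ ≤ Real.exp (-(m * S) * |z|) * (Real.exp (m * S * |z|) * vecProb a (logits m z y)) :=
        mul_le_mul_of_nonneg_left h3 (Real.exp_pos _).le
    _ = _ := by rw [← mul_assoc, ← Real.exp_add]; ring_nf; simp

theorem mixProb_pos (a : Treat m) (y : LinPred m) : 0 < mixProb a y := by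
  obtain ⟨c, hc, h⟩ := exp_mul_le_mixProb a (S := |y.2|)
  exact (mul_pos hc (vecProb_pos a y.1)).trans_le (h y le_rfl)

theorem mixProb_le_one (a : Treat m) (y : LinPred m) : mixProb a y ≤ 1 := by
  rw [← sum_mixProb y]
  exact Finset.single_le_sum (f := fun a => mixProb a y) (fun a _ => (mixProb_pos a y).le)
    (Finset.mem_univ a)

/-- Exponential moments of the intercept are bounded under the posterior given treatment. -/
theorem integral_vecProb_exp_le (a : Treat m) {S : ℝ} :
    ∃ C > 0, ∀ y : LinPred m, |y.2| ≤ S →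
      ∫ z, vecProb a (logits m z y) * Real.exp (2 * |z|) ∂stdNormal ≤ C * mixProb a y := by
  obtain ⟨c, hc, h⟩ := exp_mul_le_mixProb a (S := S)
  -- The numerator bounds the integral by a multiple of the probability at intercept zero; dividing
  -- by `c` returns to `mixProb`.
  refine ⟨(∫ z, Real.exp ((m * S + 2) * |z|) ∂stdNormal) / c,
    div_pos (integral_exp_pos (integrable_exp_abs _)) hc, fun y hy => ?_⟩
  rw [div_mul_eq_mul_div, le_div_iff₀ hc]
  have h1 : ∫ z, vecProb a (logits m z y) * Real.exp (2 * |z|) ∂stdNormal ≤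
      (∫ z, Real.exp ((m * S + 2) * |z|) ∂stdNormal) * vecProb a y.1 := by
    rw [← integral_mul_const]
    refine integral_mono (integrable_vecProb_logits a y 2) ((integrable_exp_abs _).mul_const _)
      fun z => ?_
    have h := vecProb_le_exp_mul a (logits m z y) y.1
    have h2 : ‖logits m z y - y.1‖ ≤ |z| * S :=
      (norm_logits_sub_le z y).trans (mul_le_mul_of_nonneg_left hy (abs_nonneg _))
    have h3 : vecProb a (logits m z y) ≤ Real.exp (m * S * |z|) * vecProb a y.1 := by
      refine h.trans (mul_le_mul_of_nonneg_right (Real.exp_le_exp.2 ?_) (vecProb_pos _ _).le)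
      rw [mul_assoc, mul_comm S]
      exact mul_le_mul_of_nonneg_left h2 (Nat.cast_nonneg _)
    calc _ ≤ Real.exp (m * S * |z|) * vecProb a y.1 * Real.exp (2 * |z|) :=
          mul_le_mul_of_nonneg_right h3 (Real.exp_pos _).le
      _ = _ := by rw [add_mul, Real.exp_add]; ring
  have hI : 0 < ∫ z, Real.exp ((m * S + 2) * |z|) ∂stdNormal :=
    integral_exp_pos (integrable_exp_abs _)
  have h2 := h y hy
  nlinarith

/-- Derivative of `log (mixProb a)`. -/
def logMixGrad (a : Treat m) (y : LinPred m) : LinPred m →L[ℝ] ℝ := (mixProb a y)⁻¹ • mixGrad a y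

/-- Second derivative of `log (mixProb a)`. -/
def logMixHess (a : Treat m) (y : LinPred m) : LinPred m →L[ℝ] LinPred m →L[ℝ] ℝ :=
  (mixProb a y)⁻¹ • mixHess a y +
    (-(mixProb a y ^ 2)⁻¹ • mixGrad a y).smulRight (mixGrad a y)

theorem hasFDerivAt_log_mixProb (a : Treat m) (y : LinPred m) :
    HasFDerivAt (fun y => Real.log (mixProb a y)) (logMixGrad a y) y :=
  (hasFDerivAt_mixProb a y).log (mixProb_pos a y).ne'

theorem hasFDerivAt_logMixGrad (a : Treat m) (y : LinPred m) :
    HasFDerivAt (logMixGrad a) (logMixHess a y) y :=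
  ((hasDerivAt_inv (mixProb_pos a y).ne').comp_hasFDerivAt y (hasFDerivAt_mixProb a y)).smul
    (hasFDerivAt_mixGrad a y)

theorem continuous_logMixGrad (a : Treat m) : Continuous (logMixGrad a) :=
  continuous_iff_continuousAt.2 fun u => (hasFDerivAt_logMixGrad a u).continuousAt

theorem continuous_logMixHess (a : Treat m) : Continuous (logMixHess a) :=
  continuous_smul_add_smulRight
    ((continuous_mixProb a).inv₀ fun y => (mixProb_pos a y).ne')
    (((continuous_mixProb a).pow 2).inv₀ fun y => (pow_pos (mixProb_pos a y) 2).ne').neg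
    (continuous_mixHess a) (continuous_mixGrad a) (continuous_mixGrad a)

/-- Gradient and Hessian of `log mixProb` are built from posterior means, given the treatment, of
quantities growing at most like `exp (2 * |z|)`. These means are bounded uniformly in the linear
predictors, only the scale of the intercept mattering; hence the score can grow no faster than the
regressors. -/
theorem logMix_bounds (a : Treat m) (S : ℝ) :
    ∃ C > 0, ∀ y : LinPred m, |y.2| ≤ S → ‖logMixGrad a y‖ ≤ C ∧ ‖logMixHess a y‖ ≤ C := by
  obtain ⟨C, hC, h⟩ := integral_vecProb_exp_le a (S := S)
  set D : ℝ := m * C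
  set D' : ℝ := (m + m ^ 2) * C
  have hD : 0 ≤ D := by positivity
  refine ⟨D + D' + D ^ 2 + 1, by positivity, fun y hy => ?_⟩
  have hp := mixProb_pos a y
  have h1 : ‖mixGrad a y‖ ≤ D * mixProb a y := by
    refine (norm_integral_le_of_norm_le ((integrable_vecProb_logits a y 2).const_mul (m : ℝ))
      (Eventually.of_forall fun z => norm_grad_integrand_le a z y)).trans ?_
    rw [integral_const_mul, mul_assoc]
    exact mul_le_mul_of_nonneg_left (h y hy) (Nat.cast_nonneg _)
  have h2 : ‖mixHess a y‖ ≤ D' * mixProb a y := by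
    refine (norm_integral_le_of_norm_le
      ((integrable_vecProb_logits a y 2).const_mul ((m : ℝ) + m ^ 2))
      (Eventually.of_forall fun z => norm_mixHessIntegrand_le a z y)).trans ?_
    rw [integral_const_mul, mul_assoc]
    exact mul_le_mul_of_nonneg_left (h y hy) (by positivity)
  have h3 : (mixProb a y)⁻¹ * ‖mixGrad a y‖ ≤ D := by
    rw [inv_mul_le_iff₀ hp, mul_comm]; exact h1
  have h4 : (mixProb a y)⁻¹ * ‖mixHess a y‖ ≤ D' := by
    rw [inv_mul_le_iff₀ hp, mul_comm]; exact h2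
  have hD' : 0 ≤ D' := by positivity
  constructor
  · rw [logMixGrad, norm_smul, norm_inv, Real.norm_of_nonneg hp.le]
    nlinarith
  · refine (norm_smul_add_smulRight_le _ _ _ _ _).trans ?_
    rw [abs_neg, abs_of_pos (inv_pos.2 hp), abs_of_pos (inv_pos.2 (pow_pos hp 2))]
    have : (mixProb a y ^ 2)⁻¹ * ‖mixGrad a y‖ * ‖mixGrad a y‖ =
        ((mixProb a y)⁻¹ * ‖mixGrad a y‖) ^ 2 := by
      rw [mul_pow, inv_pow]; ring
    rw [this]
    have : ((mixProb a y)⁻¹ * ‖mixGrad a y‖) ^ 2 ≤ D ^ 2 := pow_le_pow_left₀ (by positivity) h3 2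
    linarith

end Cluster

end

/-! ### The log-likelihood of the propensity model -/

section

/-! ### Second order chain rule for a map that is linear up to one scalar coordinate. -/

section AbstractChain

variable {V W : Type*} [NormedAddCommGroup V] [NormedSpace ℝ V] [NormedAddCommGroup W]
  [NormedSpace ℝ W] {T : Type*} [TopologicalSpace T]

/-- Derivative of `ν ↦ A ν + r (p ν) • e`, where `r₁ = r' (p ν)`. -/
def partLinDeriv (A : V →L[ℝ] W) (p : V →L[ℝ] ℝ) (e : W) (r₁ : ℝ) : V →L[ℝ] W :=
  A + (r₁ • p).smulRight e

/-- Second derivative of `ν ↦ f (A ν + r (p ν) • e)`, in terms of the derivatives `f₁, f₂` of `f`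
and `r₁, r₂` of `r`. -/
def partLinHess (A : V →L[ℝ] W) (p : V →L[ℝ] ℝ) (e : W) (r₁ r₂ : ℝ) (f₁ : W →L[ℝ] ℝ)
    (f₂ : W →L[ℝ] W →L[ℝ] ℝ) : V →L[ℝ] V →L[ℝ] ℝ :=
  (ContinuousLinearMap.compL ℝ V W ℝ f₁).comp ((r₂ • p).smulRight (p.smulRight e)) +
    ((ContinuousLinearMap.compL ℝ V W ℝ).flip (partLinDeriv A p e r₁)).comp
      (f₂.comp (partLinDeriv A p e r₁))

theorem hasFDerivAt_partLin (A : V →L[ℝ] W) (p : V →L[ℝ] ℝ) (e : W) {r : ℝ → ℝ} {r₁ : ℝ} {ν : V}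
    (hr : HasDerivAt r r₁ (p ν)) :
    HasFDerivAt (fun ν => A ν + r (p ν) • e) (partLinDeriv A p e r₁) ν :=
  A.hasFDerivAt.add ((hr.comp_hasFDerivAt ν p.hasFDerivAt).smul_const e)

theorem hasFDerivAt_partLinDeriv (A : V →L[ℝ] W) (p : V →L[ℝ] ℝ) (e : W) {r : ℝ → ℝ} {r₁ : ℝ}
    {ν : V} (hr : HasDerivAt r r₁ (p ν)) :
    HasFDerivAt (fun ν => partLinDeriv A p e (r (p ν)))
      ((r₁ • p).smulRight (p.smulRight e)) ν := by
  -- Rewritten so that only a scalar in front of a fixed operator varies with `ν`.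
  have h : (fun ν => partLinDeriv A p e (r (p ν))) =
      fun ν => A + r (p ν) • p.smulRight e := by
    ext ν v
    simp [partLinDeriv, mul_smul]
  rw [h]
  exact ((hr.comp_hasFDerivAt ν p.hasFDerivAt).smul_const (p.smulRight e)).const_add A

theorem hasFDerivAt_partLin_comp {A : V →L[ℝ] W} {p : V →L[ℝ] ℝ} {e : W} {f₁ : W → W →L[ℝ] ℝ}
    {f₂ : W →L[ℝ] W →L[ℝ] ℝ} {r r' : ℝ → ℝ} {r₂ : ℝ} {ν : V}
    (hf : HasFDerivAt f₁ f₂ (A ν + r (p ν) • e)) (hr : HasDerivAt r (r' (p ν)) (p ν))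
    (hr' : HasDerivAt r' r₂ (p ν)) :
    HasFDerivAt (fun ν => (f₁ (A ν + r (p ν) • e)).comp (partLinDeriv A p e (r' (p ν))))
      (partLinHess A p e (r' (p ν)) r₂ (f₁ (A ν + r (p ν) • e)) f₂) ν :=
  (hf.comp ν (hasFDerivAt_partLin A p e hr)).clm_comp (hasFDerivAt_partLinDeriv A p e hr')

theorem norm_partLinDeriv_le (A : V →L[ℝ] W) {p : V →L[ℝ] ℝ} {e : W} (r₁ : ℝ) (hp : ‖p‖ ≤ 1)
    (he : ‖e‖ ≤ 1) : ‖partLinDeriv A p e r₁‖ ≤ ‖A‖ + |r₁| := by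
  refine (norm_add_le _ _).trans (add_le_add le_rfl ?_)
  rw [ContinuousLinearMap.norm_smulRight_apply, norm_smul, Real.norm_eq_abs, mul_assoc]
  exact mul_le_of_le_one_right (abs_nonneg _) (mul_le_one₀ hp (norm_nonneg _) he)

theorem norm_partLinHess_le (A : V →L[ℝ] W) {p : V →L[ℝ] ℝ} {e : W} (r₁ r₂ : ℝ)
    (f₁ : W →L[ℝ] ℝ) (f₂ : W →L[ℝ] W →L[ℝ] ℝ) (hp : ‖p‖ ≤ 1) (he : ‖e‖ ≤ 1) :
    ‖partLinHess A p e r₁ r₂ f₁ f₂‖ ≤ ‖f₁‖ * |r₂| + ‖f₂‖ * (‖A‖ + |r₁|) ^ 2 := by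
  have hT := norm_partLinDeriv_le A r₁ hp he
  refine (norm_add_le ((ContinuousLinearMap.compL ℝ V W ℝ f₁).comp
    ((r₂ • p).smulRight (p.smulRight e))) _).trans (add_le_add ?_ ?_)
  · refine (ContinuousLinearMap.opNorm_comp_le _ _).trans ?_
    refine mul_le_mul ?_ ?_ (norm_nonneg _) (norm_nonneg _)
    · refine (ContinuousLinearMap.le_opNorm _ _).trans ?_
      exact mul_le_of_le_one_left (norm_nonneg _) (ContinuousLinearMap.norm_compL_le ..)
    · rw [ContinuousLinearMap.norm_smulRight_apply, ContinuousLinearMap.norm_smulRight_apply,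
        norm_smul, Real.norm_eq_abs, mul_assoc]
      exact mul_le_of_le_one_right (abs_nonneg _) (mul_le_one₀ hp (by positivity)
        (mul_le_one₀ hp (norm_nonneg _) he))
  · rw [← ContinuousLinearMap.comp_assoc]
    refine (norm_flip_comp_comp_le _ _).trans ?_
    calc _ = ‖f₂‖ * ‖partLinDeriv A p e r₁‖ ^ 2 := by ring
      _ ≤ _ := mul_le_mul_of_nonneg_left (pow_le_pow_left₀ (norm_nonneg _) hT 2)
          (ContinuousLinearMap.opNorm_nonneg _)

theorem continuous_partLinDeriv {A : T → V →L[ℝ] W} {p : V →L[ℝ] ℝ} {e : W} {r₁ : T → ℝ}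
    (hA : Continuous A) (hr : Continuous r₁) :
    Continuous fun t => partLinDeriv (A t) p e (r₁ t) := by
  have h : (fun t => partLinDeriv (A t) p e (r₁ t)) =
      fun t => A t + r₁ t • p.smulRight e := by
    ext t v
    simp [partLinDeriv, mul_smul]
  rw [h]
  fun_prop

theorem continuous_partLinHess {A : T → V →L[ℝ] W} {p : V →L[ℝ] ℝ} {e : W} {r₁ r₂ : T → ℝ}
    {f₁ : T → W →L[ℝ] ℝ} {f₂ : T → W →L[ℝ] W →L[ℝ] ℝ}
    (hA : Continuous A) (hr : Continuous r₁) (hr₂ : Continuous r₂) (hf₁ : Continuous f₁)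
    (hf₂ : Continuous f₂) :
    Continuous fun t => partLinHess (A t) p e (r₁ t) (r₂ t) (f₁ t) (f₂ t) := by
  have h1 := continuous_partLinDeriv (p := p) (e := e) hA hr
  have h2 : Continuous fun t => (r₂ t • p).smulRight (p.smulRight e) := by
    have h : (fun t => (r₂ t • p).smulRight (p.smulRight e)) =
        fun t => r₂ t • p.smulRight (p.smulRight e) := by
      ext t v w
      simp [mul_smul]
    rw [h]
    exact hr₂.smul continuous_const
  have h3 : Continuous fun t => ContinuousLinearMap.compL ℝ V W ℝ (f₁ t) := by fun_prop
  have h4 : Continuous fun t => (ContinuousLinearMap.compL ℝ V W ℝ).flip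
      (partLinDeriv (A t) p e (r₁ t)) := by fun_prop
  exact (h3.clm_comp h2).add (h4.clm_comp (hf₂.clm_comp h1))

end AbstractChain

/-! ### Score and Hessian of the propensity model in its parameters. -/

variable {m d : ℕ}

/-- The precision as a linear functional. -/
def precisionCLM (d : ℕ) : PSParam d →L[ℝ] ℝ := ContinuousLinearMap.proj (Sum.inr ())

@[simp] theorem precisionCLM_apply (ν : PSParam d) : precisionCLM d ν = ν.precision := rfl

/-- The contribution of one regressor to the linear predictors. -/
def regressorCLM (m : ℕ) (j : Fin m) (i : Unit ⊕ Fin d ⊕ Fin d) : PSParam d →L[ℝ] LinPred m :=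
  (ContinuousLinearMap.proj (R := ℝ) (Sum.inl i) : PSParam d →L[ℝ] ℝ).smulRight
    ((Pi.single j 1, 0) : LinPred m)

/-- The linear predictors as a linear function of the parameter. -/
def linPred (x : Covar m d) : PSParam d →L[ℝ] LinPred m :=
  ∑ j, ∑ i, psRegressor x j i • regressorCLM m j i

/-- The unit of the standard deviation coordinate. -/
def scaleVec (m : ℕ) : LinPred m := (0, 1)

theorem linPred_apply (x : Covar m d) (ν : PSParam d) :
    linPred x ν = (fun j => ∑ i, psRegressor x j i * ν (Sum.inl i), 0) := by
  simp only [linPred, regressorCLM, sum_apply, smul_apply, ContinuousLinearMap.smulRight_apply,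
    ContinuousLinearMap.proj_apply]
  ext j
  · simp only [Prod.fst_sum, Finset.sum_apply]
    rw [Finset.sum_eq_single j]
    · simp
    · intro b _ hb
      simp [Pi.single_eq_of_ne' hb]
    · simp
  · simp [Prod.snd_sum]

/-- Standard deviation of the random intercept as a function of its precision. -/
def interceptScale (lam : ℝ) : ℝ := (√lam)⁻¹

/-- Standardizing the intercept moves the parameter from the Gaussian measure into the integrand,
where it enters linearly except for the scale; derivatives can then be taken under a fixed measure.
-/
theorem psModel_eq (a : Treat m) (x : Covar m d) (ν : PSParam d) :
    psModel a x ν = mixProb a (linPred x ν + interceptScale (precisionCLM d ν) • scaleVec m) := by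
  have h : gaussianReal 0 (Real.toNNReal ν.precision⁻¹) =
      stdNormal.map (interceptScale ν.precision * ·) := by
    rw [gaussianReal_map_const_mul, mul_zero, mul_one]
    congr 1
    ext
    simp only [interceptScale, NNReal.coe_mk, Real.coe_toNNReal', inv_pow]
    -- For nonpositive precision both conventions give variance zero, so the identity needs no
    -- positivity.
    rcases le_total 0 ν.precision with h | h
    · rw [Real.sq_sqrt h, max_eq_left (inv_nonneg.2 h)]
    · rw [Real.sqrt_eq_zero_of_nonpos h, max_eq_right (inv_nonpos.2 h)]; simp
  have hc : Continuous fun b : ℝ => ∏ j, psUnit ν x b j (a j) := by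
    refine continuous_finsetProd _ fun j _ => ?_
    have := continuous_sigmoid
    unfold psUnit
    cases a j <;> simp only [Bool.false_eq_true, if_false, if_true] <;> fun_prop
  rw [psModel, h, integral_map (by fun_prop) hc.aestronglyMeasurable, mixProb]
  refine integral_congr_ae (Eventually.of_forall fun z => ?_)
  refine Finset.prod_congr rfl fun j _ => ?_
  rw [logits_apply, linPred_apply]
  simp only [psUnit, unitProb, scaleVec, precisionCLM_apply, Prod.fst_add, Prod.smul_fst,
    Prod.snd_add, Prod.smul_snd, smul_zero, add_zero, zero_add, smul_eq_mul, mul_one]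
  rw [mul_comm z]

theorem psModel_pos (a : Treat m) (x : Covar m d) (ν : PSParam d) : 0 < psModel a x ν := by
  rw [psModel_eq]; exact mixProb_pos _ _

theorem psModel_le_one (a : Treat m) (x : Covar m d) (ν : PSParam d) : psModel a x ν ≤ 1 := by
  rw [psModel_eq]; exact mixProb_le_one _ _

theorem sum_psModel (x : Covar m d) (ν : PSParam d) : ∑ a, psModel a x ν = 1 := by
  simp_rw [psModel_eq]; exact sum_mixProb _

/-- First derivative of `interceptScale`. -/
def interceptScale₁ (lam : ℝ) : ℝ := -(1 / 2) * lam ^ (-(3 / 2) : ℝ)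

/-- Second derivative of `interceptScale`. -/
def interceptScale₂ (lam : ℝ) : ℝ := 3 / 4 * lam ^ (-(5 / 2) : ℝ)

theorem interceptScale_eq {lam : ℝ} (h : 0 < lam) : interceptScale lam = lam ^ (-(1 / 2) : ℝ) := by
  rw [interceptScale, Real.sqrt_eq_rpow, Real.rpow_neg h.le]

theorem hasDerivAt_interceptScale {lam : ℝ} (h : 0 < lam) :
    HasDerivAt interceptScale (interceptScale₁ lam) lam := by
  have h1 := Real.hasDerivAt_rpow_const (x := lam) (p := -(1 / 2)) (Or.inl h.ne')
  have e : (-(1 / 2) : ℝ) - 1 = -(3 / 2) := by norm_num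
  rw [e] at h1
  refine h1.congr_of_eventuallyEq ?_
  filter_upwards [lt_mem_nhds h] with t ht
  exact interceptScale_eq ht

theorem hasDerivAt_interceptScale₁ {lam : ℝ} (h : 0 < lam) :
    HasDerivAt interceptScale₁ (interceptScale₂ lam) lam := by
  have h1 := (Real.hasDerivAt_rpow_const (x := lam) (p := -(3 / 2)) (Or.inl h.ne')).const_mul
    (-(1 / 2))
  have e : (-(3 / 2) : ℝ) - 1 = -(5 / 2) := by norm_num
  rw [e] at h1
  have e2 : interceptScale₂ lam = -(1 / 2) * (-(3 / 2) * lam ^ (-(5 / 2) : ℝ)) := by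
    unfold interceptScale₂; ring
  rw [e2]
  exact h1

theorem interceptScale_bounds {lam₀ : ℝ} (h₀ : 0 < lam₀) : ∃ C > 0, ∀ lam, lam₀ ≤ lam →
    |interceptScale lam| ≤ C ∧ |interceptScale₁ lam| ≤ C ∧ |interceptScale₂ lam| ≤ C := by
  refine ⟨lam₀ ^ (-(1 / 2) : ℝ) + lam₀ ^ (-(3 / 2) : ℝ) + lam₀ ^ (-(5 / 2) : ℝ), by positivity,
    fun lam h => ?_⟩
  have hl : 0 < lam := h₀.trans_le h
  have key : ∀ q : ℝ, q ≤ 0 → 0 < lam ^ q ∧ lam ^ q ≤ lam₀ ^ q := fun q hq =>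
    ⟨Real.rpow_pos_of_pos hl q, Real.rpow_le_rpow_of_nonpos h₀ h hq⟩
  obtain ⟨p1, l1⟩ := key (-(1 / 2)) (by norm_num)
  obtain ⟨p2, l2⟩ := key (-(3 / 2)) (by norm_num)
  obtain ⟨p3, l3⟩ := key (-(5 / 2)) (by norm_num)
  rw [interceptScale_eq hl, interceptScale₁, interceptScale₂, abs_of_pos p1,
    abs_of_neg (by linarith), abs_of_pos (by linarith)]
  refine ⟨by linarith, by linarith, by linarith⟩

/-- Score of the propensity model. -/
def psGrad (a : Treat m) (x : Covar m d) (ν : PSParam d) : PSParam d →L[ℝ] ℝ :=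
  (logMixGrad a (linPred x ν + interceptScale (precisionCLM d ν) • scaleVec m)).comp
    (partLinDeriv (linPred x) (precisionCLM d) (scaleVec m)
      (interceptScale₁ (precisionCLM d ν)))

/-- Second derivative of the log-likelihood of the propensity model. -/
def psHess (a : Treat m) (x : Covar m d) (ν : PSParam d) :
    PSParam d →L[ℝ] PSParam d →L[ℝ] ℝ :=
  partLinHess (linPred x) (precisionCLM d) (scaleVec m) (interceptScale₁ (precisionCLM d ν))
    (interceptScale₂ (precisionCLM d ν))
    (logMixGrad a (linPred x ν + interceptScale (precisionCLM d ν) • scaleVec m))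
    (logMixHess a (linPred x ν + interceptScale (precisionCLM d ν) • scaleVec m))

theorem hasFDerivAt_log_psModel (a : Treat m) (x : Covar m d) {ν : PSParam d}
    (h : 0 < ν.precision) :
    HasFDerivAt (fun ν => Real.log (psModel a x ν)) (psGrad a x ν) ν := by
  simp_rw [psModel_eq]
  exact (hasFDerivAt_log_mixProb a _).comp ν
    (hasFDerivAt_partLin (linPred x) (precisionCLM d) (scaleVec m) (hasDerivAt_interceptScale h))

theorem hasFDerivAt_psGrad (a : Treat m) (x : Covar m d) {ν : PSParam d}
    (h : 0 < ν.precision) : HasFDerivAt (psGrad a x) (psHess a x ν) ν :=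
  hasFDerivAt_partLin_comp (hasFDerivAt_logMixGrad a _) (hasDerivAt_interceptScale h)
    (hasDerivAt_interceptScale₁ h)

theorem norm_precisionCLM_le : ‖precisionCLM d‖ ≤ 1 :=
  ContinuousLinearMap.opNorm_le_bound _ zero_le_one fun ν => by
    simpa [PSParam.precision] using norm_le_pi_norm ν (Sum.inr ())

theorem norm_scaleVec_le : ‖scaleVec m‖ ≤ 1 := by simp [scaleVec, Prod.norm_def]

theorem norm_regressorCLM_le (j : Fin m) (i : Unit ⊕ Fin d ⊕ Fin d) :
    ‖regressorCLM m j i‖ ≤ 1 := by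
  refine ContinuousLinearMap.opNorm_le_bound _ zero_le_one fun ν => ?_
  have : ‖(Pi.single j 1 : Fin m → ℝ)‖ = 1 := by
    rw [Pi.norm_single, norm_one]
  simp only [regressorCLM, ContinuousLinearMap.smulRight_apply, ContinuousLinearMap.proj_apply,
    norm_smul, Prod.norm_def, this]
  simpa using norm_le_pi_norm ν (Sum.inl i)

theorem covarNorm_nonneg (x : Covar m d) : 0 ≤ covarNorm x := Real.sqrt_nonneg _

theorem abs_apply_le_covarNorm (x : Covar m d) (j : Fin m) (r : Fin d) :
    |x j r| ≤ covarNorm x := by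
  refine Real.abs_le_sqrt ?_
  calc x j r ^ 2 ≤ ∑ r, x j r ^ 2 :=
        Finset.single_le_sum (f := fun r => x j r ^ 2) (fun _ _ => sq_nonneg _)
          (Finset.mem_univ r)
    _ ≤ _ := Finset.single_le_sum (f := fun j => ∑ r, x j r ^ 2)
          (fun _ _ => Finset.sum_nonneg fun _ _ => sq_nonneg _) (Finset.mem_univ j)

theorem abs_sum_erase_le (x : Covar m d) (j : Fin m) (r : Fin d) :
    |∑ l ∈ Finset.univ.erase j, x l r| ≤ m * covarNorm x := by
  refine (Finset.abs_sum_le_sum_abs _ _).trans ?_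
  calc _ ≤ ∑ _l ∈ Finset.univ.erase j, covarNorm x :=
        Finset.sum_le_sum fun l _ => abs_apply_le_covarNorm x l r
    _ = (Finset.univ.erase j).card * covarNorm x := by simp
    _ ≤ m * covarNorm x := by
        refine mul_le_mul_of_nonneg_right ?_ (covarNorm_nonneg x)
        exact_mod_cast (Finset.card_le_univ _).trans_eq (by simp)

theorem abs_psRegressor_le (x : Covar m d) (j : Fin m) (i : Unit ⊕ Fin d ⊕ Fin d) :
    |psRegressor x j i| ≤ (m + 1) * (1 + covarNorm x) := by
  have hx := covarNorm_nonneg x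
  have hm : (0 : ℝ) ≤ m := Nat.cast_nonneg _
  have h0 : 0 ≤ (m : ℝ) * covarNorm x := mul_nonneg hm hx
  rcases i with _ | r | r
  · simp only [psRegressor, Sum.elim_inl, abs_one]; nlinarith
  · have := abs_apply_le_covarNorm x j r
    simp only [psRegressor, Sum.elim_inl, Sum.elim_inr]; nlinarith
  · have := abs_sum_erase_le x j r
    simp only [psRegressor, Sum.elim_inr]; nlinarith

theorem norm_linPred_le (m d : ℕ) : ∃ C > 0,
    ∀ x : Covar m d, ‖linPred x‖ ≤ C * (1 + covarNorm x) := by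
  refine ⟨∑ _j : Fin m, ∑ _i : Unit ⊕ Fin d ⊕ Fin d, ((m : ℝ) + 1) + 1, by positivity,
    fun x => ?_⟩
  have hx := covarNorm_nonneg x
  refine (norm_sum_le _ _).trans ?_
  rw [add_mul, one_mul]
  refine le_trans ?_ (le_add_of_nonneg_right (by linarith))
  rw [Finset.sum_mul]
  refine Finset.sum_le_sum fun j _ => (norm_sum_le _ _).trans ?_
  rw [Finset.sum_mul]
  refine Finset.sum_le_sum fun i _ => ?_
  rw [norm_smul]
  calc _ ≤ |psRegressor x j i| * 1 :=
        mul_le_mul_of_nonneg_left (norm_regressorCLM_le j i) (abs_nonneg _)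
    _ ≤ _ := by rw [mul_one]; exact abs_psRegressor_le x j i

theorem continuous_psRegressor (j : Fin m) (i : Unit ⊕ Fin d ⊕ Fin d) :
    Continuous fun x : Covar m d => psRegressor x j i := by
  rcases i with _ | r | r <;> simp only [psRegressor, Sum.elim_inl, Sum.elim_inr] <;> fun_prop

theorem continuous_linPred : Continuous (linPred (m := m) (d := d)) := by
  have := continuous_psRegressor (m := m) (d := d)
  unfold linPred
  fun_prop

/-- Joint continuity is taken over the positive precisions, the scale being singular at zero. -/
theorem continuous_predictor :
    Continuous fun q : Covar m d × {ν : PSParam d // 0 < ν.precision} =>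
      linPred q.1 q.2.1 + interceptScale (precisionCLM d q.2.1) • scaleVec m := by
  have h1 := continuous_linPred (m := m) (d := d)
  have h2 : Continuous fun q : Covar m d × {ν : PSParam d // 0 < ν.precision} =>
      interceptScale (precisionCLM d q.2.1) := by
    unfold interceptScale
    refine Continuous.inv₀ (by fun_prop) fun q => ?_
    exact (Real.sqrt_pos.2 q.2.2).ne'
  fun_prop

theorem measurable_psModel (a : Treat m) :
    Measurable fun q : Covar m d × PSParam d => psModel a q.1 q.2 := by
  have h1 := continuous_linPred (m := m) (d := d)
  have h2 : Measurable fun q : Covar m d × PSParam d => interceptScale (precisionCLM d q.2) := by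
    unfold interceptScale
    have : Continuous fun q : Covar m d × PSParam d => √(precisionCLM d q.2) := by fun_prop
    exact this.measurable.inv
  have h3 : Measurable fun q : Covar m d × PSParam d => linPred q.1 q.2 :=
    (show Continuous fun q : Covar m d × PSParam d => linPred q.1 q.2 by fun_prop).measurable
  simp_rw [psModel_eq]
  exact (continuous_mixProb a).measurable.comp (h3.add (h2.smul_const _))

theorem continuous_interceptScale_comp {T : Type*} [TopologicalSpace T]
    {ν : T → {ν : PSParam d // 0 < ν.precision}} (hν : Continuous ν) :
    Continuous (fun t => interceptScale₁ (precisionCLM d (ν t).1)) ∧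
      Continuous fun t => interceptScale₂ (precisionCLM d (ν t).1) := by
  have h : Continuous fun t => precisionCLM d (ν t).1 := by fun_prop
  constructor
  · exact continuous_const.mul (h.rpow_const fun t => Or.inl (ν t).2.ne')
  · exact continuous_const.mul (h.rpow_const fun t => Or.inl (ν t).2.ne')

theorem continuous_psGrad (a : Treat m) :
    Continuous fun q : Covar m d × {ν : PSParam d // 0 < ν.precision} => psGrad a q.1 q.2.1 := by
  have h1 := continuous_partLinDeriv (p := precisionCLM d) (e := scaleVec m)
    (continuous_linPred.comp continuous_fst)
    (continuous_interceptScale_comp (T := Covar m d × {ν : PSParam d // 0 < ν.precision})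
      continuous_snd).1
  exact ((continuous_logMixGrad a).comp continuous_predictor).clm_comp h1

theorem continuous_psHess (a : Treat m) :
    Continuous fun q : Covar m d × {ν : PSParam d // 0 < ν.precision} => psHess a q.1 q.2.1 := by
  have h := continuous_interceptScale_comp (T := Covar m d × {ν : PSParam d // 0 < ν.precision})
    continuous_snd
  exact continuous_partLinHess (continuous_linPred.comp continuous_fst) h.1 h.2
    ((continuous_logMixGrad a).comp continuous_predictor)
    ((continuous_logMixHess a).comp continuous_predictor)

/-- The lower bound on the precision bounds the scale, so `logMix_bounds` contributes constants
only. Growth in the covariates comes from the linear predictors, one factor per derivative. -/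
theorem psGrad_psHess_bounds (m d : ℕ) {lam₀ : ℝ} (h₀ : 0 < lam₀) :
    ∃ C > 0, ∀ (a : Treat m) (x : Covar m d) (ν : PSParam d), lam₀ ≤ ν.precision →
      ‖psGrad a x ν‖ ≤ C * (1 + covarNorm x) ∧ ‖psHess a x ν‖ ≤ C * (1 + covarNorm x) ^ 2 := by
  obtain ⟨R, hR, hr⟩ := interceptScale_bounds h₀
  obtain ⟨L, hL, hl⟩ := norm_linPred_le m d
  choose B hB hb using fun a : Treat m => logMix_bounds a R
  set D : ℝ := ∑ a, B a with hD
  have hBD : ∀ a, B a ≤ D := fun a =>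
    Finset.single_le_sum (f := B) (fun a _ => (hB a).le) (Finset.mem_univ a)
  have hD0 : 0 < D := (hB fun _ => true).trans_le (hBD _)
  refine ⟨D * (L + R) + (D * R + D * (L + R) ^ 2), by positivity, fun a x ν hν => ?_⟩
  obtain ⟨r0, r1, r2⟩ := hr _ hν
  have hs : |(linPred x ν + interceptScale (precisionCLM d ν) • scaleVec m).2| ≤ R := by
    rw [linPred_apply]
    simpa [scaleVec] using r0
  obtain ⟨b1, b2⟩ := hb a _ hs
  have hx := covarNorm_nonneg x
  set ξ := 1 + covarNorm x with hξ
  have hξ1 : 1 ≤ ξ := by linarith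
  have hT : ‖linPred x‖ + |interceptScale₁ (precisionCLM d ν)| ≤ (L + R) * ξ := by
    have := hl x
    have : |interceptScale₁ (precisionCLM d ν)| ≤ R := r1
    nlinarith
  constructor
  · calc ‖psGrad a x ν‖ ≤ D * ((L + R) * ξ) := by
          refine (ContinuousLinearMap.opNorm_comp_le _ _).trans ?_
          exact mul_le_mul (b1.trans (hBD a)) ((norm_partLinDeriv_le _ _ norm_precisionCLM_le
            norm_scaleVec_le).trans hT) (norm_nonneg _) hD0.le
      _ = D * (L + R) * ξ := by ring
      _ ≤ _ := mul_le_mul_of_nonneg_right (le_add_of_nonneg_right (by positivity)) (by linarith)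
  · calc ‖psHess a x ν‖ ≤ D * R + D * ((L + R) * ξ) ^ 2 := by
          refine (norm_partLinHess_le _ _ _ _ _ norm_precisionCLM_le norm_scaleVec_le).trans ?_
          refine add_le_add (mul_le_mul (b1.trans (hBD a)) r2 (abs_nonneg _) hD0.le) ?_
          exact mul_le_mul (b2.trans (hBD a)) (pow_le_pow_left₀ (by positivity) hT 2)
            (by positivity) hD0.le
      _ ≤ (D * R + D * (L + R) ^ 2) * ξ ^ 2 := by
          have h1 : 1 ≤ ξ ^ 2 := one_le_pow₀ hξ1
          have h2 : 0 < D * R := by positivity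
          nlinarith
      _ ≤ _ := mul_le_mul_of_nonneg_right (le_add_of_nonneg_left (by positivity)) (by positivity)

/-- The logarithm is nonpositive. From below, the probability is compared with its value at zero
logits, and the loss is exponential in the norm of the linear predictors. -/
theorem abs_log_psModel_le (ν : PSParam d) : ∃ C > 0, ∀ (a : Treat m) (x : Covar m d),
    |Real.log (psModel a x ν)| ≤ C * (1 + covarNorm x) := by
  obtain ⟨L, hL, hl⟩ := norm_linPred_le m d
  choose c hc h using fun a : Treat m =>
    exp_mul_le_mixProb a (S := |interceptScale (precisionCLM d ν)|)
  set D : ℝ := ∑ a, |Real.log (c a * vecProb a 0)| with hD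
  refine ⟨D + m * (L * ‖ν‖) + 1, by positivity, fun a x => ?_⟩
  have hx := covarNorm_nonneg x
  have h1 : c a * vecProb a (linPred x ν).1 ≤ psModel a x ν := by
    rw [psModel_eq]
    have := h a (linPred x ν + interceptScale (precisionCLM d ν) • scaleVec m) (by
      rw [linPred_apply]; simp [scaleVec])
    simpa [scaleVec] using this
  have hv0 := vecProb_pos a (0 : Fin m → ℝ)
  have h2 := vecProb_le_exp_mul a 0 (linPred x ν).1
  have h3 : ‖(0 : Fin m → ℝ) - (linPred x ν).1‖ ≤ L * (1 + covarNorm x) * ‖ν‖ := by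
    rw [zero_sub, norm_neg]
    exact (norm_fst_le _).trans ((ContinuousLinearMap.le_opNorm _ _).trans
      (mul_le_mul_of_nonneg_right (hl x) (norm_nonneg _)))
  have h4 : Real.log (c a * vecProb a 0) - m * (L * (1 + covarNorm x) * ‖ν‖) ≤
      Real.log (psModel a x ν) := by
    have h5 : c a * vecProb a 0 ≤ Real.exp (m * (L * (1 + covarNorm x) * ‖ν‖)) *
        psModel a x ν := by
      calc c a * vecProb a 0 ≤ c a * (Real.exp (m * ‖(0 : Fin m → ℝ) - (linPred x ν).1‖) *
            vecProb a (linPred x ν).1) := mul_le_mul_of_nonneg_left h2 (hc a).le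
        _ = Real.exp (m * ‖(0 : Fin m → ℝ) - (linPred x ν).1‖) *
            (c a * vecProb a (linPred x ν).1) := by ring
        _ ≤ _ := mul_le_mul (Real.exp_le_exp.2 (mul_le_mul_of_nonneg_left h3 (Nat.cast_nonneg _)))
            h1 (mul_pos (hc a) (vecProb_pos _ _)).le (Real.exp_pos _).le
    have := Real.log_le_log (mul_pos (hc a) hv0) h5
    rw [Real.log_mul (Real.exp_ne_zero _) (psModel_pos a x ν).ne', Real.log_exp] at this
    linarith
  have h6 : Real.log (psModel a x ν) ≤ 0 :=
    Real.log_nonpos (psModel_pos a x ν).le (psModel_le_one a x ν)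
  have h7 : |Real.log (c a * vecProb a 0)| ≤ D :=
    Finset.single_le_sum (f := fun a => |Real.log (c a * vecProb a 0)|)
      (fun a _ => abs_nonneg _) (Finset.mem_univ a)
  have h8 := neg_abs_le (Real.log (c a * vecProb a 0))
  have hD0 : 0 ≤ D := (abs_nonneg _).trans h7
  rw [abs_of_nonpos h6]
  nlinarith

theorem measurable_covarNorm : Measurable (covarNorm (m := m) (d := d)) := by
  have : Continuous (covarNorm (m := m) (d := d)) := by unfold covarNorm; fun_prop
  exact this.measurable

end

/-! ### M-estimation -/

section

section MEstimation

variable {Ω 𝒵 : Type*} [MeasurableSpace Ω] [MeasurableSpace 𝒵] {μ : Measure Ω}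
  [IsProbabilityMeasure μ] {P : Measure 𝒵} {Z : ℕ → Ω → 𝒵}
  {E : Type*} [NormedAddCommGroup E] [NormedSpace ℝ E]

/-- Consistency of maximizers of averages of a Lipschitz criterion over a compact set. -/
theorem IsSample.consistent (hs : IsSample μ P Z) {Θ : Set E} (hΘ : IsCompact Θ)
    {m : 𝒵 → E → ℝ} {B : 𝒵 → ℝ} (hBm : Measurable B) (hBi : Integrable B P) (hB0 : ∀ z, 0 ≤ B z)
    (hLip : ∀ z, ∀ ν ∈ Θ, ∀ ν' ∈ Θ, |m z ν - m z ν'| ≤ B z * ‖ν - ν'‖)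
    (hmeas : ∀ ν ∈ Θ, Measurable fun z => m z ν) (hint : ∀ ν ∈ Θ, Integrable (fun z => m z ν) P)
    {ν₀ : E} (h₀ : ν₀ ∈ Θ) (hmax : ∀ ν ∈ Θ, ν ≠ ν₀ → ∫ z, m z ν ∂P < ∫ z, m z ν₀ ∂P)
    {est : ℕ → Ω → E}
    (hest : HighProb μ fun N ω => est N ω ∈ Θ ∧ ∀ ν ∈ Θ,
      avg Z (fun z => m z ν) N ω ≤ avg Z (fun z => m z (est N ω)) N ω) :
    SmallInProb μ fun N ω => est N ω - ν₀ := by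
  intro δ hδ
  set K := Θ ∩ {ν | δ ≤ ‖ν - ν₀‖} with hK
  have hKc : IsCompact K := hΘ.inter_right
    (isClosed_le continuous_const (by fun_prop))
  rcases K.eq_empty_or_nonempty with hKe | hKn
  · refine hest.imp fun N ω h => ?_
    by_contra hc
    exact (Set.eq_empty_iff_forall_notMem.1 hKe (est N ω)) ⟨h.1, not_lt.1 hc⟩
  set b := ∫ z, B z ∂P with hb
  have hb0 : 0 ≤ b := integral_nonneg hB0
  have hMlip : ∀ ν ∈ Θ, ∀ ν' ∈ Θ, |∫ z, m z ν ∂P - ∫ z, m z ν' ∂P| ≤ b * ‖ν - ν'‖ := by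
    intro ν hν ν' hν'
    rw [← integral_sub (hint ν hν) (hint ν' hν'), hb, ← integral_mul_const]
    exact norm_integral_le_of_norm_le (f := fun z => m z ν - m z ν') (hBi.mul_const _)
      (Eventually.of_forall fun z => hLip z ν hν ν' hν')
  have hMc : ContinuousOn (fun ν => ∫ z, m z ν ∂P) K := by
    have : LipschitzOnWith (Real.toNNReal b) (fun ν => ∫ z, m z ν ∂P) K :=
      LipschitzOnWith.of_dist_le_mul fun ν hν ν' hν' => by
        rw [Real.dist_eq, dist_eq_norm, Real.coe_toNNReal _ hb0]
        exact hMlip ν hν.1 ν' hν'.1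
    exact this.continuousOn
  obtain ⟨ν₁, hν₁, hν₁max⟩ := hKc.exists_isMaxOn hKn hMc
  have hν₁ne : ν₁ ≠ ν₀ := by
    rintro rfl
    have := hν₁.2
    simp only [Set.mem_ofPred_eq, sub_self, norm_zero] at this
    linarith
  set gap := ∫ z, m z ν₀ ∂P - ∫ z, m z ν₁ ∂P with hgap
  have hgap0 : 0 < gap := sub_pos.2 (hmax ν₁ hν₁.1 hν₁ne)
  -- Three errors of `gap / 4` occur: the law of large numbers at `ν₀` and at a point of the net,
  -- and the passage from the estimator to that point, where the average of `B` is at most `b + 1`.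
  set ρ := gap / 4 / (b + 1) with hρ
  have hρ0 : 0 < ρ := by positivity
  obtain ⟨t, htK, htf, htc⟩ := hKc.finite_cover_balls hρ0
  have e1 : HighProb μ fun N ω => ∀ ν ∈ t,
      ‖avg Z (fun z => m z ν) N ω - ∫ z, m z ν ∂P‖ < gap / 4 :=
    HighProb.forall_mem_finite htf fun ν hν =>
      hs.lln (hmeas ν (htK hν).1) (hint ν (htK hν).1) _ (by positivity)
  have e2 := hs.lln (hmeas ν₀ h₀) (hint ν₀ h₀) (gap / 4) (by positivity)
  have e3 := hs.lln hBm hBi 1 one_pos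
  refine (((e1.and e2).and e3).and hest).imp fun N ω h => ?_
  obtain ⟨⟨⟨h1, h2⟩, h3⟩, h4, h5⟩ := h
  by_contra hc
  have hmem : est N ω ∈ K := ⟨h4, not_lt.1 hc⟩
  obtain ⟨ν, hνt, hν⟩ := Set.mem_iUnion₂.1 (htc hmem)
  have hνK := htK hνt
  have hd : avg Z (fun z => m z (est N ω)) N ω - avg Z (fun z => m z ν) N ω ≤
      avg Z B N ω * ‖est N ω - ν‖ := by
    rw [← avg_sub, mul_comm, ← avg_const_mul]
    refine avg_mono_of fun i _ => ?_
    rw [mul_comm]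
    exact (le_abs_self _).trans (hLip _ _ h4 _ hνK.1)
  have h6 := (abs_lt.1 (Real.norm_eq_abs _ ▸ h1 ν hνt)).2
  have h7 := (abs_lt.1 (Real.norm_eq_abs _ ▸ h2)).1
  have h8 := (abs_lt.1 (Real.norm_eq_abs _ ▸ h3)).2
  have h9 := h5 ν₀ h₀
  have h10 : ∫ z, m z ν ∂P ≤ ∫ z, m z ν₁ ∂P := hν₁max hνK
  have h11 : ‖est N ω - ν‖ ≤ ρ := by
    rw [← dist_eq_norm]; exact (Metric.mem_ball.1 hν).le
  have h12 : avg Z B N ω * ‖est N ω - ν‖ ≤ (b + 1) * ρ :=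
    mul_le_mul (by linarith) h11 (norm_nonneg _) (by linarith)
  have h13 : (b + 1) * ρ = gap / 4 := by
    rw [hρ]; field_simp
  linarith

/-- `est` is an asymptotically linear estimator of `ν₀` with influence function `κ`. -/
structure IsAsympLinear [MeasurableSpace E] (μ : Measure Ω) (P : Measure 𝒵) (Z : ℕ → Ω → 𝒵)
    (est : ℕ → Ω → E) (ν₀ : E) (κ : 𝒵 → E) : Prop where
  meas : Measurable κ
  memLp : MemLp κ 2 P
  mean : ∫ z, κ z ∂P = 0
  small : SmallInProb μ fun (N : ℕ) ω => √(N : ℝ) • (est N ω - ν₀) - √(N : ℝ) • avg Z κ N ω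

theorem IsSample.bddInProb_sqrt_avg_finiteDimensional [FiniteDimensional ℝ E] [MeasurableSpace E]
    [BorelSpace E] (hs : IsSample μ P Z) {g : 𝒵 → E} (hg : Measurable g) (h2 : MemLp g 2 P)
    (h0 : ∫ z, g z ∂P = 0) :
    BddInProb μ fun (N : ℕ) ω => √(N : ℝ) • avg Z g N ω := by
  let e := (Module.finBasis ℝ E).equivFunL
  have hi : Integrable g P := by
    have := hs.isProbabilityMeasure
    exact h2.integrable (by norm_num)
  have h := hs.bddInProb_sqrt_avg_pi (g := fun z => e (g z)) (e.continuous.measurable.comp hg)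
    (e.toContinuousLinearMap.comp_memLp' h2) (by
      have := e.toContinuousLinearMap.integral_comp_comm hi
      simpa [h0] using this)
  refine h.of_imp fun C => ⟨‖(e.symm : (Fin (Module.finrank ℝ E) → ℝ) →L[ℝ] E)‖ * C,
    highProb_of_forall
    (Eventually.of_forall fun N ω hC => ?_)⟩
  have h3 : √(N : ℝ) • avg Z g N ω =
      (e.symm : (Fin (Module.finrank ℝ E) → ℝ) →L[ℝ] E)
        (√(N : ℝ) • avg Z (fun z => e (g z)) N ω) := by
    have := avg_clm (Z := Z) (N := N) (ω := ω) (e : E →L[ℝ] (Fin (Module.finrank ℝ E) → ℝ)) g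
    simp only [ContinuousLinearEquiv.coe_coe] at this
    rw [this]
    simp
  rw [h3]
  exact (ContinuousLinearMap.le_opNorm _ _).trans
    (mul_le_mul_of_nonneg_left hC (norm_nonneg _))

theorem IsAsympLinear.bddInProb [FiniteDimensional ℝ E] [MeasurableSpace E]
    [BorelSpace E] (hs : IsSample μ P Z) {est : ℕ → Ω → E} {ν₀ : E} {κ : 𝒵 → E}
    (h : IsAsympLinear μ P Z est ν₀ κ) :
    BddInProb μ fun (N : ℕ) ω => √(N : ℝ) • (est N ω - ν₀) := by
  simpa using h.small.bddInProb.add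
    (hs.bddInProb_sqrt_avg_finiteDimensional h.meas h.memLp h.mean)

/-- An estimator whose error equals an average up to a relatively negligible term is
asymptotically linear. -/
theorem IsSample.isAsympLinear_of_relative [FiniteDimensional ℝ E] [MeasurableSpace E]
    [BorelSpace E] (hs : IsSample μ P Z) {est : ℕ → Ω → E} {ν₀ : E} {κ : 𝒵 → E}
    (hκ : Measurable κ) (h2 : MemLp κ 2 P) (h0 : ∫ z, κ z ∂P = 0)
    (h : ∀ ε > 0, HighProb μ fun N ω => ‖est N ω - ν₀ - avg Z κ N ω‖ ≤ ε * ‖est N ω - ν₀‖) :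
    IsAsympLinear μ P Z est ν₀ κ := by
  refine ⟨hκ, h2, h0, fun δ hδ => ?_⟩
  refine (hs.bddInProb_sqrt_avg_finiteDimensional hκ h2 h0).highProb fun C => ?_
  have hC : 0 < 2 * |C| + 1 := by positivity
  refine ((h (1 / 2) (by norm_num)).and (h (δ / (2 * |C| + 1)) (by positivity))).imp
    fun N ω hh hb => ?_
  obtain ⟨ha, hc⟩ := hh
  change ‖√(N : ℝ) • (est N ω - ν₀) - √(N : ℝ) • avg Z κ N ω‖ < δ
  rw [← smul_sub, norm_smul]
  rw [norm_smul] at hb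
  set D := est N ω - ν₀
  set A := avg Z κ N ω
  -- The relative bound with `ε = 1 / 2` is absorbed into the left side. It makes the error of order
  -- `N ^ (-1/2)`, and the other relative bound becomes an absolute one.
  have h1 : ‖D‖ ≤ 2 * ‖A‖ := by
    have := norm_le_norm_add_norm_sub' D A
    linarith
  have hs0 : 0 ≤ ‖√(N : ℝ)‖ := norm_nonneg _
  calc ‖√(N : ℝ)‖ * ‖D - A‖ ≤ ‖√(N : ℝ)‖ * (δ / (2 * |C| + 1) * (2 * ‖A‖)) := by
        refine mul_le_mul_of_nonneg_left (hc.trans ?_) hs0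
        exact mul_le_mul_of_nonneg_left h1 (by positivity)
    _ = δ / (2 * |C| + 1) * (2 * (‖√(N : ℝ)‖ * ‖A‖)) := by ring
    _ ≤ δ / (2 * |C| + 1) * (2 * |C|) :=
        mul_le_mul_of_nonneg_left (by linarith [le_abs_self C]) (by positivity)
    _ < δ := by
        rw [div_mul_eq_mul_div, div_lt_iff₀ hC]
        nlinarith

/-- Asymptotic linearity of consistent M-estimators. Gradients are represented in a space `F`
identified with the dual by `Φ`. -/
theorem IsSample.mEstimator [FiniteDimensional ℝ E] [MeasurableSpace E] [BorelSpace E]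
    {F : Type*} [NormedAddCommGroup F] [NormedSpace ℝ F] [FiniteDimensional ℝ F]
    [MeasurableSpace F] [BorelSpace F] (Φ : F ≃L[ℝ] (E →L[ℝ] ℝ))
    (hs : IsSample μ P Z) {Θ : Set E}
    {m : 𝒵 → E → ℝ} {ν₀ : E} {r : ℝ} (hr : 0 < r) (hball : Metric.ball ν₀ r ⊆ Θ)
    (hmeas : ∀ ν ∈ Θ, Measurable fun z => m z ν) (hint : ∀ ν ∈ Θ, Integrable (fun z => m z ν) P)
    (hmax : ∀ ν ∈ Θ, ν ≠ ν₀ → ∫ z, m z ν ∂P < ∫ z, m z ν₀ ∂P)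
    {s : 𝒵 → E → F} {h : 𝒵 → E → E →L[ℝ] F} {B B₂ : 𝒵 → ℝ}
    (hm : ∀ z, ∀ ν ∈ Metric.ball ν₀ r, HasFDerivAt (m z) (Φ (s z ν)) ν)
    (hsd : ∀ z, ∀ ν ∈ Metric.ball ν₀ r, HasFDerivAt (s z) (h z ν) ν)
    (hsmeas : Measurable fun z => s z ν₀)
    (hhmeas : ∀ ν ∈ Metric.ball ν₀ r, Measurable fun z => h z ν)
    (hhcont : ∀ z, ContinuousOn (h z) (Metric.ball ν₀ r))
    (hB : MemLp B 2 P) (hsB : ∀ z, ∀ ν ∈ Metric.ball ν₀ r, ‖s z ν‖ ≤ B z)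
    (hB₂ : Integrable B₂ P) (hhB : ∀ z, ∀ ν ∈ Metric.ball ν₀ r, ‖h z ν‖ ≤ B₂ z)
    (hinfo : ∀ v ≠ 0, Φ ((∫ z, h z ν₀ ∂P) v) v < 0)
    {est : ℕ → Ω → E} (hcons : SmallInProb μ fun N ω => est N ω - ν₀)
    (hest : HighProb μ fun N ω => est N ω ∈ Θ ∧ ∀ ν ∈ Θ,
      avg Z (fun z => m z ν) N ω ≤ avg Z (fun z => m z (est N ω)) N ω) :
    ∃ κ, IsAsympLinear μ P Z est ν₀ κ := by
  have := hs.isProbabilityMeasure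
  have : ProperSpace E := FiniteDimensional.proper_real E
  have : ProperSpace F := FiniteDimensional.proper_real F
  have : ProperSpace (E →L[ℝ] F) := FiniteDimensional.proper ℝ _
  have h00 : ν₀ ∈ Metric.ball ν₀ r := Metric.mem_ball_self hr
  have hBi : Integrable B P := hB.integrable (by norm_num)
  have hsL : MemLp (fun z => s z ν₀) 2 P := hB.mono' hsmeas.aestronglyMeasurable
    (Eventually.of_forall fun z => hsB z ν₀ h00)
  have hhi : Integrable (fun z => h z ν₀) P := hB₂.mono'
    (hhmeas ν₀ h00).aestronglyMeasurable (Eventually.of_forall fun z => hhB z ν₀ h00)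
  have hΦi : ∀ z, ∀ ν ∈ Metric.ball ν₀ r, ‖Φ (s z ν)‖ ≤ ‖(Φ : F →L[ℝ] E →L[ℝ] ℝ)‖ * B z :=
    fun z ν hν => ((Φ : F →L[ℝ] E →L[ℝ] ℝ).le_opNorm _).trans
      (mul_le_mul_of_nonneg_left (hsB z ν hν) (norm_nonneg _))
  -- The score is centred because `ν₀` is an interior maximizer of the population criterion; correct
  -- specification plays no role.
  have hmean : ∫ z, s z ν₀ ∂P = 0 := by
    have hd : HasFDerivAt (fun ν => ∫ z, m z ν ∂P) (∫ z, Φ (s z ν₀) ∂P) ν₀ :=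
      hasFDerivAt_integral_of_dominated_of_fderiv_le (Metric.ball_mem_nhds ν₀ hr)
        (by filter_upwards [Metric.ball_mem_nhds ν₀ hr] with ν hν
            exact (hmeas ν (hball hν)).aestronglyMeasurable)
        (hint ν₀ (hball h00))
        (Φ.continuous.comp_aestronglyMeasurable hsmeas.aestronglyMeasurable)
        (Eventually.of_forall hΦi) (hBi.const_mul _) (Eventually.of_forall hm)
    have h0 : ∫ z, Φ (s z ν₀) ∂P = 0 := by
      refine IsLocalMax.hasFDerivAt_eq_zero ?_ hd
      filter_upwards [Metric.ball_mem_nhds ν₀ hr] with ν hν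
      rcases eq_or_ne ν ν₀ with rfl | hne
      · exact le_rfl
      · exact (hmax ν (hball hν) hne).le
    rw [Φ.integral_comp_comm] at h0
    exact Φ.map_eq_zero_iff.1 h0
  set H : E →L[ℝ] F := ∫ z, h z ν₀ ∂P with hH
  -- A negative definite form has trivial kernel, and a left inverse of the mean Hessian is all that
  -- is needed.
  have hinj : LinearMap.ker (H : E →ₗ[ℝ] F) = ⊥ := by
    rw [LinearMap.ker_eq_bot']
    intro v hv
    by_contra hne
    have h1 := hinfo v hne
    have h2 : H v = 0 := hv
    rw [h2, map_zero] at h1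
    simp at h1
  obtain ⟨K₀, hK₀⟩ := LinearMap.exists_leftInverse_of_injective _ hinj
  let K : F →L[ℝ] E := LinearMap.toContinuousLinearMap K₀
  have hK : ∀ v, K (H v) = v := fun v => LinearMap.congr_fun hK₀ v
  have hκm : Measurable fun z => (-K) (s z ν₀) := (-K).continuous.measurable.comp hsmeas
  refine ⟨fun z => (-K) (s z ν₀), hs.isAsympLinear_of_relative hκm
    ((-K).comp_memLp' hsL) ?_ fun ε hε => ?_⟩
  · rw [(-K).integral_comp_comm (hsL.integrable (by norm_num)), hmean, map_zero]
  -- Two errors of size `η` are made, the variation of the Hessian near `ν₀` and its deviation from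
  -- its mean, and `K` magnifies both.
  set η := ε / (2 * (‖K‖ + 1)) with hη
  have hη0 : 0 < η := by positivity
  obtain ⟨δ, hδ, hδr, hequi⟩ := hs.equicontinuous hr hhcont hhmeas hB₂ hhB hη0
  refine (((hequi.and (hs.lln (hhmeas ν₀ h00) hhi η hη0)).and (hcons δ hδ)).and hest).imp
    fun N ω hh => ?_
  obtain ⟨⟨⟨he, hl⟩, hc⟩, hmem, hopt⟩ := hh
  have hin : est N ω ∈ Metric.ball ν₀ δ := by rwa [Metric.mem_ball, dist_eq_norm]
  have hsub : Metric.ball ν₀ δ ⊆ Metric.ball ν₀ r := Metric.ball_subset_ball hδr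
  have hSd : ∀ ν ∈ Metric.ball ν₀ δ, HasFDerivAt (fun ν => avg Z (fun z => s z ν) N ω)
      (avg Z (fun z => h z ν) N ω) ν := fun ν hν =>
    (HasFDerivAt.fun_sum fun i _ => hsd (Z i ω) ν (hsub hν)).const_smul _
  have hMd : HasFDerivAt (fun ν => avg Z (fun z => m z ν) N ω)
      (avg Z (fun z => Φ (s z (est N ω))) N ω) (est N ω) := by
    have hsum := HasFDerivAt.fun_sum (u := Finset.range N) fun i _ => hm (Z i ω) _ (hsub hin)
    exact hsum.const_mul (N : ℝ)⁻¹
  -- The estimator lies in an open ball inside `Θ`, so the first order condition holds exactly.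
  have hS0 : avg Z (fun z => s z (est N ω)) N ω = 0 := by
    have e : avg Z (fun z => Φ (s z (est N ω))) N ω = Φ (avg Z (fun z => s z (est N ω)) N ω) :=
      avg_clm (Φ : F →L[ℝ] E →L[ℝ] ℝ) _
    refine Φ.map_eq_zero_iff.1 ?_
    rw [← e]
    refine IsLocalMax.hasFDerivAt_eq_zero ?_ hMd
    filter_upwards [Metric.isOpen_ball.mem_nhds hin] with ν hν
    exact hopt ν (hball (hsub hν))
  -- Mean value inequality relative to the sample Hessian at `ν₀`: the average score is linear in
  -- the error up to `η * ‖est N ω - ν₀‖`.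
  have hmv := Convex.norm_image_sub_le_of_norm_hasFDerivWithin_le' (C := η)
    (s := Metric.ball ν₀ δ) (φ := avg Z (fun z => h z ν₀) N ω)
    (fun ν hν => (hSd ν hν).hasFDerivWithinAt)
    (fun ν hν => by
      rw [← avg_sub]
      exact (norm_avg_le_of fun i _ => le_rfl).trans (he ν hν)) (convex_ball ν₀ δ)
    (Metric.mem_ball_self hδ) hin
  rw [hS0] at hmv
  set Δ := est N ω - ν₀ with hΔ
  set S := avg Z (fun z => s z ν₀) N ω with hS
  have h1 : ‖S + H Δ‖ ≤ 2 * η * ‖Δ‖ := by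
    have e : S + H Δ = -(0 - S - (avg Z (fun z => h z ν₀) N ω) Δ) -
        (avg Z (fun z => h z ν₀) N ω - H) Δ := by
      simp only [sub_apply]; abel
    rw [e]
    refine (norm_sub_le _ _).trans ?_
    rw [norm_neg]
    have := (ContinuousLinearMap.le_opNorm (avg Z (fun z => h z ν₀) N ω - H) Δ).trans
      (mul_le_mul_of_nonneg_right hl.le (norm_nonneg _))
    linarith
  have h2 : avg Z (fun z => (-K) (s z ν₀)) N ω = -K S := by rw [avg_clm]; rfl
  have h3 : Δ - avg Z (fun z => (-K) (s z ν₀)) N ω = K (S + H Δ) := by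
    rw [h2, map_add, hK]; abel
  rw [h3]
  calc ‖K (S + H Δ)‖ ≤ ‖K‖ * (2 * η * ‖Δ‖) := (ContinuousLinearMap.le_opNorm _ _).trans
        (mul_le_mul_of_nonneg_left h1 (norm_nonneg _))
    _ = (2 * η * ‖K‖) * ‖Δ‖ := by ring
    _ ≤ ε * ‖Δ‖ := by
        refine mul_le_mul_of_nonneg_right ?_ (norm_nonneg _)
        have : 2 * η * (‖K‖ + 1) = ε := by rw [hη]; field_simp
        linarith

end MEstimation

end

/-! ### Mixtures over cluster types -/

section

section Mixture

variable {K : ℕ} {M d : Fin K → ℕ}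

/-- The σ-algebra of a disjoint union is the infimum of those pushed forward from the summands, so
measurability is checked type by type. -/
theorem measurable_sigma_of {γ : Type*} [MeasurableSpace γ] {f : Data M d → γ}
    (h : ∀ k, Measurable fun o => f ⟨k, o⟩) : Measurable f := by
  intro s hs
  change MeasurableSet[⨅ k, _] _
  rw [MeasurableSpace.measurableSet_iInf]
  exact fun k => h k hs

theorem measurable_mk (k : Fin K) : Measurable (Sigma.mk (β := fun k => Obs (M k) (d k)) k) := by
  intro s hs
  change MeasurableSet[⨅ k, _] _ at hs
  rw [MeasurableSpace.measurableSet_iInf] at hs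
  exact hs k

theorem measurableEmbedding_mk (k : Fin K) :
    MeasurableEmbedding (Sigma.mk (β := fun k => Obs (M k) (d k)) k) := by
  refine ⟨sigma_mk_injective, measurable_mk k, fun {s} hs => ?_⟩
  change MeasurableSet[⨅ k, _] _
  rw [MeasurableSpace.measurableSet_iInf]
  intro j
  change MeasurableSet (Sigma.mk (β := fun k => Obs (M k) (d k)) j ⁻¹' (Sigma.mk k '' s))
  by_cases h : j = k
  · subst h
    rwa [Set.preimage_image_eq _ sigma_mk_injective]
  · convert MeasurableSet.empty
    ext o
    simp only [Set.mem_preimage, Set.mem_image, Set.mem_empty_iff_false, iff_false]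
    rintro ⟨o', _, ho⟩
    exact h (congrArg Sigma.fst ho).symm

/-- `1(L = k) f(O)` with values in a vector space. -/
def onTypeV {E : Type*} [Zero E] (k : Fin K) (f : Obs (M k) (d k) → E) (z : Data M d) : E :=
  if h : z.1 = k then f (h ▸ z.2) else 0

theorem onType_eq (k : Fin K) (f : Obs (M k) (d k) → ℝ) (z : Data M d) :
    onType k f z = onTypeV k f z := rfl

section OnType

variable {E : Type*} [Zero E] (k : Fin K) (f : Obs (M k) (d k) → E)

@[simp] theorem onTypeV_mk_self (o : Obs (M k) (d k)) :
    onTypeV k f (⟨k, o⟩ : Data M d) = f o := by simp [onTypeV]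

theorem onTypeV_mk_ne {j : Fin K} (h : j ≠ k) (o : Obs (M j) (d j)) :
    onTypeV k f (⟨j, o⟩ : Data M d) = 0 := by simp [onTypeV, h]

variable {k f}

theorem measurable_onTypeV [MeasurableSpace E] (hf : Measurable f) :
    Measurable (onTypeV k f : Data M d → E) := by
  refine measurable_sigma_of fun j => ?_
  by_cases h : j = k
  · subst h; simpa using hf
  · simp_rw [onTypeV_mk_ne k f h]; exact measurable_const

/-- Pointwise properties of `onTypeV` reduce to type `k`. -/
theorem onTypeV_cases {p : Data M d → Prop} (z : Data M d) (h₁ : ∀ o, p ⟨k, o⟩)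
    (h₂ : ∀ j o, j ≠ k → p ⟨j, o⟩) : p z := by
  obtain ⟨j, o⟩ := z
  by_cases h : j = k
  · subst h; exact h₁ o
  · exact h₂ j o h

theorem onTypeV_map {F : Type*} [Zero F] {T : E → F} (hT : T 0 = 0) (z : Data M d) :
    onTypeV k (fun o => T (f o)) z = T (onTypeV k f z) := by
  refine onTypeV_cases (k := k) (p := fun z => onTypeV k (fun o => T (f o)) z =
    T (onTypeV k f z)) z (fun o => by simp) fun j o h => ?_
  rw [onTypeV_mk_ne _ _ h, onTypeV_mk_ne _ _ h, hT]

theorem onTypeV_map₂ {F G : Type*} [Zero F] [Zero G] {T : E → F → G} (hT : T 0 0 = 0)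
    {g : Obs (M k) (d k) → F} (z : Data M d) :
    onTypeV k (fun o => T (f o) (g o)) z = T (onTypeV k f z) (onTypeV k g z) := by
  refine onTypeV_cases (k := k) (p := fun z => onTypeV k (fun o => T (f o) (g o)) z =
    T (onTypeV k f z) (onTypeV k g z)) z (fun o => by simp) fun j o h => ?_
  rw [onTypeV_mk_ne _ _ h, onTypeV_mk_ne _ _ h, onTypeV_mk_ne _ _ h, hT]

end OnType

/-- Law of `(O, L)` when `pr(L = k) = p k` and `O` has law `P k` given `L = k`. -/
def mixLaw (p : Fin K → ℝ) (P : ∀ k, Measure (Obs (M k) (d k))) : Measure (Data M d) :=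
  ∑ k, ENNReal.ofReal (p k) • (P k).map (Sigma.mk k)

theorem obsLaw_eq_mixLaw (p : Fin K → ℝ) (Q : ∀ k, Measure (Full (M k) (d k))) :
    obsLaw p Q = mixLaw p fun k => (Q k).map observe := rfl

variable {p : Fin K → ℝ} {P : ∀ k, Measure (Obs (M k) (d k))}

theorem mixLaw_image_mk (k : Fin K) (s : Set (Obs (M k) (d k))) :
    mixLaw p P (Sigma.mk k '' s) = ENNReal.ofReal (p k) * P k s := by
  simp only [mixLaw, Measure.finsetSum_apply, Measure.smul_apply, smul_eq_mul]
  rw [Finset.sum_eq_single k]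
  · rw [(measurableEmbedding_mk k).map_apply, Set.preimage_image_eq _ sigma_mk_injective]
  · intro j _ hj
    rw [(measurableEmbedding_mk j).map_apply]
    convert mul_zero _
    convert measure_empty (μ := P j)
    ext o
    simp only [Set.mem_preimage, Set.mem_image, Set.mem_empty_iff_false, iff_false]
    rintro ⟨o', _, ho⟩
    exact hj (congrArg Sigma.fst ho).symm
  · simp

theorem fst_preimage_eq (k : Fin K) :
    (Sigma.fst ⁻¹' {k} : Set (Data M d)) = Sigma.mk k '' Set.univ := by
  ext ⟨j, o⟩
  simp only [Set.mem_preimage, Set.mem_singleton_iff, Set.image_univ, Set.mem_range]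
  constructor
  · rintro rfl; exact ⟨o, rfl⟩
  · rintro ⟨o', h⟩; exact (congrArg Sigma.fst h).symm

theorem measurableSet_fst_preimage (k : Fin K) :
    MeasurableSet (Sigma.fst ⁻¹' {k} : Set (Data M d)) := by
  rw [fst_preimage_eq]
  exact (measurableEmbedding_mk k).measurableSet_image.2 MeasurableSet.univ

variable [∀ k, IsProbabilityMeasure (P k)]

theorem typeProb_mixLaw (hp : ∀ k, 0 ≤ p k) (k : Fin K) : typeProb (mixLaw p P) k = p k := by
  rw [typeProb, fst_preimage_eq, measureReal_def, mixLaw_image_mk]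
  simp [hp k]

theorem condLaw_mixLaw (hp : ∀ k, 0 < p k) (k : Fin K) : condLaw (mixLaw p P) k = P k := by
  ext s hs
  rw [condLaw, fst_preimage_eq, mixLaw_image_mk,
    measure_univ, mul_one, Measure.smul_apply, (measurableEmbedding_mk k).comap_apply,
    mixLaw_image_mk, smul_eq_mul, ← mul_assoc,
    ENNReal.inv_mul_cancel (by simpa using hp k) ENNReal.ofReal_ne_top, one_mul]

theorem ae_mixLaw {q : Data M d → Prop} (h : ∀ k, ∀ᵐ o ∂(P k), q ⟨k, o⟩) :
    ∀ᵐ z ∂(mixLaw p P), q z := by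
  rw [mixLaw, ae_finsetSum_measure_iff]
  intro k _
  exact Measure.ae_smul_measure ((measurableEmbedding_mk k).ae_map_iff.2 (h k)) _

section Integrals

variable {E : Type*} [NormedAddCommGroup E] [NormedSpace ℝ E]

theorem integrable_mixLaw {G : Data M d → E} (h : ∀ k, Integrable (fun o => G ⟨k, o⟩) (P k)) :
    Integrable G (mixLaw p P) := by
  rw [mixLaw, integrable_finsetSum_measure]
  intro k _
  exact (((measurableEmbedding_mk k).integrable_map_iff).2 (h k)).smul_measure
    ENNReal.ofReal_ne_top

theorem memLp_mixLaw {G : Data M d → E} (hG : ∀ k, MemLp (fun o => G ⟨k, o⟩) 2 (P k)) :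
    MemLp G 2 (mixLaw p P) := by
  have hm : ∀ k ∈ Finset.univ, AEStronglyMeasurable G
      (ENNReal.ofReal (p k) • (P k).map (Sigma.mk k)) := fun k _ =>
    (((measurableEmbedding_mk k).aestronglyMeasurable_map_iff).2 (hG k).1).smul_measure _
  have hm' : AEStronglyMeasurable G (mixLaw p P) := by
    rw [mixLaw, ← Measure.sum_coe_finset]
    exact aestronglyMeasurable_sum_measure_iff.2 fun k => hm k k.2
  rw [← memLp_norm_iff hm', memLp_two_iff_integrable_sq hm'.norm]
  refine integrable_mixLaw fun k => ?_
  exact (memLp_two_iff_integrable_sq (hG k).1.norm).1 (hG k).norm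

theorem integral_mixLaw (hp : ∀ k, 0 ≤ p k) {G : Data M d → E}
    (h : ∀ k, Integrable (fun o => G ⟨k, o⟩) (P k)) :
    ∫ z, G z ∂(mixLaw p P) = ∑ k, p k • ∫ o, G ⟨k, o⟩ ∂(P k) := by
  rw [mixLaw, integral_finsetSum_measure]
  · refine Finset.sum_congr rfl fun k _ => ?_
    rw [integral_smul_measure, (measurableEmbedding_mk k).integral_map,
      ENNReal.toReal_ofReal (hp k)]
  · intro k _
    exact (((measurableEmbedding_mk k).integrable_map_iff).2 (h k)).smul_measure
      ENNReal.ofReal_ne_top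

theorem integrable_onTypeV {k : Fin K} {f : Obs (M k) (d k) → E} (hf : Integrable f (P k)) :
    Integrable (onTypeV k f) (mixLaw p P) := by
  refine integrable_mixLaw fun j => ?_
  by_cases h : j = k
  · subst h; simpa using hf
  · simp_rw [onTypeV_mk_ne k f h]; exact integrable_zero _ _ _

theorem memLp_onTypeV {k : Fin K} {f : Obs (M k) (d k) → E} (hf : MemLp f 2 (P k)) :
    MemLp (onTypeV k f) 2 (mixLaw p P) := by
  refine memLp_mixLaw fun j => ?_
  by_cases h : j = k
  · subst h; simpa using hf
  · simp_rw [onTypeV_mk_ne k f h]; exact MemLp.zero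

theorem integral_onTypeV (hp : ∀ k, 0 ≤ p k) {k : Fin K} {f : Obs (M k) (d k) → E}
    (hf : Integrable f (P k)) :
    ∫ z, onTypeV k f z ∂(mixLaw p P) = p k • ∫ o, f o ∂(P k) := by
  rw [integral_mixLaw hp, Finset.sum_eq_single k]
  · simp
  · intro j _ hj
    simp_rw [onTypeV_mk_ne k f hj]; simp
  · simp
  · intro j
    by_cases h : j = k
    · subst h; simpa using hf
    · simp_rw [onTypeV_mk_ne k f h]; exact integrable_zero _ _ _

end Integrals

end Mixture

/-! ### The propensity score estimator -/

section PSEstimator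

/-- Treatments form a countable discrete space, so each treatment may be considered separately. -/
theorem measurable_treat {m d : ℕ} {γ : Type*} [MeasurableSpace γ] {f : Treat m → Covar m d → γ}
    (h : ∀ a, Measurable (f a)) : Measurable fun o : Obs m d => f o.2.1 o.2.2 := by
  have : Measurable fun q : Treat m × Covar m d => f q.1 q.2 :=
    measurable_from_prod_countable_right h
  exact this.comp measurable_snd

/-- Identifies the iterated partial derivatives with the entries of `psHess`. Positive precision is
an open condition, so the first derivative is known on a neighbourhood before the second is taken.
-/
theorem psInformation_apply {m d : ℕ} (P : Measure (Obs m d)) {ν : PSParam d}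
    (hν : 0 < ν.precision) (i i' : (Unit ⊕ Fin d ⊕ Fin d) ⊕ Unit) :
    psInformation P ν i i' =
      -∫ o, psHess o.2.1 o.2.2 ν (Pi.single i 1) (Pi.single i' 1) ∂P := by
  simp only [psInformation, Matrix.of_apply]
  congr 1
  refine integral_congr_ae (Eventually.of_forall fun o => ?_)
  have hopen : ∀ᶠ ν' : PSParam d in 𝓝 ν, 0 < ν'.precision :=
    (precisionCLM d).continuous.continuousAt.eventually (lt_mem_nhds hν)
  have h1 : (partialDeriv i' fun ν' => Real.log (psModel o.2.1 o.2.2 ν')) =ᶠ[𝓝 ν]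
      fun ν' => psGrad o.2.1 o.2.2 ν' (Pi.single i' 1) := by
    filter_upwards [hopen] with ν' hν'
    rw [partialDeriv, (hasFDerivAt_log_psModel o.2.1 o.2.2 hν').fderiv]
  have h2 : HasFDerivAt (fun ν' => psGrad o.2.1 o.2.2 ν' (Pi.single i' 1))
      ((psHess o.2.1 o.2.2 ν).flip (Pi.single i' 1)) ν :=
    (ContinuousLinearMap.apply ℝ ℝ (Pi.single i' 1 : PSParam d)).hasFDerivAt.comp ν
      (hasFDerivAt_psGrad o.2.1 o.2.2 hν)
  simp only [partialDeriv] at h1 ⊢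
  rw [h1.fderiv_eq, h2.fderiv]
  rfl

end PSEstimator

end

/-! ### Asymptotic linearity of the propensity score estimator -/

section

section PSEstimator

section Moments

variable {m d : ℕ} {P : Measure (Obs m d)} [IsProbabilityMeasure P]

theorem measurable_covarNorm_obs : Measurable fun o : Obs m d => covarNorm o.2.2 :=
  measurable_covarNorm.comp measurable_snd.snd

theorem integrable_one_add_covarNorm_pow
    (h : Integrable (fun o : Obs m d => covarNorm o.2.2 ^ 3) P) {q : ℕ} (hq : q ≤ 3) :
    Integrable (fun o : Obs m d => (1 + covarNorm o.2.2) ^ q) P := by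
  refine Integrable.mono' (((integrable_const (1 : ℝ)).add h).const_mul 4)
    ((measurable_const.add measurable_covarNorm_obs).pow_const q).aestronglyMeasurable
    (Eventually.of_forall fun o => ?_)
  have h0 := covarNorm_nonneg o.2.2
  rw [Real.norm_of_nonneg (by positivity)]
  refine (pow_le_pow_right₀ (by linarith) hq).trans ?_
  simp only [Pi.add_apply]
  nlinarith [mul_nonneg (add_nonneg h0 zero_le_one) (sq_nonneg (covarNorm o.2.2 - 1))]

theorem memLp_one_add_covarNorm
    (h : Integrable (fun o : Obs m d => covarNorm o.2.2 ^ 3) P) :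
    MemLp (fun o : Obs m d => 1 + covarNorm o.2.2) 2 P :=
  (memLp_two_iff_integrable_sq
    (measurable_const.add measurable_covarNorm_obs).aestronglyMeasurable).2
    (integrable_one_add_covarNorm_pow h (by norm_num))

theorem measurable_log_psModel (ν : PSParam d) :
    Measurable fun o : Obs m d => Real.log (psModel o.2.1 o.2.2 ν) :=
  measurable_treat (f := fun a x => Real.log (psModel a x ν)) fun a =>
    ((measurable_psModel a).comp (measurable_id.prodMk measurable_const)).log

theorem integrable_log_psModel (h : Integrable (fun o : Obs m d => covarNorm o.2.2 ^ 3) P)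
    (ν : PSParam d) : Integrable (fun o : Obs m d => Real.log (psModel o.2.1 o.2.2 ν)) P := by
  obtain ⟨C, -, hC⟩ := abs_log_psModel_le (m := m) ν
  have := (integrable_one_add_covarNorm_pow h (q := 1) (by norm_num)).const_mul C
  exact this.mono' (measurable_log_psModel ν).aestronglyMeasurable
    (Eventually.of_forall fun o => by simpa using hC o.2.1 o.2.2)

theorem measurable_psGrad {ν : PSParam d} (hν : 0 < ν.precision) :
    Measurable fun o : Obs m d => psGrad o.2.1 o.2.2 ν :=
  measurable_treat (f := fun a x => psGrad a x ν) fun a =>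
    ((continuous_psGrad a).comp (continuous_id.prodMk
      (continuous_const (y := (⟨ν, hν⟩ : {ν : PSParam d // 0 < ν.precision}))))).measurable

theorem measurable_psHess {ν : PSParam d} (hν : 0 < ν.precision) :
    Measurable fun o : Obs m d => psHess o.2.1 o.2.2 ν :=
  measurable_treat (f := fun a x => psHess a x ν) fun a =>
    ((continuous_psHess a).comp (continuous_id.prodMk
      (continuous_const (y := (⟨ν, hν⟩ : {ν : PSParam d // 0 < ν.precision}))))).measurable

theorem continuousOn_of_continuous_prod_subtype {X T Y : Type*} [TopologicalSpace X]
    [TopologicalSpace T] [TopologicalSpace Y] {q : T → Prop} {f : X → T → Y}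
    (h : Continuous fun p : X × {t // q t} => f p.1 p.2.1) (x : X) :
    ContinuousOn (f x) {t | q t} :=
  continuousOn_iff_continuous_domRestrict.2
    (h.comp (continuous_const.prodMk continuous_id : Continuous fun t : {t // q t} => (x, t)))

theorem continuousOn_psHess (a : Treat m) (x : Covar m d) :
    ContinuousOn (psHess a x) {ν | 0 < ν.precision} :=
  continuousOn_of_continuous_prod_subtype (f := psHess a) (continuous_psHess a) x

theorem exists_precision_lower_bound {Θ : Set (PSParam d)} (hΘ : IsCompact Θ)
    (hpos : ∀ ν ∈ Θ, 0 < ν.precision) : ∃ lam₀ > 0, ∀ ν ∈ Θ, lam₀ ≤ ν.precision := by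
  rcases Θ.eq_empty_or_nonempty with rfl | hne
  · exact ⟨1, one_pos, by simp⟩
  obtain ⟨ν, hν, h⟩ := hΘ.exists_isMinOn hne (precisionCLM d).continuous.continuousOn
  exact ⟨ν.precision, hpos ν hν, fun ν' hν' => h hν'⟩

theorem integrable_clm_of_le {α V F : Type*} [MeasurableSpace α] {ρ : Measure α}
    [NormedAddCommGroup V] [NormedSpace ℝ V] [FiniteDimensional ℝ V]
    [NormedAddCommGroup F] [NormedSpace ℝ F] [FiniteDimensional ℝ F]
    {f : α → V →L[ℝ] F} (hf : Measurable f) {B : α → ℝ} (hB : Integrable B ρ)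
    (h : ∀ z, ‖f z‖ ≤ B z) : Integrable f ρ :=
  hB.mono' hf.aestronglyMeasurable (Eventually.of_forall h)

/-- Turns positive definiteness of the information matrix into negative definiteness of the mean
Hessian, the form required by `IsSample.mEstimator`. -/
theorem psInformation_quadForm {ν : PSParam d} (hν : 0 < ν.precision)
    {B : Obs m d → ℝ} (hB : Integrable B P) (hH : ∀ o, ‖psHess o.2.1 o.2.2 ν‖ ≤ B o)
    (v : PSParam d) :
    dotProduct v ((psInformation P ν).mulVec v) = -(∫ o, psHess o.2.1 o.2.2 ν ∂P) v v := by
  have h := integrable_clm_of_le (F := PSParam d →L[ℝ] ℝ)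
    (measurable_psHess (m := m) hν) hB hH
  have key : ∀ i i', (∫ o, psHess o.2.1 o.2.2 ν ∂P) (Pi.single i 1) (Pi.single i' 1) =
      -psInformation P ν i i' := fun i i' => by
    rw [psInformation_apply P hν, neg_neg, ContinuousLinearMap.integral_apply h,
      ContinuousLinearMap.integral_apply (h.apply_continuousLinearMap _)]
  set H := ∫ o, psHess o.2.1 o.2.2 ν ∂P
  have hv : v = ∑ i, v i • (Pi.single i 1 : PSParam d) := by
    ext i; simp [Finset.sum_apply, Pi.single_apply]
  have hH : H v v = ∑ i, ∑ i', v i * (v i' * H (Pi.single i 1) (Pi.single i' 1)) := by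
    conv_lhs => rw [hv]
    simp only [map_sum, map_smul, sum_apply, smul_apply, smul_eq_mul, Finset.mul_sum]
    exact Finset.sum_comm.trans (Finset.sum_congr rfl fun i _ =>
      Finset.sum_congr rfl fun i' _ => by ring)
  rw [hH, ← Finset.sum_neg_distrib]
  simp only [dotProduct, Matrix.mulVec]
  refine Finset.sum_congr rfl fun i _ => ?_
  rw [Finset.mul_sum, ← Finset.sum_neg_distrib]
  refine Finset.sum_congr rfl fun i' _ => ?_
  rw [key]; ring

end Moments

variable {K : ℕ} {M d : Fin K → ℕ} {Ω : Type*} [MeasurableSpace Ω] {μ : Measure Ω}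
  [IsProbabilityMeasure μ] {Z : ℕ → Ω → Data M d} {p : Fin K → ℝ}
  {P : ∀ k, Measure (Obs (M k) (d k))} [∀ k, IsProbabilityMeasure (P k)]

theorem norm_onTypeV_le {E : Type*} [NormedAddCommGroup E] {k : Fin K}
    {f : Obs (M k) (d k) → E} {g : Obs (M k) (d k) → ℝ} (h : ∀ o, ‖f o‖ ≤ g o) (z : Data M d) :
    ‖onTypeV k f z‖ ≤ onTypeV k g z := by
  refine onTypeV_cases (k := k) (p := fun z => ‖onTypeV k f z‖ ≤ onTypeV k g z) z
    (fun o => by simpa using h o) fun j o hj => ?_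
  simp [onTypeV_mk_ne _ _ hj]

theorem avg_onType (k : Fin K) (f : Obs (M k) (d k) → ℝ) (N : ℕ) (ω : Ω) :
    avg Z (onType k f) N ω = (N : ℝ)⁻¹ * ∑ i ∈ Finset.range N, onType k f (Z i ω) := by
  simp [avg]

set_option maxHeartbeats 1000000 in
/-- The maximum likelihood estimator of the propensity model is asymptotically linear. -/
theorem psEst_isAsympLinear (hp : ∀ k, 0 < p k) (hs : IsSample μ (mixLaw p P) Z) (k : Fin K)
    {Θ : Set (PSParam (d k))} (hΘ : IsCompact Θ) (hpos : ∀ ν ∈ Θ, 0 < ν.precision)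
    {ν₀ : PSParam (d k)} (hν₀ : ν₀ ∈ interior Θ) (hmax : IsPopulationMaximizer (P k) Θ ν₀)
    (h3 : Integrable (fun o => covarNorm o.2.2 ^ 3) (P k))
    (hinfo : (psInformation (P k) ν₀).PosDef) {est : ℕ → Ω → PSParam (d k)}
    (hest : IsMaximizerEventually μ Θ (psSampleLogLik Z k) est) :
    ∃ κ, IsAsympLinear μ (mixLaw p P) Z est ν₀ κ := by
  obtain ⟨lam₀, hlam₀, hlam⟩ := exists_precision_lower_bound hΘ hpos
  obtain ⟨C, hC, hbd⟩ := psGrad_psHess_bounds (M k) (d k) hlam₀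
  obtain ⟨r, hr, hball⟩ := Metric.mem_nhds_iff.1 (mem_interior_iff_mem_nhds.1 hν₀)
  have hν₀Θ := interior_subset hν₀
  have hp0 : ∀ k, 0 ≤ p k := fun k => (hp k).le
  set l : Data M d → PSParam (d k) → ℝ := fun z ν =>
    onTypeV k (fun o => Real.log (psModel o.2.1 o.2.2 ν)) z with hl
  set B : Data M d → ℝ := onTypeV k fun o => C * (1 + covarNorm o.2.2) with hB
  set B₂ : Data M d → ℝ := onTypeV k fun o => C * (1 + covarNorm o.2.2) ^ 2 with hB₂
  have hBm : Measurable B :=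
    measurable_onTypeV ((measurable_const.add measurable_covarNorm_obs).const_mul C)
  have hB2 : MemLp B 2 (mixLaw p P) :=
    memLp_onTypeV ((memLp_one_add_covarNorm h3).const_mul C)
  have hBi : Integrable B (mixLaw p P) := by
    have := hs.isProbabilityMeasure
    exact hB2.integrable (by norm_num)
  have hB₂i : Integrable B₂ (mixLaw p P) :=
    integrable_onTypeV ((integrable_one_add_covarNorm_pow h3 (by norm_num)).const_mul C)
  have hmeas : ∀ ν, Measurable fun z => l z ν := fun ν =>
    measurable_onTypeV (measurable_log_psModel ν)
  have hint : ∀ ν, Integrable (fun z => l z ν) (mixLaw p P) := fun ν =>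
    integrable_onTypeV (integrable_log_psModel h3 ν)
  -- Over the whole sample the criterion is the one of type `k` multiplied by `p k`, so the
  -- maximizer is unchanged.
  have hlmax : ∀ ν ∈ Θ, ν ≠ ν₀ → ∫ z, l z ν ∂(mixLaw p P) < ∫ z, l z ν₀ ∂(mixLaw p P) := by
    intro ν hν hne
    simp only [hl]
    rw [integral_onTypeV hp0 (integrable_log_psModel h3 ν),
      integral_onTypeV hp0 (integrable_log_psModel h3 ν₀), smul_eq_mul, smul_eq_mul]
    exact mul_lt_mul_of_pos_left (hmax.2 ν hν hne) (hp k)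
  have hest' : HighProb μ fun N ω => est N ω ∈ Θ ∧ ∀ ν ∈ Θ,
      avg Z (fun z => l z ν) N ω ≤ avg Z (fun z => l z (est N ω)) N ω := by
    refine HighProb.imp (p := fun N ω => est N ω ∈ Θ ∧ ∀ θ ∈ Θ,
      psSampleLogLik Z k N ω θ ≤ psSampleLogLik Z k N ω (est N ω)) hest fun N ω h =>
        ⟨h.1, fun ν hν => ?_⟩
    exact (mul_le_mul_of_nonneg_left (h.2 ν hν) (by positivity : (0 : ℝ) ≤ (N : ℝ)⁻¹))
  have hderiv : ∀ z (ν : PSParam (d k)), 0 < ν.precision →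
      HasFDerivAt (l z) (onTypeV k (fun o => psGrad o.2.1 o.2.2 ν) z) ν := fun z ν hν => by
    refine onTypeV_cases (k := k) (p := fun z => HasFDerivAt (l z)
      (onTypeV k (fun o => psGrad o.2.1 o.2.2 ν) z) ν) z (fun o => ?_) fun j o h => ?_
    · simpa [hl] using hasFDerivAt_log_psModel o.2.1 o.2.2 hν
    · simp only [hl, onTypeV_mk_ne _ _ h]
      exact hasFDerivAt_const _ _
  have hgradB : ∀ z (ν : PSParam (d k)), lam₀ ≤ ν.precision →
      ‖onTypeV k (fun o => psGrad o.2.1 o.2.2 ν) z‖ ≤ B z := fun z ν hν => by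
    refine onTypeV_cases (k := k) (p := fun z =>
      ‖onTypeV k (fun o => psGrad o.2.1 o.2.2 ν) z‖ ≤ B z) z (fun o => ?_) fun j o h => ?_
    · simpa [hB] using (hbd o.2.1 o.2.2 ν hν).1
    · simp [hB, onTypeV_mk_ne _ _ h]
  have hB0 : ∀ z, 0 ≤ B z := fun z =>
    (norm_nonneg _).trans (hgradB z ν₀ (hlam ν₀ hν₀Θ))
  -- Segments between points of `Θ` may leave `Θ`. This half space contains `Θ`, is convex, and the
  -- gradient bound holds on it.
  have hconv : Convex ℝ {ν : PSParam (d k) | lam₀ ≤ ν.precision} :=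
    convex_halfSpace_ge (precisionCLM (d k)).isLinear lam₀
  have hLip : ∀ z, ∀ ν ∈ Θ, ∀ ν' ∈ Θ, |l z ν - l z ν'| ≤ B z * ‖ν - ν'‖ :=
    fun z ν hν ν' hν' => hconv.norm_image_sub_le_of_norm_hasFDerivWithin_le
      (fun x hx => (hderiv z x (hlam₀.trans_le hx)).hasFDerivWithinAt)
      (fun x hx => hgradB z x hx) (hlam ν' hν') (hlam ν hν)
  have hcons := hs.consistent hΘ hBm hBi hB0 hLip (fun ν _ => hmeas ν) (fun ν _ => hint ν) hν₀Θ
    hlmax hest'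
  have hbpos : ∀ ν ∈ Metric.ball ν₀ r, lam₀ ≤ ν.precision := fun ν hν => hlam ν (hball hν)
  have hbpos' : ∀ ν ∈ Metric.ball ν₀ r, 0 < ν.precision := fun ν hν => hpos ν (hball hν)
  have hHb : ∀ o : Obs (M k) (d k), ‖psHess o.2.1 o.2.2 ν₀‖ ≤ C * (1 + covarNorm o.2.2) ^ 2 :=
    fun o => (hbd o.2.1 o.2.2 ν₀ (hlam ν₀ hν₀Θ)).2
  have hBi2 : Integrable (fun o : Obs (M k) (d k) => C * (1 + covarNorm o.2.2) ^ 2) (P k) :=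
    (integrable_one_add_covarNorm_pow h3 (by norm_num)).const_mul C
  have hHi := integrable_clm_of_le (F := PSParam (d k) →L[ℝ] ℝ)
    (measurable_psHess (m := M k) (hpos ν₀ hν₀Θ)) hBi2 hHb
  refine hs.mEstimator (ContinuousLinearEquiv.refl ℝ _) hr hball (fun ν _ => hmeas ν)
    (fun ν _ => hint ν) hlmax
    (s := fun z ν => onTypeV k (fun o => psGrad o.2.1 o.2.2 ν) z)
    (h := fun z ν => onTypeV k (fun o => psHess o.2.1 o.2.2 ν) z)
    (fun z ν hν => hderiv z ν (hbpos' ν hν)) ?_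
    (measurable_onTypeV (measurable_psGrad (hpos ν₀ hν₀Θ)))
    (fun ν hν => measurable_onTypeV (measurable_psHess (hbpos' ν hν))) ?_ hB2
    (fun z ν hν => hgradB z ν (hbpos ν hν)) hB₂i ?_ ?_ hcons hest'
  · intro z ν hν
    refine onTypeV_cases (k := k) (p := fun z => HasFDerivAt
      (fun ν => onTypeV k (fun o => psGrad o.2.1 o.2.2 ν) z)
      (onTypeV k (fun o => psHess o.2.1 o.2.2 ν) z) ν) z (fun o => ?_) fun j o h => ?_
    · simpa using hasFDerivAt_psGrad o.2.1 o.2.2 (hbpos' ν hν)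
    · simp only [onTypeV_mk_ne _ _ h]
      exact hasFDerivAt_const _ _
  · intro z
    refine onTypeV_cases (k := k) (p := fun z => ContinuousOn
      (fun ν => onTypeV k (fun o => psHess o.2.1 o.2.2 ν) z) (Metric.ball ν₀ r)) z
      (fun o => ?_) fun j o h => ?_
    · simp only [onTypeV_mk_self]
      exact (continuousOn_psHess o.2.1 o.2.2).mono hbpos'
    · simp only [onTypeV_mk_ne _ _ h]
      exact continuousOn_const
  · intro z ν hν
    exact norm_onTypeV_le (E := PSParam (d k) →L[ℝ] PSParam (d k) →L[ℝ] ℝ)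
      (fun o => (hbd o.2.1 o.2.2 ν (hbpos ν hν)).2) z
  · intro v hv
    rw [integral_onTypeV hp0 hHi]
    have := psInformation_quadForm (hpos ν₀ hν₀Θ) hBi2 hHb v
    have h2 := hinfo.dotProduct_mulVec_pos hv
    rw [star_trivial, this] at h2
    change p k * _ < 0
    exact mul_neg_of_pos_of_neg (hp k) (neg_pos.1 h2)

end PSEstimator

end

/-! ### Linear estimating equations -/

section

section LinearEquation

variable {𝒵 Ω E : Type*} [MeasurableSpace 𝒵] [MeasurableSpace Ω] {μ : Measure Ω}
  [IsProbabilityMeasure μ] {P : Measure 𝒵} {Z : ℕ → Ω → 𝒵}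
  [NormedAddCommGroup E] [NormedSpace ℝ E] [FiniteDimensional ℝ E] [MeasurableSpace E]
  [BorelSpace E]

/-- Since `avg A` applied to the estimator equals `avg b`, the deviation is `-L (avg A - E A)`
applied to `est - β`: small relative to the error itself, with integrability of `A` alone. -/
theorem IsSample.linearEquation_relative (hs : IsSample μ P Z) {A : 𝒵 → E →L[ℝ] E} {b : 𝒵 → E}
    (hA : Measurable A) (hAi : Integrable A P) {L : E →L[ℝ] E}
    (hL : ∀ v, L ((∫ z, A z ∂P) v) = v) {est : ℕ → Ω → E} {β : E}
    (hest : HighProb μ fun N ω => avg Z (fun z => b z - A z (est N ω)) N ω = 0)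
    {ε : ℝ} (hε : 0 < ε) :
    HighProb μ fun N ω =>
      ‖est N ω - β - avg Z (fun z => L (b z - A z β)) N ω‖ ≤ ε * ‖est N ω - β‖ := by
  have hsm := hs.lln hA hAi (ε / (‖L‖ + 1)) (by positivity)
  refine (hsm.and hest).imp fun N ω ⟨h1, h2⟩ => ?_
  have e1 : ∀ v, avg Z (fun z => A z v) N ω = avg Z A N ω v := fun v =>
    avg_clm (ContinuousLinearMap.apply ℝ E v) A
  rw [avg_sub, e1] at h2
  rw [avg_clm, avg_sub, e1, sub_eq_zero.1 h2]
  have e2 : est N ω - β - L (avg Z A N ω (est N ω) - avg Z A N ω β) =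
      -L ((avg Z A N ω - ∫ z, A z ∂P) (est N ω - β)) := by
    rw [sub_apply, map_sub L (avg Z A N ω (est N ω - β)), hL, map_sub (avg Z A N ω), map_sub L]
    abel
  rw [e2, norm_neg]
  refine (L.le_opNorm _).trans ?_
  refine (mul_le_mul_of_nonneg_left (ContinuousLinearMap.le_opNorm _ _) (norm_nonneg _)).trans ?_
  rw [← mul_assoc]
  refine mul_le_mul_of_nonneg_right ?_ (norm_nonneg _)
  refine (mul_le_mul_of_nonneg_left (le_of_lt h1) (norm_nonneg _)).trans ?_
  rw [mul_div_assoc', div_le_iff₀ (by positivity)]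
  nlinarith [norm_nonneg L]

/-- Works with first moments only. This matters when the outcome model is wrong, where residual
times covariate need not be square integrable. -/
theorem IsSample.linearEquation_consistent (hs : IsSample μ P Z) {A : 𝒵 → E →L[ℝ] E} {b : 𝒵 → E}
    (hA : Measurable A) (hAi : Integrable A P) (hb : Measurable b) (hbi : Integrable b P)
    {L : E →L[ℝ] E} (hL : ∀ v, L ((∫ z, A z ∂P) v) = v) {est : ℕ → Ω → E} {β : E}
    (h0 : ∫ z, b z - A z β ∂P = 0)
    (hest : HighProb μ fun N ω => avg Z (fun z => b z - A z (est N ω)) N ω = 0) :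
    SmallInProb μ fun N ω => est N ω - β := by
  have hAβ : Measurable fun z => A z β := hA.apply_continuousLinearMap β
  have hm : Measurable fun z => L (b z - A z β) := L.continuous.measurable.comp (hb.sub hAβ)
  have hi : Integrable (fun z => b z - A z β) P := hbi.sub (hAi.apply_continuousLinearMap β)
  have h := hs.lln hm (L.integrable_comp hi)
  rw [L.integral_comp_comm hi, h0, map_zero] at h
  intro δ hδ
  refine ((h (δ / 2) (by positivity)).and (hs.linearEquation_relative hA hAi hL (β := β) hest
    (ε := 1 / 2) (by norm_num))).imp fun N ω ⟨h1, h2⟩ => ?_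
  simp only [sub_zero] at h1 ⊢
  have := norm_sub_norm_le (est N ω - β) (avg Z (fun z => L (b z - A z β)) N ω)
  linarith

theorem IsSample.linearEquation_isAsympLinear (hs : IsSample μ P Z) {A : 𝒵 → E →L[ℝ] E}
    {b : 𝒵 → E} (hA : Measurable A) (hAi : Integrable A P) (hb : Measurable b)
    {L : E →L[ℝ] E} (hL : ∀ v, L ((∫ z, A z ∂P) v) = v) {est : ℕ → Ω → E} {β : E}
    (h2 : MemLp (fun z => b z - A z β) 2 P) (h0 : ∫ z, b z - A z β ∂P = 0)
    (hest : HighProb μ fun N ω => avg Z (fun z => b z - A z (est N ω)) N ω = 0) :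
    IsAsympLinear μ P Z est β fun z => L (b z - A z β) := by
  have := hs.isProbabilityMeasure
  have hAβ : Measurable fun z => A z β := hA.apply_continuousLinearMap β
  refine hs.isAsympLinear_of_relative (L.continuous.measurable.comp (hb.sub hAβ))
    (L.comp_memLp' h2) ?_ fun ε hε => hs.linearEquation_relative hA hAi hL hest hε
  rw [L.integral_comp_comm (h2.integrable (by norm_num)), h0, map_zero]

end LinearEquation

/-! ### Normal equations of the outcome model -/

section NormalEquations

variable {m d : ℕ}

/-- Sherman–Morrison formula for a rank one perturbation of a multiple of the identity. -/
theorem orCov_inv {η ρ : ℝ} (hη : 0 < η) (hρ : 0 ≤ ρ) :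
    (orCov m η ρ)⁻¹ = η • (1 : Matrix (Fin m) (Fin m) ℝ)
      - (ρ * η ^ 2 / (1 + m * η * ρ)) • Matrix.of fun _ _ => 1 := by
  have hpos : 0 < 1 + m * η * ρ := by positivity
  apply Matrix.inv_eq_right_inv
  have hJ : (Matrix.of fun _ _ => 1 : Matrix (Fin m) (Fin m) ℝ) * Matrix.of (fun _ _ => 1) =
      (m : ℝ) • Matrix.of fun _ _ => 1 := by
    ext i j; simp [Matrix.mul_apply]
  rw [orCov]
  simp only [add_mul, mul_sub, smul_mul_assoc, mul_smul_comm, one_mul, mul_one, hJ]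
  ext i j
  simp only [Matrix.add_apply, Matrix.sub_apply, Matrix.smul_apply, Matrix.of_apply, smul_eq_mul]
  field_simp
  ring

theorem dotProduct_orCov_inv {η ρ : ℝ} (hη : 0 < η) (hρ : 0 ≤ ρ) (u r : Fin m → ℝ) :
    dotProduct u ((orCov m η ρ)⁻¹.mulVec r) =
      η * ∑ j, u j * r j - ρ * η ^ 2 / (1 + m * η * ρ) * ((∑ j, u j) * ∑ j, r j) := by
  rw [orCov_inv hη hρ, Matrix.sub_mulVec, Matrix.smul_mulVec, Matrix.smul_mulVec,
    Matrix.one_mulVec, dotProduct_sub, dotProduct_smul, dotProduct_smul, smul_eq_mul, smul_eq_mul]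
  congr 2
  simp only [dotProduct, Matrix.mulVec, Matrix.of_apply, one_mul, Finset.sum_mul]

/-- The score of the least squares criterion of the outcome model. -/
def orScore (o : Obs m d) (β : ORCoef d) (i : Fin 3 ⊕ Fin d ⊕ Fin d) : ℝ :=
  ∑ j, orRegressor o.2.1 o.2.2 j i * orResid o β j

theorem orModel_add_smul (a : Treat m) (x : Covar m d) (β h : ORCoef d) (t : ℝ) (j : Fin m) :
    orModel a x (β + t • h) j = orModel a x β j + t * orModel a x h j := by
  simp only [orModel, Pi.add_apply, Pi.smul_apply, smul_eq_mul, mul_add, Finset.sum_add_distrib,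
    Finset.mul_sum]
  congr 1
  exact Finset.sum_congr rfl fun i _ => by ring

theorem orModel_single (a : Treat m) (x : Covar m d) (i : Fin 3 ⊕ Fin d ⊕ Fin d) (j : Fin m) :
    orModel a x (Pi.single i 1) j = orRegressor a x j i := by
  simp [orModel, Pi.single_apply]

/-- Directional derivative of the log-likelihood of the outcome model. -/
def orDirScore (o : Obs m d) (γ : ORParam d) (h : ORCoef d) : ℝ :=
  dotProduct (orModel o.2.1 o.2.2 h)
    ((orCov m γ.2.1 γ.2.2)⁻¹.mulVec (orResid o γ.1))

/-- With the variance components fixed, the log-likelihood is exactly quadratic along lines in the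
coefficients, so the first order condition needs no differentiation. -/
theorem orLogLik_add_smul (o : Obs m d) {γ : ORParam d} (hγ : γ ∈ orSpace d) (h : ORCoef d)
    (t : ℝ) : orLogLik o (γ.1 + t • h, γ.2) = orLogLik o γ + t * orDirScore o γ h
      - t ^ 2 * (1 / 2 * dotProduct (orModel o.2.1 o.2.2 h)
        ((orCov m γ.2.1 γ.2.2)⁻¹.mulVec (orModel o.2.1 o.2.2 h))) := by
  have hr : orResid o (γ.1 + t • h) = orResid o γ.1 - t • orModel o.2.1 o.2.2 h := by
    ext j
    simp only [orResid, orModel_add_smul, Pi.sub_apply, Pi.smul_apply, smul_eq_mul]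
    ring
  have hsymm : dotProduct (orResid o γ.1)
      ((orCov m γ.2.1 γ.2.2)⁻¹.mulVec (orModel o.2.1 o.2.2 h)) = orDirScore o γ h := by
    rw [orDirScore, dotProduct_orCov_inv hγ.1 hγ.2, dotProduct_orCov_inv hγ.1 hγ.2]
    simp only [mul_comm]
  simp only [orLogLik, hr, Matrix.mulVec_sub, Matrix.mulVec_smul, dotProduct_sub,
    sub_dotProduct, dotProduct_smul, smul_dotProduct, smul_eq_mul, hsymm]
  rw [orDirScore]
  ring

theorem eq_zero_of_forall_mul_le_sq {l q : ℝ} (h : ∀ t : ℝ, t * l ≤ t ^ 2 * q) : l = 0 := by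
  by_contra hl
  have hq : 0 < |q| + 1 := by positivity
  -- At this `t` the linear term is at least twice the quadratic one, unless `l = 0`.
  have h1 := h (l / (2 * (|q| + 1)))
  have h2 : l / (2 * (|q| + 1)) * l = 2 * (l / (2 * (|q| + 1))) ^ 2 * (|q| + 1) := by
    field_simp
  have h3 : 0 < (l / (2 * (|q| + 1))) ^ 2 := by positivity
  nlinarith [le_abs_self q, abs_nonneg q]

theorem sum_add_sum_erase (f : Fin m → ℝ) (j : Fin m) :
    f j + ∑ l ∈ Finset.univ.erase j, f l = ∑ l, f l :=
  Finset.add_sum_erase _ _ (Finset.mem_univ j)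

/-- Weighted normal equations for exchangeable weights imply the unweighted ones for a regressor
`f` and its companion `∑_{l ≠ j} f_l`. -/
theorem normal_equations_pair {n : Type*} {s : Finset n} {η c : ℝ} (hη : η ≠ 0)
    (hc : η - c * m ≠ 0) (f r : n → Fin m → ℝ)
    (h₁ : ∑ i ∈ s, (η * ∑ j, f i j * r i j - c * ((∑ j, f i j) * ∑ j, r i j)) = 0)
    (h₂ : ∑ i ∈ s, (η * ∑ j, (∑ l ∈ Finset.univ.erase j, f i l) * r i j
      - c * ((∑ j, ∑ l ∈ Finset.univ.erase j, f i l) * ∑ j, r i j)) = 0) :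
    ∑ i ∈ s, ∑ j, f i j * r i j = 0 ∧
      ∑ i ∈ s, ∑ j, (∑ l ∈ Finset.univ.erase j, f i l) * r i j = 0 := by
  have e : ∀ i j, ∑ l ∈ Finset.univ.erase j, f i l = ∑ l, f i l - f i j := fun i j => by
    rw [← sum_add_sum_erase (f i) j]; ring
  set V := ∑ i ∈ s, ∑ j, f i j * r i j with hV
  set G := ∑ i ∈ s, (∑ j, f i j) * ∑ j, r i j with hG
  have e1 : ∀ i, ∑ j, (∑ l ∈ Finset.univ.erase j, f i l) * r i j =
      (∑ j, f i j) * ∑ j, r i j - ∑ j, f i j * r i j := fun i => by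
    simp only [e, sub_mul, Finset.sum_sub_distrib, Finset.mul_sum]
  have e2 : ∀ i, ∑ j, ∑ l ∈ Finset.univ.erase j, f i l = (m - 1) * ∑ j, f i j := fun i => by
    simp only [e, Finset.sum_sub_distrib, Finset.sum_const, Finset.card_univ, Fintype.card_fin,
      nsmul_eq_mul]
    ring
  have e3 : η * V - c * G = 0 := by
    rw [← h₁, Finset.sum_sub_distrib, ← Finset.mul_sum, ← Finset.mul_sum]
  have e4 : η * (G - V) - c * ((m - 1) * G) = 0 := by
    rw [← h₂, Finset.sum_sub_distrib, ← Finset.mul_sum, ← Finset.mul_sum]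
    simp only [e1, e2, Finset.sum_sub_distrib, mul_assoc, ← Finset.mul_sum, hV, hG]
  -- The regressor and its companion add up to the cluster total in every unit, so adding the two
  -- equations eliminates `V` and leaves a multiple of `G`.
  have hG0 : G = 0 := by
    have : (η - c * m) * G = 0 := by linear_combination e3 + e4
    exact (mul_eq_zero.1 this).resolve_left hc
  have hV0 : V = 0 := by
    rw [hG0, mul_zero, sub_zero] at e3
    exact (mul_eq_zero.1 e3).resolve_left hη
  refine ⟨hV0, ?_⟩
  simp only [e1, Finset.sum_sub_distrib]
  rw [← hG, ← hV, hG0, hV0, sub_zero]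

/-- A maximizer of the log-likelihood of the outcome model solves the least squares normal
equations. -/
theorem sum_orScore_eq_zero {n : Type*} (s : Finset n) (o : n → Obs m d) {γ : ORParam d}
    (hγ : γ ∈ orSpace d)
    (hmax : ∀ γ' ∈ orSpace d, ∑ i ∈ s, orLogLik (o i) γ' ≤ ∑ i ∈ s, orLogLik (o i) γ)
    (i : Fin 3 ⊕ Fin d ⊕ Fin d) : ∑ n ∈ s, orScore (o n) γ.1 i = 0 := by
  obtain ⟨hη, hρ⟩ := hγ
  set η := γ.2.1
  set ρ := γ.2.2
  set c := ρ * η ^ 2 / (1 + m * η * ρ) with hc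
  have hpos : 0 < 1 + m * η * ρ := by positivity
  have hdir : ∀ i, ∑ n ∈ s, (η * ∑ j, orRegressor (o n).2.1 (o n).2.2 j i * orResid (o n) γ.1 j
      - c * ((∑ j, orRegressor (o n).2.1 (o n).2.2 j i) * ∑ j, orResid (o n) γ.1 j)) = 0 := by
    intro i
    have h0 : ∑ n ∈ s, orDirScore (o n) γ (Pi.single i 1) = 0 := by
      refine eq_zero_of_forall_mul_le_sq (q := ∑ n ∈ s, (1 / 2 * dotProduct
        (orModel (o n).2.1 (o n).2.2 (Pi.single i 1)) ((orCov m γ.2.1 γ.2.2)⁻¹.mulVec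
          (orModel (o n).2.1 (o n).2.2 (Pi.single i 1))))) fun t => ?_
      have h := hmax (γ.1 + t • Pi.single i 1, γ.2) ⟨hη, hρ⟩
      simp only [orLogLik_add_smul _ (show γ ∈ orSpace d from ⟨hη, hρ⟩), Finset.sum_sub_distrib,
        Finset.sum_add_distrib, ← Finset.mul_sum] at h
      simp only [← Finset.mul_sum]
      linarith
    rw [← h0]
    refine Finset.sum_congr rfl fun n _ => ((dotProduct_orCov_inv hη hρ _ _).trans ?_).symm
    simp only [orModel_single, hc]
  -- This is the eigenvalue of the inverse covariance at the vector of ones.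
  have hcm : η - c * m ≠ 0 := by
    have : η - c * m = η / (1 + m * η * ρ) := by
      rw [hc]; field_simp; ring
    rw [this]; positivity
  have pair₁ := normal_equations_pair hη.ne' hcm (s := s) (fun n j => trt ((o n).2.1 j))
    (fun n j => orResid (o n) γ.1 j) (by simpa [orRegressor] using hdir (Sum.inl 1))
    (by simpa [orRegressor] using hdir (Sum.inl 2))
  have pair₂ := fun r : Fin d => normal_equations_pair hη.ne' hcm (s := s)
    (fun n j => (o n).2.2 j r) (fun n j => orResid (o n) γ.1 j)
    (by simpa [orRegressor] using hdir (Sum.inr (Sum.inl r)))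
    (by simpa [orRegressor] using hdir (Sum.inr (Sum.inr r)))
  match i with
  | Sum.inl 0 =>
    -- The intercept needs no companion: the vector of ones is an eigenvector of the inverse
    -- covariance.
    have h := hdir (Sum.inl 0)
    simp only [orRegressor, Sum.elim_inl, Matrix.cons_val_zero, one_mul, Finset.sum_const,
      Finset.card_univ, Fintype.card_fin, nsmul_eq_mul, mul_one] at h
    simp only [← mul_assoc, ← sub_mul, ← Finset.mul_sum] at h
    simpa [orScore, orRegressor] using (mul_eq_zero.1 h).resolve_left hcm
  | Sum.inl 1 => simpa [orScore, orRegressor] using pair₁.1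
  | Sum.inl 2 => simpa [orScore, orRegressor] using pair₁.2
  | Sum.inr (Sum.inl r) => simpa [orScore, orRegressor] using (pair₂ r).1
  | Sum.inr (Sum.inr r) => simpa [orScore, orRegressor] using (pair₂ r).2

end NormalEquations

end

/-! ### Propensity score and outcome regression as conditional means -/

section

section Nuisance

variable {m d : ℕ}

theorem sigmaX_le (m d : ℕ) : sigmaX m d ≤ (inferInstance : MeasurableSpace (Obs m d)) :=
  (show Measurable (fun o : Obs m d => o.2.2) from measurable_snd.snd).comap_le

/-- The indicator `1(A = a)`. -/
def ind (a : Treat m) (o : Obs m d) : ℝ := if o.2.1 = a then 1 else 0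

theorem ind_nonneg (a : Treat m) (o : Obs m d) : 0 ≤ ind a o := by
  unfold ind; split_ifs <;> norm_num

theorem ind_le_one (a : Treat m) (o : Obs m d) : ind a o ≤ 1 := by
  unfold ind; split_ifs <;> norm_num

theorem abs_ind_le_one (a : Treat m) (o : Obs m d) : |ind a o| ≤ 1 := by
  rw [abs_of_nonneg (ind_nonneg a o)]; exact ind_le_one a o

theorem sum_ind_mul (f : Treat m → ℝ) (o : Obs m d) : ∑ a, ind a o * f a = f o.2.1 := by
  simp [ind]

theorem measurableSet_treat (a : Treat m) : MeasurableSet {o : Obs m d | o.2.1 = a} :=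
  measurable_snd.fst (MeasurableSet.singleton a)

theorem measurable_ind (a : Treat m) : Measurable (ind a : Obs m d → ℝ) :=
  Measurable.ite (measurableSet_treat a) measurable_const measurable_const

theorem indicator_eq_ind_mul (a : Treat m) (f : Obs m d → ℝ) :
    ({o : Obs m d | o.2.1 = a}.indicator fun o => f o) = fun o => ind a o * f o := by
  ext o
  by_cases h : o.2.1 = a <;> simp [ind, Set.indicator, h]

theorem stronglyMeasurable_covar {f : Covar m d → ℝ} (hf : Measurable f) :
    StronglyMeasurable[sigmaX m d] fun o : Obs m d => f o.2.2 := by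
  have h1 : Measurable[sigmaX m d] fun o : Obs m d => o.2.2 := comap_measurable _
  exact (hf.comp h1).stronglyMeasurable

theorem integrable_ind_mul {P : Measure (Obs m d)} {f : Obs m d → ℝ} (hf : Integrable f P)
    (a : Treat m) : Integrable (fun o => ind a o * f o) P :=
  hf.bdd_mul (measurable_ind a).aestronglyMeasurable
    (Eventually.of_forall fun o => abs_ind_le_one a o)

theorem memLp_ind_mul {P : Measure (Obs m d)} {f : Obs m d → ℝ} (hf : MemLp f 2 P)
    (a : Treat m) : MemLp (fun o => ind a o * f o) 2 P :=
  hf.of_le ((measurable_ind a).aestronglyMeasurable.mul hf.1) (Eventually.of_forall fun o => by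
    rw [norm_mul]
    exact mul_le_of_le_one_left (norm_nonneg _) (abs_ind_le_one a o))

variable {P : Measure (Obs m d)}

theorem propensity_eq (a : Treat m) : propensity P a = condExp (sigmaX m d) P (ind a) := by
  rw [propensity]
  congr 1
  ext o
  by_cases h : o.2.1 = a <;> simp [ind, Set.indicator, h]

theorem stronglyMeasurable_propensity (a : Treat m) :
    StronglyMeasurable[sigmaX m d] (propensity P a) := stronglyMeasurable_condExp

theorem stronglyMeasurable_outcomeReg (a : Treat m) (j : Fin m) :
    StronglyMeasurable[sigmaX m d] (outcomeReg P a j) :=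
  (stronglyMeasurable_condExp (m := sigmaX m d)).measurable.div
    (stronglyMeasurable_propensity a).measurable |>.stronglyMeasurable

theorem measurable_propensity (a : Treat m) : Measurable (propensity P a) :=
  ((stronglyMeasurable_propensity a).mono (sigmaX_le m d)).measurable

theorem measurable_outcomeReg (a : Treat m) (j : Fin m) : Measurable (outcomeReg P a j) :=
  ((stronglyMeasurable_outcomeReg a j).mono (sigmaX_le m d)).measurable

variable [IsProbabilityMeasure P]

theorem integrable_ind (a : Treat m) : Integrable (ind a : Obs m d → ℝ) P := by
  simpa using integrable_ind_mul (integrable_const (1 : ℝ)) a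

theorem propensity_nonneg (a : Treat m) : ∀ᵐ o ∂P, 0 ≤ propensity P a o := by
  rw [propensity_eq]
  exact condExp_nonneg (Eventually.of_forall (ind_nonneg a))

theorem propensity_le_one (a : Treat m) : ∀ᵐ o ∂P, propensity P a o ≤ 1 := by
  have h := condExp_mono (m := sigmaX m d) (integrable_ind (P := P) a) (integrable_const (1 : ℝ))
    (Eventually.of_forall (ind_le_one a))
  rw [propensity_eq]
  filter_upwards [h] with o ho
  rwa [condExp_const (sigmaX_le m d)] at ho

theorem condExp_ind_mul {a : Treat m} {h : Obs m d → ℝ} (hh : StronglyMeasurable[sigmaX m d] h)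
    (hi : Integrable (fun o => ind a o * h o) P) :
    condExp (sigmaX m d) P (fun o => ind a o * h o) =ᵐ[P] fun o => propensity P a o * h o := by
  rw [propensity_eq]
  exact condExp_mul_of_stronglyMeasurable_right hh hi (integrable_ind a)

theorem integral_ind_mul {a : Treat m} {h : Obs m d → ℝ} (hh : StronglyMeasurable[sigmaX m d] h)
    (hi : Integrable (fun o => ind a o * h o) P) :
    ∫ o, ind a o * h o ∂P = ∫ o, propensity P a o * h o ∂P := by
  rw [← integral_congr_ae (condExp_ind_mul hh hi), integral_condExp (sigmaX_le m d)]

/-- Overlap and second moments of the outcome. -/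
structure IsRegularLaw (P : Measure (Obs m d)) : Prop where
  overlap : ∃ c > 0, ∀ a, ∀ᵐ o ∂P, c < propensity P a o
  memLp : ∀ j, MemLp (fun o : Obs m d => o.1 j) 2 P

theorem IsRegularLaw.integrable (hP : IsRegularLaw P) (j : Fin m) :
    Integrable (fun o : Obs m d => o.1 j) P := (hP.memLp j).integrable (by norm_num)

theorem IsRegularLaw.propensity_pos (hP : IsRegularLaw P) (a : Treat m) :
    ∀ᵐ o ∂P, 0 < propensity P a o := by
  obtain ⟨c, hc, h⟩ := hP.overlap
  exact (h a).mono fun o ho => hc.trans ho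

theorem IsRegularLaw.propensity_mul_outcomeReg (hP : IsRegularLaw P) (a : Treat m) (j : Fin m) :
    (fun o => propensity P a o * outcomeReg P a j o) =ᵐ[P]
      condExp (sigmaX m d) P fun o => ind a o * o.1 j := by
  filter_upwards [hP.propensity_pos a] with o ho
  rw [outcomeReg, indicator_eq_ind_mul, mul_div_cancel₀ _ ho.ne']

/-- Conditional expectation contracts `L²`, and overlap bounds the division by the propensity score.
-/
theorem IsRegularLaw.memLp_outcomeReg (hP : IsRegularLaw P) (a : Treat m) (j : Fin m) :
    MemLp (outcomeReg P a j) 2 P := by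
  obtain ⟨c, hc, h⟩ := hP.overlap
  have h1 : MemLp (condExp (sigmaX m d) P fun o => ind a o * o.1 j) 2 P :=
    (memLp_ind_mul (hP.memLp j) a).condExp (by norm_num)
  refine (h1.const_mul c⁻¹).of_le (measurable_outcomeReg a j).aestronglyMeasurable ?_
  filter_upwards [h a] with o ho
  rw [outcomeReg, indicator_eq_ind_mul, norm_div, norm_mul, div_eq_inv_mul, norm_inv]
  refine mul_le_mul_of_nonneg_right ?_ (norm_nonneg _)
  rw [Real.norm_of_nonneg hc.le, Real.norm_of_nonneg (hc.trans ho).le]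
  exact inv_anti₀ hc ho.le

theorem IsRegularLaw.condExp_outcome (hP : IsRegularLaw P) {a : Treat m} {j : Fin m}
    {h : Obs m d → ℝ} (hh : StronglyMeasurable[sigmaX m d] h)
    (hi : Integrable (fun o => ind a o * o.1 j * h o) P) :
    condExp (sigmaX m d) P (fun o => ind a o * o.1 j * h o) =ᵐ[P]
      fun o => propensity P a o * outcomeReg P a j o * h o := by
  have h1 := condExp_mul_of_stronglyMeasurable_right hh hi
    (integrable_ind_mul (hP.integrable j) a)
  filter_upwards [h1, hP.propensity_mul_outcomeReg a j] with o h1 h2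
  rw [h2]; exact h1

theorem IsRegularLaw.integral_ind_mul_outcome (hP : IsRegularLaw P) {a : Treat m} {j : Fin m}
    {h : Obs m d → ℝ} (hh : StronglyMeasurable[sigmaX m d] h)
    (hi : Integrable (fun o => ind a o * o.1 j * h o) P) :
    ∫ o, ind a o * o.1 j * h o ∂P = ∫ o, propensity P a o * outcomeReg P a j o * h o ∂P := by
  rw [← integral_congr_ae (hP.condExp_outcome hh hi), integral_condExp (sigmaX_le m d)]

/-- The residuals of the outcome regression are orthogonal to functions of `(A, X)`. -/
theorem IsRegularLaw.integral_ind_mul_resid (hP : IsRegularLaw P) {a : Treat m} {j : Fin m}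
    {h : Obs m d → ℝ} (hh : StronglyMeasurable[sigmaX m d] h)
    (hi : Integrable (fun o => ind a o * o.1 j * h o) P)
    (hi' : Integrable (fun o => ind a o * outcomeReg P a j o * h o) P) :
    ∫ o, ind a o * (o.1 j - outcomeReg P a j o) * h o ∂P = 0 := by
  have e : ∀ o : Obs m d, ind a o * (o.1 j - outcomeReg P a j o) * h o =
      ind a o * o.1 j * h o - ind a o * outcomeReg P a j o * h o := fun o => by ring
  simp only [e]
  rw [integral_sub hi hi', hP.integral_ind_mul_outcome hh hi, sub_eq_zero]
  have h2 := integral_ind_mul (P := P) (a := a) (h := fun o => outcomeReg P a j o * h o)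
    ((stronglyMeasurable_outcomeReg a j).mul hh) (by simpa only [mul_assoc] using hi')
  simpa only [mul_assoc] using h2.symm

end Nuisance

/-! ### Identification -/

section Identification

/-- Under almost every regular conditional distribution `f` and `g` are independent, so the mean of
the product factors there. -/
theorem condExp_mul_of_condIndepFun {Ω : Type*} {m' mΩ : MeasurableSpace Ω}
    [StandardBorelSpace Ω] {hm' : m' ≤ mΩ} {μ : Measure Ω} [IsFiniteMeasure μ] {f g : Ω → ℝ}
    (h : CondIndepFun m' hm' f g μ) (hf : Measurable f) (hg : Measurable g)
    (hfi : Integrable f μ) (hgi : Integrable g μ) (hfg : Integrable (fun ω => f ω * g ω) μ) :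
    condExp m' μ (fun ω => f ω * g ω) =ᵐ[μ] fun ω => condExp m' μ f ω * condExp m' μ g ω := by
  have hk := ae_of_ae_trim hm' ((condIndepFun_iff_map_prod_eq_prod_map_map hf hg).1 h)
  filter_upwards [hk, condExp_ae_eq_integral_condExpKernel hm' hfi,
    condExp_ae_eq_integral_condExpKernel hm' hgi,
    condExp_ae_eq_integral_condExpKernel hm' hfg] with ω hω h1 h2 h3
  rw [h1, h2, h3]
  have hind : IndepFun f g (condExpKernel μ m' ω) := by
    rw [indepFun_iff_map_prod_eq_prod_map_map hf.aemeasurable hg.aemeasurable]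
    rwa [Kernel.map_apply _ (hf.prodMk hg), Kernel.prod_apply, Kernel.map_apply _ hf,
      Kernel.map_apply _ hg] at hω
  exact hind.integral_fun_mul_eq_mul_integral hf.aestronglyMeasurable hg.aestronglyMeasurable

variable {m d : ℕ} {Q : Measure (Full m d)} [IsProbabilityMeasure Q]

theorem measurable_observe : Measurable (observe : Full m d → Obs m d) := by
  have h : Measurable fun f : Full m d => f.1 f.2.1 := by
    have : Measurable fun q : (Treat m) × (Treat m → Fin m → ℝ) => q.2 q.1 :=
      measurable_from_prod_countable_right fun a => measurable_pi_apply a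
    exact this.comp (measurable_snd.fst.prodMk measurable_fst)
  exact h.prodMk measurable_snd

instance : IsProbabilityMeasure (Q.map observe) :=
  Measure.isProbabilityMeasure_map measurable_observe.aemeasurable

theorem Identifying.isRegularLaw (hQ : Identifying Q) : IsRegularLaw (Q.map observe) := by
  obtain ⟨c, hc, h⟩ := hQ.overlap
  refine ⟨⟨c, hc, fun a => (h a).mono fun o ho => ho.1⟩, fun j => ?_⟩
  have hm : Measurable fun o : Obs m d => o.1 j := (measurable_pi_apply j).comp measurable_fst
  rw [memLp_map_measure_iff hm.aestronglyMeasurable measurable_observe.aemeasurable]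
  have h2 : MemLp (fun f : Full m d => ∑ a, ‖f.1 a j‖) 2 Q :=
    memLp_finsetSum _ fun a _ => (hQ.moments a j).norm
  refine h2.of_le (hm.comp measurable_observe).aestronglyMeasurable
    (Eventually.of_forall fun f => ?_)
  rw [Real.norm_of_nonneg (Finset.sum_nonneg fun a _ => norm_nonneg _)]
  exact Finset.single_le_sum (f := fun a => ‖f.1 a j‖) (fun a _ => norm_nonneg _)
    (Finset.mem_univ f.2.1)

theorem stronglyMeasurable_comp_observe {h : Obs m d → ℝ}
    (hh : StronglyMeasurable[sigmaX m d] h) :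
    StronglyMeasurable[sigmaXFull m d] (h ∘ observe) := by
  have : Measurable[sigmaXFull m d, sigmaX m d] (observe : Full m d → Obs m d) := by
    rw [measurable_comap_iff]
    exact comap_measurable (fun f : Full m d => f.2.2)
  exact hh.comp_measurable this

theorem integral_observe {h : Obs m d → ℝ} (hh : AEStronglyMeasurable h (Q.map observe)) :
    ∫ o, h o ∂(Q.map observe) = ∫ f, h (observe f) ∂Q :=
  integral_map measurable_observe.aemeasurable hh

/-- The covariates are part of the observed data, so the σ-algebra they generate on the full data is
the pullback along `observe` of the one on the observed data. -/
theorem condExp_observe {h : Obs m d → ℝ} (hh : Integrable h (Q.map observe)) :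
    (fun f => condExp (sigmaX m d) (Q.map observe) h (observe f)) =ᵐ[Q]
      condExp (sigmaXFull m d) Q fun f => h (observe f) := by
  have hhQ : Integrable (fun f => h (observe f)) Q := hh.comp_measurable measurable_observe
  have hgi : Integrable (fun f => condExp (sigmaX m d) (Q.map observe) h (observe f)) Q :=
    (integrable_condExp (m := sigmaX m d) (μ := Q.map observe) (f := h)).comp_measurable
      measurable_observe
  refine ae_eq_condExp_of_forall_setIntegral_eq (sigmaXFull_le m d) hhQ
    (fun s _ _ => hgi.integrableOn) ?_
    (stronglyMeasurable_comp_observe stronglyMeasurable_condExp).aestronglyMeasurable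
  rintro s ⟨t, ht, rfl⟩ -
  have hs : MeasurableSet[sigmaX m d] ((fun o : Obs m d => o.2.2) ⁻¹' t) := ⟨t, ht, rfl⟩
  have hs' := sigmaX_le m d _ hs
  have e : ((fun f : Full m d => f.2.2) ⁻¹' t) =
      observe ⁻¹' ((fun o : Obs m d => o.2.2) ⁻¹' t) := rfl
  rw [e, ← setIntegral_map (g := observe) hs' integrable_condExp.1 measurable_observe.aemeasurable,
    ← setIntegral_map (g := observe) hs' hh.1 measurable_observe.aemeasurable,
    setIntegral_condExp (sigmaX_le m d) hh hs]

/-- Consistency replaces `Y` by `Y(a)` on `A = a`, and ignorability factors the conditional mean of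
`1(A = a) Y(a)`. Dividing by the propensity score, the regression is `E{Y(a) | X}`. -/
theorem Identifying.integral_outcomeReg (hQ : Identifying Q) {h : Covar m d → ℝ}
    (hh : Measurable h) {C : ℝ} (hC : ∀ x, |h x| ≤ C) (a : Treat m) (j : Fin m) :
    ∫ o, h o.2.2 * outcomeReg (Q.map observe) a j o ∂(Q.map observe) =
      ∫ f, h f.2.2 * f.1 a j ∂Q := by
  have hP := hQ.isRegularLaw
  have hYi : Integrable (fun f : Full m d => f.1 a j) Q :=
    (hQ.moments a j).integrable (by norm_num)
  have hYm : Measurable fun f : Full m d => f.1 a j :=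
    (measurable_pi_apply j).comp ((measurable_pi_apply a).comp measurable_fst)
  have hA : Measurable fun f : Full m d => ind a (observe f) :=
    (measurable_ind a).comp measurable_observe
  have hAi : Integrable (fun f : Full m d => ind a (observe f)) Q :=
    (integrable_ind a).comp_measurable measurable_observe
  have hind : ∀ f : Full m d, ind a (observe f) * (observe f).1 j =
      f.1 a j * ind a (observe f) := fun f => by
    by_cases hf : f.2.1 = a
    · subst hf; simp [observe, mul_comm]
    · simp [ind, observe, hf]
  have hmi : Integrable (fun f : Full m d => f.1 a j * ind a (observe f)) Q :=
    hYi.mul_bdd hA.aestronglyMeasurable (Eventually.of_forall fun f => abs_ind_le_one a _)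
  have hci : CondIndepFun (sigmaXFull m d) (sigmaXFull_le m d) (fun f : Full m d => f.1 a j)
      (fun f => ind a (observe f)) Q :=
    (hQ.ignorability a).comp (φ := fun y : Fin m → ℝ => y j)
      (ψ := fun a' : Treat m => if a' = a then (1 : ℝ) else 0) (measurable_pi_apply j)
      (measurable_of_countable _)
  have h1 := condExp_mul_of_condIndepFun hci hYm hA hYi hAi hmi
  have h2 := condExp_observe (Q := Q) (integrable_ind_mul (hP.integrable j) a)
  have h3 := condExp_observe (Q := Q) (integrable_ind (P := Q.map observe) a)
  simp only [hind] at h2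
  have h4 : (fun f => outcomeReg (Q.map observe) a j (observe f)) =ᵐ[Q]
      condExp (sigmaXFull m d) Q fun f => f.1 a j := by
    filter_upwards [h1, h2, h3, ae_of_ae_map measurable_observe.aemeasurable
      (hP.propensity_pos a)] with f h1 h2 h3 hpos
    rw [outcomeReg, indicator_eq_ind_mul, h2, h1, ← h3, ← propensity_eq,
      mul_div_cancel_right₀ _ hpos.ne']
  have hhm : Measurable fun o : Obs m d => h o.2.2 := hh.comp measurable_snd.snd
  rw [integral_observe (h := fun o => h o.2.2 * outcomeReg (Q.map observe) a j o)
    (hhm.mul (measurable_outcomeReg a j)).aestronglyMeasurable]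
  have h5 : (fun f : Full m d => h (observe f).2.2 * outcomeReg (Q.map observe) a j (observe f))
      =ᵐ[Q] condExp (sigmaXFull m d) Q fun f => h f.2.2 * f.1 a j := by
    have hi : Integrable (fun f : Full m d => h f.2.2 * f.1 a j) Q :=
      hYi.bdd_mul (hh.comp measurable_snd.snd).aestronglyMeasurable
        (Eventually.of_forall fun f => hC f.2.2)
    have := condExp_mul_of_stronglyMeasurable_left
      (stronglyMeasurable_comp_observe (stronglyMeasurable_covar hh)) hi hYi
    filter_upwards [this, h4] with f hf1 hf2
    rw [hf2]; exact hf1.symm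
  rw [integral_congr_ae h5, integral_condExp (sigmaXFull_le m d)]

theorem IsRegularLaw.integrable_weight_mul_outcomeReg {P : Measure (Obs m d)}
    [IsProbabilityMeasure P] (hP : IsRegularLaw P) {h : Covar m d → ℝ} (hh : Measurable h) {C : ℝ}
    (hC : ∀ x, |h x| ≤ C) (a : Treat m) (j : Fin m) :
    Integrable (fun o => h o.2.2 * outcomeReg P a j o) P :=
  ((hP.memLp_outcomeReg a j).integrable (by norm_num)).bdd_mul
    (hh.comp measurable_snd.snd).aestronglyMeasurable (Eventually.of_forall fun o => hC o.2.2)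

/-- Identification of the causal estimand. -/
theorem Identifying.thetaObs_eq (hQ : Identifying Q) {w : Treat m → Covar m d → Fin m → ℝ}
    (hw : ∀ a j, Measurable fun x => w a x j) {C : ℝ} (hC : ∀ a x j, |w a x j| ≤ C) :
    thetaObs w (Q.map observe) = thetaCausal w Q := by
  rw [thetaObs, thetaCausal]
  refine Finset.sum_congr rfl fun a _ => ?_
  rw [integral_finsetSum _ fun j _ =>
    hQ.isRegularLaw.integrable_weight_mul_outcomeReg (hw a j) (fun x => hC a x j) a j,
    integral_finsetSum]
  · exact Finset.sum_congr rfl fun j _ =>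
      hQ.integral_outcomeReg (hw a j) (fun x => hC a x j) a j
  · intro j _
    exact ((hQ.moments a j).integrable (by norm_num)).bdd_mul
      ((hw a j).comp measurable_snd.snd).aestronglyMeasurable
      (Eventually.of_forall fun f => hC a f.2.2 j)

end Identification

end

/-! ### The outcome regression estimator -/

section

/-! ### Gram matrix of the regressors and population least squares. -/

section Gram

variable {m d : ℕ}

theorem abs_trt_le_one (b : Bool) : |trt b| ≤ 1 := by cases b <;> simp [trt]

theorem abs_orRegressor_le (a : Treat m) (x : Covar m d) (j : Fin m) (i : Fin 3 ⊕ Fin d ⊕ Fin d) :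
    |orRegressor a x j i| ≤ (m + 1) * (1 + covarNorm x) := by
  have h0 := covarNorm_nonneg x
  have hm : (0 : ℝ) ≤ m := Nat.cast_nonneg m
  have hmx : 0 ≤ m * covarNorm x := by positivity
  match i with
  | Sum.inl 0 => simp only [orRegressor, Sum.elim_inl, Matrix.cons_val_zero, abs_one]; nlinarith
  | Sum.inl 1 =>
    refine (abs_trt_le_one (a j)).trans ?_; nlinarith
  | Sum.inl 2 =>
    have : |∑ l ∈ Finset.univ.erase j, trt (a l)| ≤ m := by
      refine (Finset.abs_sum_le_sum_abs _ _).trans ?_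
      refine (Finset.sum_le_card_nsmul _ _ 1 fun l _ => abs_trt_le_one (a l)).trans ?_
      rw [nsmul_eq_mul, mul_one, Nat.cast_le]
      exact (Finset.card_le_univ _).trans (by simp)
    refine this.trans ?_; nlinarith
  | Sum.inr (Sum.inl r) =>
    refine (abs_apply_le_covarNorm x j r).trans ?_; nlinarith
  | Sum.inr (Sum.inr r) =>
    refine (abs_sum_erase_le x j r).trans ?_; nlinarith

theorem continuous_orRegressor (a : Treat m) (j : Fin m) (i : Fin 3 ⊕ Fin d ⊕ Fin d) :
    Continuous fun x : Covar m d => orRegressor a x j i := by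
  rcases i with i | i | i
  · exact continuous_const
  · simp only [orRegressor, Sum.elim_inr, Sum.elim_inl]; fun_prop
  · simp only [orRegressor, Sum.elim_inr]; fun_prop

theorem measurable_orRegressor (j : Fin m) (i : Fin 3 ⊕ Fin d ⊕ Fin d) :
    Measurable fun o : Obs m d => orRegressor o.2.1 o.2.2 j i :=
  measurable_treat (f := fun a x => orRegressor a x j i) fun a =>
    (continuous_orRegressor a j i).measurable

/-- The Gram matrix `RᵀR` of the regressors of one cluster, as a linear map. -/
def orGram (a : Treat m) (x : Covar m d) : ORCoef d →L[ℝ] ORCoef d :=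
  ∑ i, ∑ i', (∑ j, orRegressor a x j i * orRegressor a x j i') •
    (ContinuousLinearMap.proj (R := ℝ) (φ := fun _ => ℝ) i').smulRight
      (Pi.single i 1 : ORCoef d)

theorem orGram_apply (a : Treat m) (x : Covar m d) (β : ORCoef d) (i : Fin 3 ⊕ Fin d ⊕ Fin d) :
    orGram a x β i = ∑ j, orRegressor a x j i * orModel a x β j := by
  simp only [orGram, sum_apply, smul_apply, ContinuousLinearMap.smulRight_apply,
    ContinuousLinearMap.proj_apply, Finset.sum_apply, Pi.smul_apply, smul_eq_mul, Pi.single_apply]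
  rw [Finset.sum_comm]
  simp only [mul_ite, mul_one, mul_zero, Finset.sum_ite_eq, Finset.mem_univ, if_true, orModel,
    Finset.mul_sum, Finset.sum_mul]
  rw [Finset.sum_comm]
  exact Finset.sum_congr rfl fun j _ => Finset.sum_congr rfl fun i' _ => by ring

/-- `RᵀY` for one cluster. -/
def orCross (o : Obs m d) : ORCoef d := fun i => ∑ j, orRegressor o.2.1 o.2.2 j i * o.1 j

theorem orScore_eq (o : Obs m d) (β : ORCoef d) :
    orScore o β = orCross o - orGram o.2.1 o.2.2 β := by
  ext i
  rw [Pi.sub_apply, orGram_apply, orScore, orCross, ← Finset.sum_sub_distrib]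
  exact Finset.sum_congr rfl fun j _ => by rw [orResid]; ring

theorem measurable_orGram : Measurable fun o : Obs m d => orGram o.2.1 o.2.2 := by
  refine Finset.measurable_fun_sum _ fun i _ => Finset.measurable_fun_sum _ fun i' _ => ?_
  exact (Finset.measurable_fun_sum _ fun j _ =>
    (measurable_orRegressor j i).mul (measurable_orRegressor j i')).smul_const _

theorem measurable_outcome (j : Fin m) : Measurable fun o : Obs m d => o.1 j :=
  (measurable_pi_apply j).comp measurable_fst

theorem measurable_orCross : Measurable (orCross : Obs m d → ORCoef d) :=
  measurable_pi_lambda _ fun i => Finset.measurable_fun_sum _ fun j _ =>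
    (measurable_orRegressor j i).mul (measurable_outcome j)

variable {P : Measure (Obs m d)} [IsProbabilityMeasure P]

theorem memLp_orRegressor (h : Integrable (fun o : Obs m d => covarNorm o.2.2 ^ 3) P)
    (j : Fin m) (i : Fin 3 ⊕ Fin d ⊕ Fin d) :
    MemLp (fun o : Obs m d => orRegressor o.2.1 o.2.2 j i) 2 P :=
  ((memLp_one_add_covarNorm h).const_mul (m + 1 : ℝ)).of_le
    (measurable_orRegressor j i).aestronglyMeasurable (Eventually.of_forall fun o =>
      (abs_orRegressor_le o.2.1 o.2.2 j i).trans (le_abs_self _))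

theorem integrable_sum_sum_smul {α ι F : Type*} [MeasurableSpace α] {ρ : Measure α} [Fintype ι]
    [NormedAddCommGroup F] [NormedSpace ℝ F] {f : ι → ι → α → ℝ}
    (hf : ∀ i i', Integrable (f i i') ρ) (c : ι → ι → F) :
    Integrable (fun z => ∑ i, ∑ i', f i i' z • c i i') ρ :=
  integrable_finsetSum _ fun i _ => integrable_finsetSum _ fun i' _ => (hf i i').smul_const _

theorem integrable_orGram (h : Integrable (fun o : Obs m d => covarNorm o.2.2 ^ 3) P) :
    Integrable (fun o : Obs m d => orGram o.2.1 o.2.2) P := by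
  have hf : ∀ i i', Integrable (fun o : Obs m d =>
      ∑ j, orRegressor o.2.1 o.2.2 j i * orRegressor o.2.1 o.2.2 j i') P := fun i i' =>
    integrable_finsetSum _ fun j _ =>
      (memLp_orRegressor h j i).integrable_mul (memLp_orRegressor h j i')
  have := integrable_sum_sum_smul hf fun i i' =>
    (ContinuousLinearMap.proj (R := ℝ) (φ := fun _ => ℝ) i').smulRight
      (Pi.single i 1 : ORCoef d)
  exact this

theorem integrable_orCross (hP : IsRegularLaw P)
    (h : Integrable (fun o : Obs m d => covarNorm o.2.2 ^ 3) P) :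
    Integrable (orCross : Obs m d → ORCoef d) P :=
  Integrable.of_eval fun i => integrable_finsetSum _ fun j _ =>
    (memLp_orRegressor h j i).integrable_mul (hP.memLp j)

/-- Positivity: the exceptional covariate set has zero integral against `e(a | X)`, which is
positive, so it is null. -/
theorem IsRegularLaw.ae_of_ae_treat (hP : IsRegularLaw P) (a : Treat m) {q : Covar m d → Prop}
    (hq : MeasurableSet {x | q x}) (h : ∀ᵐ o ∂P, o.2.1 = a → q o.2.2) : ∀ᵐ o ∂P, q o.2.2 := by
  set f : Covar m d → ℝ := {x | ¬ q x}.indicator 1 with hf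
  have hfm : Measurable f := measurable_one.indicator hq.compl
  have hf1 : ∀ x, |f x| ≤ 1 := fun x => by
    by_cases hx : q x <;> simp [hf, hx]
  have hi : Integrable (fun o : Obs m d => f o.2.2) P :=
    Integrable.of_bound (hfm.comp measurable_snd.snd).aestronglyMeasurable 1
      (Eventually.of_forall fun o => hf1 _)
  have h1 := integral_ind_mul (P := P) (a := a) (stronglyMeasurable_covar hfm)
    (integrable_ind_mul hi a)
  have h2 : ∫ o, ind a o * f o.2.2 ∂P = 0 := by
    refine integral_eq_zero_of_ae ?_
    filter_upwards [h] with o ho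
    by_cases hoa : o.2.1 = a
    · simp [hf, ho hoa]
    · simp [ind, hoa]
  rw [h2] at h1
  have hnn : 0 ≤ᵐ[P] fun o => propensity P a o * f o.2.2 := by
    filter_upwards [propensity_nonneg (P := P) a] with o ho
    exact mul_nonneg ho (Set.indicator_nonneg (fun _ _ => zero_le_one) _)
  have hpi : Integrable (fun o => propensity P a o * f o.2.2) P :=
    integrable_condExp.congr
      (condExp_ind_mul (P := P) (stronglyMeasurable_covar hfm) (integrable_ind_mul hi a))
  have h3 := (integral_eq_zero_iff_of_nonneg_ae hnn hpi).1 h1.symm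
  filter_upwards [h3, hP.propensity_pos a] with o h3 hpos
  by_contra hq'
  have : f o.2.2 = 1 := by simp [hf, hq']
  simp only [this, mul_one, Pi.zero_apply] at h3
  exact hpos.ne' h3

theorem orModel_eq (a : Treat m) (x : Covar m d) (v : ORCoef d) (j : Fin m) :
    orModel a x v j = v (Sum.inl 0) + trt (a j) * v (Sum.inl 1)
      + (∑ l ∈ Finset.univ.erase j, trt (a l)) * v (Sum.inl 2)
      + (∑ r, x j r * v (Sum.inr (Sum.inl r))
        + ∑ r, (∑ l ∈ Finset.univ.erase j, x l r) * v (Sum.inr (Sum.inr r))) := by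
  simp [orModel, orRegressor, Fintype.sum_sum_type, Fin.sum_univ_three]

theorem measurable_orModel (v : ORCoef d) (a : Treat m) (j : Fin m) :
    Measurable fun x : Covar m d => orModel a x v j :=
  Finset.measurable_fun_sum _ fun i _ =>
    (continuous_orRegressor a j i).measurable.mul_const _

/-- Comparing no treatment with one treated unit, seen from that unit and from another, isolates the
two treatment coefficients; the remaining affine relation in the covariates is excluded by
non-degeneracy. The second unit is what makes the spillover coefficients visible. -/
theorem orCoef_eq_zero (hm : 2 ≤ m) (hP : NondegenerateCovar P) {v : ORCoef d}
    (h : ∀ a j, ∀ᵐ o ∂P, orModel a o.2.2 v j = 0) : v = 0 := by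
  let j₀ : Fin m := ⟨0, by omega⟩
  let j₁ : Fin m := ⟨1, by omega⟩
  have hj : j₁ ≠ j₀ := by simp [j₀, j₁]
  have hj' : j₀ ∈ Finset.univ.erase j₁ := Finset.mem_erase.2 ⟨hj.symm, Finset.mem_univ _⟩
  -- Only `j₀` is treated, so `j₀` feels the direct effect alone and `j₁` the spillover alone.
  set a₁ : Treat m := fun j => decide (j = j₀) with ha₁
  have t0 : trt (a₁ j₀) = 1 := by simp [ha₁, trt]
  have t1 : ∀ l, l ≠ j₀ → trt (a₁ l) = 0 := fun l hl => by simp [ha₁, trt, hl]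
  have s0 : ∑ l ∈ Finset.univ.erase j₀, trt (a₁ l) = 0 :=
    Finset.sum_eq_zero fun l hl => t1 l (Finset.ne_of_mem_erase hl)
  have s1 : ∑ l ∈ Finset.univ.erase j₁, trt (a₁ l) = 1 := by
    rw [Finset.sum_eq_single_of_mem j₀ hj' fun l _ hl => t1 l hl, t0]
  have hne : (ae P).NeBot := inferInstance
  obtain ⟨o, h1, h2, h3, h4⟩ := ((h (fun _ => false) j₀).and ((h a₁ j₀).and
    ((h (fun _ => false) j₁).and (h a₁ j₁)))).exists
  rw [orModel_eq] at h1 h2 h3 h4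
  rw [t0, s0] at h2
  rw [t1 j₁ hj, s1] at h4
  simp only [trt, Bool.false_eq_true, if_false, Finset.sum_const_zero, zero_mul, add_zero,
    one_mul] at h1 h2 h3 h4
  have v1 : v (Sum.inl 1) = 0 := by linarith
  have v2 : v (Sum.inl 2) = 0 := by linarith
  -- In the predictor of unit `j₀` its own covariates carry the direct coefficients and all other
  -- units carry the spillover ones, so `c = 0` kills both groups.
  set c : Covar m d := fun j r =>
    if j = j₀ then v (Sum.inr (Sum.inl r)) else v (Sum.inr (Sum.inr r)) with hc
  have hc0 : c = 0 := by
    by_contra hne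
    refine hP c hne ⟨-v (Sum.inl 0), ?_⟩
    filter_upwards [h (fun _ => false) j₀] with o ho
    rw [orModel_eq] at ho
    simp only [trt, Bool.false_eq_true, if_false, Finset.sum_const_zero, zero_mul, add_zero] at ho
    have e : ∑ j, ∑ i, c j i * o.2.2 j i = ∑ r, o.2.2 j₀ r * v (Sum.inr (Sum.inl r))
        + ∑ r, (∑ l ∈ Finset.univ.erase j₀, o.2.2 l r) * v (Sum.inr (Sum.inr r)) := by
      rw [← sum_add_sum_erase (fun j => ∑ i, c j i * o.2.2 j i) j₀]
      congr 1
      · exact Finset.sum_congr rfl fun r _ => by simp [hc, mul_comm]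
      · rw [Finset.sum_comm]
        refine Finset.sum_congr rfl fun r _ => ?_
        rw [Finset.sum_mul]
        exact Finset.sum_congr rfl fun l hl => by
          simp [hc, Finset.ne_of_mem_erase hl, mul_comm]
    linarith
  have v3 : ∀ r, v (Sum.inr (Sum.inl r)) = 0 := fun r => by
    have := congrFun (congrFun hc0 j₀) r
    simpa [hc] using this
  have v4 : ∀ r, v (Sum.inr (Sum.inr r)) = 0 := fun r => by
    have := congrFun (congrFun hc0 j₁) r
    simpa [hc, hj] using this
  have v0 : v (Sum.inl 0) = 0 := by simpa [v3, v4] using h1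
  ext i
  match i with
  | Sum.inl 0 => exact v0
  | Sum.inl 1 => exact v1
  | Sum.inl 2 => exact v2
  | Sum.inr (Sum.inl r) => exact v3 r
  | Sum.inr (Sum.inr r) => exact v4 r

/-- If the mean Gram matrix kills `v`, then the mean of the squared predictor of `v` is zero. So the
predictor vanishes at the received treatment, and by overlap at every treatment. -/
theorem orGram_injective (hm : 2 ≤ m) (hP : IsRegularLaw P) (hnd : NondegenerateCovar P)
    (h3 : Integrable (fun o : Obs m d => covarNorm o.2.2 ^ 3) P) :
    Function.Injective ⇑(∫ o, orGram o.2.1 o.2.2 ∂P : ORCoef d →L[ℝ] ORCoef d) := by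
  refine (injective_iff_map_eq_zero _).2 fun v hv => ?_
  have hGi := integrable_orGram h3
  have hGv := hGi.apply_continuousLinearMap v
  have hmod : ∀ j, MemLp (fun o : Obs m d => orModel o.2.1 o.2.2 v j) 2 P := fun j =>
    memLp_finsetSum _ fun i _ => (memLp_orRegressor h3 j i).mul_const (v i)
  have h0 : ∫ o, ∑ j, orModel o.2.1 o.2.2 v j ^ 2 ∂P = 0 := by
    have e : ∀ o : Obs m d, ∑ j, orModel o.2.1 o.2.2 v j ^ 2 =
        ∑ i, v i * orGram o.2.1 o.2.2 v i := fun o => by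
      simp only [orGram_apply, Finset.mul_sum]
      rw [Finset.sum_comm]
      refine Finset.sum_congr rfl fun j _ => ?_
      rw [sq]
      change (∑ i, orRegressor o.2.1 o.2.2 j i * v i) * orModel o.2.1 o.2.2 v j = _
      rw [Finset.sum_mul]
      exact Finset.sum_congr rfl fun i _ => by ring
    have hGvi : ∀ i, Integrable (fun o : Obs m d => orGram o.2.1 o.2.2 v i) P := fun i =>
      hGv.eval i
    simp only [e]
    rw [integral_finsetSum _ fun i _ => (hGvi i).const_mul (v i)]
    refine Finset.sum_eq_zero fun i _ => ?_
    rw [integral_const_mul, ← eval_integral fun i => hGvi i,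
      ← ContinuousLinearMap.integral_apply hGi, hv]
    simp
  have hae := (integral_eq_zero_iff_of_nonneg (fun o => Finset.sum_nonneg fun j _ => sq_nonneg _)
    (integrable_finsetSum _ fun j _ => (hmod j).integrable_sq)).1 h0
  refine orCoef_eq_zero hm hnd fun a j => hP.ae_of_ae_treat a
    (q := fun x => orModel a x v j = 0)
    (measurable_orModel v a j (MeasurableSet.singleton 0)) ?_
  filter_upwards [hae] with o ho ha
  have := (Finset.sum_eq_zero_iff_of_nonneg fun j _ => sq_nonneg _).1 ho j (Finset.mem_univ j)
  subst ha
  exact pow_eq_zero_iff (two_ne_zero) |>.1 this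

theorem integrable_orScore (hP : IsRegularLaw P)
    (h3 : Integrable (fun o : Obs m d => covarNorm o.2.2 ^ 3) P) (β : ORCoef d) :
    Integrable (fun o => orScore o β) P := by
  simp only [orScore_eq]
  exact (integrable_orCross hP h3).sub ((integrable_orGram h3).apply_continuousLinearMap β)

/-- Supplies the limit of the coefficient estimator when the outcome model is wrong. An injective
endomorphism in finite dimension is onto. -/
theorem exists_integral_orScore_eq_zero (hm : 2 ≤ m) (hP : IsRegularLaw P)
    (hnd : NondegenerateCovar P)
    (h3 : Integrable (fun o : Obs m d => covarNorm o.2.2 ^ 3) P) :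
    ∃ β, ∫ o, orScore o β ∂P = 0 := by
  have hsurj : Function.Surjective ⇑(∫ o, orGram o.2.1 o.2.2 ∂P : ORCoef d →L[ℝ] ORCoef d) :=
    LinearMap.surjective_of_injective (f := (∫ o, orGram o.2.1 o.2.2 ∂P).toLinearMap)
      (orGram_injective hm hP hnd h3)
  obtain ⟨β, hβ⟩ := hsurj (∫ o, orCross o ∂P)
  refine ⟨β, ?_⟩
  have hGi := integrable_orGram h3
  simp only [orScore_eq]
  rw [integral_sub (integrable_orCross hP h3) (hGi.apply_continuousLinearMap β),
    ← ContinuousLinearMap.integral_apply hGi, hβ, sub_self]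

/-- If the outcome model is correct, its true coefficients solve the population least squares
equations. -/
theorem integral_orScore_eq_zero (hP : IsRegularLaw P)
    (h3 : Integrable (fun o : Obs m d => covarNorm o.2.2 ^ 3) P)
    {β : ORCoef d} (hβ : ∀ a j, ∀ᵐ o ∂P, outcomeReg P a j o = orModel a o.2.2 β j) :
    ∫ o, orScore o β ∂P = 0 := by
  ext i
  have hint : ∀ i, Integrable (fun o => orScore o β i) P := fun i =>
    (integrable_orScore hP h3 β).eval i
  rw [eval_integral hint, Pi.zero_apply]
  have hR : ∀ a j, MemLp (fun o : Obs m d => ind a o * orRegressor a o.2.2 j i) 2 P :=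
    fun a j => by
    refine (memLp_ind_mul (memLp_orRegressor h3 j i) a).congr_norm
      ((measurable_ind a).mul ((continuous_orRegressor a j i).measurable.comp
        measurable_snd.snd)).aestronglyMeasurable (Eventually.of_forall fun o => ?_)
    by_cases h : o.2.1 = a
    · rw [← h]
    · simp [ind, h]
  have hi : ∀ a j, Integrable (fun o : Obs m d => ind a o * o.1 j * orRegressor a o.2.2 j i) P :=
    fun a j => ((hR a j).integrable_mul (hP.memLp j)).congr
      (Eventually.of_forall fun o => by simp only [Pi.mul_apply]; ring)
  have hi' : ∀ a j, Integrable
      (fun o : Obs m d => ind a o * outcomeReg P a j o * orRegressor a o.2.2 j i) P :=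
    fun a j => ((hR a j).integrable_mul (hP.memLp_outcomeReg a j)).congr
      (Eventually.of_forall fun o => by simp only [Pi.mul_apply]; ring)
  have e : (fun o => orScore o β i) =ᵐ[P] fun o => ∑ j, ∑ a,
      ind a o * (o.1 j - outcomeReg P a j o) * orRegressor a o.2.2 j i := by
    filter_upwards [ae_all_iff.2 fun a => ae_all_iff.2 fun j => hβ a j] with o ho
    rw [orScore]
    refine Finset.sum_congr rfl fun j _ => ?_
    simp only [ho, mul_assoc]
    rw [sum_ind_mul (fun a => (o.1 j - orModel a o.2.2 β j) * orRegressor a o.2.2 j i), orResid,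
      mul_comm]
  have hii : ∀ a j, Integrable (fun o : Obs m d =>
      ind a o * (o.1 j - outcomeReg P a j o) * orRegressor a o.2.2 j i) P := fun a j =>
    ((hi a j).sub (hi' a j)).congr (Eventually.of_forall fun o => by
      simp only [Pi.sub_apply]; ring)
  rw [integral_congr_ae e,
    integral_finsetSum _ fun j _ => integrable_finsetSum _ fun a _ => hii a j]
  refine Finset.sum_eq_zero fun j _ => ?_
  rw [integral_finsetSum _ fun a _ => hii a j]
  exact Finset.sum_eq_zero fun a _ => hP.integral_ind_mul_resid
    (stronglyMeasurable_covar (continuous_orRegressor a j i).measurable) (hi a j) (hi' a j)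

end Gram

/-! ### Consistency and asymptotic linearity of the outcome coefficients. -/

section OREstimator

variable {K : ℕ} {M d : Fin K → ℕ} {Ω : Type*} [MeasurableSpace Ω] {μ : Measure Ω}
  [IsProbabilityMeasure μ] {Z : ℕ → Ω → Data M d} {p : Fin K → ℝ}
  {P : ∀ k, Measure (Obs (M k) (d k))} [∀ k, IsProbabilityMeasure (P k)]

theorem exists_sum_onType_eq (k : Fin K) (z : ℕ → Data M d) (N : ℕ) :
    ∃ (s : Finset ℕ) (o : ℕ → Obs (M k) (d k)), ∀ f : Obs (M k) (d k) → ℝ,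
      ∑ i ∈ Finset.range N, onType k f (z i) = ∑ i ∈ s, f (o i) := by
  -- The value `0` at clusters of other types is arbitrary, since the filter removes those indices.
  refine ⟨(Finset.range N).filter fun i => (z i).1 = k,
    fun i => if h : (z i).1 = k then h ▸ (z i).2 else 0, fun f => ?_⟩
  rw [Finset.sum_filter]
  refine Finset.sum_congr rfl fun i _ => ?_
  by_cases h : (z i).1 = k <;> simp [onType, h]

theorem onTypeV_orScore (k : Fin K) (β : ORCoef (d k)) (z : Data M d) :
    onTypeV k orCross z - onTypeV k (fun o => orGram o.2.1 o.2.2) z β =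
      onTypeV k (fun o => orScore o β) z := by
  simp only [orScore_eq]
  exact (onTypeV_map₂ (k := k) (T := fun c (G : ORCoef (d k) →L[ℝ] ORCoef (d k)) => c - G β)
    (by simp) z).symm

theorem highProb_avg_orScore_eq_zero (k : Fin K) {est : ℕ → Ω → ORParam (d k)}
    (hest : IsMaximizerEventually μ (orSpace (d k)) (orSampleLogLik Z k) est) :
    HighProb μ fun N ω => avg Z (fun z => onTypeV k orCross z
      - onTypeV k (fun o => orGram o.2.1 o.2.2) z (est N ω).1) N ω = 0 := by
  refine HighProb.imp (p := fun N ω => est N ω ∈ orSpace (d k) ∧ ∀ γ ∈ orSpace (d k),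
    orSampleLogLik Z k N ω γ ≤ orSampleLogLik Z k N ω (est N ω)) hest fun N ω h => ?_
  obtain ⟨s, o, hso⟩ := exists_sum_onType_eq k (fun i => Z i ω) N
  simp only [orSampleLogLik, hso] at h
  simp only [onTypeV_orScore]
  ext i
  rw [avg_apply]
  have e : ∀ z : Data M d, onTypeV k (fun o => orScore o (est N ω).1) z i =
      onType k (fun o => orScore o (est N ω).1 i) z := fun z =>
    (onTypeV_map (k := k) (T := fun v : ORCoef (d k) => v i) rfl z).symm
  simp only [e]
  rw [avg_onType, hso, sum_orScore_eq_zero s o h.1 h.2 i, mul_zero, Pi.zero_apply]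

theorem orEst_leftInverse (hp : ∀ k, 0 < p k) (k : Fin K) (hm : 2 ≤ M k)
    (hP : IsRegularLaw (P k)) (hnd : NondegenerateCovar (P k))
    (h3 : Integrable (fun o => covarNorm o.2.2 ^ 3) (P k)) :
    ∃ L : ORCoef (d k) →L[ℝ] ORCoef (d k), ∀ v,
      L ((∫ z, onTypeV k (fun o => orGram o.2.1 o.2.2) z ∂(mixLaw p P)) v) = v := by
  obtain ⟨g, hg⟩ := LinearMap.exists_leftInverse_of_injective
    (∫ o, orGram o.2.1 o.2.2 ∂(P k)).toLinearMap
    (LinearMap.ker_eq_bot.2 (orGram_injective hm hP hnd h3))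
  refine ⟨(p k)⁻¹ • LinearMap.toContinuousLinearMap g, fun v => ?_⟩
  rw [integral_onTypeV (fun k => (hp k).le) (integrable_orGram h3)]
  have := LinearMap.congr_fun hg v
  simp only [LinearMap.comp_apply, LinearMap.id_apply, ContinuousLinearMap.coe_coe] at this
  simp only [smul_apply, map_smul, LinearMap.coe_toContinuousLinearMap']
  rw [this, smul_smul, mul_inv_cancel₀ (hp k).ne', one_smul]

theorem integral_onTypeV_orScore (hp : ∀ k, 0 < p k) (k : Fin K) (hP : IsRegularLaw (P k))
    (h3 : Integrable (fun o => covarNorm o.2.2 ^ 3) (P k)) {β : ORCoef (d k)}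
    (h0 : ∫ o, orScore o β ∂(P k) = 0) :
    ∫ z, onTypeV k orCross z - onTypeV k (fun o => orGram o.2.1 o.2.2) z β ∂(mixLaw p P) = 0 := by
  simp only [onTypeV_orScore]
  rw [integral_onTypeV (fun k => (hp k).le) (integrable_orScore hP h3 β), h0, smul_zero]

theorem orEst_consistent (hp : ∀ k, 0 < p k) (hs : IsSample μ (mixLaw p P) Z) (k : Fin K)
    (hm : 2 ≤ M k) (hP : IsRegularLaw (P k)) (hnd : NondegenerateCovar (P k))
    (h3 : Integrable (fun o => covarNorm o.2.2 ^ 3) (P k)) {β : ORCoef (d k)}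
    (h0 : ∫ o, orScore o β ∂(P k) = 0) {est : ℕ → Ω → ORParam (d k)}
    (hest : IsMaximizerEventually μ (orSpace (d k)) (orSampleLogLik Z k) est) :
    SmallInProb μ fun N ω => (est N ω).1 - β := by
  obtain ⟨L, hL⟩ := orEst_leftInverse (p := p) hp k hm hP hnd h3
  exact hs.linearEquation_consistent (measurable_onTypeV measurable_orGram)
    (integrable_onTypeV (integrable_orGram h3)) (measurable_onTypeV measurable_orCross)
    (integrable_onTypeV (integrable_orCross hP h3)) hL
    (integral_onTypeV_orScore hp k hP h3 h0) (highProb_avg_orScore_eq_zero k hest)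

theorem orEst_isAsympLinear (hp : ∀ k, 0 < p k) (hs : IsSample μ (mixLaw p P) Z) (k : Fin K)
    (hm : 2 ≤ M k) (hP : IsRegularLaw (P k)) (hnd : NondegenerateCovar (P k))
    (h3 : Integrable (fun o => covarNorm o.2.2 ^ 3) (P k)) {β : ORCoef (d k)}
    (h0 : ∫ o, orScore o β ∂(P k) = 0) (h2 : MemLp (fun o => orScore o β) 2 (P k))
    {est : ℕ → Ω → ORParam (d k)}
    (hest : IsMaximizerEventually μ (orSpace (d k)) (orSampleLogLik Z k) est) :
    ∃ κ, IsAsympLinear μ (mixLaw p P) Z (fun N ω => (est N ω).1) β κ := by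
  obtain ⟨L, hL⟩ := orEst_leftInverse (p := p) hp k hm hP hnd h3
  refine ⟨_, hs.linearEquation_isAsympLinear (measurable_onTypeV measurable_orGram)
    (integrable_onTypeV (integrable_orGram h3)) (measurable_onTypeV measurable_orCross) hL ?_
    (integral_onTypeV_orScore hp k hP h3 h0) (highProb_avg_orScore_eq_zero k hest)⟩
  simp only [onTypeV_orScore]
  exact memLp_onTypeV h2

end OREstimator

end

/-! ### Expansion of averages weighted by an estimated propensity score -/

section

section WeightedExpansion

theorem abs_exp_neg_sub_one_le {u : ℝ} (hu : |u| ≤ 1) : |Real.exp (-u) - 1| ≤ 2 * |u| := by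
  simpa using Real.abs_exp_sub_one_le (x := -u) (by simpa using hu)

theorem abs_exp_neg_sub_one_add_le {u : ℝ} (hu : |u| ≤ 1) : |Real.exp (-u) - 1 + u| ≤ u ^ 2 := by
  simpa using Real.abs_exp_sub_one_sub_id_le (x := -u) (by simpa using hu)

variable {𝒵 Ω E F : Type*} [MeasurableSpace 𝒵] [MeasurableSpace Ω] {μ : Measure Ω}
  [IsProbabilityMeasure μ] {P : Measure 𝒵} {Z : ℕ → Ω → 𝒵}
  [NormedAddCommGroup E] [NormedSpace ℝ E] [FiniteDimensional ℝ E] [MeasurableSpace E]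
  [BorelSpace E]
  [NormedAddCommGroup F] [NormedSpace ℝ F] [FiniteDimensional ℝ F] [MeasurableSpace F]
  [BorelSpace F]

/-- `b² |ρ|` need not be integrable. One factor `b` is replaced by its sample maximum, of order
`o(√N)`; what remains is the average of `b |ρ|`, which is bounded in probability, times `‖√N h‖²`.
-/
theorem IsSample.small_sqrt_mul_sq_mul_avg (hs : IsSample μ P Z) {b ρ : 𝒵 → ℝ} (hb : Measurable b)
    (hb0 : ∀ z, 0 ≤ b z) (hb3 : Integrable (fun z => b z ^ 3) P) (hρ : Measurable ρ)
    (hbρ : Integrable (fun z => b z * |ρ z|) P) {h : ℕ → Ω → E}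
    (hh : BddInProb μ fun (N : ℕ) ω => √(N : ℝ) • h N ω) :
    SmallInProb μ fun (N : ℕ) ω =>
      √(N : ℝ) * ‖h N ω‖ ^ 2 * avg Z (fun z => b z ^ 2 * |ρ z|) N ω := by
  have hY : BddInProb μ fun (N : ℕ) ω =>
      ‖√(N : ℝ) • h N ω‖ * ‖√(N : ℝ) • h N ω‖ * avg Z (fun z => b z * |ρ z|) N ω :=
    (hh.norm.mul hh.norm).mul (hs.bddInProb_avg (hb.mul hρ.abs) hbρ)
  intro η hη
  refine hY.highProb fun C => ?_
  have hC : 0 < |C| + 1 := by positivity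
  refine (hs.max_small hb hb0 hb3 (δ := η / (|C| + 1)) (by positivity)).imp fun N ω hmax hle => ?_
  set δ := η / (|C| + 1) with hδ
  have hδ0 : 0 < δ := by positivity
  have h1 : avg Z (fun z => b z ^ 2 * |ρ z|) N ω ≤
      δ * √(N : ℝ) * avg Z (fun z => b z * |ρ z|) N ω := by
    rw [← avg_const_mul]
    refine avg_mono_of fun i hi => ?_
    have := mul_le_mul_of_nonneg_right (hmax i hi)
      (mul_nonneg (hb0 (Z i ω)) (abs_nonneg (ρ (Z i ω))))
    calc b (Z i ω) ^ 2 * |ρ (Z i ω)| = b (Z i ω) * (b (Z i ω) * |ρ (Z i ω)|) := by ring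
      _ ≤ _ := this
  have hn : 0 ≤ avg Z (fun z => b z ^ 2 * |ρ z|) N ω :=
    avg_nonneg fun z => mul_nonneg (sq_nonneg _) (abs_nonneg _)
  have hs0 := Real.sqrt_nonneg (N : ℝ)
  rw [Real.norm_of_nonneg (by positivity)]
  have h2 := le_trans (le_abs_self _) hle
  rw [norm_smul, Real.norm_of_nonneg hs0] at h2
  calc √(N : ℝ) * ‖h N ω‖ ^ 2 * avg Z (fun z => b z ^ 2 * |ρ z|) N ω
      ≤ √(N : ℝ) * ‖h N ω‖ ^ 2 * (δ * √(N : ℝ) * avg Z (fun z => b z * |ρ z|) N ω) :=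
        mul_le_mul_of_nonneg_left h1 (by positivity)
    _ = δ * (√(N : ℝ) * ‖h N ω‖ * (√(N : ℝ) * ‖h N ω‖) * avg Z (fun z => b z * |ρ z|) N ω) := by
        ring
    _ ≤ δ * |C| := mul_le_mul_of_nonneg_left (h2.trans (le_abs_self C)) hδ0.le
    _ < δ * (|C| + 1) := by nlinarith
    _ = η := by rw [hδ]; field_simp

/-- Effect of replacing the weights `1` by `exp (-u z ν̂)` in an average of `ρ - q g`, where `u`
vanishes at `ν₀` and `g` tends to zero in probability. -/
theorem IsSample.weighted_expansion (hs : IsSample μ P Z) {u : 𝒵 → E → ℝ} {s : 𝒵 → E →L[ℝ] ℝ}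
    {b : 𝒵 → ℝ} {r : ℝ} (hr : 0 < r) {ν₀ : E} (hb : Measurable b) (hb0 : ∀ z, 0 ≤ b z)
    (hb3 : Integrable (fun z => b z ^ 3) P) (hb2 : MemLp b 2 P)
    (hu₁ : ∀ z ν, ‖ν - ν₀‖ < r → |u z ν| ≤ b z * ‖ν - ν₀‖)
    (hu₂ : ∀ z ν, ‖ν - ν₀‖ < r → |u z ν - s z (ν - ν₀)| ≤ b z ^ 2 * ‖ν - ν₀‖ ^ 2)
    (hsm : Measurable s) (hsb : ∀ z, ‖s z‖ ≤ b z) {ρ : 𝒵 → ℝ} (hρ : Measurable ρ)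
    (hρ2 : MemLp ρ 2 P) {q : 𝒵 → F →L[ℝ] ℝ} (hq : Measurable q)
    (hbq : Integrable (fun z => b z * ‖q z‖) P)
    {est : ℕ → Ω → E} {κ : 𝒵 → E} (hest : IsAsympLinear μ P Z est ν₀ κ)
    {g : ℕ → Ω → F} (hg : SmallInProb μ g) :
    SmallInProb μ fun (N : ℕ) ω =>
      √(N : ℝ) * avg Z (fun z => (Real.exp (-u z (est N ω)) - 1) * (ρ z - q z (g N ω))) N ω
        - √(N : ℝ) * avg Z (fun z => -(∫ z, ρ z • s z ∂P) (κ z)) N ω := by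
  set h : ℕ → Ω → E := fun N ω => est N ω - ν₀ with hh
  set L := ∫ z, ρ z • s z ∂P with hL
  have hhB : BddInProb μ fun (N : ℕ) ω => √(N : ℝ) • h N ω := hest.bddInProb hs
  have hbρ : Integrable (fun z => b z * |ρ z|) P := hb2.integrable_mul hρ2.norm
  have hρs : Measurable fun z => ρ z • s z := hρ.smul hsm
  have hρsi : Integrable (fun z => ρ z • s z) P := by
    refine hbρ.mono' hρs.aestronglyMeasurable (Eventually.of_forall fun z => ?_)
    rw [norm_smul, mul_comm]
    exact mul_le_mul_of_nonneg_right (hsb z) (abs_nonneg _)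
  have hsmall : SmallInProb μ h := by
    have h1 : SmallInProb μ fun (N : ℕ) (_ : Ω) => (√(N : ℝ))⁻¹ :=
      smallInProb_of_tendsto ((tendsto_inv_atTop_zero.comp Real.tendsto_sqrt_atTop).comp
        tendsto_natCast_atTop_atTop)
    refine SmallInProb.of_norm_le_mul h1 hhB.norm (highProb_of_forall ?_)
    filter_upwards [eventually_gt_atTop 0] with N hN ω
    have : 0 < √(N : ℝ) := Real.sqrt_pos.2 (by exact_mod_cast hN)
    rw [norm_smul, Real.norm_of_nonneg this.le, inv_mul_cancel_left₀ this.ne']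
  -- the linear term
  have t1 : SmallInProb μ fun (N : ℕ) ω =>
      (avg Z (fun z => ρ z • s z) N ω - L) (√(N : ℝ) • h N ω) :=
    SmallInProb.of_norm_le_mul (hs.lln hρs hρsi).norm hhB.norm
      (highProb_of_forall (Eventually.of_forall fun N ω => ContinuousLinearMap.le_opNorm _ _))
  have t2 : SmallInProb μ fun (N : ℕ) ω =>
      L (√(N : ℝ) • h N ω - √(N : ℝ) • avg Z κ N ω) :=
    SmallInProb.of_norm_le_mul hest.small.norm (bddInProb_const ‖L‖)
      (highProb_of_forall (Eventually.of_forall fun N ω => by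
        rw [mul_comm]; exact L.le_opNorm _))
  -- the remainders
  have t3 := hs.small_sqrt_mul_sq_mul_avg hb hb0 hb3 hρ hbρ hhB
  have t4 : SmallInProb μ fun (N : ℕ) ω =>
      ‖g N ω‖ * (‖√(N : ℝ) • h N ω‖ * avg Z (fun z => b z * ‖q z‖) N ω) :=
    hg.norm.mul_bdd (hhB.norm.mul (hs.bddInProb_avg (hb.mul hq.norm) hbq))
  have t34 := (t3.add t4).add (t3.add t4)
  -- All exponents in the sample are at most one with high probability, so the Taylor bounds for the
  -- exponential apply to every term at once.
  have hmaxu : HighProb μ fun N ω => ∀ i < N, b (Z i ω) * ‖h N ω‖ ≤ 1 := by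
    refine hhB.highProb fun C => ?_
    refine (hs.max_small hb hb0 hb3 (δ := 1 / (|C| + 1)) (by positivity)).imp
      fun N ω hmax hle i hi => ?_
    rw [norm_smul, Real.norm_of_nonneg (Real.sqrt_nonneg _)] at hle
    calc b (Z i ω) * ‖h N ω‖ ≤ 1 / (|C| + 1) * √(N : ℝ) * ‖h N ω‖ :=
          mul_le_mul_of_nonneg_right (hmax i hi) (norm_nonneg _)
      _ = 1 / (|C| + 1) * (√(N : ℝ) * ‖h N ω‖) := by ring
      _ ≤ 1 / (|C| + 1) * (|C| + 1) := by
          refine mul_le_mul_of_nonneg_left ?_ (by positivity)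
          linarith [le_abs_self C]
      _ = 1 := by field_simp
  -- After removal of the first order term `-ρ s(h)`, the part with `ρ` is quadratic in `h`, and the
  -- part with `q` is of order `‖h‖ ‖g‖` with `g` tending to zero.
  have t5 : SmallInProb μ fun (N : ℕ) ω => √(N : ℝ) * avg Z (fun z =>
      (Real.exp (-u z (est N ω)) - 1) * (ρ z - q z (g N ω)) + ρ z * s z (h N ω)) N ω := by
    refine SmallInProb.of_norm_le t34 ((hmaxu.and (hsmall r hr)).imp fun N ω ⟨hm, hball⟩ => ?_)
    have hs0 := Real.sqrt_nonneg (N : ℝ)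
    have key : ‖avg Z (fun z =>
        (Real.exp (-u z (est N ω)) - 1) * (ρ z - q z (g N ω)) + ρ z * s z (h N ω)) N ω‖ ≤
        avg Z (fun z => (2 * ‖h N ω‖ ^ 2) * (b z ^ 2 * |ρ z|)
          + (2 * (‖g N ω‖ * ‖h N ω‖)) * (b z * ‖q z‖)) N ω := by
      refine norm_avg_le_of fun i hi => ?_
      have hu1 := hu₁ (Z i ω) (est N ω) hball
      have hu2 := hu₂ (Z i ω) (est N ω) hball
      have hule := hu1.trans (hm i hi)
      have e1 := abs_exp_neg_sub_one_le hule
      have e2 := abs_exp_neg_sub_one_add_le hule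
      set z := Z i ω
      set U := u z (est N ω)
      have e3 : |Real.exp (-U) - 1 + s z (h N ω)| ≤ 2 * (b z ^ 2 * ‖h N ω‖ ^ 2) := by
        have hU2 : U ^ 2 ≤ b z ^ 2 * ‖h N ω‖ ^ 2 := by
          rw [← sq_abs, ← mul_pow]
          exact pow_le_pow_left₀ (abs_nonneg _) hu1 2
        calc |Real.exp (-U) - 1 + s z (h N ω)|
            = |(Real.exp (-U) - 1 + U) - (U - s z (h N ω))| := by congr 1; ring
          _ ≤ |Real.exp (-U) - 1 + U| + |U - s z (h N ω)| := abs_sub _ _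
          _ ≤ 2 * (b z ^ 2 * ‖h N ω‖ ^ 2) := by linarith
      have e4 : |q z (g N ω)| ≤ ‖q z‖ * ‖g N ω‖ := (q z).le_opNorm _
      calc ‖(Real.exp (-U) - 1) * (ρ z - q z (g N ω)) + ρ z * s z (h N ω)‖
          = |(Real.exp (-U) - 1 + s z (h N ω)) * ρ z
              - (Real.exp (-U) - 1) * q z (g N ω)| := by
            rw [Real.norm_eq_abs]; congr 1; ring
        _ ≤ |Real.exp (-U) - 1 + s z (h N ω)| * |ρ z|
              + |Real.exp (-U) - 1| * |q z (g N ω)| := by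
            rw [← abs_mul, ← abs_mul]; exact abs_sub _ _
        _ ≤ 2 * (b z ^ 2 * ‖h N ω‖ ^ 2) * |ρ z|
              + 2 * (b z * ‖h N ω‖) * (‖q z‖ * ‖g N ω‖) := by
            have hbz := hb0 z
            gcongr
            exact e1.trans (by linarith)
        _ = _ := by ring
    replace key := key.trans_eq (by rw [avg_add, avg_const_mul, avg_const_mul])
    rw [norm_mul, Real.norm_of_nonneg hs0, norm_smul, Real.norm_of_nonneg hs0]
    refine (mul_le_mul_of_nonneg_left key hs0).trans (le_of_eq ?_)
    ring
  have e : ∀ (N : ℕ) ω, √(N : ℝ) * avg Z (fun z =>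
      (Real.exp (-u z (est N ω)) - 1) * (ρ z - q z (g N ω))) N ω
        - √(N : ℝ) * avg Z (fun z => -L (κ z)) N ω =
      √(N : ℝ) * avg Z (fun z => (Real.exp (-u z (est N ω)) - 1) * (ρ z - q z (g N ω))
        + ρ z * s z (h N ω)) N ω
      - (avg Z (fun z => ρ z • s z) N ω - L) (√(N : ℝ) • h N ω)
      - L (√(N : ℝ) • h N ω - √(N : ℝ) • avg Z κ N ω) := by
    intro N ω
    have a1 : avg Z (fun z => ρ z * s z (h N ω)) N ω =
        avg Z (fun z => ρ z • s z) N ω (h N ω) :=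
      avg_clm (ContinuousLinearMap.apply ℝ ℝ (h N ω)) fun z => ρ z • s z
    have a2 : avg Z (fun z => -L (κ z)) N ω = -L (avg Z κ N ω) := avg_clm (-L) κ
    rw [avg_add, a1, a2]
    simp only [sub_apply, map_sub, map_smul, smul_eq_mul]
    ring
  simp only [e]
  exact (t5.sub t1).sub t2

end WeightedExpansion

end

/-! ### The slope in the outcome coefficients -/

section

section Slope

variable {𝒵 Ω F : Type*} [MeasurableSpace 𝒵] [MeasurableSpace Ω] {μ : Measure Ω}
  [IsProbabilityMeasure μ] {P : Measure 𝒵} {Z : ℕ → Ω → 𝒵}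
  [NormedAddCommGroup F] [NormedSpace ℝ F] [FiniteDimensional ℝ F] [MeasurableSpace F]
  [BorelSpace F]

/-- A centred slope makes `√N` times its average tight, so a merely consistent coefficient estimator
has no first order effect. -/
theorem IsSample.slope_centred (hs : IsSample μ P Z) {S : 𝒵 → F →L[ℝ] ℝ} (hS : Measurable S)
    (hS2 : MemLp S 2 P) (hS0 : ∫ z, S z ∂P = 0) {g : ℕ → Ω → F} (hg : SmallInProb μ g) :
    SmallInProb μ fun (N : ℕ) ω => √(N : ℝ) * avg Z S N ω (g N ω) := by
  have hB := hs.bddInProb_sqrt_avg_finiteDimensional hS hS2 hS0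
  refine SmallInProb.of_norm_le_mul hg.norm hB.norm
    (highProb_of_forall (Eventually.of_forall fun N ω => ?_))
  rw [mul_comm ‖g N ω‖]
  exact (√(N : ℝ) • avg Z S N ω).le_opNorm (g N ω)

/-- Without centring, the slope converges to its mean, through which the influence function of the
coefficients is passed. -/
theorem IsSample.slope_linear (hs : IsSample μ P Z) {S : 𝒵 → F →L[ℝ] ℝ} (hS : Measurable S)
    (hSi : Integrable S P) {est : ℕ → Ω → F} {β : F} {κ : 𝒵 → F}
    (hest : IsAsympLinear μ P Z est β κ) :
    SmallInProb μ fun (N : ℕ) ω => √(N : ℝ) * avg Z S N ω (est N ω - β)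
      - √(N : ℝ) * avg Z (fun z => (∫ z, S z ∂P) (κ z)) N ω := by
  set L := ∫ z, S z ∂P with hL
  have hB := hest.bddInProb hs
  have t1 : SmallInProb μ fun (N : ℕ) ω => (avg Z S N ω - L) (√(N : ℝ) • (est N ω - β)) :=
    SmallInProb.of_norm_le_mul (hs.lln hS hSi).norm hB.norm
      (highProb_of_forall (Eventually.of_forall fun N ω => ContinuousLinearMap.le_opNorm _ _))
  have t2 : SmallInProb μ fun (N : ℕ) ω =>
      L (√(N : ℝ) • (est N ω - β) - √(N : ℝ) • avg Z κ N ω) :=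
    SmallInProb.of_norm_le_mul hest.small.norm (bddInProb_const ‖L‖)
      (highProb_of_forall (Eventually.of_forall fun N ω => by
        rw [mul_comm]; exact L.le_opNorm _))
  have e : ∀ (N : ℕ) ω, √(N : ℝ) * avg Z S N ω (est N ω - β)
      - √(N : ℝ) * avg Z (fun z => L (κ z)) N ω =
      (avg Z S N ω - L) (√(N : ℝ) • (est N ω - β))
        + L (√(N : ℝ) • (est N ω - β) - √(N : ℝ) • avg Z κ N ω) := fun N ω => by
    rw [avg_clm L κ]
    simp only [sub_apply, map_sub, map_smul, smul_eq_mul]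
    ring
  simp only [e]
  exact t1.add t2

end Slope

/-! ### The augmented inverse probability weighted term under the working models -/

section ModelAipw

variable {m d : ℕ}

/-- `orModel` as a linear functional of the coefficients. -/
def orModelCLM (a : Treat m) (x : Covar m d) (j : Fin m) : ORCoef d →L[ℝ] ℝ :=
  ∑ i, orRegressor a x j i • ContinuousLinearMap.proj (R := ℝ) (φ := fun _ => ℝ) i

@[simp] theorem orModelCLM_apply (a : Treat m) (x : Covar m d) (j : Fin m) (β : ORCoef d) :
    orModelCLM a x j β = orModel a x β j := by
  simp [orModelCLM, orModel, sum_apply]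

theorem norm_orModelCLM_le (m d : ℕ) : ∃ C > 0, ∀ (a : Treat m) (x : Covar m d) (j : Fin m),
    ‖orModelCLM a x j‖ ≤ C * (1 + covarNorm x) := by
  refine ⟨Fintype.card (Fin 3 ⊕ Fin d ⊕ Fin d) * (m + 1), by simp; positivity, fun a x j => ?_⟩
  refine (norm_sum_le _ _).trans ?_
  have h : ∀ i ∈ (Finset.univ : Finset (Fin 3 ⊕ Fin d ⊕ Fin d)), ‖orRegressor a x j i •
      ContinuousLinearMap.proj (R := ℝ) (φ := fun _ : Fin 3 ⊕ Fin d ⊕ Fin d => ℝ) i‖ ≤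
        (m + 1) * (1 + covarNorm x) := fun i _ => by
    rw [norm_smul]
    refine le_trans ?_ (abs_orRegressor_le a x j i)
    refine mul_le_of_le_one_right (norm_nonneg _) ?_
    refine ContinuousLinearMap.opNorm_le_bound _ zero_le_one fun v => ?_
    rw [one_mul]
    exact norm_le_pi_norm v i
  refine (Finset.sum_le_card_nsmul _ _ _ h).trans (le_of_eq ?_)
  rw [nsmul_eq_mul, Finset.card_univ, mul_assoc]

theorem measurable_orModelCLM (a : Treat m) (j : Fin m) :
    Measurable fun x : Covar m d => orModelCLM a x j :=
  Finset.measurable_fun_sum _ fun i _ =>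
    (continuous_orRegressor a j i).measurable.smul_const _

/-- The inverse probability weighted residual term. -/
def ipwResid (w : Treat m → Covar m d → Fin m → ℝ) (ν : PSParam d) (β : ORCoef d) (o : Obs m d) :
    ℝ := (psModel o.2.1 o.2.2 ν)⁻¹ * ∑ j, w o.2.1 o.2.2 j * orResid o β j

/-- Minus the slope of `ipwResid` in `β`. -/
def ipwSlope (w : Treat m → Covar m d → Fin m → ℝ) (ν : PSParam d) (o : Obs m d) :
    ORCoef d →L[ℝ] ℝ :=
  (psModel o.2.1 o.2.2 ν)⁻¹ • ∑ j, w o.2.1 o.2.2 j • orModelCLM o.2.1 o.2.2 j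

/-- Slope of the regression term in `β`. -/
def regSlope (w : Treat m → Covar m d → Fin m → ℝ) (x : Covar m d) : ORCoef d →L[ℝ] ℝ :=
  ∑ a, ∑ j, w a x j • orModelCLM a x j

/-- The augmented inverse probability weighted term under the working models. -/
def modelAipw (w : Treat m → Covar m d → Fin m → ℝ) (ν : PSParam d) (β : ORCoef d) : Obs m d → ℝ :=
  aipw w (fun a o => psModel a o.2.2 ν) fun a j o => orModel a o.2.2 β j

theorem modelAipw_eq (w : Treat m → Covar m d → Fin m → ℝ) (ν : PSParam d) (β : ORCoef d)
    (o : Obs m d) : modelAipw w ν β o = ipwResid w ν β o + regSlope w o.2.2 β := by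
  simp only [modelAipw, aipw, ipwResid, regSlope, sum_apply, smul_apply, orModelCLM_apply,
    smul_eq_mul, div_eq_inv_mul]
  rfl

theorem ipwResid_eq (w : Treat m → Covar m d → Fin m → ℝ) (ν : PSParam d) (β β₀ : ORCoef d)
    (o : Obs m d) : ipwResid w ν β o = ipwResid w ν β₀ o - ipwSlope w ν o (β - β₀) := by
  simp only [ipwResid, ipwSlope, sum_apply, smul_apply, smul_eq_mul, ← mul_sub,
    ← Finset.sum_sub_distrib, map_sub, orModelCLM_apply, orResid]
  congr 1
  exact Finset.sum_congr rfl fun j _ => by ring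

/-- The ratio of propensity scores is written as an exponential of a log-likelihood difference, and
dependence on the coefficients is affine. This isolates the joint effect of both errors from a slope
that does not involve the error in `ν`. -/
theorem modelAipw_sub (w : Treat m → Covar m d → Fin m → ℝ) (ν ν₀ : PSParam d) (β β₀ : ORCoef d)
    (o : Obs m d) : modelAipw w ν β o = modelAipw w ν₀ β₀ o
      + (Real.exp (-(Real.log (psModel o.2.1 o.2.2 ν) - Real.log (psModel o.2.1 o.2.2 ν₀))) - 1)
        * (ipwResid w ν₀ β₀ o - ipwSlope w ν₀ o (β - β₀))
      + (regSlope w o.2.2 - ipwSlope w ν₀ o) (β - β₀) := by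
  have h1 := psModel_pos o.2.1 o.2.2 ν
  have h0 := psModel_pos o.2.1 o.2.2 ν₀
  rw [neg_sub, Real.exp_sub, Real.exp_log h0, Real.exp_log h1, ← ipwResid_eq, modelAipw_eq,
    modelAipw_eq, sub_apply, map_sub, ipwResid_eq w ν₀ β β₀ o]
  have h2 : ipwResid w ν β o = psModel o.2.1 o.2.2 ν₀ / psModel o.2.1 o.2.2 ν *
      ipwResid w ν₀ β o := by
    simp only [ipwResid]; field_simp
  rw [h2, ipwResid_eq w ν₀ β β₀ o]
  ring

theorem measurable_weight {w : Treat m → Covar m d → Fin m → ℝ}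
    (hw : ∀ a j, Measurable fun x => w a x j) (j : Fin m) :
    Measurable fun o : Obs m d => w o.2.1 o.2.2 j :=
  measurable_treat (f := fun a x => w a x j) fun a => hw a j

theorem measurable_psModel_obs (ν : PSParam d) :
    Measurable fun o : Obs m d => psModel o.2.1 o.2.2 ν :=
  measurable_treat (f := fun a x => psModel a x ν) fun a =>
    (measurable_psModel a).comp (measurable_id.prodMk measurable_const)

theorem measurable_orModel_obs (β : ORCoef d) (j : Fin m) :
    Measurable fun o : Obs m d => orModel o.2.1 o.2.2 β j :=
  measurable_treat (f := fun a x => orModel a x β j) fun a => measurable_orModel β a j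

theorem measurable_ipwResid {w : Treat m → Covar m d → Fin m → ℝ}
    (hw : ∀ a j, Measurable fun x => w a x j) (ν : PSParam d) (β : ORCoef d) :
    Measurable (ipwResid w ν β) :=
  (measurable_psModel_obs ν).inv.mul (Finset.measurable_fun_sum _ fun j _ =>
    (measurable_weight hw j).mul ((measurable_outcome j).sub (measurable_orModel_obs β j)))

theorem measurable_ipwSlope {w : Treat m → Covar m d → Fin m → ℝ}
    (hw : ∀ a j, Measurable fun x => w a x j) (ν : PSParam d) :
    Measurable (ipwSlope w ν : Obs m d → _) := by
  refine (measurable_psModel_obs ν).inv.smul (Finset.measurable_fun_sum _ fun j _ =>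
    (measurable_weight hw j).smul ?_)
  exact measurable_treat (f := fun a x => orModelCLM a x j) fun a => measurable_orModelCLM a j

theorem measurable_regSlope {w : Treat m → Covar m d → Fin m → ℝ}
    (hw : ∀ a j, Measurable fun x => w a x j) : Measurable (regSlope w) :=
  Finset.measurable_fun_sum _ fun a _ => Finset.measurable_fun_sum _ fun j _ =>
    (hw a j).smul (measurable_orModelCLM a j)

variable {P : Measure (Obs m d)} [IsProbabilityMeasure P]

/-- The working propensity score is bounded away from zero. -/
def ModelOverlap (P : Measure (Obs m d)) (ν : PSParam d) : Prop :=
  ∃ c > 0, ∀ a, ∀ᵐ o ∂P, c < psModel a o.2.2 ν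

theorem ModelOverlap.exists_inv_le {ν : PSParam d} (h : ModelOverlap P ν) :
    ∃ C > 0, ∀ᵐ o ∂P, ∀ a, (psModel a o.2.2 ν)⁻¹ ≤ C := by
  obtain ⟨c, hc, h⟩ := h
  refine ⟨c⁻¹, by positivity, ?_⟩
  filter_upwards [ae_all_iff.2 h] with o ho a
  exact inv_anti₀ hc (ho a).le

theorem memLp_orModel (h3 : Integrable (fun o : Obs m d => covarNorm o.2.2 ^ 3) P) (β : ORCoef d)
    (j : Fin m) : MemLp (fun o : Obs m d => orModel o.2.1 o.2.2 β j) 2 P :=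
  memLp_finsetSum _ fun i _ => (memLp_orRegressor h3 j i).mul_const (β i)

theorem memLp_orResid (hP : IsRegularLaw P)
    (h3 : Integrable (fun o : Obs m d => covarNorm o.2.2 ^ 3) P) (β : ORCoef d) (j : Fin m) :
    MemLp (fun o : Obs m d => orResid o β j) 2 P :=
  (hP.memLp j).sub (memLp_orModel h3 β j)

variable {w : Treat m → Covar m d → Fin m → ℝ}

theorem memLp_ipwResid (hw : ∀ a j, Measurable fun x => w a x j) {C : ℝ}
    (hC : ∀ a x j, |w a x j| ≤ C) (hP : IsRegularLaw P)
    (h3 : Integrable (fun o : Obs m d => covarNorm o.2.2 ^ 3) P) {ν : PSParam d}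
    (hov : ModelOverlap P ν) (β : ORCoef d) : MemLp (ipwResid w ν β) 2 P := by
  obtain ⟨B, hB, hBle⟩ := hov.exists_inv_le
  have h1 : MemLp (fun o : Obs m d => B * ∑ j, C * |orResid o β j|) 2 P :=
    (memLp_finsetSum _ fun j _ => (memLp_orResid hP h3 β j).abs.const_mul C).const_mul B
  refine h1.of_le (measurable_ipwResid hw ν β).aestronglyMeasurable ?_
  filter_upwards [hBle] with o ho
  refine le_trans ?_ (le_abs_self _)
  rw [ipwResid, norm_mul, Real.norm_of_nonneg (inv_nonneg.2 (psModel_pos _ _ _).le)]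
  refine mul_le_mul (ho _) ?_ (norm_nonneg _) hB.le
  refine (norm_sum_le _ _).trans (Finset.sum_le_sum fun j _ => ?_)
  rw [norm_mul]
  exact mul_le_mul_of_nonneg_right (hC _ _ j) (abs_nonneg _)

theorem exists_norm_ipwSlope_le {C : ℝ}
    (hC : ∀ a x j, |w a x j| ≤ C) {ν : PSParam d} (hov : ModelOverlap P ν) :
    ∃ B > 0, ∀ᵐ o ∂P, ‖ipwSlope w ν o‖ ≤ B * (1 + covarNorm o.2.2) := by
  obtain ⟨B, hB, hBle⟩ := hov.exists_inv_le
  obtain ⟨D, hD, hDle⟩ := norm_orModelCLM_le m d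
  have hCa : ∀ a x j, |w a x j| ≤ |C| := fun a x j => (hC a x j).trans (le_abs_self C)
  refine ⟨B * (m * (|C| * D)) + 1, by positivity, ?_⟩
  filter_upwards [hBle] with o ho
  have hx := covarNorm_nonneg o.2.2
  rw [ipwSlope, norm_smul, Real.norm_of_nonneg (inv_nonneg.2 (psModel_pos _ _ _).le)]
  have h1 : ‖∑ j, w o.2.1 o.2.2 j • orModelCLM o.2.1 o.2.2 j‖ ≤
      m * (|C| * (D * (1 + covarNorm o.2.2))) := by
    refine (norm_sum_le _ _).trans ((Finset.sum_le_card_nsmul _ _ _ fun j _ => ?_).trans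
      (le_of_eq (by rw [nsmul_eq_mul, Finset.card_univ, Fintype.card_fin])))
    rw [norm_smul]
    exact mul_le_mul (hCa _ _ j) (hDle _ _ j) (norm_nonneg _) (abs_nonneg _)
  refine (mul_le_mul (ho _) h1 (norm_nonneg _) hB.le).trans ?_
  nlinarith

theorem exists_norm_regSlope_le {C : ℝ} (hC : ∀ a x j, |w a x j| ≤ C) :
    ∃ B > 0, ∀ x, ‖regSlope w x‖ ≤ B * (1 + covarNorm x) := by
  obtain ⟨D, hD, hDle⟩ := norm_orModelCLM_le m d
  have hCa : ∀ a x j, |w a x j| ≤ |C| := fun a x j => (hC a x j).trans (le_abs_self C)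
  refine ⟨Fintype.card (Treat m) * (m * (|C| * D)) + 1, by positivity, fun x => ?_⟩
  have hx := covarNorm_nonneg x
  have h1 : ‖regSlope w x‖ ≤
      Fintype.card (Treat m) * (m * (|C| * (D * (1 + covarNorm x)))) := by
    refine (norm_sum_le _ _).trans ((Finset.sum_le_card_nsmul _ _ _ fun a _ => ?_).trans
      (le_of_eq (by rw [nsmul_eq_mul, Finset.card_univ])))
    refine (norm_sum_le _ _).trans ((Finset.sum_le_card_nsmul _ _ _ fun j _ => ?_).trans
      (le_of_eq (by rw [nsmul_eq_mul, Finset.card_univ, Fintype.card_fin])))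
    rw [norm_smul]
    exact mul_le_mul (hCa _ _ j) (hDle _ _ j) (norm_nonneg _) (abs_nonneg _)
  refine h1.trans ?_
  nlinarith

theorem memLp_regSlope_sub_ipwSlope (hw : ∀ a j, Measurable fun x => w a x j) {C : ℝ}
    (hC : ∀ a x j, |w a x j| ≤ C)
    (h3 : Integrable (fun o : Obs m d => covarNorm o.2.2 ^ 3) P) {ν : PSParam d}
    (hov : ModelOverlap P ν) :
    MemLp (fun o : Obs m d => regSlope w o.2.2 - ipwSlope w ν o) 2 P := by
  obtain ⟨B, hB, hBle⟩ := exists_norm_ipwSlope_le hC hov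
  obtain ⟨B', hB', hBle'⟩ := exists_norm_regSlope_le hC
  refine ((memLp_one_add_covarNorm h3).const_mul (B' + B)).of_le
    (((measurable_regSlope hw).comp measurable_snd.snd).sub
      (measurable_ipwSlope hw ν)).aestronglyMeasurable ?_
  filter_upwards [hBle] with o ho
  refine le_trans ?_ (le_abs_self _)
  rw [add_mul]
  exact (norm_sub_le _ _).trans (add_le_add (hBle' _) ho)

theorem memLp_modelAipw (hw : ∀ a j, Measurable fun x => w a x j) {C : ℝ}
    (hC : ∀ a x j, |w a x j| ≤ C) (hP : IsRegularLaw P)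
    (h3 : Integrable (fun o : Obs m d => covarNorm o.2.2 ^ 3) P) {ν : PSParam d}
    (hov : ModelOverlap P ν) (β : ORCoef d) : MemLp (modelAipw w ν β) 2 P := by
  obtain ⟨B', hB', hBle'⟩ := exists_norm_regSlope_le hC
  have h1 : MemLp (fun o : Obs m d => regSlope w o.2.2 β) 2 P := by
    refine ((memLp_one_add_covarNorm h3).const_mul (B' * ‖β‖)).of_le
      (((measurable_regSlope hw).comp measurable_snd.snd).apply_continuousLinearMap
        β).aestronglyMeasurable (Eventually.of_forall fun o => ?_)
    refine le_trans ?_ (le_abs_self _)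
    refine ((regSlope w o.2.2).le_opNorm β).trans ?_
    rw [mul_right_comm]
    exact mul_le_mul_of_nonneg_right (hBle' _) (norm_nonneg _)
  have h2 := (memLp_ipwResid hw hC hP h3 hov β).add h1
  exact h2.congr_norm (by
    have : modelAipw w ν β = fun o => ipwResid w ν β o + regSlope w o.2.2 β :=
      funext fun o => modelAipw_eq w ν β o
    rw [this]; exact h2.1) (Eventually.of_forall fun o => by rw [modelAipw_eq]; rfl)

theorem measurable_modelAipw (hw : ∀ a j, Measurable fun x => w a x j) (ν : PSParam d)
    (β : ORCoef d) : Measurable (modelAipw w ν β) := by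
  have : modelAipw w ν β = fun o => ipwResid w ν β o + regSlope w o.2.2 β :=
    funext fun o => modelAipw_eq w ν β o
  rw [this]
  exact (measurable_ipwResid hw ν β).add
    (((measurable_regSlope hw).comp measurable_snd.snd).apply_continuousLinearMap β)

/-- Second order expansion of the log propensity score. -/
theorem log_psModel_expansion {ν₀ : PSParam d} (h₀ : 0 < ν₀.precision) :
    ∃ C > 0, ∃ r > 0, ∀ (a : Treat m) (x : Covar m d), ‖psGrad a x ν₀‖ ≤ C * (1 + covarNorm x) ∧
      ∀ ν, ‖ν - ν₀‖ < r →
      |Real.log (psModel a x ν) - Real.log (psModel a x ν₀)| ≤ C * (1 + covarNorm x) * ‖ν - ν₀‖ ∧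
      |Real.log (psModel a x ν) - Real.log (psModel a x ν₀) - psGrad a x ν₀ (ν - ν₀)| ≤
        (C * (1 + covarNorm x)) ^ 2 * ‖ν - ν₀‖ ^ 2 := by
  -- With half the precision as radius, the precision stays above `lam₀` throughout the ball.
  set lam₀ := ν₀.precision / 2 with hlam
  have hlam₀ : 0 < lam₀ := by positivity
  obtain ⟨C, hC, hbd⟩ := psGrad_psHess_bounds m d hlam₀
  refine ⟨C + 1, by positivity, lam₀, hlam₀, fun a x => ?_⟩
  have hx := covarNorm_nonneg x
  have hν₀ : lam₀ ≤ ν₀.precision := by rw [hlam]; linarith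
  have hCx : C * (1 + covarNorm x) ≤ (C + 1) * (1 + covarNorm x) := by nlinarith
  refine ⟨((hbd a x ν₀ hν₀).1).trans hCx, fun ν hν => ?_⟩
  have hconv : Convex ℝ {ν : PSParam d | lam₀ ≤ ν.precision} :=
    convex_halfSpace_ge (precisionCLM d).isLinear lam₀
  have hνm : lam₀ ≤ ν.precision := by
    have h1 : |ν.precision - ν₀.precision| ≤ ‖ν - ν₀‖ := norm_le_pi_norm (ν - ν₀) (Sum.inr ())
    have := neg_le_of_abs_le h1
    linarith
  constructor
  · refine (hconv.norm_image_sub_le_of_norm_hasFDerivWithin_le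
      (f := fun ν => Real.log (psModel a x ν)) (C := C * (1 + covarNorm x))
      (fun ν hν => (hasFDerivAt_log_psModel a x (hlam₀.trans_le hν)).hasFDerivWithinAt)
      (fun ν hν => (hbd a x ν hν).1) hν₀ hνm).trans ?_
    exact mul_le_mul_of_nonneg_right hCx (norm_nonneg _)
  -- On this closed ball the gradient differs from its value at `ν₀` by at most the Hessian bound
  -- times `‖ν - ν₀‖`, which yields the quadratic error.
  · have hconv' := hconv.inter (convex_closedBall ν₀ ‖ν - ν₀‖)
    have hgrad : ∀ ν' : PSParam d, lam₀ ≤ ν'.precision → ‖psGrad a x ν' - psGrad a x ν₀‖ ≤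
        C * (1 + covarNorm x) ^ 2 * ‖ν' - ν₀‖ := fun ν' hν' =>
      hconv.norm_image_sub_le_of_norm_hasFDerivWithin_le
        (fun ν hν => (hasFDerivAt_psGrad a x (hlam₀.trans_le hν)).hasFDerivWithinAt)
        (fun ν hν => (hbd a x ν hν).2) hν₀ hν'
    refine (hconv'.norm_image_sub_le_of_norm_hasFDerivWithin_le'
      (f := fun ν => Real.log (psModel a x ν)) (φ := psGrad a x ν₀)
      (C := C * (1 + covarNorm x) ^ 2 * ‖ν - ν₀‖)
      (fun ν hν => (hasFDerivAt_log_psModel a x (hlam₀.trans_le hν.1)).hasFDerivWithinAt)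
      (fun ν' hν' => (hgrad ν' hν'.1).trans ?_) ⟨hν₀, by simp⟩
      ⟨hνm, by simp [dist_eq_norm]⟩).trans ?_
    · refine mul_le_mul_of_nonneg_left ?_ (by positivity)
      simpa [dist_eq_norm] using hν'.2
    · rw [mul_assoc, ← sq]
      refine mul_le_mul_of_nonneg_right ?_ (by positivity)
      rw [mul_pow]
      refine mul_le_mul_of_nonneg_right ?_ (by positivity)
      nlinarith

end ModelAipw

end

/-! ### Population moments of the augmented inverse probability weighted term -/

section

section Moments

variable {m d : ℕ} {P : Measure (Obs m d)} [IsProbabilityMeasure P]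
  {w : Treat m → Covar m d → Fin m → ℝ}

theorem memLp_orModel_covar (h3 : Integrable (fun o : Obs m d => covarNorm o.2.2 ^ 3) P)
    (a : Treat m) (β : ORCoef d) (j : Fin m) :
    MemLp (fun o : Obs m d => orModel a o.2.2 β j) 2 P := by
  refine memLp_finsetSum _ fun i _ => MemLp.mul_const ?_ (β i)
  exact ((memLp_one_add_covarNorm h3).const_mul (m + 1 : ℝ)).of_le
    ((continuous_orRegressor a j i).measurable.comp measurable_snd.snd).aestronglyMeasurable
    (Eventually.of_forall fun o => (abs_orRegressor_le a o.2.2 j i).trans (le_abs_self _))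

theorem integrable_ind_resid (hP : IsRegularLaw P)
    (h3 : Integrable (fun o : Obs m d => covarNorm o.2.2 ^ 3) P) (a : Treat m) (j : Fin m)
    (β : ORCoef d) {h : Covar m d → ℝ} (hh2 : MemLp (fun o : Obs m d => h o.2.2) 2 P) :
    Integrable (fun o => ind a o * ((o.1 j - orModel a o.2.2 β j) * h o.2.2)) P :=
  integrable_ind_mul (((hP.memLp j).sub (memLp_orModel_covar h3 a β j)).integrable_mul hh2) a

theorem integral_ind_resid (hP : IsRegularLaw P)
    (h3 : Integrable (fun o : Obs m d => covarNorm o.2.2 ^ 3) P) (a : Treat m) (j : Fin m)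
    (β : ORCoef d) {h : Covar m d → ℝ} (hh : Measurable h)
    (hh2 : MemLp (fun o : Obs m d => h o.2.2) 2 P) :
    ∫ o, ind a o * ((o.1 j - orModel a o.2.2 β j) * h o.2.2) ∂P =
      ∫ o, propensity P a o * ((outcomeReg P a j o - orModel a o.2.2 β j) * h o.2.2) ∂P := by
  have hY : Integrable (fun o : Obs m d => ind a o * o.1 j * h o.2.2) P :=
    (integrable_ind_mul ((hP.memLp j).integrable_mul hh2) a).congr
      (Eventually.of_forall fun o => by simp only [Pi.mul_apply]; ring)
  have hg : Integrable (fun o : Obs m d => ind a o * outcomeReg P a j o * h o.2.2) P :=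
    (integrable_ind_mul ((hP.memLp_outcomeReg a j).integrable_mul hh2) a).congr
      (Eventually.of_forall fun o => by simp only [Pi.mul_apply]; ring)
  have hr : Integrable (fun o : Obs m d =>
      ind a o * ((outcomeReg P a j o - orModel a o.2.2 β j) * h o.2.2)) P :=
    integrable_ind_mul
      (((hP.memLp_outcomeReg a j).sub (memLp_orModel_covar h3 a β j)).integrable_mul hh2) a
  have hres : Integrable (fun o : Obs m d =>
      ind a o * (o.1 j - outcomeReg P a j o) * h o.2.2) P :=
    (hY.sub hg).congr (Eventually.of_forall fun o => by simp only [Pi.sub_apply]; ring)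
  have e : ∀ o : Obs m d, ind a o * ((o.1 j - orModel a o.2.2 β j) * h o.2.2) =
      ind a o * (o.1 j - outcomeReg P a j o) * h o.2.2
        + ind a o * ((outcomeReg P a j o - orModel a o.2.2 β j) * h o.2.2) := fun o => by ring
  simp only [e]
  rw [integral_add hres hr, hP.integral_ind_mul_resid (stronglyMeasurable_covar hh) hY hg, zero_add]
  exact integral_ind_mul (((stronglyMeasurable_outcomeReg a j).sub
    (stronglyMeasurable_covar (measurable_orModel β a j))).mul (stronglyMeasurable_covar hh)) hr

theorem ipwResid_eq_sum (ν : PSParam d) (β : ORCoef d) (o : Obs m d) :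
    ipwResid w ν β o = ∑ a, ∑ j, ind a o *
      ((o.1 j - orModel a o.2.2 β j) * ((psModel a o.2.2 ν)⁻¹ * w a o.2.2 j)) := by
  simp only [← Finset.mul_sum]
  rw [sum_ind_mul (fun a => ∑ j, (o.1 j - orModel a o.2.2 β j) *
    ((psModel a o.2.2 ν)⁻¹ * w a o.2.2 j)), ipwResid, Finset.mul_sum]
  exact Finset.sum_congr rfl fun j _ => by rw [orResid]; ring

theorem memLp_inv_psModel_mul_weight (hw : ∀ a j, Measurable fun x => w a x j) {C : ℝ}
    (hC : ∀ a x j, |w a x j| ≤ C) {ν : PSParam d} (hov : ModelOverlap P ν) (a : Treat m)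
    (j : Fin m) {f : Obs m d → ℝ} (hf : MemLp f 2 P) :
    MemLp (fun o : Obs m d => (psModel a o.2.2 ν)⁻¹ * w a o.2.2 j * f o) 2 P := by
  obtain ⟨B, hB, hBle⟩ := hov.exists_inv_le
  refine (hf.const_mul (B * C)).of_le ((((measurable_psModel a).comp
    (measurable_snd.snd.prodMk measurable_const)).inv.mul
      ((hw a j).comp measurable_snd.snd)).aestronglyMeasurable.mul hf.1) ?_
  have hC0 : 0 ≤ C := (abs_nonneg _).trans (hC a 0 j)
  filter_upwards [hBle] with o ho
  rw [norm_mul, norm_mul, norm_mul, Real.norm_of_nonneg (inv_nonneg.2 (psModel_pos _ _ _).le),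
    Real.norm_of_nonneg (mul_nonneg hB.le hC0)]
  exact mul_le_mul_of_nonneg_right (mul_le_mul (ho a) (hC a _ j) (abs_nonneg _) hB.le)
    (norm_nonneg _)

theorem memLp_inv_psModel_mul_weight' (hw : ∀ a j, Measurable fun x => w a x j) {C : ℝ}
    (hC : ∀ a x j, |w a x j| ≤ C) {ν : PSParam d} (hov : ModelOverlap P ν) (a : Treat m)
    (j : Fin m) : MemLp (fun o : Obs m d => (psModel a o.2.2 ν)⁻¹ * w a o.2.2 j) 2 P := by
  simpa using memLp_inv_psModel_mul_weight hw hC hov a j (memLp_const (1 : ℝ))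

theorem measurable_inv_psModel_mul_weight (hw : ∀ a j, Measurable fun x => w a x j)
    (ν : PSParam d) (a : Treat m) (j : Fin m) :
    Measurable fun x : Covar m d => (psModel a x ν)⁻¹ * w a x j :=
  ((measurable_psModel a).comp (measurable_id.prodMk measurable_const)).inv.mul (hw a j)

theorem integrable_weight_mul (hw : ∀ a j, Measurable fun x => w a x j) {C : ℝ}
    (hC : ∀ a x j, |w a x j| ≤ C) (a : Treat m) (j : Fin m) {f : Obs m d → ℝ}
    (hf : Integrable f P) : Integrable (fun o : Obs m d => w a o.2.2 j * f o) P :=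
  hf.bdd_mul ((hw a j).comp measurable_snd.snd).aestronglyMeasurable
    (Eventually.of_forall fun o => hC a o.2.2 j)

/-- Both robustness cases are visible here: the factor `propensity * psModel⁻¹` is one if the
propensity model is right, and the difference of regressions is zero if the outcome model is right.
Either way the sum becomes the estimand. -/
theorem integral_modelAipw_eq (hw : ∀ a j, Measurable fun x => w a x j) {C : ℝ}
    (hC : ∀ a x j, |w a x j| ≤ C) (hP : IsRegularLaw P)
    (h3 : Integrable (fun o : Obs m d => covarNorm o.2.2 ^ 3) P) {ν : PSParam d}
    (hov : ModelOverlap P ν) (β : ORCoef d) :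
    ∫ o, modelAipw w ν β o ∂P =
      ∑ a, ∑ j, (∫ o, propensity P a o * ((outcomeReg P a j o - orModel a o.2.2 β j) *
        ((psModel a o.2.2 ν)⁻¹ * w a o.2.2 j)) ∂P + ∫ o, w a o.2.2 j * orModel a o.2.2 β j ∂P) := by
  have e : ∀ o : Obs m d, modelAipw w ν β o = ∑ a, ∑ j, (ind a o *
      ((o.1 j - orModel a o.2.2 β j) * ((psModel a o.2.2 ν)⁻¹ * w a o.2.2 j))
        + w a o.2.2 j * orModel a o.2.2 β j) := fun o => by
    rw [modelAipw_eq, ipwResid_eq_sum]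
    simp only [regSlope, sum_apply, smul_apply, orModelCLM_apply, smul_eq_mul,
      Finset.sum_add_distrib]
  have h1 := fun a j => integrable_ind_resid hP h3 a j β
    (h := fun x => (psModel a x ν)⁻¹ * w a x j) (memLp_inv_psModel_mul_weight' hw hC hov a j)
  have h2 : ∀ a j, Integrable (fun o : Obs m d => w a o.2.2 j * orModel a o.2.2 β j) P :=
    fun a j => integrable_weight_mul hw hC a j
      ((memLp_orModel_covar h3 a β j).integrable (by norm_num))
  have h12 : ∀ a j, Integrable (fun o : Obs m d => ind a o *
      ((o.1 j - orModel a o.2.2 β j) * ((psModel a o.2.2 ν)⁻¹ * w a o.2.2 j))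
        + w a o.2.2 j * orModel a o.2.2 β j) P := fun a j => (h1 a j).add (h2 a j)
  simp only [e]
  rw [integral_finsetSum _ fun a _ => integrable_finsetSum _ fun j _ => h12 a j]
  refine Finset.sum_congr rfl fun a _ => ?_
  rw [integral_finsetSum _ fun j _ => h12 a j]
  refine Finset.sum_congr rfl fun j _ => ?_
  rw [integral_add (h1 a j) (h2 a j), integral_ind_resid hP h3 a j β
    (measurable_inv_psModel_mul_weight hw ν a j) (memLp_inv_psModel_mul_weight' hw hC hov a j)]

theorem thetaObs_eq_sum (hw : ∀ a j, Measurable fun x => w a x j) {C : ℝ}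
    (hC : ∀ a x j, |w a x j| ≤ C) (hP : IsRegularLaw P) :
    thetaObs w P = ∑ a, ∑ j, ∫ o, w a o.2.2 j * outcomeReg P a j o ∂P :=
  Finset.sum_congr rfl fun a _ => integral_finsetSum _ fun j _ =>
    integrable_weight_mul hw hC a j ((hP.memLp_outcomeReg a j).integrable (by norm_num))

theorem integral_modelAipw_of_psCorrect (hw : ∀ a j, Measurable fun x => w a x j) {C : ℝ}
    (hC : ∀ a x j, |w a x j| ≤ C) (hP : IsRegularLaw P)
    (h3 : Integrable (fun o : Obs m d => covarNorm o.2.2 ^ 3) P) {ν : PSParam d}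
    (hov : ModelOverlap P ν) (hps : PSCorrect P ν) (β : ORCoef d) :
    ∫ o, modelAipw w ν β o ∂P = thetaObs w P := by
  rw [integral_modelAipw_eq hw hC hP h3 hov, thetaObs_eq_sum hw hC hP]
  refine Finset.sum_congr rfl fun a _ => Finset.sum_congr rfl fun j _ => ?_
  have h1 : Integrable (fun o => w a o.2.2 j * outcomeReg P a j o) P :=
    integrable_weight_mul hw hC a j ((hP.memLp_outcomeReg a j).integrable (by norm_num))
  have h2 : Integrable (fun o : Obs m d => w a o.2.2 j * orModel a o.2.2 β j) P :=
    integrable_weight_mul hw hC a j ((memLp_orModel_covar h3 a β j).integrable (by norm_num))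
  rw [← eq_sub_iff_add_eq, ← integral_sub h1 h2]
  refine integral_congr_ae ?_
  filter_upwards [hps a] with o ho
  have := (psModel_pos a o.2.2 ν).ne'
  rw [ho]; field_simp

theorem integral_modelAipw_of_orCorrect (hw : ∀ a j, Measurable fun x => w a x j) {C : ℝ}
    (hC : ∀ a x j, |w a x j| ≤ C) (hP : IsRegularLaw P)
    (h3 : Integrable (fun o : Obs m d => covarNorm o.2.2 ^ 3) P) {ν : PSParam d}
    (hov : ModelOverlap P ν) {β : ORCoef d}
    (hβ : ∀ a j, ∀ᵐ o ∂P, outcomeReg P a j o = orModel a o.2.2 β j) :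
    ∫ o, modelAipw w ν β o ∂P = thetaObs w P := by
  rw [integral_modelAipw_eq hw hC hP h3 hov, thetaObs_eq_sum hw hC hP]
  refine Finset.sum_congr rfl fun a _ => Finset.sum_congr rfl fun j _ => ?_
  have h1 : ∫ o, propensity P a o * ((outcomeReg P a j o - orModel a o.2.2 β j) *
      ((psModel a o.2.2 ν)⁻¹ * w a o.2.2 j)) ∂P = 0 := by
    refine integral_eq_zero_of_ae ?_
    filter_upwards [hβ a j] with o ho
    simp [ho]
  rw [h1, zero_add]
  refine integral_congr_ae ?_
  filter_upwards [hβ a j] with o ho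
  rw [ho]

/-- Weighting `1(A = a)` by the true inverse propensity score averages to one given `X`, so the
weighted part of the slope has the same mean as the regression part. -/
theorem integral_slope_of_psCorrect (hw : ∀ a j, Measurable fun x => w a x j) {C : ℝ}
    (hC : ∀ a x j, |w a x j| ≤ C)
    (h3 : Integrable (fun o : Obs m d => covarNorm o.2.2 ^ 3) P) {ν : PSParam d}
    (hov : ModelOverlap P ν) (hps : PSCorrect P ν) :
    ∫ o, regSlope w o.2.2 - ipwSlope w ν o ∂P = 0 := by
  have hi := (memLp_regSlope_sub_ipwSlope hw hC h3 hov).integrable (by norm_num)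
  ext v
  rw [ContinuousLinearMap.integral_apply hi, zero_apply]
  have h1 : ∀ a j, Integrable (fun o : Obs m d => w a o.2.2 j * orModel a o.2.2 v j) P :=
    fun a j => integrable_weight_mul hw hC a j
      ((memLp_orModel_covar h3 a v j).integrable (by norm_num))
  have h2 : ∀ a j, Integrable (fun o : Obs m d => ind a o *
      ((psModel a o.2.2 ν)⁻¹ * w a o.2.2 j * orModel a o.2.2 v j)) P := fun a j =>
    integrable_ind_mul ((memLp_inv_psModel_mul_weight hw hC hov a j
      (memLp_orModel_covar h3 a v j)).integrable (by norm_num)) a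
  have e : ∀ o : Obs m d, (regSlope w o.2.2 - ipwSlope w ν o) v = ∑ a, ∑ j,
      (w a o.2.2 j * orModel a o.2.2 v j - ind a o *
        ((psModel a o.2.2 ν)⁻¹ * w a o.2.2 j * orModel a o.2.2 v j)) := fun o => by
    simp only [Finset.sum_sub_distrib, ← Finset.mul_sum]
    rw [sum_ind_mul (fun a => ∑ j, (psModel a o.2.2 ν)⁻¹ * w a o.2.2 j * orModel a o.2.2 v j)]
    simp only [regSlope, ipwSlope, sub_apply, sum_apply, smul_apply, orModelCLM_apply, smul_eq_mul,
      Finset.mul_sum, mul_assoc]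
  have h12 : ∀ a j, Integrable (fun o : Obs m d => w a o.2.2 j * orModel a o.2.2 v j - ind a o *
      ((psModel a o.2.2 ν)⁻¹ * w a o.2.2 j * orModel a o.2.2 v j)) P :=
    fun a j => (h1 a j).sub (h2 a j)
  simp only [e]
  rw [integral_finsetSum _ fun a _ => integrable_finsetSum _ fun j _ => h12 a j]
  refine Finset.sum_eq_zero fun a _ => ?_
  rw [integral_finsetSum _ fun j _ => h12 a j]
  refine Finset.sum_eq_zero fun j _ => ?_
  rw [integral_sub (h1 a j) (h2 a j), sub_eq_zero]
  rw [integral_ind_mul (h := fun o => (psModel a o.2.2 ν)⁻¹ * w a o.2.2 j * orModel a o.2.2 v j)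
    (stronglyMeasurable_covar (f := fun x => (psModel a x ν)⁻¹ * w a x j * orModel a x v j)
      ((measurable_inv_psModel_mul_weight hw ν a j).mul (measurable_orModel v a j))) (h2 a j)]
  refine integral_congr_ae ?_
  filter_upwards [hps a] with o ho
  have := (psModel_pos a o.2.2 ν).ne'
  rw [ho]; field_simp

theorem measurable_apply_of_continuous_prod_subtype {X T F : Type*} [TopologicalSpace X]
    [TopologicalSpace T] [MeasurableSpace X] [OpensMeasurableSpace X] [NormedAddCommGroup F]
    [NormedSpace ℝ F] {q : T → Prop} {f : X → T → F →L[ℝ] ℝ}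
    (h : Continuous fun p : X × {t // q t} => f p.1 p.2.1) {t : T} (ht : q t) (v : F) :
    Measurable fun x => f x t v := by
  have h1 : Continuous fun x => f x t :=
    h.comp (continuous_id.prodMk (continuous_const (y := (⟨t, ht⟩ : {t // q t}))))
  exact (h1.clm_apply continuous_const).measurable

theorem measurable_psGrad_covar_apply {ν : PSParam d} (hν : 0 < ν.precision) (a : Treat m)
    (v : PSParam d) : Measurable fun x : Covar m d => psGrad a x ν v := by
  have := measurable_apply_of_continuous_prod_subtype (continuous_psGrad (d := d) a) hν v
  exact this

theorem integrable_ipwResid_smul_psGrad (hw : ∀ a j, Measurable fun x => w a x j)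
    {C : ℝ} (hC : ∀ a x j, |w a x j| ≤ C) (hP : IsRegularLaw P)
    (h3 : Integrable (fun o : Obs m d => covarNorm o.2.2 ^ 3) P) {ν : PSParam d}
    (hν : 0 < ν.precision) (hov : ModelOverlap P ν) (β : ORCoef d) :
    Integrable (fun o : Obs m d => ipwResid w ν β o • psGrad o.2.1 o.2.2 ν) P := by
  obtain ⟨D, hD, r, -, hbd⟩ := log_psModel_expansion (m := m) hν
  have hbd' := fun (a : Treat m) x => (hbd a x).1
  have h1 := (memLp_ipwResid hw hC hP h3 hov β).norm.integrable_mul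
    ((memLp_one_add_covarNorm h3).const_mul D)
  refine h1.mono' ((measurable_ipwResid hw ν β).smul (measurable_psGrad hν)).aestronglyMeasurable
    (Eventually.of_forall fun o => ?_)
  rw [norm_smul]
  exact mul_le_mul_of_nonneg_left (hbd' _ _) (norm_nonneg _)

/-- Given `(A, X)` the residual is centred, while weights, propensity score and its gradient depend
on `(A, X)` alone. Hence estimating `ν` has no first order effect. -/
theorem integral_ipwResid_smul_psGrad_of_orCorrect (hw : ∀ a j, Measurable fun x => w a x j)
    {C : ℝ} (hC : ∀ a x j, |w a x j| ≤ C) (hP : IsRegularLaw P)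
    (h3 : Integrable (fun o : Obs m d => covarNorm o.2.2 ^ 3) P) {ν : PSParam d}
    (hν : 0 < ν.precision) (hov : ModelOverlap P ν) {β : ORCoef d}
    (hβ : ∀ a j, ∀ᵐ o ∂P, outcomeReg P a j o = orModel a o.2.2 β j) :
    ∫ o, ipwResid w ν β o • psGrad o.2.1 o.2.2 ν ∂P = 0 := by
  obtain ⟨D, hD, r, -, hbd⟩ := log_psModel_expansion (m := m) hν
  have hbd' := fun (a : Treat m) x => (hbd a x).1
  have hmem : ∀ v (a : Treat m), MemLp (fun o : Obs m d => psGrad a o.2.2 ν v) 2 P := fun v a => by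
    refine ((memLp_one_add_covarNorm h3).const_mul (D * ‖v‖)).of_le
      ((measurable_psGrad_covar_apply hν a v).comp measurable_snd.snd).aestronglyMeasurable
        (Eventually.of_forall fun o => ?_)
    refine ((psGrad a o.2.2 ν).le_opNorm v).trans (le_trans ?_ (le_abs_self _))
    rw [mul_right_comm]
    exact mul_le_mul_of_nonneg_right (hbd' a o.2.2) (norm_nonneg _)
  have hi := integrable_ipwResid_smul_psGrad hw hC hP h3 hν hov β
  ext v
  rw [ContinuousLinearMap.integral_apply hi, zero_apply]
  set h : Treat m → Fin m → Covar m d → ℝ := fun a j x =>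
    (psModel a x ν)⁻¹ * w a x j * psGrad a x ν v with hh
  have hhm : ∀ a j, Measurable (h a j) := fun a j => by
    exact (measurable_inv_psModel_mul_weight hw ν a j).mul
      (measurable_psGrad_covar_apply hν a v)
  have hh2 : ∀ a j, MemLp (fun o : Obs m d => h a j o.2.2) 2 P := fun a j =>
    memLp_inv_psModel_mul_weight hw hC hov a j (hmem v a)
  have e : ∀ o : Obs m d, (ipwResid w ν β o • psGrad o.2.1 o.2.2 ν) v = ∑ a, ∑ j, ind a o *
      ((o.1 j - orModel a o.2.2 β j) * h a j o.2.2) := fun o => by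
    simp only [← Finset.mul_sum]
    rw [sum_ind_mul (fun a => ∑ j, (o.1 j - orModel a o.2.2 β j) * h a j o.2.2), smul_apply,
      ipwResid, smul_eq_mul, Finset.mul_sum, Finset.sum_mul]
    exact Finset.sum_congr rfl fun j _ => by rw [orResid, hh]; ring
  have hint := fun a j => integrable_ind_resid hP h3 a j β (hh2 a j)
  simp only [e]
  rw [integral_finsetSum _ fun a _ => integrable_finsetSum _ fun j _ => hint a j]
  refine Finset.sum_eq_zero fun a _ => ?_
  rw [integral_finsetSum _ fun j _ => hint a j]
  refine Finset.sum_eq_zero fun j _ => ?_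
  rw [integral_ind_resid hP h3 a j β (hhm a j) (hh2 a j)]
  refine integral_eq_zero_of_ae ?_
  filter_upwards [hβ a j] with o ho
  simp [ho]

end Moments

/-! ### Expansion of the estimated augmented inverse probability weighted average -/

section Expansion

variable {K : ℕ} {M d : Fin K → ℕ} {Ω : Type*} [MeasurableSpace Ω] {μ : Measure Ω}
  [IsProbabilityMeasure μ] {Z : ℕ → Ω → Data M d} {p : Fin K → ℝ}
  {P : ∀ k, Measure (Obs (M k) (d k))} [∀ k, IsProbabilityMeasure (P k)]

/-- Averages `modelAipw_sub`: its middle term is covered by `IsSample.weighted_expansion`, its last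
term by `hslope`, which each robustness case supplies in its own way. -/
theorem modelAipw_expansion (hs : IsSample μ (mixLaw p P) Z) (k : Fin K)
    {w : Treat (M k) → Covar (M k) (d k) → Fin (M k) → ℝ}
    (hw : ∀ a j, Measurable fun x => w a x j) {C : ℝ} (hC : ∀ a x j, |w a x j| ≤ C)
    (hP : IsRegularLaw (P k)) (h3 : Integrable (fun o => covarNorm o.2.2 ^ 3) (P k))
    {ν₀ : PSParam (d k)} (hν₀ : 0 < ν₀.precision) (hov : ModelOverlap (P k) ν₀)
    {β₀ : ORCoef (d k)} {psE : ℕ → Ω → PSParam (d k)} {κ : Data M d → PSParam (d k)}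
    (hps : IsAsympLinear μ (mixLaw p P) Z psE ν₀ κ) {orE : ℕ → Ω → ORCoef (d k)}
    (hor : SmallInProb μ fun N ω => orE N ω - β₀) {κ' : Data M d → ℝ}
    (hslope : SmallInProb μ fun (N : ℕ) ω => √(N : ℝ) *
      avg Z (onTypeV k fun o => regSlope w o.2.2 - ipwSlope w ν₀ o) N ω (orE N ω - β₀)
        - √(N : ℝ) * avg Z κ' N ω) :
    SmallInProb μ fun (N : ℕ) ω =>
      √(N : ℝ) * avg Z (onType k (modelAipw w (psE N ω) (orE N ω))) N ω
        - √(N : ℝ) * avg Z (fun z => onType k (modelAipw w ν₀ β₀) z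
          + (-(∫ z, onTypeV k (ipwResid w ν₀ β₀) z • onTypeV k (fun o => psGrad o.2.1 o.2.2 ν₀) z
            ∂(mixLaw p P)) (κ z) + κ' z)) N ω := by
  obtain ⟨D, hD, r, hr, hexp⟩ := log_psModel_expansion (m := M k) hν₀
  obtain ⟨B, hB, hBle⟩ := exists_norm_ipwSlope_le hC hov
  have hmain := hs.weighted_expansion hr (ν₀ := ν₀)
    (u := fun z ν => onTypeV k (fun o => Real.log (psModel o.2.1 o.2.2 ν)
      - Real.log (psModel o.2.1 o.2.2 ν₀)) z)
    (s := onTypeV k fun o => psGrad o.2.1 o.2.2 ν₀)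
    (b := onTypeV k fun o => D * (1 + covarNorm o.2.2))
    (measurable_onTypeV ((measurable_const.add measurable_covarNorm_obs).const_mul D)) ?_ ?_
    (memLp_onTypeV ((memLp_one_add_covarNorm h3).const_mul D)) ?_ ?_
    (measurable_onTypeV (measurable_psGrad hν₀)) ?_
    (ρ := onTypeV k (ipwResid w ν₀ β₀)) (measurable_onTypeV (measurable_ipwResid hw ν₀ β₀))
    (memLp_onTypeV (memLp_ipwResid hw hC hP h3 hov β₀))
    (q := onTypeV k (ipwSlope w ν₀)) (measurable_onTypeV (measurable_ipwSlope hw ν₀)) ?_ hps hor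
  · refine (hmain.add hslope).congr (highProb_of_forall (Eventually.of_forall fun N ω => ?_))
    set L := ∫ z, onTypeV k (ipwResid w ν₀ β₀) z • onTypeV k (fun o => psGrad o.2.1 o.2.2 ν₀) z
            ∂(mixLaw p P)
    have e1 : avg Z (onTypeV k fun o => regSlope w o.2.2 - ipwSlope w ν₀ o) N ω (orE N ω - β₀) =
        avg Z (fun z => onTypeV k (fun o => regSlope w o.2.2 - ipwSlope w ν₀ o) z
          (orE N ω - β₀)) N ω :=
      (avg_clm (ContinuousLinearMap.apply ℝ ℝ (orE N ω - β₀)) _).symm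
    have e2 : avg Z (onType k (modelAipw w (psE N ω) (orE N ω))) N ω =
        avg Z (fun z => onType k (modelAipw w ν₀ β₀) z
          + ((Real.exp (-onTypeV k (fun o => Real.log (psModel o.2.1 o.2.2 (psE N ω))
              - Real.log (psModel o.2.1 o.2.2 ν₀)) z) - 1)
            * (onTypeV k (ipwResid w ν₀ β₀) z - onTypeV k (ipwSlope w ν₀) z (orE N ω - β₀))
          + onTypeV k (fun o => regSlope w o.2.2 - ipwSlope w ν₀ o) z (orE N ω - β₀))) N ω := by
      congr 1
      ext z
      refine onTypeV_cases (k := k) (p := fun z => onType k (modelAipw w (psE N ω) (orE N ω)) z =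
        onType k (modelAipw w ν₀ β₀) z
          + ((Real.exp (-onTypeV k (fun o => Real.log (psModel o.2.1 o.2.2 (psE N ω))
              - Real.log (psModel o.2.1 o.2.2 ν₀)) z) - 1)
            * (onTypeV k (ipwResid w ν₀ β₀) z - onTypeV k (ipwSlope w ν₀) z (orE N ω - β₀))
          + onTypeV k (fun o => regSlope w o.2.2 - ipwSlope w ν₀ o) z (orE N ω - β₀))) z
        (fun o => ?_) fun j o h => ?_
      · simp only [onType_eq, onTypeV_mk_self]
        rw [modelAipw_sub w (psE N ω) ν₀ (orE N ω) β₀ o]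
        ring
      · simp [onType_eq, onTypeV_mk_ne _ _ h]
    rw [e1, e2]
    rw [avg_add (onType k (modelAipw w ν₀ β₀)), avg_add, avg_add (onType k (modelAipw w ν₀ β₀)),
      avg_add _ κ']
    ring
  · intro z
    refine onTypeV_cases (k := k)
      (p := fun z => 0 ≤ onTypeV k (fun o => D * (1 + covarNorm o.2.2)) z) z
      (fun o => ?_) fun j o h => by rw [onTypeV_mk_ne _ _ h]
    rw [onTypeV_mk_self]
    have := covarNorm_nonneg o.2.2
    positivity
  · have e : (fun z : Data M d => onTypeV k (fun o => D * (1 + covarNorm o.2.2)) z ^ 3) =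
        onTypeV k fun o => D ^ 3 * (1 + covarNorm o.2.2) ^ 3 := by
      ext z
      rw [← onTypeV_map (T := fun t : ℝ => t ^ 3) (by simp)]
      simp only [mul_pow]
    rw [e]
    exact integrable_onTypeV ((integrable_one_add_covarNorm_pow h3 le_rfl).const_mul (D ^ 3))
  · intro z ν hν
    refine onTypeV_cases (k := k) (p := fun z => |onTypeV k (fun o =>
      Real.log (psModel o.2.1 o.2.2 ν) - Real.log (psModel o.2.1 o.2.2 ν₀)) z| ≤
        onTypeV k (fun o => D * (1 + covarNorm o.2.2)) z * ‖ν - ν₀‖) z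
      (fun o => ?_) fun j o h => by simp [onTypeV_mk_ne _ _ h]
    simpa only [onTypeV_mk_self] using ((hexp o.2.1 o.2.2).2 ν hν).1
  · intro z ν hν
    refine onTypeV_cases (k := k) (p := fun z => |onTypeV k (fun o =>
      Real.log (psModel o.2.1 o.2.2 ν) - Real.log (psModel o.2.1 o.2.2 ν₀)) z
        - onTypeV k (fun o => psGrad o.2.1 o.2.2 ν₀) z (ν - ν₀)| ≤
        onTypeV k (fun o => D * (1 + covarNorm o.2.2)) z ^ 2 * ‖ν - ν₀‖ ^ 2) z
      (fun o => ?_) fun j o h => by simp [onTypeV_mk_ne _ _ h]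
    simpa only [onTypeV_mk_self] using ((hexp o.2.1 o.2.2).2 ν hν).2
  · exact norm_onTypeV_le fun o => (hexp o.2.1 o.2.2).1
  · have e : (fun z : Data M d => onTypeV k (fun o => D * (1 + covarNorm o.2.2)) z
        * ‖onTypeV k (ipwSlope w ν₀) z‖) =
        onTypeV k fun o => D * (1 + covarNorm o.2.2) * ‖ipwSlope w ν₀ o‖ := by
      ext z
      exact (onTypeV_map₂ (T := fun (t : ℝ) (q : ORCoef (d k) →L[ℝ] ℝ) => t * ‖q‖) (by simp)
        z).symm
    rw [e]
    refine integrable_onTypeV (((integrable_one_add_covarNorm_pow h3 (q := 2)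
      (by norm_num)).const_mul (D * B)).mono'
      (((measurable_const.add measurable_covarNorm_obs).const_mul D).mul
        (measurable_ipwSlope hw ν₀).norm).aestronglyMeasurable ?_)
    filter_upwards [hBle] with o ho
    have hx := covarNorm_nonneg o.2.2
    rw [Real.norm_of_nonneg (by positivity)]
    calc D * (1 + covarNorm o.2.2) * ‖ipwSlope w ν₀ o‖
        ≤ D * (1 + covarNorm o.2.2) * (B * (1 + covarNorm o.2.2)) :=
          mul_le_mul_of_nonneg_left ho (by positivity)
      _ = D * B * (1 + covarNorm o.2.2) ^ 2 := by ring

end Expansion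

end

/-! ### A correct propensity model -/

section

section PSCorrect

variable {m d : ℕ} {P : Measure (Obs m d)} [IsProbabilityMeasure P]

theorem IsRegularLaw.modelOverlap (hP : IsRegularLaw P) {ν : PSParam d} (hps : PSCorrect P ν) :
    ModelOverlap P ν := by
  obtain ⟨c, hc, h⟩ := hP.overlap
  refine ⟨c, hc, fun a => ?_⟩
  filter_upwards [h a, hps a] with o h1 h2
  rwa [← h2]

/-- The true parameter of a correct and identifiable propensity model is the unique maximizer of
the population log-likelihood. -/
theorem IsRegularLaw.isPopulationMaximizer (hP : IsRegularLaw P) {Θ : Set (PSParam d)}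
    {ν : PSParam d} (hν : ν ∈ Θ) (hps : PSCorrect P ν) (hid : PSIdentifiable P Θ)
    (h3 : Integrable (fun o : Obs m d => covarNorm o.2.2 ^ 3) P) :
    IsPopulationMaximizer P Θ ν := by
  refine ⟨hν, fun ν' hν' hne => ?_⟩
  obtain ⟨B, hB, hBle⟩ := (hP.modelOverlap hps).exists_inv_le
  -- The likelihood ratio of `ν'` to the truth; its mean at the received treatment is one, since the
  -- model probabilities sum to one.
  set q : Treat m → Covar m d → ℝ := fun a x => psModel a x ν' * (psModel a x ν)⁻¹ with hq
  have hqm : ∀ a, Measurable (q a) := fun a =>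
    ((measurable_psModel a).comp (measurable_id.prodMk measurable_const)).mul
      ((measurable_psModel a).comp (measurable_id.prodMk measurable_const)).inv
  have hq0 : ∀ a x, 0 < q a x := fun a x =>
    mul_pos (psModel_pos _ _ _) (inv_pos.2 (psModel_pos _ _ _))
  have hqa : ∀ a, Integrable (fun o : Obs m d => q a o.2.2) P := fun a => by
    refine Integrable.of_bound ((hqm a).comp measurable_snd.snd).aestronglyMeasurable B ?_
    filter_upwards [hBle] with o ho
    rw [Real.norm_of_nonneg (hq0 _ _).le]
    calc q a o.2.2 ≤ 1 * B := mul_le_mul (psModel_le_one _ _ _) (ho a)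
          (inv_nonneg.2 (psModel_pos _ _ _).le) zero_le_one
      _ = B := one_mul B
  have hqsum : ∀ o : Obs m d, q o.2.1 o.2.2 = ∑ a, ind a o * q a o.2.2 := fun o =>
    (sum_ind_mul (fun a => q a o.2.2) o).symm
  have hqi : Integrable (fun o : Obs m d => q o.2.1 o.2.2) P := by
    simp only [hqsum]
    exact integrable_finsetSum _ fun a _ => integrable_ind_mul (hqa a) a
  have hint : ∫ o : Obs m d, q o.2.1 o.2.2 ∂P = 1 := by
    simp only [hqsum]
    rw [integral_finsetSum _ fun a _ => integrable_ind_mul (hqa a) a]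
    have h1 : ∀ a, ∫ o, ind a o * q a o.2.2 ∂P = ∫ o, psModel a o.2.2 ν' ∂P := by
      intro a
      rw [integral_ind_mul (stronglyMeasurable_covar (hqm a)) (integrable_ind_mul (hqa a) a)]
      refine integral_congr_ae ?_
      filter_upwards [hps a] with o ho
      have := (psModel_pos a o.2.2 ν).ne'
      rw [ho, hq]; field_simp
    simp only [h1]
    rw [← integral_finsetSum]
    · simp [sum_psModel]
    · intro a _
      refine Integrable.of_bound ((measurable_psModel a).comp
        (measurable_snd.snd.prodMk measurable_const)).aestronglyMeasurable 1
        (Eventually.of_forall fun o => ?_)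
      rw [Real.norm_of_nonneg (psModel_pos _ _ _).le]
      exact psModel_le_one _ _ _
  have hl := integrable_log_psModel h3 ν
  have hl' := integrable_log_psModel h3 ν'
  have hlog : ∀ o : Obs m d, Real.log (q o.2.1 o.2.2) =
      Real.log (psModel o.2.1 o.2.2 ν') - Real.log (psModel o.2.1 o.2.2 ν) := fun o => by
    rw [hq, Real.log_mul (psModel_pos _ _ _).ne' (inv_ne_zero (psModel_pos _ _ _).ne'),
      Real.log_inv, sub_eq_add_neg]
  -- The gap in `log x ≤ x - 1`. It is nonnegative, its mean is the loss of expected log-likelihood,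
  -- and it vanishes only where the ratio is one.
  set D : Obs m d → ℝ := fun o => (q o.2.1 o.2.2 - 1)
    - (Real.log (psModel o.2.1 o.2.2 ν') - Real.log (psModel o.2.1 o.2.2 ν)) with hD
  have hq1i : Integrable (fun o : Obs m d => q o.2.1 o.2.2 - 1) P := hqi.sub (integrable_const _)
  have hli : Integrable (fun o : Obs m d =>
    Real.log (psModel o.2.1 o.2.2 ν') - Real.log (psModel o.2.1 o.2.2 ν)) P := hl'.sub hl
  have hDi : Integrable D P := hq1i.sub hli
  have hD0 : ∀ o, 0 ≤ D o := fun o => by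
    have := Real.log_le_sub_one_of_pos (hq0 o.2.1 o.2.2)
    rw [hlog] at this
    rw [hD]; linarith
  have hDint : ∫ o, D o ∂P = ∫ o, Real.log (psModel o.2.1 o.2.2 ν) ∂P
      - ∫ o, Real.log (psModel o.2.1 o.2.2 ν') ∂P := by
    rw [hD, integral_sub hq1i hli, integral_sub hqi (integrable_const _), hint,
      integral_sub hl' hl]
    simp
  rcases (integral_nonneg (μ := P) (f := D) hD0).lt_or_eq with h | h
  · rw [hDint] at h; linarith
  exfalso
  have hae := (integral_eq_zero_iff_of_nonneg (f := D) hD0 hDi).1 h.symm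
  have hae' : ∀ᵐ o ∂P, q o.2.1 o.2.2 = 1 := by
    filter_upwards [hae] with o ho
    by_contra hne
    have := Real.log_lt_sub_one_of_pos (hq0 o.2.1 o.2.2) hne
    rw [hlog] at this
    have h2 : D o = 0 := ho
    rw [hD] at h2
    simp only at h2
    linarith
  refine hne (hid ν' hν' ν hν fun a => ?_)
  -- Equality at the received treatment extends to every treatment by overlap, which is what
  -- identifiability asks for.
  have h1 := hP.ae_of_ae_treat a (q := fun x => q a x = 1) ((hqm a) (measurableSet_singleton 1)) (by
    filter_upwards [hae'] with o ho ha
    rw [← ha]; exact ho)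
  filter_upwards [h1] with o ho
  have := (psModel_pos a o.2.2 ν).ne'
  rw [hq] at ho
  simp only at ho
  field_simp at ho
  exact ho

end PSCorrect

/-! ### Calculus of asymptotically linear estimators -/

section Calculus

variable {𝒵 Ω E F : Type*} [MeasurableSpace 𝒵] [MeasurableSpace Ω] {μ : Measure Ω}
  [IsProbabilityMeasure μ] {P : Measure 𝒵} {Z : ℕ → Ω → 𝒵}
  [NormedAddCommGroup E] [NormedSpace ℝ E] [FiniteDimensional ℝ E] [MeasurableSpace E]
  [BorelSpace E]

theorem IsAsympLinear.congr {est est' : ℕ → Ω → E} {ν₀ : E} {κ : 𝒵 → E}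
    (h : IsAsympLinear μ P Z est ν₀ κ) (he : HighProb μ fun N ω => est' N ω = est N ω) :
    IsAsympLinear μ P Z est' ν₀ κ :=
  ⟨h.meas, h.memLp, h.mean, h.small.congr (he.imp fun N ω h => by rw [h])⟩

theorem IsAsympLinear.sum {ι : Type*} [Fintype ι] {est : ι → ℕ → Ω → E} {ν₀ : ι → E}
    {κ : ι → 𝒵 → E} [IsProbabilityMeasure P] (h : ∀ i, IsAsympLinear μ P Z (est i) (ν₀ i) (κ i)) :
    IsAsympLinear μ P Z (fun N ω => ∑ i, est i N ω) (∑ i, ν₀ i) fun z => ∑ i, κ i z := by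
  refine ⟨Finset.measurable_fun_sum _ fun i _ => (h i).meas, memLp_finsetSum _ fun i _ =>
    (h i).memLp, ?_, (SmallInProb.sum Finset.univ fun i _ => (h i).small).congr
      (highProb_of_forall (Eventually.of_forall fun N ω => ?_))⟩
  · rw [integral_finsetSum _ fun i _ => (h i).memLp.integrable (by norm_num)]
    exact Finset.sum_eq_zero fun i _ => (h i).mean
  · rw [avg_sum, ← Finset.sum_sub_distrib, Finset.smul_sum, Finset.smul_sum,
      Finset.sum_sub_distrib]

/-- The delta method. -/
theorem IsAsympLinear.delta (hs : IsSample μ P Z) {est : ℕ → Ω → E} {ν₀ : E} {κ : 𝒵 → E}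
    (h : IsAsympLinear μ P Z est ν₀ κ) {f : E → ℝ} {L : E →L[ℝ] ℝ} (hf : HasFDerivAt f L ν₀) :
    IsAsympLinear μ P Z (fun N ω => f (est N ω)) (f ν₀) fun z => L (κ z) := by
  have := hs.isProbabilityMeasure
  have hb := h.bddInProb hs
  have hc : SmallInProb μ fun N ω => est N ω - ν₀ := by
    have h0 : SmallInProb μ fun (N : ℕ) (_ : Ω) => (√(N : ℝ))⁻¹ := by
      refine smallInProb_of_tendsto ?_
      exact tendsto_inv_atTop_zero.comp (Real.tendsto_sqrt_atTop.comp tendsto_natCast_atTop_atTop)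
    refine SmallInProb.of_norm_le_mul h0 hb.norm (highProb_of_forall ?_)
    filter_upwards [eventually_gt_atTop 0] with N hN ω
    have hN' : 0 < √(N : ℝ) := Real.sqrt_pos.2 (by exact_mod_cast hN)
    rw [norm_smul, Real.norm_of_nonneg hN'.le, inv_mul_cancel_left₀ hN'.ne']
  have hrem : SmallInProb μ fun (N : ℕ) ω =>
      √(N : ℝ) * (f (est N ω) - f ν₀ - L (est N ω - ν₀)) := by
    intro δ hδ
    refine hb.highProb fun C => ?_
    have hC : 0 < |C| + 1 := by positivity
    have hη : 0 < δ / (|C| + 1) := by positivity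
    obtain ⟨r, hr, hball⟩ := Metric.eventually_nhds_iff.1 (hf.isLittleO.def hη)
    refine (hc r hr).imp fun N ω h1 h2 => ?_
    have h3 := hball (y := est N ω) (by rwa [dist_eq_norm])
    rw [norm_smul, Real.norm_of_nonneg (Real.sqrt_nonneg _)] at h2
    rw [norm_mul, Real.norm_of_nonneg (Real.sqrt_nonneg _)]
    calc √(N : ℝ) * ‖f (est N ω) - f ν₀ - L (est N ω - ν₀)‖
        ≤ √(N : ℝ) * (δ / (|C| + 1) * ‖est N ω - ν₀‖) :=
          mul_le_mul_of_nonneg_left h3 (Real.sqrt_nonneg _)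
      _ = δ / (|C| + 1) * (√(N : ℝ) * ‖est N ω - ν₀‖) := by ring
      _ ≤ δ / (|C| + 1) * |C| :=
          mul_le_mul_of_nonneg_left (h2.trans (le_abs_self C)) hη.le
      _ < δ / (|C| + 1) * (|C| + 1) := mul_lt_mul_of_pos_left (lt_add_one _) hη
      _ = δ := div_mul_cancel₀ _ hC.ne'
  have hL : SmallInProb μ fun (N : ℕ) ω =>
      L (√(N : ℝ) • (est N ω - ν₀) - √(N : ℝ) • avg Z κ N ω) :=
    SmallInProb.of_norm_le_mul h.small.norm (bddInProb_const ‖L‖)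
      (highProb_of_forall (Eventually.of_forall fun N ω => by
        rw [mul_comm]; exact L.le_opNorm _))
  have hκi : Integrable κ P := h.memLp.integrable (by norm_num)
  refine ⟨L.continuous.measurable.comp h.meas, L.comp_memLp' h.memLp, ?_,
    (hrem.add hL).congr (highProb_of_forall (Eventually.of_forall fun N ω => ?_))⟩
  · rw [L.integral_comp_comm hκi, h.mean, map_zero]
  · rw [avg_clm]
    simp only [map_sub, map_smul, smul_eq_mul]
    ring

end Calculus

section Product

variable {𝒵 Ω : Type*} [MeasurableSpace 𝒵] [MeasurableSpace Ω] {μ : Measure Ω}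
  [IsProbabilityMeasure μ] {P : Measure 𝒵} {Z : ℕ → Ω → 𝒵}

theorem IsAsympLinear.prodMk [IsProbabilityMeasure P] {S T : ℕ → Ω → ℝ} {s t : ℝ} {κ ξ : 𝒵 → ℝ}
    (hS : IsAsympLinear μ P Z S s κ) (hT : IsAsympLinear μ P Z T t ξ) :
    IsAsympLinear μ P Z (fun N ω => (S N ω, T N ω)) (s, t) fun z => (κ z, ξ z) := by
  have h2 : MemLp (fun z => (κ z, ξ z)) 2 P := by
    refine (hS.memLp.norm.add hT.memLp.norm).of_le
      (hS.meas.prodMk hT.meas).aestronglyMeasurable (Eventually.of_forall fun z => ?_)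
    rw [Pi.add_apply, Real.norm_of_nonneg (by positivity), Prod.norm_def]
    exact max_le (by simp) (by simp)
  refine ⟨hS.meas.prodMk hT.meas, h2, ?_, ?_⟩
  · rw [integral_pair (hS.memLp.integrable (by norm_num)) (hT.memLp.integrable (by norm_num)),
      hS.mean, hT.mean]
    rfl
  · refine (hS.small.norm.add hT.small.norm).of_norm_le
      (highProb_of_forall (Eventually.of_forall fun N ω => ?_))
    have e : avg Z (fun z => (κ z, ξ z)) N ω = (avg Z κ N ω, avg Z ξ N ω) := by
      refine Prod.ext ?_ ?_
      · exact (avg_clm (ContinuousLinearMap.fst ℝ ℝ ℝ) (fun z => (κ z, ξ z))).symm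
      · exact (avg_clm (ContinuousLinearMap.snd ℝ ℝ ℝ) (fun z => (κ z, ξ z))).symm
    rw [e, Prod.norm_def]
    exact max_le (le_add_of_nonneg_right (norm_nonneg _)) (le_add_of_nonneg_left (norm_nonneg _))

end Product

end

/-! ### The estimated augmented inverse probability weighted average of one type -/

section

/-- Regressors grow at most like `1 + ‖X‖`, so the score is dominated by the residual and by `‖X‖`
times the residual; the extra moment covers the latter. -/
theorem memLp_orScore {m d : ℕ} {P : Measure (Obs m d)} [IsProbabilityMeasure P]
    (hP : IsRegularLaw P) (h3 : Integrable (fun o : Obs m d => covarNorm o.2.2 ^ 3) P)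
    {β : ORCoef d} (hβ : ∀ a j, ∀ᵐ o ∂P, outcomeReg P a j o = orModel a o.2.2 β j)
    (hres : ∀ j, Integrable (fun o => covarNorm o.2.2 ^ 2 *
      (o.1 j - outcomeReg P o.2.1 j o) ^ 2) P) : MemLp (fun o => orScore o β) 2 P := by
  have hr : ∀ j, MemLp (fun o : Obs m d => covarNorm o.2.2 * orResid o β j) 2 P := fun j => by
    have hm : Measurable fun o : Obs m d => covarNorm o.2.2 * orResid o β j :=
      measurable_covarNorm_obs.mul ((measurable_outcome j).sub (measurable_orModel_obs β j))
    refine (memLp_two_iff_integrable_sq hm.aestronglyMeasurable).2 ((hres j).congr ?_)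
    filter_upwards [ae_all_iff.2 fun a => hβ a j] with o ho
    rw [ho o.2.1, orResid]; ring
  refine MemLp.of_eval fun i => memLp_finsetSum _ fun j _ => ?_
  refine (((memLp_orResid hP h3 β j).norm.add (hr j).norm).const_mul (m + 1 : ℝ)).of_le
    ((measurable_orRegressor j i).mul ((measurable_outcome j).sub
      (measurable_orModel_obs β j))).aestronglyMeasurable (Eventually.of_forall fun o => ?_)
  have hx := covarNorm_nonneg o.2.2
  refine le_trans ?_ (le_abs_self _)
  rw [norm_mul, Pi.add_apply, norm_mul (covarNorm _), Real.norm_of_nonneg hx]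
  calc ‖orRegressor o.2.1 o.2.2 j i‖ * ‖orResid o β j‖
      ≤ (m + 1) * (1 + covarNorm o.2.2) * ‖orResid o β j‖ :=
        mul_le_mul_of_nonneg_right (abs_orRegressor_le _ _ j i) (norm_nonneg _)
    _ = (m + 1) * (‖orResid o β j‖ + covarNorm o.2.2 * ‖orResid o β j‖) := by ring

section OneType

variable {K : ℕ} {M d : Fin K → ℕ} {Ω : Type*} [MeasurableSpace Ω] {μ : Measure Ω}
  [IsProbabilityMeasure μ] {Z : ℕ → Ω → Data M d} {p : Fin K → ℝ}
  {P : ∀ k, Measure (Obs (M k) (d k))} [∀ k, IsProbabilityMeasure (P k)]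

theorem onType_sub_const (k : Fin K) (f : Obs (M k) (d k) → ℝ) (θ : ℝ) (z : Data M d) :
    onType k (fun o => f o - θ) z = onType k f z - θ * onType k (fun _ => 1) z := by
  refine onTypeV_cases (k := k) (p := fun z => onType k (fun o => f o - θ) z =
    onType k f z - θ * onType k (fun _ => 1) z) z (fun o => ?_) fun j o h => ?_
  · simp [onType_eq]
  · simp [onType_eq, onTypeV_mk_ne _ _ h]

theorem avg_onType_sub_const {N : ℕ} {ω : Ω} (k : Fin K) (f : Obs (M k) (d k) → ℝ) (θ : ℝ) :
    avg Z (onType k fun o => f o - θ) N ω =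
      avg Z (onType k f) N ω - θ * avg Z (onType k fun _ => 1) N ω := by
  rw [← avg_const_mul, ← avg_sub]
  exact congrArg (fun g => avg Z g N ω) (funext (onType_sub_const k f θ))

/-- Three contributions to the influence function: the centred term at the limiting parameters, the
estimation of `ν`, and that of the coefficients. Subtracting `θ` within the type makes the limit
zero. -/
theorem modelAipw_isAsympLinear (hp : ∀ k, 0 ≤ p k) (hs : IsSample μ (mixLaw p P) Z) (k : Fin K)
    {w : Treat (M k) → Covar (M k) (d k) → Fin (M k) → ℝ}
    (hw : ∀ a j, Measurable fun x => w a x j) {C : ℝ} (hC : ∀ a x j, |w a x j| ≤ C)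
    (hP : IsRegularLaw (P k)) (h3 : Integrable (fun o => covarNorm o.2.2 ^ 3) (P k))
    {ν₀ : PSParam (d k)} (hν₀ : 0 < ν₀.precision) (hov : ModelOverlap (P k) ν₀)
    {β₀ : ORCoef (d k)} {θ : ℝ} (hθ : ∫ o, modelAipw w ν₀ β₀ o ∂(P k) = θ)
    {psE : ℕ → Ω → PSParam (d k)} {κ : Data M d → PSParam (d k)}
    (hps : IsAsympLinear μ (mixLaw p P) Z psE ν₀ κ) {orE : ℕ → Ω → ORCoef (d k)}
    (hor : SmallInProb μ fun N ω => orE N ω - β₀) {κ' : Data M d → ℝ} (hκm : Measurable κ')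
    (hκ2 : MemLp κ' 2 (mixLaw p P)) (hκ0 : ∫ z, κ' z ∂(mixLaw p P) = 0)
    (hslope : SmallInProb μ fun (N : ℕ) ω => √(N : ℝ) *
      avg Z (onTypeV k fun o => regSlope w o.2.2 - ipwSlope w ν₀ o) N ω (orE N ω - β₀)
        - √(N : ℝ) * avg Z κ' N ω) :
    IsAsympLinear μ (mixLaw p P) Z
      (fun N ω => avg Z (onType k fun o => modelAipw w (psE N ω) (orE N ω) o - θ) N ω) 0
      fun z => onType k (fun o => modelAipw w ν₀ β₀ o - θ) z
        + (-(∫ z, onTypeV k (ipwResid w ν₀ β₀) z • onTypeV k (fun o => psGrad o.2.1 o.2.2 ν₀) z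
            ∂(mixLaw p P)) (κ z) + κ' z) := by
  have := hs.isProbabilityMeasure
  have hexp := modelAipw_expansion hs k hw hC hP h3 hν₀ hov hps hor hslope
  set L := ∫ z, onTypeV k (ipwResid w ν₀ β₀) z • onTypeV k (fun o => psGrad o.2.1 o.2.2 ν₀) z
            ∂(mixLaw p P) with hL
  have hfm : Measurable fun o : Obs (M k) (d k) => modelAipw w ν₀ β₀ o - θ :=
    (measurable_modelAipw hw ν₀ β₀).sub_const θ
  have hf2 : MemLp (fun o : Obs (M k) (d k) => modelAipw w ν₀ β₀ o - θ) 2 (P k) :=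
    (memLp_modelAipw hw hC hP h3 hov β₀).sub (memLp_const θ)
  have h12 : MemLp (fun z => onType k (fun o => modelAipw w ν₀ β₀ o - θ) z) 2 (mixLaw p P) :=
    memLp_onTypeV hf2
  have h22 : MemLp (fun z => -L (κ z)) 2 (mixLaw p P) := (L.comp_memLp' hps.memLp).neg
  have h32 : MemLp (fun z => -L (κ z) + κ' z) 2 (mixLaw p P) := h22.add hκ2
  refine ⟨(measurable_onTypeV hfm).add (((L.continuous.measurable.comp hps.meas).neg).add hκm),
    h12.add h32, ?_, hexp.congr (highProb_of_forall (Eventually.of_forall fun N ω => ?_))⟩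
  · have e1 : ∫ z, onType k (fun o => modelAipw w ν₀ β₀ o - θ) z ∂(mixLaw p P) = 0 := by
      refine (integral_onTypeV (P := P) hp (hf2.integrable (by norm_num))).trans ?_
      rw [integral_sub ((memLp_modelAipw hw hC hP h3 hov β₀).integrable (by norm_num))
        (integrable_const _), hθ]
      simp
    have e2 : ∫ z, -L (κ z) ∂(mixLaw p P) = 0 := by
      rw [integral_neg, L.integral_comp_comm (hps.memLp.integrable (by norm_num)), hps.mean,
        map_zero, neg_zero]
    rw [integral_add (h12.integrable (by norm_num)) (h32.integrable (by norm_num)), e1,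
      integral_add (h22.integrable (by norm_num)) (hκ2.integrable (by norm_num)), e2, hκ0]
    simp
  · rw [avg_add (fun z => onType k (fun o => modelAipw w ν₀ β₀ o - θ) z),
      avg_add (fun z => onType k (modelAipw w ν₀ β₀) z)]
    have e1 := avg_onType_sub_const (Z := Z) (N := N) (ω := ω) k (modelAipw w (psE N ω) (orE N ω)) θ
    have e2 := avg_onType_sub_const (Z := Z) (N := N) (ω := ω) k (modelAipw w ν₀ β₀) θ
    simp only [smul_eq_mul, sub_zero]
    rw [e1, e2]
    ring

variable {w : ∀ k, Treat (M k) → Covar (M k) (d k) → Fin (M k) → ℝ} {Θ : ∀ k, Set (PSParam (d k))}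

theorem memLp_onTypeV_slope (k : Fin K)
    {w : Treat (M k) → Covar (M k) (d k) → Fin (M k) → ℝ}
    (hw : ∀ a j, Measurable fun x => w a x j) {C : ℝ} (hC : ∀ a x j, |w a x j| ≤ C)
    (h3 : Integrable (fun o => covarNorm o.2.2 ^ 3) (P k))
    {ν₀ : PSParam (d k)} (hov : ModelOverlap (P k) ν₀) :
    MemLp (onTypeV k fun o => regSlope w o.2.2 - ipwSlope w ν₀ o) 2 (mixLaw p P) :=
  memLp_onTypeV (memLp_regSlope_sub_ipwSlope hw hC h3 hov)

theorem measurable_onTypeV_slope (k : Fin K)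
    {w : Treat (M k) → Covar (M k) (d k) → Fin (M k) → ℝ}
    (hw : ∀ a j, Measurable fun x => w a x j) (ν₀ : PSParam (d k)) :
    Measurable (onTypeV k (fun o => regSlope w o.2.2 - ipwSlope w ν₀ o) :
      Data M d → ORCoef (d k) →L[ℝ] ℝ) :=
  measurable_onTypeV (((measurable_regSlope hw).comp measurable_snd.snd).sub
    (measurable_ipwSlope hw ν₀))

theorem slope_small_of_psCorrect (hp : ∀ k, 0 ≤ p k) (hs : IsSample μ (mixLaw p P) Z) (k : Fin K)
    {w : Treat (M k) → Covar (M k) (d k) → Fin (M k) → ℝ}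
    (hw : ∀ a j, Measurable fun x => w a x j) {C : ℝ} (hC : ∀ a x j, |w a x j| ≤ C)
    (h3 : Integrable (fun o => covarNorm o.2.2 ^ 3) (P k))
    {ν₀ : PSParam (d k)} (hov : ModelOverlap (P k) ν₀) (hps : PSCorrect (P k) ν₀)
    {β₀ : ORCoef (d k)} {orE : ℕ → Ω → ORCoef (d k)}
    (hor : SmallInProb μ fun N ω => orE N ω - β₀) :
    SmallInProb μ fun (N : ℕ) ω => √(N : ℝ) *
      avg Z (onTypeV k fun o => regSlope w o.2.2 - ipwSlope w ν₀ o) N ω (orE N ω - β₀)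
        - √(N : ℝ) * avg Z (fun _ => (0 : ℝ)) N ω := by
  have h0 : ∫ z, (onTypeV k fun o => regSlope w o.2.2 - ipwSlope w ν₀ o) z ∂(mixLaw p P) = 0 := by
    rw [integral_onTypeV hp
      ((memLp_regSlope_sub_ipwSlope hw hC h3 hov).integrable (by norm_num)),
      integral_slope_of_psCorrect hw hC h3 hov hps, smul_zero]
  refine (hs.slope_centred (measurable_onTypeV_slope k hw ν₀) (memLp_onTypeV_slope k hw hC h3 hov)
    h0 hor).congr (highProb_of_forall (Eventually.of_forall fun N ω => ?_))
  simp [avg]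

/-- Under a correct propensity model, the estimated average of one type is asymptotically linear. -/
theorem exists_modelAipw_isAsympLinear_of_psCorrect (hp : ∀ k, 0 < p k)
    (hs : IsSample μ (mixLaw p P) Z) (k : Fin K) (hm : 2 ≤ M k)
    {w : Treat (M k) → Covar (M k) (d k) → Fin (M k) → ℝ}
    (hw : ∀ a j, Measurable fun x => w a x j) {C : ℝ} (hC : ∀ a x j, |w a x j| ≤ C)
    (hP : IsRegularLaw (P k)) (hnd : NondegenerateCovar (P k))
    (h3 : Integrable (fun o => covarNorm o.2.2 ^ 3) (P k))
    {ν₀ : PSParam (d k)} (hν₀ : 0 < ν₀.precision) (hps : PSCorrect (P k) ν₀)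
    {psE : ℕ → Ω → PSParam (d k)} {κ : Data M d → PSParam (d k)}
    (hpsE : IsAsympLinear μ (mixLaw p P) Z psE ν₀ κ) {orE : ℕ → Ω → ORParam (d k)}
    (horE : IsMaximizerEventually μ (orSpace (d k)) (orSampleLogLik Z k) orE) :
    ∃ ζ, IsAsympLinear μ (mixLaw p P) Z (fun N ω => avg Z (onType k fun o =>
      modelAipw w (psE N ω) (orE N ω).1 o - thetaObs w (P k)) N ω) 0 ζ := by
  have hov := hP.modelOverlap hps
  -- The coefficients converge to the population least squares solution, whether or not it describes
  -- the regression.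
  obtain ⟨β, hβ⟩ := exists_integral_orScore_eq_zero hm hP hnd h3
  have hor := orEst_consistent hp hs k hm hP hnd h3 hβ horE
  exact ⟨_, modelAipw_isAsympLinear (fun k => (hp k).le) hs k hw hC hP h3 hν₀ hov
    (integral_modelAipw_of_psCorrect hw hC hP h3 hov hps β) hpsE hor (κ' := fun _ => 0)
    measurable_const MemLp.zero
    (by simp) (slope_small_of_psCorrect (fun k => (hp k).le) hs k hw hC h3 hov hps hor)⟩

/-- Under a correct outcome model, the estimated average of one type is asymptotically linear. -/
theorem exists_modelAipw_isAsympLinear_of_orCorrect (hp : ∀ k, 0 < p k)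
    (hs : IsSample μ (mixLaw p P) Z) (k : Fin K) (hm : 2 ≤ M k)
    {w : Treat (M k) → Covar (M k) (d k) → Fin (M k) → ℝ}
    (hw : ∀ a j, Measurable fun x => w a x j) {C : ℝ} (hC : ∀ a x j, |w a x j| ≤ C)
    (hP : IsRegularLaw (P k)) (hnd : NondegenerateCovar (P k))
    (h3 : Integrable (fun o => covarNorm o.2.2 ^ 3) (P k))
    {ν₀ : PSParam (d k)} (hν₀ : 0 < ν₀.precision) (hov : ModelOverlap (P k) ν₀)
    (hOR : ORCorrect (P k)) (hres : ∀ j, Integrable (fun o => covarNorm o.2.2 ^ 2 *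
      (o.1 j - outcomeReg (P k) o.2.1 j o) ^ 2) (P k))
    {psE : ℕ → Ω → PSParam (d k)} {κ : Data M d → PSParam (d k)}
    (hpsE : IsAsympLinear μ (mixLaw p P) Z psE ν₀ κ) {orE : ℕ → Ω → ORParam (d k)}
    (horE : IsMaximizerEventually μ (orSpace (d k)) (orSampleLogLik Z k) orE) :
    ∃ ζ, IsAsympLinear μ (mixLaw p P) Z (fun N ω => avg Z (onType k fun o =>
      modelAipw w (psE N ω) (orE N ω).1 o - thetaObs w (P k)) N ω) 0 ζ := by
  obtain ⟨β, hβ⟩ := hOR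
  have h0 := integral_orScore_eq_zero hP h3 hβ
  have hor := orEst_consistent hp hs k hm hP hnd h3 h0 horE
  obtain ⟨κ', hκ'⟩ := orEst_isAsympLinear hp hs k hm hP hnd h3 h0
    (memLp_orScore hP h3 hβ hres) horE
  have hSi := (memLp_onTypeV_slope (p := p) (P := P) k hw hC h3 hov)
  have hprob := hs.isProbabilityMeasure
  have hslope := hs.slope_linear (measurable_onTypeV_slope k hw ν₀)
    (hSi.integrable (by norm_num)) hκ'
  set S := ∫ z, (onTypeV k fun o => regSlope w o.2.2 - ipwSlope w ν₀ o) z ∂(mixLaw p P)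
  refine ⟨_, modelAipw_isAsympLinear (fun k => (hp k).le) hs k hw hC hP h3 hν₀ hov
    (integral_modelAipw_of_orCorrect hw hC hP h3 hov hβ) hpsE hor
    (S.continuous.measurable.comp hκ'.meas) (S.comp_memLp' hκ'.memLp) ?_ hslope⟩
  have := S.integral_comp_comm (hκ'.memLp.integrable (by norm_num))
  rw [hκ'.mean, map_zero] at this
  exact this

/-- If both models are correct, the estimation of the nuisance parameters has no first order
effect. -/
theorem modelAipw_isAsympLinear_of_correct (hp : ∀ k, 0 < p k)
    (hs : IsSample μ (mixLaw p P) Z) (k : Fin K) (hm : 2 ≤ M k)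
    {w : Treat (M k) → Covar (M k) (d k) → Fin (M k) → ℝ}
    (hw : ∀ a j, Measurable fun x => w a x j) {C : ℝ} (hC : ∀ a x j, |w a x j| ≤ C)
    (hP : IsRegularLaw (P k)) (hnd : NondegenerateCovar (P k))
    (h3 : Integrable (fun o => covarNorm o.2.2 ^ 3) (P k))
    {ν₀ : PSParam (d k)} (hν₀ : 0 < ν₀.precision) (hps : PSCorrect (P k) ν₀)
    {β : ORCoef (d k)} (hβ : ∀ a j, ∀ᵐ o ∂(P k), outcomeReg (P k) a j o = orModel a o.2.2 β j)
    {psE : ℕ → Ω → PSParam (d k)} {κ : Data M d → PSParam (d k)}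
    (hpsE : IsAsympLinear μ (mixLaw p P) Z psE ν₀ κ) {orE : ℕ → Ω → ORParam (d k)}
    (horE : IsMaximizerEventually μ (orSpace (d k)) (orSampleLogLik Z k) orE) :
    IsAsympLinear μ (mixLaw p P) Z (fun N ω => avg Z (onType k fun o =>
      modelAipw w (psE N ω) (orE N ω).1 o - thetaObs w (P k)) N ω) 0
      (onType k fun o => modelAipw w ν₀ β o - thetaObs w (P k)) := by
  have hov := hP.modelOverlap hps
  have hor := orEst_consistent hp hs k hm hP hnd h3 (integral_orScore_eq_zero hP h3 hβ) horE
  have h := modelAipw_isAsympLinear (fun k => (hp k).le) hs k hw hC hP h3 hν₀ hov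
    (integral_modelAipw_of_psCorrect hw hC hP h3 hov hps β) hpsE hor (κ' := fun _ => 0)
    measurable_const MemLp.zero
    (by simp) (slope_small_of_psCorrect (fun k => (hp k).le) hs k hw hC h3 hov hps hor)
  -- The slope term has already dropped out by the correct propensity model; this coefficient
  -- vanishes by the correct outcome model.
  have hL : ∫ z, onTypeV k (ipwResid w ν₀ β) z • onTypeV k (fun o => psGrad o.2.1 o.2.2 ν₀) z
      ∂(mixLaw p P) = 0 := by
    have e : ∀ z : Data M d, onTypeV k (ipwResid w ν₀ β) z •
        onTypeV k (fun o => psGrad o.2.1 o.2.2 ν₀) z =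
        onTypeV k (fun o => ipwResid w ν₀ β o • psGrad o.2.1 o.2.2 ν₀) z := fun z =>
      (onTypeV_map₂ (T := fun (t : ℝ) (q : PSParam (d k) →L[ℝ] ℝ) => t • q) (by simp) z).symm
    simp only [e]
    rw [integral_onTypeV (fun k => (hp k).le)
      (integrable_ipwResid_smul_psGrad hw hC hP h3 hν₀ hov β),
      integral_ipwResid_smul_psGrad_of_orCorrect hw hC hP h3 hν₀ hov hβ, smul_zero]
  simpa only [hL, zero_apply, neg_zero, add_zero] using h

end OneType

end

/-! ### Asymptotic normality -/

section

section Normality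

variable {𝒵 Ω : Type*} [MeasurableSpace 𝒵] [MeasurableSpace Ω] {μ : Measure Ω}
  [IsProbabilityMeasure μ] {P : Measure 𝒵} {Z : ℕ → Ω → 𝒵}

theorem IsAsympLinear.asymptoticallyNormalWith (hs : IsSample μ P Z) {T : ℕ → Ω → ℝ} {τ : ℝ}
    {ψ : 𝒵 → ℝ} (h : IsAsympLinear μ P Z T τ ψ) (hT : ∀ N, Measurable (T N)) :
    AsymptoticallyNormalWith μ P Z T τ ψ := by
  have hsmall := smallInProb_iff_tendstoInMeasure.1 h.small
  simp only [smul_eq_mul, sqrt_mul_avg] at hsmall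
  refine ⟨h.memLp, h.mean, hsmall, ?_⟩
  have hclt := hs.clt h.meas h.memLp h.mean
  simp only [sqrt_mul_avg] at hclt
  exact tendstoInDistribution_of_tendstoInMeasure_sub _ _ hclt hsmall fun N =>
    (((hT N).sub_const τ).const_mul _).aemeasurable

theorem IsSample.avg_isAsympLinear (hs : IsSample μ P Z) {g : 𝒵 → ℝ} (hg : Measurable g)
    (h2 : MemLp g 2 P) {q : ℝ} (hq : ∫ z, g z ∂P = q) :
    IsAsympLinear μ P Z (avg Z g) q fun z => g z - q := by
  have := hs.isProbabilityMeasure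
  refine ⟨hg.sub_const q, h2.sub (memLp_const q), ?_, smallInProb_zero.congr
    (highProb_of_forall ?_)⟩
  · rw [integral_sub (h2.integrable (by norm_num)) (integrable_const _), hq]
    simp
  · filter_upwards [eventually_ne_atTop 0] with N hN ω
    rw [avg_sub, avg_const hN, sub_self]

end Normality

/-- For the delta method. At `s = 0` the derivative of the denominator drops out, so the frequency
acts only through `v`. -/
theorem hasFDerivAt_weighted_ratio {v : ℝ → ℝ} {p : ℝ} (hp : p ≠ 0) (hv : DifferentiableAt ℝ v p)
    (θ : ℝ) : HasFDerivAt (fun s : ℝ × ℝ => v s.2 * (s.1 / s.2 + θ))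
      ((v p / p) • ContinuousLinearMap.fst ℝ ℝ ℝ
        + (deriv v p * θ) • ContinuousLinearMap.snd ℝ ℝ ℝ) (0, p) := by
  have h1 : HasFDerivAt (fun s : ℝ × ℝ => v s.2) (deriv v p • ContinuousLinearMap.snd ℝ ℝ ℝ)
      (0, p) := HasDerivAt.comp_hasFDerivAt (h₂ := v) (0, p) hv.hasDerivAt hasFDerivAt_snd
  have h2 : HasFDerivAt (fun s : ℝ × ℝ => (s.2)⁻¹)
      ((-(p ^ 2)⁻¹) • ContinuousLinearMap.snd ℝ ℝ ℝ) (0, p) :=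
    HasDerivAt.comp_hasFDerivAt (h₂ := fun x : ℝ => x⁻¹) (0, p) (hasDerivAt_inv hp) hasFDerivAt_snd
  have h3 := (h1.mul (((hasFDerivAt_fst (𝕜 := ℝ) (p := ((0 : ℝ), p))).mul h2).add_const θ))
  simp only [div_eq_mul_inv]
  refine h3.congr_fderiv ?_
  ext <;> simp [mul_comm]

section Estimator

variable {K : ℕ} {M d : Fin K → ℕ} {Ω : Type*} [MeasurableSpace Ω] {μ : Measure Ω}
  [IsProbabilityMeasure μ] {Z : ℕ → Ω → Data M d} {p : Fin K → ℝ}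
  {P : ∀ k, Measure (Obs (M k) (d k))} [∀ k, IsProbabilityMeasure (P k)]

theorem typeCount_div (k : Fin K) (N : ℕ) (ω : Ω) :
    typeCount Z k N ω / N = avg Z (onType k fun _ => 1) N ω := by
  rw [avg, typeCount, smul_eq_mul, div_eq_inv_mul]

theorem typeFreq_isAsympLinear (hp : ∀ k, 0 ≤ p k) (hs : IsSample μ (mixLaw p P) Z) (k : Fin K) :
    IsAsympLinear μ (mixLaw p P) Z (avg Z (onType k fun _ => 1)) (p k)
      fun z => onType k (fun _ => 1) z - p k := by
  refine hs.avg_isAsympLinear (measurable_onTypeV measurable_const)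
    (memLp_onTypeV (memLp_const (1 : ℝ)))
    ((integral_onTypeV hp (integrable_const (1 : ℝ))).trans ?_)
  simp

/-- Asymptotic linearity of `τ̂`. -/
theorem tauHat_isAsympLinear (hp : ∀ k, 0 < p k) (hs : IsSample μ (mixLaw p P) Z)
    {v : Fin K → ℝ → ℝ} (hv : ∀ k, ContDiffOn ℝ 1 (v k) (Set.Ioi 0))
    {w : ∀ k, Treat (M k) → Covar (M k) (d k) → Fin (M k) → ℝ}
    {psE : ∀ k, ℕ → Ω → PSParam (d k)} {orE : ∀ k, ℕ → Ω → ORParam (d k)} {θ : Fin K → ℝ}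
    {ζ : Fin K → Data M d → ℝ}
    (h : ∀ k, IsAsympLinear μ (mixLaw p P) Z (fun N ω => avg Z (onType k fun o =>
      modelAipw (w k) (psE k N ω) (orE k N ω).1 o - θ k) N ω) 0 (ζ k)) :
    IsAsympLinear μ (mixLaw p P) Z (tauHat v w Z psE orE) (∑ k, v k (p k) * θ k)
      fun z => ∑ k, (v k (p k) / p k * ζ k z
        + deriv (v k) (p k) * θ k * (onType k (fun _ => 1) z - p k)) := by
  have := hs.isProbabilityMeasure
  have hfreq := fun k => typeFreq_isAsympLinear (fun k => (hp k).le) hs k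
  have hd : ∀ k, DifferentiableAt ℝ (v k) (p k) := fun k =>
    ((hv k).contDiffAt (Ioi_mem_nhds (hp k))).differentiableAt one_ne_zero
  have hdelta := fun k => ((h k).prodMk (hfreq k)).delta hs
    (hasFDerivAt_weighted_ratio (hp k).ne' (hd k) (θ k))
  have hsum := IsAsympLinear.sum hdelta
  simp only [zero_div, zero_add, add_apply, smul_apply, ContinuousLinearMap.coe_fst',
    ContinuousLinearMap.coe_snd', smul_eq_mul] at hsum
  refine hsum.congr ?_
  -- With probability tending to one every type occurs, and the ratio defining `thetaHat` is
  -- genuine.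
  have hpos : ∀ k, HighProb μ fun N ω => 0 < avg Z (onType k fun _ => 1) N ω := fun k => by
    refine ((hs.lln (g := onType k fun _ => (1 : ℝ)) (measurable_onTypeV measurable_const)
      (integrable_onTypeV (integrable_const (1 : ℝ)))) (p k) (hp k)).imp fun N ω hN => ?_
    have e : ∫ z, onType k (fun _ => 1) z ∂(mixLaw p P) = p k := by
      refine (integral_onTypeV (P := P) (fun k => (hp k).le) (integrable_const (1 : ℝ))).trans ?_
      simp
    rw [e, Real.norm_eq_abs, abs_lt] at hN
    linarith [hN.1]
  refine (HighProb.forall_fintype hpos).imp fun N ω hN => ?_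
  rw [tauHat]
  refine Finset.sum_congr rfl fun k _ => ?_
  rw [typeCount_div]
  congr 1
  have e1 : thetaHat w Z psE orE k N ω = avg Z (onType k (modelAipw (w k) (psE k N ω)
      (orE k N ω).1)) N ω / avg Z (onType k fun _ => 1) N ω := by
    have hN0 : (N : ℝ) ≠ 0 := by
      rintro h0
      have := hN k
      simp [avg, h0] at this
    rw [avg, avg, smul_eq_mul, smul_eq_mul, mul_div_mul_left _ _ (inv_ne_zero hN0)]
    rfl
  rw [e1, avg_onType_sub_const, sub_div, mul_div_cancel_right₀ _ (hN k).ne']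
  ring

/-! ### Measurability of the estimator -/

/-- The data of a cluster of type `k`, with an arbitrary value for other types. -/
def projType (k : Fin K) (z : Data M d) : Obs (M k) (d k) :=
  if h : z.1 = k then h ▸ z.2 else (0, fun _ => false, 0)

theorem projType_mk_self (k : Fin K) (o : Obs (M k) (d k)) :
    projType k (⟨k, o⟩ : Data M d) = o := by simp [projType]

theorem measurable_projType (k : Fin K) : Measurable (projType k : Data M d → _) := by
  refine measurable_sigma_of fun j => ?_
  by_cases h : j = k
  · subst h; simp only [projType_mk_self]; exact measurable_id
  · simp only [projType, h, dite_false]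
    exact measurable_const

/-- Writes the term as an indicator times a function on a fixed space, so that measurability can be
proved when `f` itself varies with the sample. -/
theorem onType_eq_mul (k : Fin K) (f : Obs (M k) (d k) → ℝ) (z : Data M d) :
    onType k f z = onType k (fun _ => 1) z * f (projType k z) := by
  refine onTypeV_cases (k := k) (p := fun z => onType k f z =
    onType k (fun _ => 1) z * f (projType k z)) z (fun o => ?_) fun j o h => ?_
  · simp [onType_eq, projType_mk_self]
  · simp [onType_eq, onTypeV_mk_ne _ _ h]

theorem measurable_modelAipw_comp {m d : ℕ} {w : Treat m → Covar m d → Fin m → ℝ}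
    (hw : ∀ a j, Measurable fun x => w a x j) {o : Ω → Obs m d} (ho : Measurable o)
    {ν : Ω → PSParam d} (hν : Measurable ν) {β : Ω → ORCoef d} (hβ : Measurable β) :
    Measurable fun ω => modelAipw w (ν ω) (β ω) (o ω) := by
  have hx : Measurable fun ω => (o ω).2.2 := measurable_snd.snd.comp ho
  have hps : ∀ a, Measurable fun ω => psModel a (o ω).2.2 (ν ω) := fun a =>
    (measurable_psModel a).comp (hx.prodMk hν)
  have hor : ∀ a j, Measurable fun ω => orModel a (o ω).2.2 (β ω) j := fun a j =>
    Finset.measurable_fun_sum _ fun i _ => ((continuous_orRegressor a j i).measurable.comp hx).mul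
      ((measurable_pi_apply i).comp hβ)
  have hwx : ∀ a j, Measurable fun ω => w a (o ω).2.2 j := fun a j => (hw a j).comp hx
  have e : ∀ ω, modelAipw w (ν ω) (β ω) (o ω) = (∑ a, ind a (o ω) * ((∑ j, w a (o ω).2.2 j *
      ((o ω).1 j - orModel a (o ω).2.2 (β ω) j)) / psModel a (o ω).2.2 (ν ω)))
        + ∑ a, ∑ j, w a (o ω).2.2 j * orModel a (o ω).2.2 (β ω) j := fun ω => by
    rw [sum_ind_mul (fun a => (∑ j, w a (o ω).2.2 j *
      ((o ω).1 j - orModel a (o ω).2.2 (β ω) j)) / psModel a (o ω).2.2 (ν ω))]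
    rfl
  simp only [e]
  exact (Finset.measurable_fun_sum _ fun a _ => ((measurable_ind a).comp ho).mul
    ((Finset.measurable_fun_sum _ fun j _ => (hwx a j).mul
      (((measurable_outcome j).comp ho).sub (hor a j))).div (hps a))).add
    (Finset.measurable_fun_sum _ fun a _ => Finset.measurable_fun_sum _ fun j _ =>
      (hwx a j).mul (hor a j))

/-- The count takes natural values, so no measurability of `f` is required; `v` is controlled only
on the positive half line. -/
theorem measurable_comp_typeCount (hZ : ∀ i, Measurable (Z i)) (k : Fin K) (N : ℕ) (f : ℝ → ℝ) :
    Measurable fun ω => f (typeCount Z k N ω) := by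
  set n : Ω → ℕ := fun ω => ∑ i ∈ Finset.range N, if (Z i ω).1 = k then 1 else 0 with hn
  have hnm : Measurable n := Finset.measurable_fun_sum _ fun i _ =>
    Measurable.ite (hZ i (measurableSet_fst_preimage k)) measurable_const measurable_const
  have e : ∀ ω, typeCount Z k N ω = (n ω : ℝ) := fun ω => by
    simp only [hn, typeCount, Nat.cast_sum]
    refine Finset.sum_congr rfl fun i _ => ?_
    by_cases h : (Z i ω).1 = k <;> simp [onType, h]
  simp only [e]
  exact (measurable_from_nat (f := fun i : ℕ => f i)).comp hnm

theorem measurable_tauHat (hZ : ∀ i, Measurable (Z i)) (v : Fin K → ℝ → ℝ)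
    {w : ∀ k, Treat (M k) → Covar (M k) (d k) → Fin (M k) → ℝ}
    (hw : ∀ k a j, Measurable fun x => w k a x j)
    {psE : ∀ k, ℕ → Ω → PSParam (d k)} (hps : ∀ k N, Measurable (psE k N))
    {orE : ∀ k, ℕ → Ω → ORParam (d k)} (hor : ∀ k N, Measurable (orE k N)) (N : ℕ) :
    Measurable (tauHat v w Z psE orE N) := by
  refine Finset.measurable_fun_sum _ fun k _ => ?_
  refine (measurable_comp_typeCount hZ k N fun t => v k (t / N)).mul (Measurable.div ?_
    (measurable_comp_typeCount hZ k N id))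
  refine Finset.measurable_fun_sum _ fun i _ => ?_
  have e : ∀ ω, onType k (aipw (w k) (fun a o => psModel a o.2.2 (psE k N ω))
      (fun a j o => orModel a o.2.2 (orE k N ω).1 j)) (Z i ω) = onType k (fun _ => 1) (Z i ω) *
        modelAipw (w k) (psE k N ω) (orE k N ω).1 (projType k (Z i ω)) := fun ω =>
    onType_eq_mul _ _ _
  simp only [e]
  exact ((measurable_onTypeV measurable_const).comp (hZ i)).mul
    (measurable_modelAipw_comp (hw k) ((measurable_projType k).comp (hZ i)) (hps k N)
      (measurable_fst.comp (hor k N)))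

end Estimator

end

/-! ### Regular submodels -/

section

section Submodel

variable {𝒵 : Type*} [MeasurableSpace 𝒵] {P : Measure 𝒵}

/-- Cauchy–Schwarz, from the discriminant of the nonnegative quadratic `x ↦ ∫ (x f + g)²`. -/
theorem sq_integral_mul_le {f g : 𝒵 → ℝ} (hf : MemLp f 2 P) (hg : MemLp g 2 P) :
    (∫ z, f z * g z ∂P) ^ 2 ≤ (∫ z, f z ^ 2 ∂P) * ∫ z, g z ^ 2 ∂P := by
  have hff := hf.integrable_sq
  have hgg := hg.integrable_sq
  have hfg : Integrable (fun z => f z * g z) P := hf.integrable_mul hg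
  have h : ∀ x : ℝ, 0 ≤ (∫ z, f z ^ 2 ∂P) * (x * x) + 2 * (∫ z, f z * g z ∂P) * x
      + ∫ z, g z ^ 2 ∂P := fun x => by
    have e : ∫ z, (x * f z + g z) ^ 2 ∂P = (∫ z, f z ^ 2 ∂P) * (x * x)
        + 2 * (∫ z, f z * g z ∂P) * x + ∫ z, g z ^ 2 ∂P := by
      have e1 : ∀ z, (x * f z + g z) ^ 2 = x * x * f z ^ 2 + 2 * x * (f z * g z) + g z ^ 2 :=
        fun z => by ring
      simp only [e1]
      have i1 : Integrable (fun z => x * x * f z ^ 2 + 2 * x * (f z * g z)) P :=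
        (hff.const_mul _).add (hfg.const_mul _)
      rw [integral_add i1 hgg, integral_add (hff.const_mul _) (hfg.const_mul _),
        integral_const_mul, integral_const_mul]
      ring
    rw [← e]
    exact integral_nonneg fun z => sq_nonneg _
  have := discrim_le_zero h
  rw [discrim] at this
  nlinarith

theorem abs_integral_mul_le {f g : 𝒵 → ℝ} (hf : MemLp f 2 P) (hg : MemLp g 2 P) :
    |∫ z, f z * g z ∂P| ≤ √(∫ z, f z ^ 2 ∂P) * √(∫ z, g z ^ 2 ∂P) := by
  rw [← Real.sqrt_mul (integral_nonneg fun z => sq_nonneg _)]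
  exact Real.abs_le_sqrt (sq_integral_mul_le hf hg)

theorem sq_integral_le [IsProbabilityMeasure P] {f : 𝒵 → ℝ} (hf : MemLp f 2 P) :
    (∫ z, f z ∂P) ^ 2 ≤ ∫ z, f z ^ 2 ∂P := by
  simpa using sq_integral_mul_le hf (memLp_const (1 : ℝ))

theorem integral_abs_le [IsProbabilityMeasure P] {f : 𝒵 → ℝ} (hf : MemLp f 2 P) :
    ∫ z, |f z| ∂P ≤ √(∫ z, f z ^ 2 ∂P) := by
  refine Real.le_sqrt_of_sq_le ?_
  simpa using sq_integral_le (f := fun z => |f z|) hf.abs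

/-- Uniform integrability: integrals of `|m U|` are small for uniformly bounded `m` that are small
in `L¹`. -/
theorem exists_integral_abs_mul_le {U : 𝒵 → ℝ} (hU : Integrable U P) {B : ℝ} (hB : 0 ≤ B)
    {ε : ℝ} (hε : 0 < ε) : ∃ δ > 0, ∀ m : 𝒵 → ℝ, Integrable m P → (∀ᵐ z ∂P, |m z| ≤ B) →
      ∫ z, |m z| ∂P ≤ δ → ∫ z, |m z| * |U z| ∂P ≤ ε := by
  -- Truncate `|U|` at a level `n`: the excess has small mean and meets `|m| ≤ B`; the bounded part
  -- meets the small `L¹` norm of `m`.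
  have hlim : Tendsto (fun n : ℕ => ∫ z, (|U z| - min |U z| n) ∂P) atTop (𝓝 (∫ _, 0 ∂P)) := by
    refine tendsto_integral_of_dominated_convergence (fun z => |U z|) (fun n => ?_) hU.abs
      (fun n => Eventually.of_forall fun z => ?_) (Eventually.of_forall fun z => ?_)
    · exact hU.abs.1.sub (hU.abs.1.inf aestronglyMeasurable_const)
    · have h1 := abs_nonneg (U z)
      rw [Real.norm_of_nonneg (sub_nonneg.2 (min_le_left _ _))]
      have : (0 : ℝ) ≤ min |U z| n := le_min h1 (Nat.cast_nonneg n)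
      linarith
    · refine tendsto_const_nhds.congr' ?_
      filter_upwards [eventually_ge_atTop ⌈|U z|⌉₊] with n hn
      rw [min_eq_left ((Nat.le_ceil _).trans (by exact_mod_cast hn)), sub_self]
  rw [integral_zero] at hlim
  obtain ⟨n, hn⟩ := (hlim.eventually (gt_mem_nhds
    (show 0 < ε / (2 * (B + 1)) by positivity))).exists
  refine ⟨ε / (2 * (n + 1)), by positivity, fun m hm hmB hmδ => ?_⟩
  have hti : Integrable (fun z => |U z| - min |U z| n) P :=
    hU.abs.mono' (hU.abs.1.sub (hU.abs.1.inf aestronglyMeasurable_const))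
      (Eventually.of_forall fun z => by
        have h1 := abs_nonneg (U z)
        rw [Real.norm_of_nonneg (sub_nonneg.2 (min_le_left _ _))]
        have : (0 : ℝ) ≤ min |U z| n := le_min h1 (Nat.cast_nonneg n)
        linarith)
  have hle : ∀ᵐ z ∂P, |m z| * |U z| ≤ n * |m z| + B * (|U z| - min |U z| n) := by
    filter_upwards [hmB] with z hz
    have h1 : 0 ≤ |U z| - min |U z| n := sub_nonneg.2 (min_le_left _ _)
    have h2 : min |U z| n ≤ n := min_le_right _ _
    nlinarith [abs_nonneg (m z), mul_le_mul_of_nonneg_right hz h1,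
      mul_le_mul_of_nonneg_left h2 (abs_nonneg (m z))]
  have hri : Integrable (fun z => n * |m z| + B * (|U z| - min |U z| n)) P :=
    (hm.abs.const_mul _).add (hti.const_mul _)
  have hn0 : (0 : ℝ) ≤ n := Nat.cast_nonneg n
  calc ∫ z, |m z| * |U z| ∂P ≤ ∫ z, (n * |m z| + B * (|U z| - min |U z| n)) ∂P :=
        integral_mono_of_nonneg (Eventually.of_forall fun z => by positivity) hri hle
    _ = n * ∫ z, |m z| ∂P + B * ∫ z, (|U z| - min |U z| n) ∂P := by
        rw [integral_add (hm.abs.const_mul _) (hti.const_mul _), integral_const_mul,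
          integral_const_mul]
    _ ≤ n * (ε / (2 * (n + 1))) + B * (ε / (2 * (B + 1))) :=
        add_le_add (mul_le_mul_of_nonneg_left hmδ hn0) (mul_le_mul_of_nonneg_left hn.le hB)
    _ ≤ (n + 1) * (ε / (2 * (n + 1))) + (B + 1) * (ε / (2 * (B + 1))) := by
        gcongr <;> linarith
    _ = ε := by field_simp; ring

variable [IsProbabilityMeasure P] {r : ℝ → 𝒵 → ℝ} {s : 𝒵 → ℝ}

theorem IsRegularSubmodel.memLp (h : IsRegularSubmodel P r s) :
    ∀ᶠ t in 𝓝 (0 : ℝ), MemLp (r t) 2 P := by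
  obtain ⟨C, hC, hb⟩ := h.bounds
  filter_upwards [hb] with t ht
  refine MemLp.of_bound (h.measurable t).aestronglyMeasurable C (Eventually.of_forall fun z => ?_)
  rw [Real.norm_of_nonneg ((inv_pos.2 hC).le.trans (ht z).1)]
  exact (ht z).2

theorem IsRegularSubmodel.memLp_remainder (h : IsRegularSubmodel P r s) :
    ∀ᶠ t in 𝓝 (0 : ℝ), MemLp (fun z => (√(r t z) - 1) / t - s z / 2) 2 P := by
  obtain ⟨C, hC, hb⟩ := h.bounds
  filter_upwards [hb] with t ht
  have h1 : MemLp (fun z => √(r t z)) 2 P := by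
    refine MemLp.of_bound (h.measurable t).sqrt.aestronglyMeasurable √C
      (Eventually.of_forall fun z => ?_)
    rw [Real.norm_of_nonneg (Real.sqrt_nonneg _)]
    exact Real.sqrt_le_sqrt (ht z).2
  have h2 : MemLp (fun z => (√(r t z) - 1) * t⁻¹ - s z * 2⁻¹) 2 P :=
    ((h1.sub (memLp_const (1 : ℝ))).mul_const t⁻¹).sub (h.score_memLp.mul_const 2⁻¹)
  simpa only [div_eq_mul_inv] using h2

/-- The likelihood ratios of a regular submodel are Lipschitz at `0` in mean square. -/
theorem IsRegularSubmodel.exists_integral_sq_le (h : IsRegularSubmodel P r s) :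
    ∃ B > 0, ∀ᶠ t in 𝓝 (0 : ℝ), ∫ z, (r t z - 1) ^ 2 ∂P ≤ B * t ^ 2 := by
  obtain ⟨C, hC, hb⟩ := h.bounds
  have hS : 0 ≤ ∫ z, s z ^ 2 ∂P := integral_nonneg fun z => sq_nonneg _
  refine ⟨(√C + 1) ^ 2 * (2 * 1 + (∫ z, s z ^ 2 ∂P) / 2), by positivity, ?_⟩
  have hA : ∀ᶠ t in 𝓝 (0 : ℝ), t ≠ 0 → ∫ z, ((√(r t z) - 1) / t - s z / 2) ^ 2 ∂P < 1 :=
    eventually_nhdsWithin_iff.1 (h.qmd.eventually (gt_mem_nhds one_pos))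
  filter_upwards [hb, hA, h.memLp, h.memLp_remainder] with t ht hAt hr hrem
  by_cases h0 : t = 0
  · simp [h0, h.at_zero]
  -- Factor `r - 1 = (√r - 1) (√r + 1)`: the second factor is at most `√C + 1`, and the first is `t`
  -- times half the score plus remainder.
  have hle : ∀ z, (r t z - 1) ^ 2 ≤ (√C + 1) ^ 2 * t ^ 2 *
      (2 * ((√(r t z) - 1) / t - s z / 2) ^ 2 + s z ^ 2 / 2) := fun z => by
    have hr0 : 0 ≤ r t z := (inv_pos.2 hC).le.trans (ht z).1
    set x := √(r t z) with hx
    have hx2 : x ^ 2 = r t z := Real.sq_sqrt hr0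
    have hx0 : 0 ≤ x := Real.sqrt_nonneg _
    have hxC : x ≤ √C := Real.sqrt_le_sqrt (ht z).2
    set A := (x - 1) / t - s z / 2 with hA
    have hxA : x - 1 = t * (A + s z / 2) := by rw [hA]; field_simp; ring
    have e : (r t z - 1) ^ 2 = (x + 1) ^ 2 * (t ^ 2 * (A + s z / 2) ^ 2) := by
      rw [← mul_pow, ← hxA, ← hx2]; ring
    have h1 : (A + s z / 2) ^ 2 ≤ 2 * A ^ 2 + s z ^ 2 / 2 := by
      nlinarith [sq_nonneg (A - s z / 2)]
    have h2 : (x + 1) ^ 2 ≤ (√C + 1) ^ 2 := by gcongr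
    rw [e, mul_assoc]
    exact mul_le_mul h2 (mul_le_mul_of_nonneg_left h1 (sq_nonneg t)) (by positivity)
      (by positivity)
  have hAi := hrem.integrable_sq
  have hSi := h.score_memLp.integrable_sq
  have hi : Integrable (fun z => 2 * ((√(r t z) - 1) / t - s z / 2) ^ 2 + s z ^ 2 / 2) P :=
    (hAi.const_mul 2).add (hSi.div_const 2)
  calc ∫ z, (r t z - 1) ^ 2 ∂P ≤ ∫ z, (√C + 1) ^ 2 * t ^ 2 *
        (2 * ((√(r t z) - 1) / t - s z / 2) ^ 2 + s z ^ 2 / 2) ∂P :=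
        integral_mono (hr.sub (memLp_const (1 : ℝ))).integrable_sq (hi.const_mul _) hle
    _ = (√C + 1) ^ 2 * t ^ 2 * (2 * ∫ z, ((√(r t z) - 1) / t - s z / 2) ^ 2 ∂P
        + (∫ z, s z ^ 2 ∂P) / 2) := by
        rw [integral_const_mul, integral_add (hAi.const_mul 2) (hSi.div_const 2),
          integral_const_mul, integral_div]
    _ ≤ (√C + 1) ^ 2 * t ^ 2 * (2 * 1 + (∫ z, s z ^ 2 ∂P) / 2) := by
        have := (hAt h0).le
        gcongr
    _ = _ := by ring

theorem IsRegularSubmodel.tendsto_integral_abs (h : IsRegularSubmodel P r s) :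
    Tendsto (fun t => ∫ z, |r t z - 1| ∂P) (𝓝 0) (𝓝 0) := by
  obtain ⟨B, hB, hle⟩ := h.exists_integral_sq_le
  have hlim : Tendsto (fun t : ℝ => √(B * t ^ 2)) (𝓝 0) (𝓝 0) := by
    have : Continuous fun t : ℝ => √(B * t ^ 2) := by fun_prop
    simpa using this.tendsto 0
  refine tendsto_of_tendsto_of_tendsto_of_le_of_le' tendsto_const_nhds hlim
    (Eventually.of_forall fun t => integral_nonneg fun z => abs_nonneg _) ?_
  filter_upwards [hle, h.memLp] with t ht hr
  exact (integral_abs_le (hr.sub (memLp_const (1 : ℝ)))).trans (Real.sqrt_le_sqrt ht)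

/-- Means of square integrable functions are differentiable along regular submodels. -/
theorem IsRegularSubmodel.hasDerivAt_integral (h : IsRegularSubmodel P r s) {f : 𝒵 → ℝ}
    (hf : MemLp f 2 P) :
    HasDerivAt (fun t => ∫ z, f z * r t z ∂P) (∫ z, f z * s z ∂P) 0 := by
  obtain ⟨C, hC, hb⟩ := h.bounds
  have hfs : Integrable (fun z => f z * s z) P := hf.integrable_mul h.score_memLp
  have hfi : Integrable f P := hf.integrable (by norm_num)
  rw [hasDerivAt_iff_tendsto_slope, ← tendsto_sub_nhds_zero_iff]
  have hsmall : Tendsto (fun t => ∫ z, |√(r t z) - 1| * |f z * s z| ∂P) (𝓝 0) (𝓝 0) := by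
    refine Metric.tendsto_nhds.2 fun ε hε => ?_
    obtain ⟨δ, hδ, hle⟩ := exists_integral_abs_mul_le hfs
      (show (0 : ℝ) ≤ √C + 1 by positivity) (half_pos hε)
    filter_upwards [hb, h.tendsto_integral_abs.eventually (gt_mem_nhds hδ), h.memLp]
      with t ht hlt hr
    have hm : Integrable (fun z => √(r t z) - 1) P := by
      refine Integrable.of_bound ((h.measurable t).sqrt.sub_const 1).aestronglyMeasurable (√C + 1)
        (Eventually.of_forall fun z => ?_)
      refine (norm_sub_le _ _).trans ?_
      rw [Real.norm_of_nonneg (Real.sqrt_nonneg _), norm_one]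
      exact add_le_add (Real.sqrt_le_sqrt (ht z).2) le_rfl
    have h1 := hle (fun z => √(r t z) - 1) hm (Eventually.of_forall fun z => by
      refine (abs_sub _ _).trans ?_
      rw [abs_of_nonneg (Real.sqrt_nonneg _), abs_one]
      exact add_le_add (Real.sqrt_le_sqrt (ht z).2) le_rfl) (by
      refine (integral_mono hm.abs ((hr.sub (memLp_const (1 : ℝ))).integrable
        (by norm_num)).abs fun z => ?_).trans hlt.le
      have hr0 : 0 ≤ r t z := (inv_pos.2 hC).le.trans (ht z).1
      have hx2 : √(r t z) ^ 2 = r t z := Real.sq_sqrt hr0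
      have hx0 : 0 ≤ √(r t z) := Real.sqrt_nonneg _
      have e : r t z - 1 = (√(r t z) - 1) * (√(r t z) + 1) := by nlinarith
      simp only [Pi.sub_apply]
      rw [e, abs_mul]
      exact le_mul_of_one_le_right (abs_nonneg _) (by rw [abs_of_nonneg] <;> linarith))
    rw [Real.dist_0_eq_abs, abs_of_nonneg (integral_nonneg fun z => by positivity)]
    linarith
  have hA : Tendsto (fun t => (√C + 1) * (√(∫ z, f z ^ 2 ∂P) *
      √(∫ z, ((√(r t z) - 1) / t - s z / 2) ^ 2 ∂P)) + 2⁻¹ * ∫ z, |√(r t z) - 1| * |f z * s z| ∂P)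
      (𝓝[≠] 0) (𝓝 0) := by
    have h1 := ((Real.continuous_sqrt.tendsto 0).comp h.qmd).const_mul √(∫ z, f z ^ 2 ∂P)
    have h2 := (h1.const_mul (√C + 1)).add ((hsmall.mono_left nhdsWithin_le_nhds).const_mul 2⁻¹)
    simpa using h2
  refine squeeze_zero_norm' ?_ hA
  filter_upwards [nhdsWithin_le_nhds hb, nhdsWithin_le_nhds h.memLp_remainder,
    nhdsWithin_le_nhds h.memLp, self_mem_nhdsWithin] with t ht hrem hr ht0
  have ht0 : t ≠ 0 := ht0
  set A : 𝒵 → ℝ := fun z => (√(r t z) - 1) / t - s z / 2 with hAdef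
  have hsq : ∀ z, r t z - 1 = (√(r t z) - 1) * (√(r t z) + 1) := fun z => by
    have hr0 : 0 ≤ r t z := (inv_pos.2 hC).le.trans (ht z).1
    have hx2 : √(r t z) ^ 2 = r t z := Real.sq_sqrt hr0
    nlinarith
  have hfr : Integrable (fun z => f z * r t z) P := hf.integrable_mul hr
  -- With `A` the remainder of differentiability in quadratic mean, `(r - 1) / t - s = A (√r + 1) +
  -- s (√r - 1) / 2`. Cauchy–Schwarz controls the first part, uniform integrability (`hsmall`) the
  -- second.
  have e1 : slope (fun t => ∫ z, f z * r t z ∂P) 0 t - ∫ z, f z * s z ∂P =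
      ∫ z, (f z * (A z * (√(r t z) + 1)) + 2⁻¹ * (f z * s z * (√(r t z) - 1))) ∂P := by
    rw [slope_def_field]
    simp only [h.at_zero, mul_one, sub_zero]
    have hd : Integrable (fun z => (f z * r t z - f z) / t) P := (hfr.sub hfi).div_const t
    rw [← integral_sub hfr hfi, ← integral_div, ← integral_sub hd hfs]
    refine integral_congr_ae (Eventually.of_forall fun z => ?_)
    have : f z * r t z - f z = f z * ((√(r t z) - 1) * (√(r t z) + 1)) := by rw [← hsq]; ring
    simp only [this, hAdef]
    field_simp
    ring
  have hx0 : ∀ z, 0 ≤ √(r t z) := fun z => Real.sqrt_nonneg _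
  have hxC : ∀ z, √(r t z) ≤ √C := fun z => Real.sqrt_le_sqrt (ht z).2
  have hfA : Integrable (fun z => |f z| * |A z|) P := hf.abs.integrable_mul hrem.abs
  have i2 : Integrable (fun z => |√(r t z) - 1| * |f z * s z|) P := by
    refine hfs.abs.bdd_mul ((h.measurable t).sqrt.sub_const 1).norm.aestronglyMeasurable
      (c := √C + 1) (Eventually.of_forall fun z => ?_)
    rw [Real.norm_eq_abs, abs_abs]
    refine (abs_sub _ _).trans ?_
    rw [abs_of_nonneg (hx0 z), abs_one]
    exact add_le_add (hxC z) le_rfl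
  rw [e1]
  calc ‖∫ z, (f z * (A z * (√(r t z) + 1)) + 2⁻¹ * (f z * s z * (√(r t z) - 1))) ∂P‖
      ≤ ∫ z, ((√C + 1) * (|f z| * |A z|) + 2⁻¹ * (|√(r t z) - 1| * |f z * s z|)) ∂P := by
        refine norm_integral_le_of_norm_le ((hfA.const_mul _).add (i2.const_mul _))
          (Eventually.of_forall fun z => (norm_add_le _ _).trans (add_le_add ?_ ?_))
        · rw [norm_mul, norm_mul, Real.norm_eq_abs, Real.norm_eq_abs,
            Real.norm_of_nonneg (by linarith [hx0 z])]
          have := mul_le_mul_of_nonneg_left (hxC z)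
            (mul_nonneg (abs_nonneg (f z)) (abs_nonneg (A z)))
          nlinarith
        · rw [norm_mul, norm_mul _ (√(r t z) - 1), Real.norm_of_nonneg (by norm_num),
            Real.norm_eq_abs, Real.norm_eq_abs, mul_comm (|f z * s z|)]
    _ = (√C + 1) * ∫ z, |f z| * |A z| ∂P + 2⁻¹ * ∫ z, |√(r t z) - 1| * |f z * s z| ∂P := by
        rw [integral_add (hfA.const_mul _) (i2.const_mul _), integral_const_mul,
          integral_const_mul]
    _ ≤ _ := by
        have : ∫ z, |f z| * |A z| ∂P ≤ √(∫ z, f z ^ 2 ∂P) * √(∫ z, A z ^ 2 ∂P) := by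
          simpa only [sq_abs] using (le_abs_self _).trans
            (abs_integral_mul_le (f := fun z => |f z|) (g := fun z => |A z|) hf.abs hrem.abs)
        gcongr

theorem IsRegularSubmodel.integral_score (h : IsRegularSubmodel P r s) : ∫ z, s z ∂P = 0 := by
  have h1 := h.hasDerivAt_integral (memLp_const (1 : ℝ))
  simp only [one_mul] at h1
  have h2 : HasDerivAt (fun t => ∫ z, r t z ∂P) 0 0 :=
    (hasDerivAt_const (0 : ℝ) (1 : ℝ)).congr_of_eventuallyEq h.prob
  exact h1.unique h2

end Submodel

end

/-! ### The tangent space and the efficiency bound -/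

section

section Tangent

variable {𝒵 : Type*} [MeasurableSpace 𝒵] {P : Measure 𝒵} [IsProbabilityMeasure P]

/-- Bounded centred functions, the scores of the linear submodels. -/
structure IsBoundedScore (P : Measure 𝒵) (s : 𝒵 → ℝ) : Prop where
  measurable : Measurable s
  bounded : ∃ B, ∀ z, |s z| ≤ B
  mean : ∫ z, s z ∂P = 0

theorem IsBoundedScore.memLp {s : 𝒵 → ℝ} (h : IsBoundedScore P s) : MemLp s 2 P := by
  obtain ⟨B, hB⟩ := h.bounded
  exact MemLp.of_bound h.measurable.aestronglyMeasurable B (Eventually.of_forall hB)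

/-- The submodel is `1 + t s` near `t = 0`, replaced by the constant one for `t` too large to keep
it well inside the positive numbers. -/
theorem IsBoundedScore.exists_isRegularSubmodel {s : 𝒵 → ℝ} (h : IsBoundedScore P s) :
    ∃ r, IsRegularSubmodel P r s := by
  obtain ⟨B', hB'⟩ := h.bounded
  set B := |B'| with hBdef
  have hB0 : 0 ≤ B := abs_nonneg _
  have hB : ∀ z, |s z| ≤ B := fun z => (hB' z).trans (le_abs_self _)
  have hsm := h.measurable
  refine ⟨fun t z => if |t| * B ≤ 1 / 2 then 1 + t * s z else 1, ?_⟩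
  have hev : ∀ᶠ t in 𝓝 (0 : ℝ), |t| * B ≤ 1 / 2 := by
    have hc : Continuous fun t : ℝ => |t| * B := by fun_prop
    have := hc.tendsto 0
    simp only [abs_zero, zero_mul] at this
    exact (this.eventually (gt_mem_nhds (show (0 : ℝ) < 1 / 2 by norm_num))).mono fun t ht => ht.le
  have hts : ∀ t, |t| * B ≤ 1 / 2 → ∀ z, |t * s z| ≤ 1 / 2 := fun t ht z => by
    rw [abs_mul]
    exact (mul_le_mul_of_nonneg_left (hB z) (abs_nonneg t)).trans ht
  refine ⟨fun t => ?_, fun z => by simp, ⟨2, by norm_num, ?_⟩, ?_, h.memLp, ?_⟩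
  · by_cases ht : |t| * B ≤ 1 / 2
    · simp only [ht, if_true]; exact (hsm.const_mul t).const_add 1
    · simp only [ht, if_false]; exact measurable_const
  · filter_upwards [hev] with t ht z
    have := abs_le.1 (hts t ht z)
    simp only [ht, if_true]
    constructor <;> linarith [this.1, this.2]
  · filter_upwards [hev] with t ht
    simp only [ht, if_true]
    rw [integral_add (integrable_const _) ((h.memLp.integrable (by norm_num)).const_mul t),
      integral_const_mul, h.mean]
    simp
  · have hlim : Tendsto (fun t : ℝ => t ^ 2 * B ^ 4) (𝓝[≠] 0) (𝓝 0) := by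
      have hc : Continuous fun t : ℝ => t ^ 2 * B ^ 4 := by fun_prop
      simpa using (hc.tendsto 0).mono_left (nhdsWithin_le_nhds (s := {(0 : ℝ)}ᶜ))
    refine tendsto_of_tendsto_of_tendsto_of_le_of_le' tendsto_const_nhds hlim
      (Eventually.of_forall fun t => integral_nonneg fun z => sq_nonneg _) ?_
    filter_upwards [nhdsWithin_le_nhds hev, self_mem_nhdsWithin] with t ht ht0
    have ht0 : t ≠ 0 := ht0
    simp only [ht, if_true]
    have hle : ∀ z, ((√(1 + t * s z) - 1) / t - s z / 2) ^ 2 ≤ t ^ 2 * B ^ 4 := fun z => by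
      have h1 := abs_le.1 (hts t ht z)
      set y := √(1 + t * s z) with hy
      have hy2 : y ^ 2 = 1 + t * s z := Real.sq_sqrt (by linarith [h1.1])
      have hy0 : 0 ≤ y := Real.sqrt_nonneg _
      -- Since `s = (y² - 1) / t`, the remainder is an exact square over `2 t`, hence of order `t`.
      have e : (y - 1) / t - s z / 2 = -((y - 1) ^ 2 / (2 * t)) := by
        have : s z = (y ^ 2 - 1) / t := by rw [hy2]; field_simp; ring
        rw [this]; field_simp; ring
      have hyx : (y - 1) ^ 2 ≤ t ^ 2 * B ^ 2 := by
        have e2 : (y - 1) ^ 2 * (y + 1) ^ 2 = t ^ 2 * s z ^ 2 := by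
          rw [← mul_pow, ← mul_pow]
          congr 1
          nlinarith
        have h3 : s z ^ 2 ≤ B ^ 2 := by
          rw [← sq_abs]; exact pow_le_pow_left₀ (abs_nonneg _) (hB z) 2
        calc (y - 1) ^ 2 ≤ (y - 1) ^ 2 * (y + 1) ^ 2 :=
              le_mul_of_one_le_right (sq_nonneg _) (by nlinarith)
          _ = t ^ 2 * s z ^ 2 := e2
          _ ≤ t ^ 2 * B ^ 2 := mul_le_mul_of_nonneg_left h3 (sq_nonneg t)
      have h4 : (y - 1) ^ 2 * (y - 1) ^ 2 ≤ (t ^ 2 * B ^ 2) * (t ^ 2 * B ^ 2) :=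
        mul_self_le_mul_self (sq_nonneg _) hyx
      have ht2 : 0 < t ^ 2 := by positivity
      rw [e, neg_sq, div_pow, div_le_iff₀ (by positivity)]
      nlinarith [mul_nonneg ht2.le (sq_nonneg (t * B ^ 2))]
    calc ∫ z, ((√(1 + t * s z) - 1) / t - s z / 2) ^ 2 ∂P ≤ ∫ _, t ^ 2 * B ^ 4 ∂P :=
          integral_mono_of_nonneg (Eventually.of_forall fun z => sq_nonneg _)
            (integrable_const _) (Eventually.of_forall hle)
      _ = t ^ 2 * B ^ 4 := by simp

/-- Bounded scores are dense among the centred square integrable functions. -/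
theorem exists_isBoundedScore_approx {φ : 𝒵 → ℝ} (hφm : Measurable φ) (hφ : MemLp φ 2 P)
    (h0 : ∫ z, φ z ∂P = 0) {ε : ℝ} (hε : 0 < ε) :
    ∃ s, IsBoundedScore P s ∧ ∫ z, (φ z - s z) ^ 2 ∂P < ε := by
  -- Truncation at level `n`; it is centred afterwards.
  set T : ℕ → 𝒵 → ℝ := fun n z => max (-(n : ℝ)) (min (φ z) n) with hT
  have hTm : ∀ n, Measurable (T n) := fun n => (measurable_const.max (hφm.min measurable_const))
  have hTb : ∀ n z, |T n z| ≤ n := fun n z => by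
    have hn : (0 : ℝ) ≤ n := Nat.cast_nonneg n
    exact abs_le.2 ⟨le_max_left _ _, max_le (by linarith) (min_le_right _ _)⟩
  have hTd : ∀ n z, |φ z - T n z| ≤ |φ z| := fun n z => by
    have hn : (0 : ℝ) ≤ n := Nat.cast_nonneg n
    simp only [hT]
    rcases le_total (φ z) n with h1 | h1
    · rw [min_eq_left h1]
      rcases le_total (-(n : ℝ)) (φ z) with h2 | h2
      · rw [max_eq_right h2]; simp
      · rw [max_eq_left h2, abs_of_nonpos (by linarith), abs_of_nonpos (by linarith)]; linarith
    · rw [min_eq_right h1, max_eq_right (by linarith), abs_of_nonneg (by linarith),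
        abs_of_nonneg (by linarith)]; linarith
  have hT2 : ∀ n, MemLp (T n) 2 P := fun n =>
    MemLp.of_bound (hTm n).aestronglyMeasurable n (Eventually.of_forall (hTb n))
  have hlim : Tendsto (fun n => ∫ z, (φ z - T n z) ^ 2 ∂P) atTop (𝓝 (∫ _, 0 ∂P)) := by
    refine tendsto_integral_of_dominated_convergence (fun z => φ z ^ 2)
      (fun n => ((hφm.sub (hTm n)).pow_const 2).aestronglyMeasurable) hφ.integrable_sq
      (fun n => Eventually.of_forall fun z => ?_) (Eventually.of_forall fun z => ?_)
    · rw [Real.norm_of_nonneg (sq_nonneg _), ← sq_abs, ← sq_abs (φ z)]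
      exact pow_le_pow_left₀ (abs_nonneg _) (hTd n z) 2
    · refine tendsto_const_nhds.congr' ?_
      filter_upwards [eventually_ge_atTop ⌈|φ z|⌉₊] with n hn
      have h1 : |φ z| ≤ n := (Nat.le_ceil _).trans (by exact_mod_cast hn)
      have h2 := abs_le.1 h1
      simp only [hT]
      rw [min_eq_left h2.2, max_eq_right h2.1]; simp
  rw [integral_zero] at hlim
  obtain ⟨n, hn⟩ := (hlim.eventually (gt_mem_nhds hε)).exists
  set c := ∫ z, T n z ∂P with hc
  have hTi := (hT2 n).integrable (by norm_num)
  refine ⟨fun z => T n z - c, ⟨(hTm n).sub_const c, ⟨n + |c|, fun z =>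
    (abs_sub _ _).trans (add_le_add (hTb n z) le_rfl)⟩, ?_⟩, lt_of_le_of_lt ?_ hn⟩
  · rw [integral_sub hTi (integrable_const _), ← hc]; simp
  · have hd : MemLp (fun z => φ z - T n z) 2 P := hφ.sub (hT2 n)
    have hdi := hd.integrable (by norm_num)
    have hdint : ∫ z, (φ z - T n z) ∂P = -c := by
      rw [integral_sub (hφ.integrable (by norm_num)) hTi, h0, ← hc, zero_sub]
    -- As `φ` is centred, subtracting the mean `c` of the truncation lowers the squared error by
    -- `c²`.
    have e : ∀ z, (φ z - (T n z - c)) ^ 2 = (φ z - T n z) ^ 2 + (2 * c * (φ z - T n z) + c ^ 2) :=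
      fun z => by ring
    simp only [e]
    have i2 : Integrable (fun z => 2 * c * (φ z - T n z) + c ^ 2) P :=
      (hdi.const_mul _).add (integrable_const _)
    rw [integral_add hd.integrable_sq i2,
      integral_add (hdi.const_mul _) (integrable_const _), integral_const_mul, hdint]
    simp only [integral_const, probReal_univ, one_smul]
    nlinarith [sq_nonneg c]

/-- A pathwise derivative in the closed tangent space is the efficient influence function, and its
variance is the supremum of the Cramér-Rao bounds. -/
theorem isEfficientInfluenceFunction_and_isLUB {τ : Measure 𝒵 → ℝ} {φ : 𝒵 → ℝ}
    (hφm : Measurable φ) (hφ : MemLp φ 2 P) (h0 : ∫ z, φ z ∂P = 0)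
    (hderiv : ∀ r s, IsRegularSubmodel P r s →
      HasDerivAt (fun t => τ (submodelLaw P r t)) (∫ z, φ z * s z ∂P) 0)
    (hne : ∃ s, IsBoundedScore P s ∧ 0 < ∫ z, s z ^ 2 ∂P) :
    IsEfficientInfluenceFunction P τ φ ∧ IsLUB (cramerRaoBounds P τ) (∫ z, φ z ^ 2 ∂P) := by
  refine ⟨⟨hφ, hderiv, fun ε hε => ?_⟩, ?_, fun b hb => ?_⟩
  · obtain ⟨s, hs, hlt⟩ := exists_isBoundedScore_approx hφm hφ h0 hε
    exact ⟨s, Submodule.subset_span hs.exists_isRegularSubmodel, hlt⟩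
  · rintro b ⟨r, s, τ', hr, hpos, hτ', rfl⟩
    rw [hτ'.unique (hderiv r s hr), div_le_iff₀ hpos]
    exact sq_integral_mul_le hφ hr.score_memLp
  · have hbound : ∀ s, IsBoundedScore P s → 0 < ∫ z, s z ^ 2 ∂P →
        (∫ z, φ z * s z ∂P) ^ 2 / ∫ z, s z ^ 2 ∂P ≤ b := fun s hs hpos => by
      obtain ⟨r, hr⟩ := hs.exists_isRegularSubmodel
      exact hb ⟨r, s, _, hr, hpos, hderiv r s hr, rfl⟩
    -- Non-degeneracy of the law enters here: without a score of positive variance there would be no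
    -- bounds at all.
    have hb0 : 0 ≤ b := by
      obtain ⟨s, hs, hpos⟩ := hne
      exact (div_nonneg (sq_nonneg _) hpos.le).trans (hbound s hs hpos)
    refine le_of_forall_pos_le_add fun ε hε => ?_
    obtain ⟨s, hs, hlt⟩ := exists_isBoundedScore_approx hφm hφ h0 hε
    have hS0 : 0 ≤ ∫ z, s z ^ 2 ∂P := integral_nonneg fun z => sq_nonneg _
    have hI : (∫ z, φ z * s z ∂P) ^ 2 ≤ b * ∫ z, s z ^ 2 ∂P := by
      rcases hS0.lt_or_eq with hpos | h
      · exact (div_le_iff₀ hpos).1 (hbound s hs hpos)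
      · have := sq_integral_mul_le hφ hs.memLp
        rw [← h] at this ⊢
        simpa using this
    have hi : Integrable (fun z => φ z * s z) P := hφ.integrable_mul hs.memLp
    have e : ∫ z, (φ z - s z) ^ 2 ∂P =
        ∫ z, φ z ^ 2 ∂P - 2 * ∫ z, φ z * s z ∂P + ∫ z, s z ^ 2 ∂P := by
      have e1 : ∀ z, (φ z - s z) ^ 2 = φ z ^ 2 - 2 * (φ z * s z) + s z ^ 2 := fun z => by ring
      simp only [e1]
      have i1 : Integrable (fun z => φ z ^ 2 - 2 * (φ z * s z)) P :=
        hφ.integrable_sq.sub (hi.const_mul 2)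
      rw [integral_add i1 hs.memLp.integrable_sq,
        integral_sub hφ.integrable_sq (hi.const_mul 2), integral_const_mul]
    set S := ∫ z, s z ^ 2 ∂P
    set I := ∫ z, φ z * s z ∂P
    -- Arithmetic–geometric mean from `I² ≤ b S`. Then `∫ φ² = ∫ (φ - s)² + 2 I - S` is below `b +
    -- ε`, without dividing by `S`.
    have h2 : 2 * I ≤ b + S := by
      by_contra! hcon
      nlinarith [sq_nonneg (b - S)]
    linarith

end Tangent

end

/-! ### Reweighted laws -/

section

section Reweight

variable {𝒵 : Type*} [MeasurableSpace 𝒵] {P : Measure 𝒵}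

/-- `q` is a density with respect to `P` with values in `[C⁻¹, C]`. -/
structure IsDensity (P : Measure 𝒵) (q : 𝒵 → ℝ) (C : ℝ) : Prop where
  measurable : Measurable q
  pos : 0 < C
  bounds : ∀ z, C⁻¹ ≤ q z ∧ q z ≤ C
  integral_eq : ∫ z, q z ∂P = 1

/-- The law with density `q`. -/
def reweight (P : Measure 𝒵) (q : 𝒵 → ℝ) : Measure 𝒵 := P.withDensity fun z => ENNReal.ofReal (q z)

variable {q : 𝒵 → ℝ} {C : ℝ}

theorem IsDensity.nonneg (h : IsDensity P q C) (z : 𝒵) : 0 ≤ q z :=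
  (inv_pos.2 h.pos).le.trans (h.bounds z).1

theorem IsDensity.abs_bound (h : IsDensity P q C) (z : 𝒵) : |q z| ≤ C := by
  rw [abs_of_nonneg (h.nonneg z)]; exact (h.bounds z).2

theorem integral_reweight (hq : Measurable q) (h0 : ∀ z, 0 ≤ q z) (f : 𝒵 → ℝ) :
    ∫ z, f z ∂(reweight P q) = ∫ z, q z * f z ∂P := by
  rw [reweight, integral_withDensity_eq_integral_toReal_smul hq.ennreal_ofReal
    (Eventually.of_forall fun z => ENNReal.ofReal_lt_top)]
  simp only [ENNReal.toReal_ofReal (h0 _), smul_eq_mul]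

theorem IsDensity.integral (h : IsDensity P q C) (f : 𝒵 → ℝ) :
    ∫ z, f z ∂(reweight P q) = ∫ z, q z * f z ∂P := integral_reweight h.measurable h.nonneg f

theorem ae_reweight {p : 𝒵 → Prop} (hp : ∀ᵐ z ∂P, p z) :
    ∀ᵐ z ∂(reweight P q), p z := (withDensity_absolutelyContinuous P _).ae_le hp

theorem IsDensity.ae_of_reweight (h : IsDensity P q C) {p : 𝒵 → Prop}
    (hp : ∀ᵐ z ∂(reweight P q), p z) :
    ∀ᵐ z ∂P, p z := by
  refine (withDensity_absolutelyContinuous' h.measurable.ennreal_ofReal.aemeasurable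
    (Eventually.of_forall fun z => ?_)).ae_le hp
  exact (ENNReal.ofReal_pos.2 ((inv_pos.2 h.pos).trans_le (h.bounds z).1)).ne'

theorem IsDensity.reweight_le (h : IsDensity P q C) : reweight P q ≤ ENNReal.ofReal C • P := by
  rw [reweight, ← withDensity_const]
  exact withDensity_mono (Eventually.of_forall fun z => ENNReal.ofReal_le_ofReal (h.bounds z).2)

theorem IsDensity.memLp (h : IsDensity P q C) {f : 𝒵 → ℝ} (hf : MemLp f 2 P) :
    MemLp f 2 (reweight P q) := hf.of_measure_le_smul ENNReal.ofReal_ne_top h.reweight_le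

variable [IsProbabilityMeasure P]

theorem IsDensity.memLp_self (h : IsDensity P q C) : MemLp q 2 P :=
  MemLp.of_bound h.measurable.aestronglyMeasurable C (Eventually.of_forall h.abs_bound)

theorem IsDensity.isProbabilityMeasure (h : IsDensity P q C) :
    IsProbabilityMeasure (reweight P q) := by
  constructor
  rw [reweight, withDensity_apply _ MeasurableSet.univ, setLIntegral_univ,
    ← ofReal_integral_eq_lintegral_ofReal (h.memLp_self.integrable (by norm_num))
      (Eventually.of_forall h.nonneg), h.integral_eq, ENNReal.ofReal_one]

end Reweight

theorem memLp_mul_of_ae_bounded {𝒵 : Type*} [MeasurableSpace 𝒵] {P : Measure 𝒵} {f h : 𝒵 → ℝ}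
    (hf : MemLp f 2 P) (hh : AEStronglyMeasurable h P) {B : ℝ} (hB : ∀ᵐ z ∂P, |h z| ≤ B) :
    MemLp (fun z => f z * h z) 2 P := by
  refine hf.of_le_mul (c := B) (hf.1.mul hh) ?_
  filter_upwards [hB] with z hz
  rw [norm_mul, mul_comm]
  exact mul_le_mul_of_nonneg_right hz (norm_nonneg _)

/-! ### Stability of overlap and continuity of the propensity score under reweighting. -/

section Functional

variable {m d : ℕ} {P : Measure (Obs m d)} [IsProbabilityMeasure P] {q : Obs m d → ℝ} {C c : ℝ}

/-- Overlap is stable under bounded reweighting. -/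
theorem IsDensity.propensity_ge (h : IsDensity P q C) (hc : 0 ≤ c) (a : Treat m)
    (hov : ∀ᵐ o ∂P, c < propensity P a o) :
    -- The proof integrates over the set where the bound fails: one factor `C` is lost in passing
    -- from the new law to `P` for the treated part, another in returning for the whole.
    ∀ᵐ o ∂P, c / C ^ 2 ≤ propensity (reweight P q) a o := by
  have := h.isProbabilityMeasure
  set c' := c / C ^ 2 with hc'
  have hc'0 : 0 ≤ c' := by positivity
  set e' := propensity (reweight P q) a with he'
  set S : Set (Obs m d) := {o | e' o < c'} with hS
  have hSX : MeasurableSet[sigmaX m d] S :=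
    (stronglyMeasurable_propensity a).measurable measurableSet_Iio
  have hSm : MeasurableSet S := sigmaX_le m d _ hSX
  set f : Obs m d → ℝ := S.indicator 1 with hf
  have hfX : StronglyMeasurable[sigmaX m d] f := stronglyMeasurable_one.indicator hSX
  have hfm : Measurable f := measurable_one.indicator hSm
  have hf0 : ∀ o, 0 ≤ f o := fun o => by by_cases ho : o ∈ S <;> simp [hf, ho]
  have hf1 : ∀ o, |f o| ≤ 1 := fun o => by by_cases ho : o ∈ S <;> simp [hf, ho]
  have hfi : ∀ (ν : Measure (Obs m d)) [IsProbabilityMeasure ν], Integrable f ν := fun ν _ =>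
    Integrable.of_bound hfm.aestronglyMeasurable 1 (Eventually.of_forall hf1)
  have hei : Integrable (fun o => e' o * f o) (reweight P q) := by
    refine Integrable.of_bound ((measurable_propensity a).mul hfm).aestronglyMeasurable 1 ?_
    filter_upwards [propensity_nonneg (P := reweight P q) a,
      propensity_le_one (P := reweight P q) a] with o h1 h2
    rw [norm_mul, Real.norm_of_nonneg h1]
    exact mul_le_one₀ h2 (norm_nonneg _) (hf1 o)
  have hD0 : ∀ o, 0 ≤ (c' - e' o) * f o := fun o => by
    by_cases ho : o ∈ S
    · have : e' o < c' := ho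
      simp only [hf, Set.indicator_of_mem ho, Pi.one_apply, mul_one]; linarith
    · simp [hf, ho]
  have hDi : Integrable (fun o => (c' - e' o) * f o) (reweight P q) := by
    simp only [sub_mul]
    exact ((hfi _).const_mul c').sub hei
  have hint : ∫ o, (c' - e' o) * f o ∂(reweight P q) ≤ 0 := by
    simp only [sub_mul]
    rw [integral_sub ((hfi _).const_mul c') hei, integral_const_mul,
      ← integral_ind_mul hfX (integrable_ind_mul (hfi _) a), h.integral, h.integral, sub_nonpos]
    have h1 : ∫ o, q o * f o ∂P ≤ C * ∫ o, f o ∂P := by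
      rw [← integral_const_mul]
      refine integral_mono_of_nonneg (Eventually.of_forall fun o =>
        mul_nonneg (h.nonneg o) (hf0 o)) ((hfi P).const_mul C) (Eventually.of_forall fun o =>
          mul_le_mul_of_nonneg_right (h.bounds o).2 (hf0 o))
    have h2 : C⁻¹ * (c * ∫ o, f o ∂P) ≤ ∫ o, q o * (ind a o * f o) ∂P := by
      have h3 : c * ∫ o, f o ∂P ≤ ∫ o, ind a o * f o ∂P := by
        rw [integral_ind_mul hfX (integrable_ind_mul (hfi P) a), ← integral_const_mul]
        refine integral_mono_ae ((hfi P).const_mul c) ?_ ?_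
        · refine Integrable.of_bound ((measurable_propensity a).mul hfm).aestronglyMeasurable 1 ?_
          filter_upwards [propensity_nonneg (P := P) a, propensity_le_one (P := P) a] with o h1 h2
          rw [norm_mul, Real.norm_of_nonneg h1]
          exact mul_le_one₀ h2 (norm_nonneg _) (hf1 o)
        · filter_upwards [hov] with o ho
          exact mul_le_mul_of_nonneg_right ho.le (hf0 o)
      calc C⁻¹ * (c * ∫ o, f o ∂P) ≤ C⁻¹ * ∫ o, ind a o * f o ∂P :=
            mul_le_mul_of_nonneg_left h3 (inv_pos.2 h.pos).le
        _ ≤ ∫ o, q o * (ind a o * f o) ∂P := by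
            rw [← integral_const_mul]
            refine integral_mono ((integrable_ind_mul (hfi P) a).const_mul _) ?_ fun o =>
              mul_le_mul_of_nonneg_right (h.bounds o).1 (mul_nonneg (ind_nonneg a o) (hf0 o))
            exact (integrable_ind_mul (hfi P) a).bdd_mul h.measurable.aestronglyMeasurable
              (Eventually.of_forall h.abs_bound)
    have hI0 : 0 ≤ ∫ o, f o ∂P := integral_nonneg hf0
    calc c' * ∫ o, q o * f o ∂P ≤ c' * (C * ∫ o, f o ∂P) := mul_le_mul_of_nonneg_left h1 hc'0
      _ = C⁻¹ * (c * ∫ o, f o ∂P) := by rw [hc']; have := h.pos.ne'; field_simp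
      _ ≤ _ := h2
  have hz := (integral_eq_zero_iff_of_nonneg (f := fun o => (c' - e' o) * f o) hD0 hDi).1
    (le_antisymm hint (integral_nonneg hD0))
  filter_upwards [h.ae_of_reweight hz] with o ho
  by_contra! hlt
  have hoS : o ∈ S := hlt
  have ho' : (c' - e' o) * f o = 0 := ho
  simp only [hf, Set.indicator_of_mem hoS, Pi.one_apply, mul_one] at ho'
  linarith

theorem IsDensity.isRegularLaw (h : IsDensity P q C) (hP : IsRegularLaw P) :
    IsRegularLaw (reweight P q) := by
  obtain ⟨c, hc, hov⟩ := hP.overlap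
  have hC := h.pos
  refine ⟨⟨c / C ^ 2 / 2, by positivity, fun a => ?_⟩, fun j => h.memLp (hP.memLp j)⟩
  refine ae_reweight ?_
  filter_upwards [h.propensity_ge hc.le a (hov a)] with o ho
  exact (half_lt_self (by positivity)).trans_le ho

/-- The propensity score is continuous in the density. -/
theorem IsDensity.integral_sq_propensity_sub_le (h : IsDensity P q C) (a : Treat m) :
    ∫ o, (propensity (reweight P q) a o - propensity P a o) ^ 2 ∂P ≤ ∫ o, |q o - 1| ∂P := by
  have := h.isProbabilityMeasure
  set e' := propensity (reweight P q) a with he'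
  set e := propensity P a with he
  set f : Obs m d → ℝ := fun o => e' o - e o with hf
  have hfX : StronglyMeasurable[sigmaX m d] f :=
    (stronglyMeasurable_propensity a).sub (stronglyMeasurable_propensity a)
  have he'm : Measurable e' := measurable_propensity a
  have hem : Measurable e := measurable_propensity a
  have hfm : Measurable f := he'm.sub hem
  have hb : ∀ᵐ o ∂P, 0 ≤ e' o ∧ e' o ≤ 1 ∧ 0 ≤ e o ∧ e o ≤ 1 := by
    filter_upwards [h.ae_of_reweight (propensity_nonneg (P := reweight P q) a),
      h.ae_of_reweight (propensity_le_one (P := reweight P q) a), propensity_nonneg (P := P) a,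
      propensity_le_one (P := P) a] with o h1 h2 h3 h4
    exact ⟨h1, h2, h3, h4⟩
  have hf1 : ∀ᵐ o ∂P, |f o| ≤ 1 := by
    filter_upwards [hb] with o ho
    exact abs_le.2 ⟨by simp only [hf]; linarith [ho.1, ho.2.2.2],
      by simp only [hf]; linarith [ho.2.1, ho.2.2.1]⟩
  have hfi : ∀ {ν : Measure (Obs m d)} [IsProbabilityMeasure ν], (∀ᵐ o ∂ν, |f o| ≤ 1) →
      Integrable f ν := fun hν => Integrable.of_bound hfm.aestronglyMeasurable 1 hν
  have i1 : Integrable (fun o => e o * f o) P := by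
    refine (hfi hf1).bdd_mul hem.aestronglyMeasurable (c := 1) ?_
    filter_upwards [hb] with o ho
    rw [Real.norm_of_nonneg ho.2.2.1]; exact ho.2.2.2
  have i2 : Integrable (fun o => e' o * f o) P := by
    refine (hfi hf1).bdd_mul he'm.aestronglyMeasurable (c := 1) ?_
    filter_upwards [hb] with o ho
    rw [Real.norm_of_nonneg ho.1]; exact ho.2.1
  have i3 : Integrable (fun o => ind a o * f o) P := integrable_ind_mul (hfi hf1) a
  have hq : ∀ {g : Obs m d → ℝ}, Integrable g P → Integrable (fun o => q o * g o) P := fun hg =>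
    hg.bdd_mul h.measurable.aestronglyMeasurable (Eventually.of_forall h.abs_bound)
  -- Each propensity score is the conditional mean of `ind a` under its own law. Testing both
  -- relations on their difference `f` leaves an integral against `1 - q` with a bounded factor.
  have hR1 : ∫ o, ind a o * f o ∂P = ∫ o, e o * f o ∂P := integral_ind_mul hfX i3
  have hR2 : ∫ o, q o * (ind a o * f o) ∂P = ∫ o, q o * (e' o * f o) ∂P := by
    rw [← h.integral, ← h.integral]
    exact integral_ind_mul hfX (integrable_ind_mul (hfi (ae_reweight hf1)) a)
  have e1 : ∫ o, (e' o - e o) ^ 2 ∂P = ∫ o, (1 - q o) * ((e' o - ind a o) * f o) ∂P := by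
    have l1 : ∀ o, (e' o - e o) ^ 2 = e' o * f o - e o * f o := fun o => by simp only [hf]; ring
    have l2 : ∀ o, (1 - q o) * ((e' o - ind a o) * f o) =
        (e' o * f o - ind a o * f o) - (q o * (e' o * f o) - q o * (ind a o * f o)) :=
      fun o => by ring
    simp only [l1, l2]
    have j1 : Integrable (fun o => e' o * f o - ind a o * f o) P := i2.sub i3
    have j2 : Integrable (fun o => q o * (e' o * f o) - q o * (ind a o * f o)) P :=
      (hq i2).sub (hq i3)
    rw [integral_sub j1 j2, integral_sub i2 i1, integral_sub i2 i3,
      integral_sub (hq i2) (hq i3), hR1, hR2]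
    ring
  rw [e1]
  have hq1 : Integrable (fun o => |q o - 1|) P :=
    ((h.memLp_self.sub (memLp_const (1 : ℝ))).integrable (by norm_num)).abs
  refine (Real.le_norm_self _).trans (norm_integral_le_of_norm_le hq1 ?_)
  filter_upwards [hb, hf1] with o ho hfo
  rw [norm_mul, Real.norm_eq_abs, abs_sub_comm]
  refine mul_le_of_le_one_right (abs_nonneg _) ?_
  rw [norm_mul]
  refine mul_le_one₀ ?_ (norm_nonneg _) hfo
  exact abs_le.2 ⟨by linarith [ho.1, ind_le_one a o], by linarith [ho.2.1, ind_nonneg a o]⟩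

end Functional

end

/-! ### First order expansion of the estimand of one type -/

section

section Expansion

variable {m d : ℕ} {P : Measure (Obs m d)} [IsProbabilityMeasure P]
  {w : Treat m → Covar m d → Fin m → ℝ}

theorem aipw_eq_sum (o : Obs m d) : aipw w (propensity P) (outcomeReg P) o =
    ∑ a, ∑ j, (ind a o * (o.1 j - outcomeReg P a j o) * (w a o.2.2 j * (propensity P a o)⁻¹)
      + w a o.2.2 j * outcomeReg P a j o) := by
  simp only [Finset.sum_add_distrib, mul_assoc, ← Finset.mul_sum]
  rw [sum_ind_mul (fun a => ∑ j, (o.1 j - outcomeReg P a j o) *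
    (w a o.2.2 j * (propensity P a o)⁻¹)), aipw, div_eq_mul_inv, Finset.sum_mul]
  congr 1
  exact Finset.sum_congr rfl fun j _ => by ring

theorem measurable_aipw (hw : ∀ a j, Measurable fun x => w a x j) :
    Measurable (aipw w (propensity P) (outcomeReg P)) := by
  have e : aipw w (propensity P) (outcomeReg P) = fun o => ∑ a, ∑ j,
    (ind a o * (o.1 j - outcomeReg P a j o) * (w a o.2.2 j * (propensity P a o)⁻¹)
      + w a o.2.2 j * outcomeReg P a j o) := funext aipw_eq_sum
  rw [e]
  exact Finset.measurable_fun_sum _ fun a _ => Finset.measurable_fun_sum _ fun j _ =>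
    (((measurable_ind a).mul ((measurable_outcome j).sub (measurable_outcomeReg a j))).mul
      (((hw a j).comp measurable_snd.snd).mul (measurable_propensity a).inv)).add
      (((hw a j).comp measurable_snd.snd).mul (measurable_outcomeReg a j))

theorem IsRegularLaw.memLp_ind_resid (hP : IsRegularLaw P) (a : Treat m) (j : Fin m) :
    MemLp (fun o => ind a o * (o.1 j - outcomeReg P a j o)) 2 P :=
  memLp_ind_mul ((hP.memLp j).sub (hP.memLp_outcomeReg a j)) a

theorem ae_abs_weight_mul_inv_le {e : Obs m d → ℝ} {B c : ℝ} (hB : ∀ a x j, |w a x j| ≤ B)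
    (hc : 0 < c) {μ : Measure (Obs m d)} (he : ∀ᵐ o ∂μ, c ≤ e o) (a : Treat m) (j : Fin m) :
    ∀ᵐ o ∂μ, |w a o.2.2 j * (e o)⁻¹| ≤ B * c⁻¹ := by
  filter_upwards [he] with o ho
  rw [abs_mul, abs_of_pos (inv_pos.2 (hc.trans_le ho))]
  exact mul_le_mul (hB a _ j) (inv_anti₀ hc ho) (inv_pos.2 (hc.trans_le ho)).le
    ((abs_nonneg _).trans (hB a o.2.2 j))

theorem stronglyMeasurable_weight_mul_inv (hw : ∀ a j, Measurable fun x => w a x j)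
    (P : Measure (Obs m d)) (a : Treat m) (j : Fin m) :
    StronglyMeasurable[sigmaX m d] fun o => w a o.2.2 j * (propensity P a o)⁻¹ :=
  (stronglyMeasurable_covar (hw a j)).mul
    (stronglyMeasurable_propensity a).measurable.inv.stronglyMeasurable

/-- Inverse probability weighted residuals around an arbitrary regression. -/
theorem IsRegularLaw.integral_ind_resid_mul_inv (hP : IsRegularLaw P)
    (hw : ∀ a j, Measurable fun x => w a x j) {B : ℝ} (hB : ∀ a x j, |w a x j| ≤ B)
    (a : Treat m) (j : Fin m) {g : Obs m d → ℝ} (hg : StronglyMeasurable[sigmaX m d] g)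
    (hg2 : MemLp g 2 P) :
    ∫ o, ind a o * (o.1 j - g o) * (w a o.2.2 j * (propensity P a o)⁻¹) ∂P =
      ∫ o, w a o.2.2 j * outcomeReg P a j o ∂P - ∫ o, w a o.2.2 j * g o ∂P := by
  obtain ⟨c, hc, hov⟩ := hP.overlap
  have hh := stronglyMeasurable_weight_mul_inv hw P a j
  have hhm := (hh.mono (sigmaX_le m d)).measurable.aestronglyMeasurable (μ := P)
  have hhB := ae_abs_weight_mul_inv_le hB hc ((hov a).mono fun o ho => ho.le) a j
  set h : Obs m d → ℝ := fun o => w a o.2.2 j * (propensity P a o)⁻¹ with hdef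
  have i1 : Integrable (fun o => ind a o * o.1 j * h o) P :=
    (memLp_mul_of_ae_bounded (memLp_ind_mul (hP.memLp j) a) hhm hhB).integrable (by norm_num)
  have i2 : Integrable (fun o => ind a o * (g o * h o)) P :=
    integrable_ind_mul ((memLp_mul_of_ae_bounded hg2 hhm hhB).integrable (by norm_num)) a
  have e : ∀ o, ind a o * (o.1 j - g o) * h o = ind a o * o.1 j * h o - ind a o * (g o * h o) :=
    fun o => by ring
  refine (integral_congr_ae (Eventually.of_forall e)).trans ?_
  rw [integral_sub i1 i2, hP.integral_ind_mul_outcome hh i1,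
    integral_ind_mul (h := fun o => g o * h o)
    (hg.mul hh) i2]
  congr 1
  · refine integral_congr_ae ?_
    filter_upwards [hP.propensity_pos a] with o ho
    simp only [hdef]; field_simp
  · refine integral_congr_ae ?_
    filter_upwards [hP.propensity_pos a] with o ho
    simp only [hdef]; field_simp

theorem IsRegularLaw.memLp_aipw (hP : IsRegularLaw P) (hw : ∀ a j, Measurable fun x => w a x j)
    {B : ℝ} (hB : ∀ a x j, |w a x j| ≤ B) :
    MemLp (aipw w (propensity P) (outcomeReg P)) 2 P := by
  obtain ⟨c, hc, hov⟩ := hP.overlap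
  have e : aipw w (propensity P) (outcomeReg P) = fun o => ∑ a, ∑ j,
    (ind a o * (o.1 j - outcomeReg P a j o) * (w a o.2.2 j * (propensity P a o)⁻¹)
      + w a o.2.2 j * outcomeReg P a j o) := funext aipw_eq_sum
  rw [e]
  refine memLp_finsetSum _ fun a _ => memLp_finsetSum _ fun j _ => ?_
  have h1 := memLp_mul_of_ae_bounded (hP.memLp_ind_resid a j)
    ((stronglyMeasurable_weight_mul_inv hw P a j).mono
      (sigmaX_le m d)).measurable.aestronglyMeasurable
    (ae_abs_weight_mul_inv_le hB hc ((hov a).mono fun o ho => ho.le) a j)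
  have h2 : MemLp (fun o => w a o.2.2 j * outcomeReg P a j o) 2 P := by
    have : MemLp (fun o => outcomeReg P a j o * w a o.2.2 j) 2 P :=
      memLp_mul_of_ae_bounded (hP.memLp_outcomeReg a j)
      ((hw a j).comp measurable_snd.snd).aestronglyMeasurable
      (Eventually.of_forall fun o : Obs m d => hB a o.2.2 j)
    simpa only [mul_comm] using this
  exact h1.add h2

theorem IsRegularLaw.integral_aipw (hP : IsRegularLaw P) (hw : ∀ a j, Measurable fun x => w a x j)
    {B : ℝ} (hB : ∀ a x j, |w a x j| ≤ B) :
    ∫ o, aipw w (propensity P) (outcomeReg P) o ∂P = thetaObs w P := by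
  obtain ⟨c, hc, hov⟩ := hP.overlap
  simp only [aipw_eq_sum]
  rw [thetaObs_eq_sum hw hB hP]
  have i1 : ∀ a j, Integrable (fun o => ind a o * (o.1 j - outcomeReg P a j o) *
      (w a o.2.2 j * (propensity P a o)⁻¹)) P := fun a j =>
    (memLp_mul_of_ae_bounded (hP.memLp_ind_resid a j)
    ((stronglyMeasurable_weight_mul_inv hw P a j).mono
      (sigmaX_le m d)).measurable.aestronglyMeasurable
    (ae_abs_weight_mul_inv_le hB hc ((hov a).mono fun o ho => ho.le) a j)).integrable (by norm_num)
  have i2 : ∀ a j, Integrable (fun o => w a o.2.2 j * outcomeReg P a j o) P := fun a j =>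
    integrable_weight_mul hw hB a j ((hP.memLp_outcomeReg a j).integrable (by norm_num))
  have i12 : ∀ a j, Integrable (fun o => ind a o * (o.1 j - outcomeReg P a j o) *
      (w a o.2.2 j * (propensity P a o)⁻¹) + w a o.2.2 j * outcomeReg P a j o) P := fun a j =>
    (i1 a j).add (i2 a j)
  rw [integral_finsetSum _ fun a _ => integrable_finsetSum _ fun j _ => i12 a j]
  refine Finset.sum_congr rfl fun a _ => ?_
  rw [integral_finsetSum _ fun j _ => i12 a j]
  refine Finset.sum_congr rfl fun j _ => ?_
  rw [integral_add (i1 a j) (i2 a j), hP.integral_ind_resid_mul_inv hw hB a j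
    (stronglyMeasurable_outcomeReg a j) (hP.memLp_outcomeReg a j), sub_self, zero_add]

/-- The error of the linear approximation of the estimand. -/
theorem thetaObs_reweight_sub (hP : IsRegularLaw P) (hw : ∀ a j, Measurable fun x => w a x j)
    {B : ℝ} (hB : ∀ a x j, |w a x j| ≤ B) {q : Obs m d → ℝ} {C : ℝ} (hq : IsDensity P q C) :
    thetaObs w (reweight P q) - ∫ o, q o * aipw w (propensity P) (outcomeReg P) o ∂P =
      ∑ a, ∑ j, ∫ o, (q o - 1) * (ind a o * (o.1 j - outcomeReg P a j o) *
        (w a o.2.2 j * (propensity (reweight P q) a o)⁻¹ - w a o.2.2 j * (propensity P a o)⁻¹))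
        ∂P := by
  have := hq.isProbabilityMeasure
  have hP' := hq.isRegularLaw hP
  obtain ⟨c, hc, hov⟩ := hP.overlap
  obtain ⟨c', hc', hov'⟩ := hP'.overlap
  set V : Treat m → Fin m → Obs m d → ℝ := fun a j o =>
    ind a o * (o.1 j - outcomeReg P a j o) with hV
  have hV2 : ∀ a j, MemLp (V a j) 2 P := fun a j => hP.memLp_ind_resid a j
  have hh := stronglyMeasurable_weight_mul_inv hw P
  have hhB := fun a j => ae_abs_weight_mul_inv_le hB hc ((hov a).mono fun o ho => ho.le) a j
  have hh' := stronglyMeasurable_weight_mul_inv hw (reweight P q)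
  have hhB' := fun a j => hq.ae_of_reweight
    (ae_abs_weight_mul_inv_le hB hc' ((hov' a).mono fun o ho => ho.le) a j)
  set h : Treat m → Fin m → Obs m d → ℝ := fun a j o => w a o.2.2 j * (propensity P a o)⁻¹
    with hdef
  set h' : Treat m → Fin m → Obs m d → ℝ := fun a j o =>
    w a o.2.2 j * (propensity (reweight P q) a o)⁻¹ with hdef'
  have m1 : ∀ a j, MemLp (fun o => V a j o * h a j o) 2 P := fun a j =>
    memLp_mul_of_ae_bounded (hV2 a j)
      ((hh a j).mono (sigmaX_le m d)).measurable.aestronglyMeasurable (hhB a j)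
  have m2 : ∀ a j, MemLp (fun o => V a j o * h' a j o) 2 P := fun a j =>
    memLp_mul_of_ae_bounded (hV2 a j)
      ((hh' a j).mono (sigmaX_le m d)).measurable.aestronglyMeasurable (hhB' a j)
  have m3 : ∀ a j, MemLp (fun o => w a o.2.2 j * outcomeReg P a j o) 2 P := fun a j => by
    have : MemLp (fun o => outcomeReg P a j o * w a o.2.2 j) 2 P :=
      memLp_mul_of_ae_bounded (hP.memLp_outcomeReg a j)
      ((hw a j).comp measurable_snd.snd).aestronglyMeasurable
      (Eventually.of_forall fun o : Obs m d => hB a o.2.2 j)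
    simpa only [mul_comm] using this
  have j1 : ∀ a j, Integrable (fun o => V a j o * h a j o) (reweight P q) := fun a j =>
    (hq.memLp (m1 a j)).integrable (by norm_num)
  have j2 : ∀ a j, Integrable (fun o => V a j o * h' a j o) (reweight P q) := fun a j =>
    (hq.memLp (m2 a j)).integrable (by norm_num)
  have j3 : ∀ a j, Integrable (fun o => w a o.2.2 j * outcomeReg P a j o) (reweight P q) :=
    fun a j => (hq.memLp (m3 a j)).integrable (by norm_num)
  have j13 : ∀ a j, Integrable (fun o => V a j o * h a j o + w a o.2.2 j * outcomeReg P a j o)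
      (reweight P q) := fun a j => (j1 a j).add (j3 a j)
  have e1 : ∫ o, q o * aipw w (propensity P) (outcomeReg P) o ∂P = ∑ a, ∑ j,
      (∫ o, V a j o * h a j o ∂(reweight P q)
        + ∫ o, w a o.2.2 j * outcomeReg P a j o ∂(reweight P q)) := by
    rw [← hq.integral]
    simp only [aipw_eq_sum]
    rw [integral_finsetSum _ fun a _ => integrable_finsetSum _ fun j _ => j13 a j]
    refine Finset.sum_congr rfl fun a _ => ?_
    rw [integral_finsetSum _ fun j _ => j13 a j]
    exact Finset.sum_congr rfl fun j _ => integral_add (j1 a j) (j3 a j)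
  rw [thetaObs_eq_sum hw hB hP', e1, ← Finset.sum_sub_distrib]
  refine Finset.sum_congr rfl fun a _ => ?_
  rw [← Finset.sum_sub_distrib]
  refine Finset.sum_congr rfl fun j _ => ?_
  have e2 : ∫ o, V a j o * h' a j o ∂(reweight P q) =
      ∫ o, w a o.2.2 j * outcomeReg (reweight P q) a j o ∂(reweight P q)
        - ∫ o, w a o.2.2 j * outcomeReg P a j o ∂(reweight P q) :=
    hP'.integral_ind_resid_mul_inv hw hB a j (stronglyMeasurable_outcomeReg a j)
      (hq.memLp (hP.memLp_outcomeReg a j))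
  have m12 : MemLp (fun o => V a j o * (h' a j o - h a j o)) 2 P := by
    simp only [mul_sub]; exact (m2 a j).sub (m1 a j)
  -- Under `P` the residuals are orthogonal to functions of the covariates, so `q` may be replaced
  -- by `q - 1`; this makes the error of second order.
  have e3 : ∫ o, V a j o * (h' a j o - h a j o) ∂P = 0 := by
    have k1 : ∀ hh : Obs m d → ℝ, StronglyMeasurable[sigmaX m d] hh → (∃ b, ∀ᵐ o ∂P, |hh o| ≤ b) →
        ∫ o, V a j o * hh o ∂P = 0 := fun hh hhs ⟨b, hb⟩ => by
      have hm := (hhs.mono (sigmaX_le m d)).measurable.aestronglyMeasurable (μ := P)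
      refine hP.integral_ind_mul_resid hhs ?_ ?_
      · exact (memLp_mul_of_ae_bounded (memLp_ind_mul (hP.memLp j) a) hm hb).integrable
          (by norm_num)
      · exact (memLp_mul_of_ae_bounded (memLp_ind_mul (hP.memLp_outcomeReg a j) a) hm
          hb).integrable (by norm_num)
    simp only [mul_sub]
    rw [integral_sub ((m2 a j).integrable (by norm_num)) ((m1 a j).integrable (by norm_num)),
      k1 _ (hh' a j) ⟨_, hhB' a j⟩, k1 _ (hh a j) ⟨_, hhB a j⟩, sub_self]
  have hqm : Integrable (fun o => q o * (V a j o * (h' a j o - h a j o))) P :=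
    hq.memLp_self.integrable_mul m12
  have e4 : ∫ o, (q o - 1) * (V a j o * (h' a j o - h a j o)) ∂P =
      ∫ o, V a j o * h' a j o ∂(reweight P q) - ∫ o, V a j o * h a j o ∂(reweight P q) := by
    rw [← integral_sub (j2 a j) (j1 a j), hq.integral]
    simp only [sub_mul, one_mul, ← mul_sub]
    rw [integral_sub hqm (m12.integrable (by norm_num)), e3, sub_zero]
  rw [e4, e2]
  ring

/-- The augmented inverse probability weighted term is the first order expansion of the
estimand. -/
theorem exists_abs_thetaObs_reweight_sub_le (hP : IsRegularLaw P)
    (hw : ∀ a j, Measurable fun x => w a x j) {B : ℝ} (hB : ∀ a x j, |w a x j| ≤ B) {C : ℝ}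
    (hC : 0 < C) {ε : ℝ} (hε : 0 < ε) :
    ∃ δ > 0, ∀ q : Obs m d → ℝ, IsDensity P q C → ∫ o, (q o - 1) ^ 2 ∂P ≤ δ →
      |thetaObs w (reweight P q) - ∫ o, q o * aipw w (propensity P) (outcomeReg P) o ∂P| ≤
        ε * √(∫ o, (q o - 1) ^ 2 ∂P) := by
  obtain ⟨c, hc, hov⟩ := hP.overlap
  set n : ℝ := Fintype.card (Treat m) * m with hn
  have hn0 : 0 ≤ n := by positivity
  set η := ε / (n + 1) with hη
  have hη0 : 0 < η := by positivity
  set c' := c / C ^ 2 with hc'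
  have hc'0 : 0 < c' := by positivity
  set b := |B| * (c'⁻¹ + c⁻¹) with hb
  have hb0 : 0 ≤ b := by positivity
  -- One integrable envelope for all squared residuals, so that a single `δ` serves every term.
  set U : Obs m d → ℝ := fun o => ∑ a, ∑ j, (ind a o * (o.1 j - outcomeReg P a j o)) ^ 2 with hU
  have hU0 : ∀ o, 0 ≤ U o := fun o =>
    Finset.sum_nonneg fun a _ => Finset.sum_nonneg fun j _ => sq_nonneg _
  have hUi : Integrable U P := integrable_finsetSum _ fun a _ => integrable_finsetSum _ fun j _ =>
    (hP.memLp_ind_resid a j).integrable_sq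
  obtain ⟨δ, hδ, hδU⟩ := exists_integral_abs_mul_le hUi (sq_nonneg b) (pow_pos hη0 2)
  set k := |B| ^ 2 * (c'⁻¹ * c⁻¹) ^ 2 with hk
  have hk0 : 0 ≤ k := by positivity
  refine ⟨(δ / (k + 1)) ^ 2, by positivity, fun q hq hle => ?_⟩
  have := hq.isProbabilityMeasure
  have hq1 : MemLp (fun o => q o - 1) 2 P := hq.memLp_self.sub (memLp_const (1 : ℝ))
  rw [thetaObs_reweight_sub hP hw hB hq]
  set D : Treat m → Fin m → Obs m d → ℝ := fun a j o =>
    w a o.2.2 j * (propensity (reweight P q) a o)⁻¹ - w a o.2.2 j * (propensity P a o)⁻¹ with hD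
  have hDm : ∀ a j, Measurable (D a j) := fun a j =>
    (((hw a j).comp measurable_snd.snd).mul (measurable_propensity a).inv).sub
      (((hw a j).comp measurable_snd.snd).mul (measurable_propensity a).inv)
  have hBa : ∀ a x j, |w a x j| ≤ |B| := fun a x j => (hB a x j).trans (le_abs_self B)
  have hge := fun a => hq.propensity_ge hc.le a (hov a)
  have hDb : ∀ a j, ∀ᵐ o ∂P, |D a j o| ≤ b := fun a j => by
    filter_upwards [ae_abs_weight_mul_inv_le hBa hc'0 (hge a) a j,
      ae_abs_weight_mul_inv_le hBa hc ((hov a).mono fun o ho => ho.le) a j] with o h1 h2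
    refine (abs_sub _ _).trans ((add_le_add h1 h2).trans_eq ?_)
    rw [hb, mul_add]
  -- Both propensity scores are bounded below, so their inverses differ by a multiple of their
  -- difference.
  have hDsq : ∀ a j, ∀ᵐ o ∂P, D a j o ^ 2 ≤
      k * (propensity (reweight P q) a o - propensity P a o) ^ 2 := fun a j => by
    filter_upwards [hge a, hov a] with o h1 h2
    have p1 : 0 < propensity (reweight P q) a o := hc'0.trans_le h1
    have p2 : 0 < propensity P a o := hc.trans h2
    have e : D a j o = w a o.2.2 j * ((propensity (reweight P q) a o)⁻¹ * (propensity P a o)⁻¹)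
        * (propensity P a o - propensity (reweight P q) a o) := by
      simp only [hD]; field_simp
    rw [e, mul_pow, mul_pow, ← neg_sub (propensity (reweight P q) a o), neg_sq]
    refine mul_le_mul_of_nonneg_right ?_ (sq_nonneg _)
    rw [← sq_abs (w a o.2.2 j), hk]
    refine mul_le_mul (pow_le_pow_left₀ (abs_nonneg _) (hBa a _ j) 2) ?_ (sq_nonneg _)
      (sq_nonneg _)
    exact pow_le_pow_left₀ (mul_pos (inv_pos.2 p1) (inv_pos.2 p2)).le (mul_le_mul
      (inv_anti₀ hc'0 h1) (inv_anti₀ hc h2.le) (inv_pos.2 p2).le (inv_pos.2 hc'0).le) 2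
  -- The squared change of the propensity score is bounded in mean by `‖q - 1‖₁ ≤ ‖q - 1‖₂`, which
  -- explains the choice of `(δ / (k + 1)) ^ 2`.
  have hDint : ∀ a j, ∫ o, D a j o ^ 2 ∂P ≤ δ := fun a j => by
    have hei : Integrable (fun o => (propensity (reweight P q) a o - propensity P a o) ^ 2) P := by
      refine Integrable.of_bound (((measurable_propensity a).sub
        (measurable_propensity a)).pow_const 2).aestronglyMeasurable 1 ?_
      filter_upwards [hq.ae_of_reweight (propensity_nonneg (P := reweight P q) a),
        hq.ae_of_reweight (propensity_le_one (P := reweight P q) a), propensity_nonneg (P := P) a,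
        propensity_le_one (P := P) a] with o h1 h2 h3 h4
      rw [Real.norm_of_nonneg (sq_nonneg _), sq_le_one_iff_abs_le_one, abs_le]
      constructor <;> linarith
    calc ∫ o, D a j o ^ 2 ∂P ≤ ∫ o, k * (propensity (reweight P q) a o - propensity P a o) ^ 2 ∂P :=
          integral_mono_of_nonneg (Eventually.of_forall fun o => sq_nonneg _) (hei.const_mul k)
            (hDsq a j)
      _ = k * ∫ o, (propensity (reweight P q) a o - propensity P a o) ^ 2 ∂P :=
          integral_const_mul _ _
      _ ≤ k * √(∫ o, (q o - 1) ^ 2 ∂P) := mul_le_mul_of_nonneg_left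
          ((hq.integral_sq_propensity_sub_le a).trans (integral_abs_le hq1)) hk0
      _ ≤ k * (δ / (k + 1)) := mul_le_mul_of_nonneg_left
          (Real.sqrt_le_iff.2 ⟨by positivity, hle⟩) hk0
      _ ≤ (k + 1) * (δ / (k + 1)) := mul_le_mul_of_nonneg_right (by linarith) (by positivity)
      _ = δ := by field_simp
  -- Cauchy–Schwarz splits off `‖q - 1‖₂`; the mean of squared residual times `D²` is small by
  -- uniform integrability, since `D²` is bounded and small in mean.
  have hterm : ∀ a j, |∫ o, (q o - 1) * (ind a o * (o.1 j - outcomeReg P a j o) * D a j o) ∂P| ≤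
      η * √(∫ o, (q o - 1) ^ 2 ∂P) := fun a j => by
    have hmem := memLp_mul_of_ae_bounded (hP.memLp_ind_resid a j) (hDm a j).aestronglyMeasurable
      (hDb a j)
    refine (abs_integral_mul_le hq1 hmem).trans ?_
    rw [mul_comm]
    refine mul_le_mul_of_nonneg_right ?_ (Real.sqrt_nonneg _)
    refine Real.sqrt_le_iff.2 ⟨hη0.le, ?_⟩
    have hD2i : Integrable (fun o => D a j o ^ 2) P :=
      (MemLp.of_bound (hDm a j).aestronglyMeasurable b (hDb a j)).integrable_sq
    have hbd : ∫ o, |D a j o ^ 2| * |U o| ∂P ≤ η ^ 2 := by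
      refine hδU (fun o => D a j o ^ 2) hD2i ?_ ?_
      · filter_upwards [hDb a j] with o ho
        rw [abs_of_nonneg (sq_nonneg _), ← sq_abs]
        exact pow_le_pow_left₀ (abs_nonneg _) ho 2
      · have e : ∀ o, |D a j o ^ 2| = D a j o ^ 2 := fun o => abs_of_nonneg (sq_nonneg _)
        simp only [e]
        exact hDint a j
    refine le_trans (integral_mono_of_nonneg (Eventually.of_forall fun o => sq_nonneg _) ?_
      (Eventually.of_forall fun o => ?_)) hbd
    · refine hUi.abs.bdd_mul (c := b ^ 2) ((hDm a j).pow_const 2).norm.aestronglyMeasurable ?_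
      filter_upwards [hDb a j] with o ho
      rw [Real.norm_eq_abs, abs_abs, abs_of_nonneg (sq_nonneg _), ← sq_abs]
      exact pow_le_pow_left₀ (abs_nonneg _) ho 2
    · have h1 : (ind a o * (o.1 j - outcomeReg P a j o)) ^ 2 ≤ U o :=
        (Finset.single_le_sum (f := fun j => (ind a o * (o.1 j - outcomeReg P a j o)) ^ 2)
          (fun j _ => sq_nonneg _) (Finset.mem_univ j)).trans
        (Finset.single_le_sum (f := fun a => ∑ j, (ind a o * (o.1 j - outcomeReg P a j o)) ^ 2)
          (fun a _ => Finset.sum_nonneg fun j _ => sq_nonneg _) (Finset.mem_univ a))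
      simp only [mul_pow]
      rw [abs_of_nonneg (sq_nonneg _), abs_of_nonneg (hU0 o), mul_comm (D a j o ^ 2), ← mul_pow]
      exact mul_le_mul_of_nonneg_right h1 (sq_nonneg _)
  calc |∑ a, ∑ j, ∫ o, (q o - 1) * (ind a o * (o.1 j - outcomeReg P a j o) * D a j o) ∂P|
      ≤ ∑ a : Treat m, ∑ j : Fin m, η * √(∫ o, (q o - 1) ^ 2 ∂P) :=
        (Finset.abs_sum_le_sum_abs _ _).trans (Finset.sum_le_sum fun a _ =>
          (Finset.abs_sum_le_sum_abs _ _).trans (Finset.sum_le_sum fun j _ => hterm a j))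
    _ = n * η * √(∫ o, (q o - 1) ^ 2 ∂P) := by
        simp only [Finset.sum_const, Finset.card_univ, nsmul_eq_mul, Fintype.card_fin, hn]
        ring
    _ ≤ ε * √(∫ o, (q o - 1) ^ 2 ∂P) := by
        refine mul_le_mul_of_nonneg_right ?_ (Real.sqrt_nonneg _)
        calc n * η ≤ (n + 1) * η := mul_le_mul_of_nonneg_right (by linarith) hη0.le
          _ = ε := by rw [hη]; field_simp

end Expansion

end

/-! ### Pathwise differentiability of the estimand -/

section

section Pathwise

variable {K : ℕ} {M d : Fin K → ℕ} {p : Fin K → ℝ}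
  {P : ∀ k, Measure (Obs (M k) (d k))} [∀ k, IsProbabilityMeasure (P k)]

theorem lintegral_mixLaw (g : Data M d → ℝ≥0∞) :
    ∫⁻ z, g z ∂(mixLaw p P) = ∑ k, ENNReal.ofReal (p k) * ∫⁻ o, g ⟨k, o⟩ ∂(P k) := by
  rw [mixLaw, lintegral_finsetSum_measure]
  refine Finset.sum_congr rfl fun k _ => ?_
  rw [lintegral_smul_measure, (measurableEmbedding_mk k).lintegral_map, smul_eq_mul]

theorem reweight_mixLaw_image_mk (ρ : Data M d → ℝ) (k : Fin K) {S : Set (Obs (M k) (d k))}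
    (hS : MeasurableSet S) : reweight (mixLaw p P) ρ (Sigma.mk k '' S) =
      ENNReal.ofReal (p k) * reweight (P k) (fun o => ρ ⟨k, o⟩) S := by
  have hS' : MeasurableSet (Sigma.mk k '' S : Set (Data M d)) :=
    (measurableEmbedding_mk k).measurableSet_image.2 hS
  rw [reweight, withDensity_apply _ hS', ← lintegral_indicator hS', lintegral_mixLaw,
    Finset.sum_eq_single k]
  · rw [reweight, withDensity_apply _ hS, ← lintegral_indicator hS]
    congr 2
    ext o
    by_cases ho : o ∈ S
    · rw [Set.indicator_of_mem (Set.mem_image_of_mem _ ho), Set.indicator_of_mem ho]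
    · rw [Set.indicator_of_notMem ho, Set.indicator_of_notMem]
      rintro ⟨o', ho', h⟩
      exact ho (sigma_mk_injective h ▸ ho')
  · intro j _ hj
    have : ∀ o : Obs (M j) (d j), (Sigma.mk k '' S).indicator
        (fun z : Data M d => ENNReal.ofReal (ρ z)) ⟨j, o⟩ = 0 := fun o => by
      refine Set.indicator_of_notMem ?_ _
      rintro ⟨o', -, h⟩
      exact hj (congrArg Sigma.fst h).symm
    simp [this]
  · simp

variable {ρ : Data M d → ℝ} {C : ℝ}

theorem integral_onType_mul (hp : ∀ k, 0 ≤ p k) (k : Fin K) (f : Obs (M k) (d k) → ℝ)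
    (hf : Integrable (fun o => f o * ρ ⟨k, o⟩) (P k)) :
    ∫ z, onType k f z * ρ z ∂(mixLaw p P) = p k * ∫ o, f o * ρ ⟨k, o⟩ ∂(P k) := by
  refine Eq.trans (integral_congr_ae (Eventually.of_forall fun z => ?_))
    (integral_onTypeV (P := P) hp hf)
  refine onTypeV_cases (k := k) (p := fun z => onType k f z * ρ z =
    onTypeV k (fun o => f o * ρ ⟨k, o⟩) z) z (fun o => ?_) fun j o h => ?_
  · simp [onType_eq]
  · simp [onType_eq, onTypeV_mk_ne _ _ h]

theorem typeProb_reweight (h : IsDensity (mixLaw p P) ρ C) (k : Fin K) :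
    typeProb (reweight (mixLaw p P) ρ) k = ∫ z, onType k (fun _ => 1) z * ρ z ∂(mixLaw p P) := by
  rw [typeProb, ← integral_indicator_one (measurableSet_fst_preimage k), h.integral]
  refine integral_congr_ae (Eventually.of_forall fun z => ?_)
  by_cases h : z.1 = k
  · simp [onType, h]
  · simp [onType, h]

theorem IsDensity.measurable_section (h : IsDensity (mixLaw p P) ρ C) (k : Fin K) :
    Measurable fun o => ρ ⟨k, o⟩ := h.measurable.comp (measurable_mk k)

theorem IsDensity.memLp_section (h : IsDensity (mixLaw p P) ρ C) (k : Fin K) :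
    MemLp (fun o => ρ ⟨k, o⟩) 2 (P k) :=
  MemLp.of_bound (h.measurable_section k).aestronglyMeasurable C
    (Eventually.of_forall fun o => h.abs_bound ⟨k, o⟩)

theorem IsDensity.section_mem (h : IsDensity (mixLaw p P) ρ C) (k : Fin K) :
    C⁻¹ ≤ ∫ o, ρ ⟨k, o⟩ ∂(P k) ∧ ∫ o, ρ ⟨k, o⟩ ∂(P k) ≤ C := by
  have hi := (h.memLp_section k).integrable (by norm_num)
  constructor
  · simpa using integral_mono (integrable_const C⁻¹) hi fun o => (h.bounds ⟨k, o⟩).1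
  · simpa using integral_mono hi (integrable_const C) fun o => (h.bounds ⟨k, o⟩).2

theorem IsDensity.section_pos (h : IsDensity (mixLaw p P) ρ C) (k : Fin K) :
    0 < ∫ o, ρ ⟨k, o⟩ ∂(P k) := (inv_pos.2 h.pos).trans_le (h.section_mem k).1

/-- The normalizing constant lies in `[C⁻¹, C]`, so the bounds are squared. -/
theorem IsDensity.isDensity_section (h : IsDensity (mixLaw p P) ρ C) (k : Fin K) :
    IsDensity (P k) (fun o => ρ ⟨k, o⟩ / ∫ o, ρ ⟨k, o⟩ ∂(P k)) (C ^ 2) := by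
  have hm := h.section_mem k
  have h0 := h.section_pos k
  have hC := h.pos
  refine ⟨(h.measurable_section k).div_const _, by positivity, fun o => ⟨?_, ?_⟩, ?_⟩
  · rw [le_div_iff₀ h0]
    calc (C ^ 2)⁻¹ * ∫ o, ρ ⟨k, o⟩ ∂(P k) ≤ (C ^ 2)⁻¹ * C :=
          mul_le_mul_of_nonneg_left hm.2 (by positivity)
      _ = C⁻¹ := by field_simp
      _ ≤ _ := (h.bounds _).1
  · rw [div_le_iff₀ h0]
    calc ρ ⟨k, o⟩ ≤ C := (h.bounds _).2
      _ = C ^ 2 * C⁻¹ := by field_simp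
      _ ≤ _ := mul_le_mul_of_nonneg_left hm.1 (by positivity)
  · rw [integral_div, div_self h0.ne']

theorem condLaw_reweight (hp : ∀ k, 0 < p k) (h : IsDensity (mixLaw p P) ρ C) (k : Fin K) :
    condLaw (reweight (mixLaw p P) ρ) k =
      reweight (P k) fun o => ρ ⟨k, o⟩ / ∫ o, ρ ⟨k, o⟩ ∂(P k) := by
  have h0 := h.section_pos k
  have hpk : ENNReal.ofReal (p k) ≠ 0 := (ENNReal.ofReal_pos.2 (hp k)).ne'
  have hu : reweight (P k) (fun o => ρ ⟨k, o⟩) Set.univ =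
      ENNReal.ofReal (∫ o, ρ ⟨k, o⟩ ∂(P k)) := by
    rw [reweight, withDensity_apply _ MeasurableSet.univ, setLIntegral_univ,
      ← ofReal_integral_eq_lintegral_ofReal ((h.memLp_section k).integrable (by norm_num))
        (Eventually.of_forall fun o => h.nonneg _)]
  ext S hS
  have e2 : reweight (P k) (fun o => ρ ⟨k, o⟩ / ∫ o, ρ ⟨k, o⟩ ∂(P k)) S =
      (ENNReal.ofReal (∫ o, ρ ⟨k, o⟩ ∂(P k)))⁻¹ * reweight (P k) (fun o => ρ ⟨k, o⟩) S := by
    rw [reweight, reweight, withDensity_apply _ hS, withDensity_apply _ hS,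
      ← lintegral_const_mul _ (h.measurable_section k).ennreal_ofReal]
    refine lintegral_congr fun o => ?_
    rw [ENNReal.ofReal_div_of_pos h0, ENNReal.div_eq_inv_mul]
  rw [condLaw, fst_preimage_eq, reweight_mixLaw_image_mk ρ k MeasurableSet.univ,
    Measure.smul_apply, (measurableEmbedding_mk k).comap_apply, reweight_mixLaw_image_mk ρ k hS,
    smul_eq_mul, hu, e2, ENNReal.mul_inv (Or.inl hpk) (Or.inl ENNReal.ofReal_ne_top),
    mul_mul_mul_comm, ENNReal.inv_mul_cancel hpk ENNReal.ofReal_ne_top, one_mul]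

/-- Normalizing amounts to centring the section at its own mean, which does not increase the second
moment about one; and type `k` has weight `p k` in the mixture. -/
theorem integral_sq_section_le (hp : ∀ k, 0 < p k) (h : IsDensity (mixLaw p P) ρ C)
    [IsProbabilityMeasure (mixLaw p P)] (k : Fin K) :
    ∫ o, (ρ ⟨k, o⟩ / (∫ o, ρ ⟨k, o⟩ ∂(P k)) - 1) ^ 2 ∂(P k) ≤
      C ^ 2 * (p k)⁻¹ * ∫ z, (ρ z - 1) ^ 2 ∂(mixLaw p P) := by
  have hm := h.section_mem k
  have h0 := h.section_pos k
  have hC := h.pos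
  have hu := h.memLp_section k
  have hui := hu.integrable (q := 2) (by norm_num)
  set c := ∫ o, ρ ⟨k, o⟩ ∂(P k) with hc
  have hu1 : MemLp (fun o => ρ ⟨k, o⟩ - 1) 2 (P k) := hu.sub (memLp_const (1 : ℝ))
  have huc : MemLp (fun o => ρ ⟨k, o⟩ - c) 2 (P k) := hu.sub (memLp_const c)
  have e1 : ∫ o, (ρ ⟨k, o⟩ - c) ^ 2 ∂(P k) = ∫ o, (ρ ⟨k, o⟩ - 1) ^ 2 ∂(P k) - (c - 1) ^ 2 := by
    have e : ∀ o : Obs (M k) (d k), (ρ ⟨k, o⟩ - c) ^ 2 =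
        (ρ ⟨k, o⟩ - 1) ^ 2 - (2 * (c - 1) * ρ ⟨k, o⟩ - (c ^ 2 - 1)) := fun o => by ring
    simp only [e]
    have i1 : Integrable (fun o => 2 * (c - 1) * ρ ⟨k, o⟩) (P k) := hui.const_mul _
    have i2 : Integrable (fun o => 2 * (c - 1) * ρ ⟨k, o⟩ - (c ^ 2 - 1)) (P k) :=
      i1.sub (integrable_const _)
    rw [integral_sub hu1.integrable_sq i2, integral_sub i1 (integrable_const _),
      integral_const_mul, ← hc]
    simp only [integral_const, probReal_univ, one_smul]
    ring
  have e2 : ∀ o : Obs (M k) (d k), (ρ ⟨k, o⟩ / c - 1) ^ 2 = (c ^ 2)⁻¹ * (ρ ⟨k, o⟩ - c) ^ 2 :=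
    fun o => by field_simp
  have e3 : p k * ∫ o, (ρ ⟨k, o⟩ - 1) ^ 2 ∂(P k) ≤ ∫ z, (ρ z - 1) ^ 2 ∂(mixLaw p P) := by
    have hi : Integrable (onTypeV k fun o => (ρ ⟨k, o⟩ - 1) ^ 2) (mixLaw p P) :=
      integrable_onTypeV hu1.integrable_sq
    have := integral_onTypeV (P := P) (fun k => (hp k).le) (k := k) hu1.integrable_sq
    rw [smul_eq_mul] at this
    rw [← this]
    refine integral_mono hi (h.memLp_self.sub (memLp_const (1 : ℝ))).integrable_sq fun z => ?_
    refine onTypeV_cases (k := k) (p := fun z => onTypeV k (fun o => (ρ ⟨k, o⟩ - 1) ^ 2) z ≤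
      (ρ z - 1) ^ 2) z (fun o => by simp) fun j o h => ?_
    rw [onTypeV_mk_ne _ _ h]
    exact sq_nonneg _
  have hI : 0 ≤ ∫ o, (ρ ⟨k, o⟩ - 1) ^ 2 ∂(P k) := integral_nonneg fun o => sq_nonneg _
  have hcC : (c ^ 2)⁻¹ ≤ C ^ 2 := by
    rw [← inv_pow]
    exact pow_le_pow_left₀ (inv_pos.2 h0).le (inv_le_of_inv_le₀ hC hm.1) 2
  simp only [e2]
  rw [integral_const_mul, e1]
  calc (c ^ 2)⁻¹ * (∫ o, (ρ ⟨k, o⟩ - 1) ^ 2 ∂(P k) - (c - 1) ^ 2)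
      ≤ (c ^ 2)⁻¹ * ∫ o, (ρ ⟨k, o⟩ - 1) ^ 2 ∂(P k) :=
        mul_le_mul_of_nonneg_left (by nlinarith [sq_nonneg (c - 1)]) (by positivity)
    _ ≤ C ^ 2 * ((p k)⁻¹ * ∫ z, (ρ z - 1) ^ 2 ∂(mixLaw p P)) := by
        refine mul_le_mul hcC ?_ hI (by positivity)
        rw [inv_mul_eq_div, le_div_iff₀ (hp k), mul_comm]
        exact e3
    _ = _ := by ring

theorem IsRegularSubmodel.isDensity {𝒵 : Type*} [MeasurableSpace 𝒵] {μ : Measure 𝒵}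
    {r : ℝ → 𝒵 → ℝ} {s : 𝒵 → ℝ} (h : IsRegularSubmodel μ r s) :
    ∃ C, 0 < C ∧ ∀ᶠ t in 𝓝 (0 : ℝ), IsDensity μ (r t) C := by
  obtain ⟨C, hC, hb⟩ := h.bounds
  refine ⟨C, hC, ?_⟩
  filter_upwards [hb, h.prob] with t h1 h2
  exact ⟨h.measurable t, hC, h1, h2⟩

variable [IsProbabilityMeasure (mixLaw p P)] {r : ℝ → Data M d → ℝ} {s : Data M d → ℝ}

theorem hasDerivAt_typeProb (h : IsRegularSubmodel (mixLaw p P) r s) (k : Fin K) :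
    HasDerivAt (fun t => typeProb (submodelLaw (mixLaw p P) r t) k)
      (∫ z, onType k (fun _ => 1) z * s z ∂(mixLaw p P)) 0 := by
  obtain ⟨C, -, hd⟩ := h.isDensity
  refine (h.hasDerivAt_integral
    (memLp_onTypeV (k := k) (memLp_const (1 : ℝ)))).congr_of_eventuallyEq
    ?_
  filter_upwards [hd] with t ht
  exact typeProb_reweight ht k

/-- Pathwise derivative of the estimand of one type. -/
theorem hasDerivAt_thetaObs (hp : ∀ k, 0 < p k) (k : Fin K) (hP : IsRegularLaw (P k))
    {w : Treat (M k) → Covar (M k) (d k) → Fin (M k) → ℝ}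
    (hw : ∀ a j, Measurable fun x => w a x j) {B : ℝ} (hB : ∀ a x j, |w a x j| ≤ B)
    (h : IsRegularSubmodel (mixLaw p P) r s) :
    HasDerivAt (fun t => thetaObs w (condLaw (submodelLaw (mixLaw p P) r t) k))
      ((∫ z, onType k (fun o => aipw w (propensity (P k)) (outcomeReg (P k)) o
        - thetaObs w (P k)) z * s z ∂(mixLaw p P)) / p k) 0 := by
  obtain ⟨C, hC, hd⟩ := h.isDensity
  obtain ⟨b, hb, hsq⟩ := h.exists_integral_sq_le
  set φ := aipw w (propensity (P k)) (outcomeReg (P k)) with hφ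
  have hφ2 : MemLp φ 2 (P k) := hP.memLp_aipw hw hB
  have hφ2' : MemLp (onType k φ) 2 (mixLaw p P) := memLp_onTypeV hφ2
  have h12 : MemLp (onType k fun _ => (1 : ℝ)) 2 (mixLaw p P) := memLp_onTypeV (memLp_const (1 : ℝ))
  have hG := h.hasDerivAt_integral hφ2'
  have hF := h.hasDerivAt_integral h12
  set G : ℝ → ℝ := fun t => ∫ z, onType k φ z * r t z ∂(mixLaw p P) with hGdef
  set F : ℝ → ℝ := fun t => ∫ z, onType k (fun _ => 1) z * r t z ∂(mixLaw p P) with hFdef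
  have hp0 : ∀ k, 0 ≤ p k := fun k => (hp k).le
  have hF0 : F 0 = p k := by
    simp only [hFdef, h.at_zero]
    rw [integral_onType_mul (P := P) (ρ := fun _ => 1) hp0 k _ (integrable_const _)]
    simp
  have hG0 : G 0 = p k * thetaObs w (P k) := by
    simp only [hGdef, h.at_zero]
    rw [integral_onType_mul (P := P) (ρ := fun _ => 1) hp0 k φ
      (by simpa using hφ2.integrable (by norm_num))]
    simp only [mul_one]
    rw [hP.integral_aipw hw hB]
  -- `G / F` is the linear approximation of the estimand under the conditional law of type `k`. It
  -- is differentiated by the quotient rule, and `hrem` shows that the error is `o(t)`.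
  have hq := hG.div hF (by rw [hF0]; exact (hp k).ne')
  have hrem : HasDerivAt (fun t => thetaObs w (condLaw (submodelLaw (mixLaw p P) r t) k)
      - G t / F t) 0 0 := by
    set c := C ^ 2 * (p k)⁻¹ * b with hc
    have hc0 : 0 < c := by have := hp k; positivity
    have key : ∀ ε > 0, ∀ᶠ t in 𝓝 (0 : ℝ),
        |thetaObs w (condLaw (submodelLaw (mixLaw p P) r t) k) - G t / F t| ≤ ε * |t| := by
      intro ε hε
      -- The conditional density differs from one by at most `√c * |t|` in mean square; the factor
      -- `1 / √c` compensates.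
      obtain ⟨δ, hδ, hexp⟩ := exists_abs_thetaObs_reweight_sub_le hP hw hB
        (show 0 < C ^ 2 by positivity) (show 0 < ε / √c by positivity)
      have hsmall : ∀ᶠ t in 𝓝 (0 : ℝ), c * t ^ 2 < δ := by
        have hcont : Continuous fun t : ℝ => c * t ^ 2 := by fun_prop
        have := hcont.tendsto 0
        simp only [ne_eq, OfNat.ofNat_ne_zero, not_false_eq_true, zero_pow, mul_zero] at this
        exact this.eventually (gt_mem_nhds hδ)
      filter_upwards [hd, hsq, hsmall] with t ht hsqt hts
      have hsec := integral_sq_section_le hp ht k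
      have hsec' : ∫ o, (r t ⟨k, o⟩ / (∫ o, r t ⟨k, o⟩ ∂(P k)) - 1) ^ 2 ∂(P k) ≤ c * t ^ 2 := by
        refine hsec.trans ?_
        calc C ^ 2 * (p k)⁻¹ * ∫ z, (r t z - 1) ^ 2 ∂(mixLaw p P)
            ≤ C ^ 2 * (p k)⁻¹ * (b * t ^ 2) := by
              have := (hp k).le
              exact mul_le_mul_of_nonneg_left hsqt (by positivity)
          _ = c * t ^ 2 := by rw [hc]; ring
      have h1 := hexp _ (ht.isDensity_section k) (hsec'.trans hts.le)
      have e1 : condLaw (submodelLaw (mixLaw p P) r t) k =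
          reweight (P k) fun o => r t ⟨k, o⟩ / ∫ o, r t ⟨k, o⟩ ∂(P k) := condLaw_reweight hp ht k
      have hsp := ht.section_pos k
      have e2 : G t / F t = ∫ o, r t ⟨k, o⟩ / (∫ o, r t ⟨k, o⟩ ∂(P k)) * φ o ∂(P k) := by
        have g1 : G t = p k * ∫ o, φ o * r t ⟨k, o⟩ ∂(P k) :=
          integral_onType_mul hp0 k φ (hφ2.integrable_mul (ht.memLp_section k))
        have g2 : F t = p k * ∫ o, r t ⟨k, o⟩ ∂(P k) := by
          have := integral_onType_mul (P := P) (ρ := r t) hp0 k (fun _ => 1)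
            (by simpa using (ht.memLp_section k).integrable (by norm_num))
          simpa using this
        rw [g1, g2, mul_div_mul_left _ _ (hp k).ne', ← integral_div]
        refine integral_congr_ae (Eventually.of_forall fun o => ?_)
        simp only
        ring
      rw [e1, e2]
      refine h1.trans ?_
      calc ε / √c * √(∫ o, (r t ⟨k, o⟩ / (∫ o, r t ⟨k, o⟩ ∂(P k)) - 1) ^ 2 ∂(P k))
          ≤ ε / √c * √(c * t ^ 2) :=
            mul_le_mul_of_nonneg_left (Real.sqrt_le_sqrt hsec') (by positivity)
        _ = ε * |t| := by
            rw [Real.sqrt_mul hc0.le, Real.sqrt_sq_eq_abs]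
            have : √c ≠ 0 := (Real.sqrt_pos.2 hc0).ne'
            field_simp
    have hz : thetaObs w (condLaw (submodelLaw (mixLaw p P) r 0) k) - G 0 / F 0 = 0 := by
      have := (key 1 one_pos).self_of_nhds
      simpa using this
    rw [hasDerivAt_iff_isLittleO, Asymptotics.isLittleO_iff]
    intro ε hε
    filter_upwards [key ε hε] with t ht
    rw [hz]
    simpa using ht
  have hsum := hrem.add hq
  refine (hsum.congr_of_eventuallyEq (Eventually.of_forall fun t => by simp)).congr_deriv ?_
  have hs2 := h.score_memLp
  have e : ∀ z, onType k (fun o => φ o - thetaObs w (P k)) z * s z =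
      onType k φ z * s z - thetaObs w (P k) * (onType k (fun _ => 1) z * s z) := fun z => by
    rw [onType_sub_const]; ring
  simp only [e]
  have i1 : Integrable (fun z => onType k φ z * s z) (mixLaw p P) := hφ2'.integrable_mul hs2
  have i2 : Integrable (fun z => onType k (fun _ => 1) z * s z) (mixLaw p P) :=
    h12.integrable_mul hs2
  rw [integral_sub i1 (i2.const_mul _), integral_const_mul, hF0, hG0]
  have := (hp k).ne'
  field_simp
  ring

end Pathwise

end

/-! ### The efficient influence function -/

section

section Influence

variable {K : ℕ} {M d : Fin K → ℕ} {p : Fin K → ℝ}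
  {P : ∀ k, Measure (Obs (M k) (d k))} [∀ k, IsProbabilityMeasure (P k)]
  {v : Fin K → ℝ → ℝ} {w : ∀ k, Treat (M k) → Covar (M k) (d k) → Fin (M k) → ℝ}

theorem influence_mixLaw (hp : ∀ k, 0 < p k) (z : Data M d) : influence v w (mixLaw p P) z =
    ∑ k, (v k (p k) / p k * onType k (fun o => aipw (w k) (propensity (P k)) (outcomeReg (P k)) o
      - thetaObs (w k) (P k)) z
        + deriv (v k) (p k) * thetaObs (w k) (P k) * (onType k (fun _ => 1) z - p k)) := by
  simp only [influence, typeProb_mixLaw fun k => (hp k).le, condLaw_mixLaw hp]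
  rw [← Finset.sum_add_distrib]
  exact Finset.sum_congr rfl fun k _ => by ring

theorem tauObs_mixLaw (hp : ∀ k, 0 < p k) : tauObs v w (mixLaw p P) =
    ∑ k, v k (p k) * thetaObs (w k) (P k) := by
  simp only [tauObs, typeProb_mixLaw fun k => (hp k).le, condLaw_mixLaw hp]

theorem onTypeV_ae_eq {k : Fin K} {f g : Obs (M k) (d k) → ℝ} (h : f =ᵐ[P k] g) :
    (onTypeV k f : Data M d → ℝ) =ᵐ[mixLaw p P] onTypeV k g := by
  refine ae_mixLaw fun j => ?_
  rcases eq_or_ne j k with rfl | hj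
  · filter_upwards [h] with o ho
    simpa using ho
  · exact ae_of_all _ fun o => by simp [onTypeV_mk_ne _ _ hj]

theorem measurable_onType_aipw {k : Fin K}
    {w : Treat (M k) → Covar (M k) (d k) → Fin (M k) → ℝ}
    (hw : ∀ a j, Measurable fun x => w a x j) : Measurable (onType k fun o =>
      aipw w (propensity (P k)) (outcomeReg (P k)) o - thetaObs w (P k) : Data M d → ℝ) :=
  measurable_onTypeV ((measurable_aipw hw).sub_const _)

theorem memLp_onType_aipw {k : Fin K} (hP : IsRegularLaw (P k))
    {w : Treat (M k) → Covar (M k) (d k) → Fin (M k) → ℝ}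
    (hw : ∀ a j, Measurable fun x => w a x j) {B : ℝ} (hB : ∀ a x j, |w a x j| ≤ B) :
    MemLp (onType k fun o => aipw w (propensity (P k)) (outcomeReg (P k)) o - thetaObs w (P k))
      2 (mixLaw p P) :=
  memLp_onTypeV ((hP.memLp_aipw hw hB).sub (memLp_const _))

/-- Product and chain rule over the types. Scores have mean zero, which allows the centring of `1(L
= k)` at `p k`. -/
theorem hasDerivAt_tauObs [IsProbabilityMeasure (mixLaw p P)] (hp : ∀ k, 0 < p k)
    (hP : ∀ k, IsRegularLaw (P k))
    (hv : ∀ k, ContDiffOn ℝ 1 (v k) (Set.Ioi 0)) (hw : ∀ k a j, Measurable fun x => w k a x j)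
    {B : ℝ} (hB : ∀ k a x j, |w k a x j| ≤ B) {r : ℝ → Data M d → ℝ} {s : Data M d → ℝ}
    (h : IsRegularSubmodel (mixLaw p P) r s) :
    HasDerivAt (fun t => tauObs v w (submodelLaw (mixLaw p P) r t))
      (∫ z, influence v w (mixLaw p P) z * s z ∂(mixLaw p P)) 0 := by
  have hd : ∀ k, DifferentiableAt ℝ (v k) (p k) := fun k =>
    ((hv k).contDiffAt (Ioi_mem_nhds (hp k))).differentiableAt one_ne_zero
  have h0 : submodelLaw (mixLaw p P) r 0 = mixLaw p P := by
    simp [submodelLaw, h.at_zero]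
  have hk : ∀ k, HasDerivAt (fun t => v k (typeProb (submodelLaw (mixLaw p P) r t) k) *
      thetaObs (w k) (condLaw (submodelLaw (mixLaw p P) r t) k)) _ 0 := fun k =>
    HasDerivAt.mul (HasDerivAt.comp (h₂ := v k) 0
      (by
        rw [h0, typeProb_mixLaw fun k => (hp k).le]
        exact (hd k).hasDerivAt) (hasDerivAt_typeProb h k))
      (hasDerivAt_thetaObs hp k (hP k) (hw k) (hB k) h)
  refine (HasDerivAt.fun_sum fun k _ => hk k).congr_deriv ?_
  have hs2 := h.score_memLp
  have hsi := hs2.integrable (q := 2) (by norm_num)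
  have i1 : ∀ k, Integrable (fun z => onType k (fun o => aipw (w k) (propensity (P k))
      (outcomeReg (P k)) o - thetaObs (w k) (P k)) z * s z) (mixLaw p P) := fun k =>
    (memLp_onType_aipw (hP k) (hw k) (hB k)).integrable_mul hs2
  have i2 : ∀ k, Integrable (fun z : Data M d => onType k (fun _ => 1) z * s z) (mixLaw p P) :=
    fun k => (memLp_onTypeV (memLp_const (1 : ℝ))).integrable_mul hs2
  have i3 : ∀ k, Integrable (fun z : Data M d => onType k (fun _ => 1) z * s z - p k * s z)
    (mixLaw p P) := fun k => (i2 k).sub (hsi.const_mul _)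
  have e : ∀ z, influence v w (mixLaw p P) z * s z = ∑ k, (v k (p k) / p k *
      (onType k (fun o => aipw (w k) (propensity (P k)) (outcomeReg (P k)) o
        - thetaObs (w k) (P k)) z * s z)
      + deriv (v k) (p k) * thetaObs (w k) (P k) *
        (onType k (fun _ => 1) z * s z - p k * s z)) := fun z => by
    rw [influence_mixLaw hp, Finset.sum_mul]
    exact Finset.sum_congr rfl fun k _ => by ring
  have i4 : ∀ k, Integrable (fun z => v k (p k) / p k *
      (onType k (fun o => aipw (w k) (propensity (P k)) (outcomeReg (P k)) o
        - thetaObs (w k) (P k)) z * s z)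
      + deriv (v k) (p k) * thetaObs (w k) (P k) *
        (onType k (fun _ => 1) z * s z - p k * s z)) (mixLaw p P) := fun k =>
    ((i1 k).const_mul _).add ((i3 k).const_mul _)
  simp only [e]
  rw [integral_finsetSum _ fun k _ => i4 k]
  refine Finset.sum_congr rfl fun k _ => ?_
  rw [integral_add ((i1 k).const_mul _) ((i3 k).const_mul _), integral_const_mul,
    integral_const_mul, integral_sub (i2 k) (hsi.const_mul _), integral_const_mul,
    h.integral_score, h0, typeProb_mixLaw fun k => (hp k).le, condLaw_mixLaw hp]
  ring

/-- The law of the data is not degenerate. -/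
theorem exists_isBoundedScore_pos (hp : ∀ k, 0 < p k) [IsProbabilityMeasure (mixLaw p P)]
    (k : Fin K) (hm : 2 ≤ M k) (hP : IsRegularLaw (P k)) :
    ∃ s, IsBoundedScore (mixLaw p P) s ∧ 0 < ∫ z, s z ^ 2 ∂(mixLaw p P) := by
  obtain ⟨c, hc, hov⟩ := hP.overlap
  have hm' : Nontrivial (Fin (M k)) := Fin.nontrivial_iff_two_le.2 hm
  have : Nonempty (Fin (M k)) := hm'.to_nonempty
  -- By overlap two different treatments both have positive probability, so the indicator of one of
  -- them within type `k` is not constant.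
  obtain ⟨a, b, hab⟩ := exists_pair_ne (Treat (M k))
  set f : Data M d → ℝ := onTypeV k (ind a) with hf
  set g : Data M d → ℝ := onTypeV k (ind b) with hg
  have hfm : Measurable f := measurable_onTypeV (measurable_ind a)
  have hind : ∀ a, 0 < ∫ o, ind a o ∂(P k) := fun a => by
    have h1 := integral_ind_mul (P := P k) (a := a) (h := fun _ => 1) stronglyMeasurable_const
      (by simpa using integrable_ind a)
    simp only [mul_one] at h1
    rw [h1]
    refine hc.trans_le ?_
    have := integral_mono_ae (integrable_const (μ := P k) c)
      (by rw [propensity_eq]; exact integrable_condExp) ((hov a).mono fun o ho => ho.le)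
    simpa using this
  have hint : ∀ a, ∫ z, onTypeV k (ind a) z ∂(mixLaw p P) = p k * ∫ o, ind a o ∂(P k) := fun a =>
    integral_onTypeV (fun k => (hp k).le) (integrable_ind a)
  have hpos : ∀ a, 0 < ∫ z, onTypeV k (ind a) z ∂(mixLaw p P) := fun a => by
    rw [hint]; exact mul_pos (hp k) (hind a)
  have hfi : ∀ a, Integrable (onTypeV k (ind a) : Data M d → ℝ) (mixLaw p P) := fun a =>
    integrable_onTypeV (integrable_ind a)
  have hsum : ∫ z, f z ∂(mixLaw p P) + ∫ z, g z ∂(mixLaw p P) ≤ 1 := by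
    rw [← integral_add (hfi a) (hfi b)]
    have := integral_mono ((hfi a).add (hfi b)) (integrable_const (μ := mixLaw p P) (1 : ℝ))
      fun z => onTypeV_cases (k := k) (p := fun z => onTypeV k (ind a) z + onTypeV k (ind b) z ≤ 1)
        z (fun o => by
          simp only [onTypeV_mk_self, ind]
          by_cases h1 : o.2.1 = a
          · have h2 : o.2.1 ≠ b := fun h2 => hab (h1.symm.trans h2)
            simp [h1, hab]
          · simp only [h1, if_false]; split_ifs <;> norm_num)
        fun j o h => by simp [onTypeV_mk_ne _ _ h]
    simpa using this
  set q := ∫ z, f z ∂(mixLaw p P) with hq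
  have hq0 : 0 < q := hpos a
  have hq1 : q < 1 := by linarith [hpos b]
  have hf2 : ∀ z, f z ^ 2 = f z := fun z =>
    onTypeV_cases (k := k) (p := fun z => onTypeV k (ind a) z ^ 2 = onTypeV k (ind a) z) z
      (fun o => by simp only [onTypeV_mk_self, ind]; split_ifs <;> norm_num)
      fun j o h => by simp [onTypeV_mk_ne _ _ h]
  have hfb : ∀ z, |f z| ≤ 1 := fun z => by
    rw [← sq_le_one_iff_abs_le_one]
    have := hf2 z
    nlinarith [sq_nonneg (f z - 1)]
  refine ⟨fun z => f z - q, ⟨hfm.sub_const q, ⟨1 + |q|, fun z =>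
    (abs_sub _ _).trans (add_le_add (hfb z) le_rfl)⟩, ?_⟩, ?_⟩
  · rw [integral_sub (hfi a) (integrable_const _), ← hq]; simp
  · have e : ∀ z, (f z - q) ^ 2 = (1 - 2 * q) * f z + q ^ 2 := fun z => by
      rw [sub_sq, hf2]; ring
    simp only [e]
    rw [integral_add ((hfi a).const_mul _) (integrable_const _), integral_const_mul, ← hq]
    simp only [integral_const, probReal_univ, one_smul]
    nlinarith

end Influence

/-- Passes from the influence function at the model nuisances to the one written with conditional
expectations; the sample almost surely avoids the null set where they differ. -/
theorem IsAsympLinear.congr_ae {𝒵 Ω E : Type*} [MeasurableSpace 𝒵] [MeasurableSpace Ω]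
    {μ : Measure Ω} {P : Measure 𝒵} {Z : ℕ → Ω → 𝒵} [NormedAddCommGroup E] [NormedSpace ℝ E]
    [MeasurableSpace E] (hs : IsSample μ P Z) {est : ℕ → Ω → E} {ν₀ : E}
    {κ κ' : 𝒵 → E} (h : IsAsympLinear μ P Z est ν₀ κ) (hκ' : Measurable κ') (he : κ =ᵐ[P] κ') :
    IsAsympLinear μ P Z est ν₀ κ' := by
  refine ⟨hκ', h.memLp.ae_eq he, (integral_congr_ae he).symm.trans h.mean, h.small.congr ?_⟩
  have hae : ∀ᵐ ω ∂μ, ∀ i, κ (Z i ω) = κ' (Z i ω) := ae_all_iff.2 fun i =>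
    ae_of_ae_map (hs.meas i).aemeasurable (by rw [hs.law i]; exact he)
  have h0 : ∀ N : ℕ, μ {ω | ¬ (√(N : ℝ) • (est N ω - ν₀) - √(N : ℝ) • avg Z κ' N ω =
      √(N : ℝ) • (est N ω - ν₀) - √(N : ℝ) • avg Z κ N ω)} = 0 := fun N => by
    exact ae_iff.1 (hae.mono fun ω hω => by simp only [avg, hω])
  simp only [HighProb, h0]
  exact tendsto_const_nhds

end

end PartialInterference

end

theorem corollary2 {K : ℕ} (M d : Fin K → ℕ) (hM : ∀ k, 2 ≤ M k)
    -- population: type probabilities and the law of the full data given the type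
    (p : Fin K → ℝ) (hp : ∀ k, 0 < p k) (hp1 : ∑ k, p k = 1)
    (Q : ∀ k, Measure (Full (M k) (d k))) [∀ k, IsProbabilityMeasure (Q k)]
    (hQ : ∀ k, Identifying (Q k))
    -- the estimand
    (v : Fin K → ℝ → ℝ) (hv : ∀ k, ContDiffOn ℝ 1 (v k) (Set.Ioi 0))
    (w : ∀ k, Treat (M k) → Covar (M k) (d k) → Fin (M k) → ℝ)
    (hw : ∀ k a j, Measurable fun x => w k a x j)
    (hw_bdd : ∃ C, ∀ k a x j, |w k a x j| ≤ C)
    (τ : ℝ) (hτ : τ = ∑ k, v k (p k) * thetaCausal (w k) (Q k))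
    -- the sample: independent clusters with the law of the observed data
    {Ω : Type*} [MeasurableSpace Ω] (μ : Measure Ω) [IsProbabilityMeasure μ]
    (Z : ℕ → Ω → Data M d) (hZ : ∀ i, Measurable (Z i))
    (hZ_indep : iIndepFun Z μ)
    (hZ_law : ∀ i, μ.map (Z i) = obsLaw p Q)
    -- parameter spaces and the (pseudo-)true parameters of the propensity model
    (Θ : ∀ k, Set (PSParam (d k))) (hΘ : ∀ k, IsCompact (Θ k))
    (hΘ_pos : ∀ k, ∀ ν ∈ Θ k, 0 < ν.precision)
    (ν : ∀ k, PSParam (d k)) (hν : ∀ k, ν k ∈ interior (Θ k))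
    -- the maximum likelihood estimators
    (psEst : ∀ k, ℕ → Ω → PSParam (d k))
    (hps_meas : ∀ k N, Measurable (psEst k N))
    (hps : ∀ k, IsMaximizerEventually μ (Θ k) (psSampleLogLik Z k) (psEst k))
    (orEst : ∀ k, ℕ → Ω → ORParam (d k))
    (hor_meas : ∀ k N, Measurable (orEst k N))
    (hor : ∀ k, IsMaximizerEventually μ (orSpace (d k)) (orSampleLogLik Z k) (orEst k))
    -- (a) identifiability, (b) third moments, (c) information and non-degeneracy
    (h_ident : ∀ k, PSIdentifiable ((Q k).map observe) (Θ k))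
    (h_third : ∀ k, Integrable (fun o => covarNorm o.2.2 ^ 3) ((Q k).map observe))
    (h_info : ∀ k, (psInformation ((Q k).map observe) (ν k)).PosDef)
    (h_nondeg : ∀ k, NondegenerateCovar ((Q k).map observe)) :
    -- the propensity model is correct, the outcome model may be wrong
    ((∀ k, PSCorrect ((Q k).map observe) (ν k)) →
      ∃ ψ, AsymptoticallyNormalWith μ (obsLaw p Q) Z (tauHat v w Z psEst orEst) τ ψ) ∧
    -- the outcome model is correct, the propensity model may be wrong
    ((∀ k, ORCorrect ((Q k).map observe)) →
      (∀ k, IsPopulationMaximizer ((Q k).map observe) (Θ k) (ν k)) →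
      (∃ c > 0, ∀ k a, ∀ᵐ o ∂((Q k).map observe),
        c < psModel a o.2.2 (ν k)) →
      (∀ k j, Integrable (fun o => covarNorm o.2.2 ^ 2 *
        (o.1 j - outcomeReg ((Q k).map observe) o.2.1 j o) ^ 2) ((Q k).map observe)) →
      ∃ ψ, AsymptoticallyNormalWith μ (obsLaw p Q) Z (tauHat v w Z psEst orEst) τ ψ) ∧
    -- both models are correct
    ((∀ k, PSCorrect ((Q k).map observe) (ν k)) →
      (∀ k, ORCorrect ((Q k).map observe)) →
      tauObs v w (obsLaw p Q) = τ ∧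
      IsEfficientWith μ (obsLaw p Q) Z (tauHat v w Z psEst orEst) (tauObs v w)
        (influence v w (obsLaw p Q))) := by
  set P : ∀ k, Measure (Obs (M k) (d k)) := fun k => (Q k).map observe with hPdef
  have hs : IsSample μ (mixLaw p P) Z := ⟨hZ, hZ_indep, hZ_law⟩
  have hprob := hs.isProbabilityMeasure
  have hP : ∀ k, IsRegularLaw (P k) := fun k => (hQ k).isRegularLaw
  have hpos : ∀ k, 0 < (ν k).precision := fun k => hΘ_pos k _ (interior_subset (hν k))
  obtain ⟨C, hC⟩ := hw_bdd
  -- From here on only the observed law matters; the causal assumptions enter through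
  -- identification.
  have hτ' : τ = ∑ k, v k (p k) * thetaObs (w k) (P k) := by
    rw [hτ]
    exact Finset.sum_congr rfl fun k _ => by rw [(hQ k).thetaObs_eq (hw k) (hC k)]
  have hmeas := measurable_tauHat hZ v hw hps_meas hor_meas
  have hlaw : obsLaw p Q = mixLaw p P := obsLaw_eq_mixLaw p Q
  have hps_lin : ∀ k, IsPopulationMaximizer (P k) (Θ k) (ν k) →
      ∃ κ, IsAsympLinear μ (mixLaw p P) Z (psEst k) (ν k) κ := fun k hmax =>
    psEst_isAsympLinear hp hs k (hΘ k) (hΘ_pos k) (hν k) hmax (h_third k) (h_info k) (hps k)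
  have hmax : (∀ k, PSCorrect (P k) (ν k)) → ∀ k, IsPopulationMaximizer (P k) (Θ k) (ν k) :=
    fun hPS k => (hP k).isPopulationMaximizer (interior_subset (hν k)) (hPS k) (h_ident k)
      (h_third k)
  rw [hlaw, hτ']
  refine ⟨fun hPS => ?_, fun hOR hmaxOR hov hres => ?_, fun hPS hOR => ?_⟩
  · choose κ hκ using fun k => hps_lin k (hmax hPS k)
    choose ζ hζ using fun k => exists_modelAipw_isAsympLinear_of_psCorrect hp hs k (hM k) (hw k)
      (hC k) (hP k) (h_nondeg k) (h_third k) (hpos k) (hPS k) (hκ k) (hor k)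
    exact ⟨_, (tauHat_isAsympLinear hp hs hv hζ).asymptoticallyNormalWith hs hmeas⟩
  · choose κ hκ using fun k => hps_lin k (hmaxOR k)
    obtain ⟨c, hc, hov⟩ := hov
    choose ζ hζ using fun k => exists_modelAipw_isAsympLinear_of_orCorrect hp hs k (hM k) (hw k)
      (hC k) (hP k) (h_nondeg k) (h_third k) (hpos k) ⟨c, hc, hov k⟩ (hOR k) (hres k) (hκ k)
      (hor k)
    exact ⟨_, (tauHat_isAsympLinear hp hs hv hζ).asymptoticallyNormalWith hs hmeas⟩
  · choose κ hκ using fun k => hps_lin k (hmax hPS k)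
    choose β hβ using hOR
    have hζ : ∀ k, IsAsympLinear μ (mixLaw p P) Z (fun N ω => avg Z (onType k fun o =>
        modelAipw (w k) (psEst k N ω) (orEst k N ω).1 o - thetaObs (w k) (P k)) N ω) 0
        (onType k fun o => aipw (w k) (propensity (P k)) (outcomeReg (P k)) o
          - thetaObs (w k) (P k)) := fun k => by
      refine (modelAipw_isAsympLinear_of_correct hp hs k (hM k) (hw k) (hC k) (hP k)
        (h_nondeg k) (h_third k) (hpos k) (hPS k) (hβ k) (hκ k) (hor k)).congr_ae hs
        (measurable_onType_aipw (hw k)) ?_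
      -- Under correct models the working nuisances agree almost surely with the true ones,
      -- simultaneously over the finitely many treatments and units.
      have h : ∀ᵐ o ∂(P k), modelAipw (w k) (ν k) (β k) o - thetaObs (w k) (P k) =
          aipw (w k) (propensity (P k)) (outcomeReg (P k)) o - thetaObs (w k) (P k) := by
        filter_upwards [ae_all_iff.2 (hPS k), ae_all_iff.2 fun a => ae_all_iff.2 (hβ k a)]
          with o h1 h2
        simp only [modelAipw, aipw, P, h1, h2]
      exact onTypeV_ae_eq h
    have hlin := tauHat_isAsympLinear hp hs hv hζ
    rw [show (fun z => ∑ k, (v k (p k) / p k * onType k (fun o => aipw (w k) (propensity (P k))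
      (outcomeReg (P k)) o - thetaObs (w k) (P k)) z + deriv (v k) (p k) * thetaObs (w k) (P k) *
        (onType k (fun _ => 1) z - p k))) = influence v w (mixLaw p P) from
      funext fun z => (influence_mixLaw hp z).symm] at hlin
    -- Some type exists because the type probabilities sum to one; non-degeneracy of the law is then
    -- read off from it.
    obtain ⟨k, -⟩ : ∃ k : Fin K, k ∈ Finset.univ := by
      by_contra! h
      rw [Finset.sum_eq_zero fun k _ => absurd (Finset.mem_univ k) (h k)] at hp1
      exact zero_ne_one hp1
    refine ⟨tauObs_mixLaw hp, ?_, isEfficientInfluenceFunction_and_isLUB hlin.meas hlin.memLp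
      hlin.mean (fun r s h => hasDerivAt_tauObs hp hP hv hw hC h)
      (exists_isBoundedScore_pos hp k (hM k) (hP k))⟩
    rw [tauObs_mixLaw hp]
    exact hlin.asymptoticallyNormalWith hs hmeas
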